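/- Let $n\ge 1$ and let $\mathcal B$ be a compact smooth $(n+1)$-dimensional manifold with closed boundary $\partial\mathcal B$, with a collar neighbourhood $[0,1)\times\partial\mathcal B$ of the boundary (coordinates $(x,y)$). Let $g$ be a degenerate Riemannian metric on $\mathcal B$: smooth, positive definite on the interior $\mathbb B^\circ=\mathcal B\setminus\partial\mathcal B$, and equal to $g=dx^2+x^2h(x)$ on the collar, where $x\mapsto h(x)$, $x\in[0,1)$, is a smooth family of Riemannian metrics on $\partial\mathcal B$. Write $\mathbb B=(\mathcal B,g)$, let $\mu_g$ be the Riemannian measure and $L^2(\mathbb B)=L^2(\mathcal B,\mu_g)$. Fix a smooth function $\omega\ge 0$ on $\mathcal B$ with (closed) support in the collar, depending only on $x$ there, and equal to $1$ near $\partial\mathcal B$; a finite atlas $\kappa_j$ of $\partial\mathcal B$ with a subordinate partition of unity $\phi_j$; and a finite atlas $\chi_l$ of $\mathcal B$ with a subordinate partition of unity $\psi_l$. For $\gamma\in\mathbb R$, the Mellin–Sobolev space $\mathcal H^{1,\gamma}(\mathbb B)$ is the space of functions $u$ with finite norm $$\|u\|_{\mathcal H^{1,\gamma}}=\sum_j\big\|e^{(\gamma-\frac{n+1}{2})t}(\omega\phi_ju)(e^{-t},\kappa_j^{-1}(\eta))\big\|_{H^1(\mathbb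 R_t\times\mathbb R^n_\eta)}+\sum_l\big\|(\psi_l(1-\omega)u)\circ\chi_l^{-1}\big\|_{H^1(\mathbb R^{n+1})},$$ all functions being extended by zero. Let $\mathbb C_\omega$ be the finite-dimensional space of the functions $\sum_jc_j\omega_j$, $c_j\in\mathbb C$, where $\omega_j$ is the restriction of $\omega$ to the part of the collar over the $j$-th connected component of $\partial\mathcal B$, extended by zero. Let $H^1(\mathbb B)$ be the completion of $C_c^\infty(\mathbb B^\circ)$ for the inner product $(u,v)=\int u\overline v\,d\mu_g+\int\langle\nabla u,\nabla\overline v\rangle_g\,d\mu_g$. Then the canonical map $H^1(\mathbb B)\to L^2(\mathbb B)$ (the continuous extension of the identity of $C_c^\infty(\mathbb B^\circ)$) is injective, so that $H^1(\mathbb B)$ is a space of functions, and: 1. There is a constant $C$ such that $u+v\in H^1(\mathbb B)$ and $\|u+v\|_{H^1(\mathbb B)}\le C(\|u\|_{\mathcal H^{1,1}(\mathbb B)}+\|v\|_{\mathbb C_\omega})$ for all $u\in\mathcal H^{1,1}(\mathbb B)$ and $v=\sum_jc_j\omega_j\in\mathbb C_\omega$, where $\|v\|_{\mathbb C_\omega}=\max_j|c_j|$.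 Thus the map $\mathcal H^{1,1}(\mathbb B)\oplus\mathbb C_\omega\to H^1(\mathbb B)$, $u\oplus v\mapsto u+v$, is continuous. If $n=1$, moreover, $\mathcal H^{1,1}(\mathbb B)\cap\mathbb C_\omega=\{0\}$, and this map is injective. 2. For every $\beta<1$ there is a continuous inclusion $H^1(\mathbb B)\hookrightarrow\mathcal H^{1,\beta}(\mathbb B)$: every $u\in H^1(\mathbb B)$ lies in $\mathcal H^{1,\beta}(\mathbb B)$ and $\|u\|_{\mathcal H^{1,\beta}(\mathbb B)}\le C_\beta\|u\|_{H^1(\mathbb B)}$. 3. The inclusion $H^1(\mathbb B)\hookrightarrow L^2(\mathbb B)=\mathcal H^{0,0}(\mathbb B)$ is compact. -/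

import Mathlib

open scoped Manifold ContDiff Topology ENNReal NNReal
open MeasureTheory Set Bundle

/-- `ℝᵈ` with the Euclidean norm. -/
abbrev Rd (d : ℕ) : Type := EuclideanSpace ℝ (Fin d)

/-- A manifold with conical singularities `𝔹 = (𝓑, g)` of dimension `n + 1`: a manifold with
boundary `𝓑 = B`, whose boundary is (a copy of) the manifold `N`, with a collar neighbourhood
`[0,1) × N` of the boundary, and a degenerate Riemannian metric `g` that is equal to
`dx² + x² h(x)` on the collar, where `x ↦ h(x)`, `x ∈ [0,1)`, is a smooth family of Riemannian
metrics on `N`. Compactness of `B` and `N` is assumed separately. -/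
structure ConicManifold (n : ℕ) (B N : Type*)
    [TopologicalSpace B] [ChartedSpace (EuclideanHalfSpace (n + 1)) B]
    [IsManifold (𝓡∂ (n + 1)) ∞ B]
    [TopologicalSpace N] [ChartedSpace (EuclideanSpace ℝ (Fin n)) N]
    [IsManifold (𝓡 n) ∞ N] where
  /-- the collar `(x, y) ↦ collar (x, y)`, a diffeomorphism of `[0,1) × N` onto an open subset -/
  collar : PartialEquiv (ℝ × N) B
  collar_source : collar.source = Ico 0 1 ×ˢ univ
  isOpen_target : IsOpen collar.target
  contMDiffOn_collar :
    ContMDiffOn (𝓘(ℝ, ℝ).prod (𝓡 n)) (𝓡∂ (n + 1)) ∞ collar (Ico 0 1 ×ˢ univ)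
  contMDiffOn_collar_symm :
    ContMDiffOn (𝓡∂ (n + 1)) (𝓘(ℝ, ℝ).prod (𝓡 n)) ∞ collar.symm collar.target
  /-- the boundary of `B` is the set `{x = 0}` of the collar -/
  collar_boundary : collar '' ({0} ×ˢ univ) = (𝓡∂ (n + 1)).boundary B
  /-- the family of metrics `h(x)` on `N`; only the values for `x ∈ [0,1)` matter -/
  h : ℝ → ContMDiffRiemannianMetric (𝓡 n) ∞ (EuclideanSpace ℝ (Fin n))
    (fun y : N => TangentSpace (𝓡 n) y)
  /-- `h(x)(y)` is smooth in `(x, y) ∈ [0,1) × N` -/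
  contMDiffOn_h :
    ContMDiffOn (𝓘(ℝ, ℝ).prod (𝓡 n))
      ((𝓡 n).prod 𝓘(ℝ, Rd n →L[ℝ] Rd n →L[ℝ] ℝ)) ∞
      (fun z : ℝ × N => TotalSpace.mk' (Rd n →L[ℝ] Rd n →L[ℝ] ℝ)
        (E := fun y : N => TangentSpace (𝓡 n) y →L[ℝ] TangentSpace (𝓡 n) y →L[ℝ] ℝ)
        z.2 ((h z.1).inner z.2)) (Ico 0 1 ×ˢ univ)
  /-- the metric, a smooth symmetric 2-tensor, positive definite on the interior of `B` -/
  g : ∀ p : B, TangentSpace (𝓡∂ (n + 1)) p →L[ℝ] TangentSpace (𝓡∂ (n + 1)) p →L[ℝ] ℝ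
  contMDiff_g :
    ContMDiff (𝓡∂ (n + 1))
      ((𝓡∂ (n + 1)).prod 𝓘(ℝ, Rd (n + 1) →L[ℝ] Rd (n + 1) →L[ℝ] ℝ)) ∞
      (fun p : B => TotalSpace.mk' (Rd (n + 1) →L[ℝ] Rd (n + 1) →L[ℝ] ℝ)
        (E := fun p : B => TangentSpace (𝓡∂ (n + 1)) p →L[ℝ]
          TangentSpace (𝓡∂ (n + 1)) p →L[ℝ] ℝ) p (g p))
  g_symm : ∀ p v w, g p v w = g p w v
  g_pos : ∀ p ∈ (𝓡∂ (n + 1)).interior B, ∀ v, v ≠ 0 → 0 < g p v v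
  /-- `g = dx² + x² h(x)` on the collar -/
  g_collar : ∀ x ∈ Ico (0 : ℝ) 1, ∀ (y : N) (a b : ℝ) (v w : TangentSpace (𝓡 n) y),
    g (collar (x, y))
      (mfderivWithin (𝓘(ℝ, ℝ).prod (𝓡 n)) (𝓡∂ (n + 1)) collar (Ico 0 1 ×ˢ univ) (x, y) (a, v))
      (mfderivWithin (𝓘(ℝ, ℝ).prod (𝓡 n)) (𝓡∂ (n + 1)) collar (Ico 0 1 ×ˢ univ) (x, y) (b, w))
      = a * b + x ^ 2 * (h x).inner y v w

namespace ConicManifold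
section
variable {n : ℕ} {B N : Type*}
    [TopologicalSpace B] [ChartedSpace (EuclideanHalfSpace (n + 1)) B]
    [IsManifold (𝓡∂ (n + 1)) ∞ B]
    [TopologicalSpace N] [ChartedSpace (EuclideanSpace ℝ (Fin n)) N]
    [IsManifold (𝓡 n) ∞ N]

/-- The coordinate vector field `∂ᵢ` of the chart of `B` at `p`, evaluated at `q`. -/
noncomputable def coordField (p : B) (i : Fin (n + 1)) (q : B) : TangentSpace (𝓡∂ (n + 1)) q :=
  (trivializationAt (Rd (n + 1)) (fun q : B => TangentSpace (𝓡∂ (n + 1)) q) p).localFrame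
    (EuclideanSpace.basisFun (Fin (n + 1)) ℝ).toBasis i q

theorem coordField_eq (p : B) (i : Fin (n + 1)) {q : B}
    (hq : q ∈ (chartAt (EuclideanHalfSpace (n + 1)) p).source) :
    coordField p i q =
      (mfderivWithin 𝓘(ℝ, Rd (n + 1)) (𝓡∂ (n + 1)) (extChartAt (𝓡∂ (n + 1)) p).symm
        (range (𝓡∂ (n + 1))) (extChartAt (𝓡∂ (n + 1)) p q) :
        Rd (n + 1) →L[ℝ] Rd (n + 1)) (EuclideanSpace.single i 1) := by
  rw [← TangentBundle.symmL_trivializationAt hq]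
  rw [coordField, Trivialization.localFrame_apply_of_mem_baseSet _ _ (by simpa using hq)]
  simp only [Trivialization.basisAt, Module.Basis.map_apply, OrthonormalBasis.coe_toBasis,
    EuclideanSpace.basisFun_apply]
  exact (Trivialization.symmL_apply _ (by simpa using hq) _).symm

theorem contMDiffAt_coordField (p : B) (i : Fin (n + 1)) {q : B}
    (hq : q ∈ (chartAt (EuclideanHalfSpace (n + 1)) p).source) :
    ContMDiffAt (𝓡∂ (n + 1)) ((𝓡∂ (n + 1)).prod 𝓘(ℝ, Rd (n + 1))) ∞
      (fun q : B => TotalSpace.mk' (Rd (n + 1)) (E := fun q : B => TangentSpace (𝓡∂ (n + 1)) q)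
       q (coordField p i q)) q :=
  contMDiffAt_localFrame_of_mem ∞ _ _ i (by simpa using hq)

/-- Gram matrix `g_{ik} = g(∂ᵢ, ∂ₖ)` in the chart of `B` at `p`. -/
noncomputable def gram (M : ConicManifold n B N) (p q : B) : Matrix (Fin (n + 1)) (Fin (n + 1)) ℝ :=
  Matrix.of fun i k => M.g q (coordField p i q) (coordField p k q)

/-- `∂ᵢ u` in the chart of `B` at `p`. -/
noncomputable def coordDeriv (u : B → ℂ) (p : B) (i : Fin (n + 1)) (q : B) : ℂ :=
  (mfderiv (𝓡∂ (n + 1)) 𝓘(ℝ, ℂ) u q : TangentSpace (𝓡∂ (n + 1)) q →L[ℝ] ℂ) (coordField p i q)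

/-- `∑_{ik} g^{ik} ∂ᵢu ∂ₖv̄` at `q`, computed in the chart of `B` at `p`. -/
noncomputable def gradInnerIn (M : ConicManifold n B N) (p : B) (u v : B → ℂ) (q : B) : ℂ :=
  ∑ i, ∑ k, (((M.gram p q)⁻¹ i k : ℝ) : ℂ) * coordDeriv u p i q * starRingEnd ℂ (coordDeriv v p k q)

/-- `⟨∇u, ∇v̄⟩_g = ∑_{ik} g^{ik} ∂ᵢu ∂ₖv̄`, which does not depend on the chart in which it is
computed (see `gradInnerIn_eq`). -/
noncomputable def gradInner (M : ConicManifold n B N) (u v : B → ℂ) (q : B) : ℂ :=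
  M.gradInnerIn q u v q

theorem continuousAt_gram (M : ConicManifold n B N) (p : B) {q : B}
    (hq : q ∈ (chartAt (EuclideanHalfSpace (n + 1)) p).source) :
    ContinuousAt (M.gram p) q := by
  refine continuousAt_pi.2 fun i => continuousAt_pi.2 fun k => ?_
  have h := ContMDiffAt.clm_bundle_apply₂ (F₁ := Rd (n+1)) (F₂ := Rd (n+1)) (F₃ := ℝ)
    (E₁ := fun q : B => TangentSpace (𝓡∂ (n + 1)) q)
    (E₂ := fun q : B => TangentSpace (𝓡∂ (n + 1)) q)
    (E₃ := Bundle.Trivial B ℝ) (b := id)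
    (ψ := fun q => M.g q) (M.contMDiff_g q) (contMDiffAt_coordField p i hq) (contMDiffAt_coordField p k hq)
  have h2 := h.continuousAt
  rw [FiberBundle.continuousAt_totalSpace] at h2
  exact h2.2

theorem continuousAt_coordDeriv {u : B → ℂ} (hu : ContMDiff (𝓡∂ (n + 1)) 𝓘(ℝ, ℂ) ∞ u) (p : B)
    (i : Fin (n + 1)) {q : B} (hq : q ∈ (chartAt (EuclideanHalfSpace (n + 1)) p).source) :
    ContinuousAt (coordDeriv u p i) q := by
  have h1 := (hu.contMDiff_tangentMap (m := 0) (by simp)).continuous.continuousAt.comp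
    (contMDiffAt_coordField p i hq).continuousAt
  rw [FiberBundle.continuousAt_totalSpace] at h1
  have h2 := h1.2
  simp [tangentMap] at h2
  exact h2

/-- The coordinate vector fields as a basis of the tangent space. -/
noncomputable def coordBasis (p r : B)
    (hp : r ∈ (chartAt (EuclideanHalfSpace (n + 1)) p).source) :
    Module.Basis (Fin (n + 1)) ℝ (TangentSpace (𝓡∂ (n + 1)) r) :=
  (trivializationAt (Rd (n + 1)) (fun q : B => TangentSpace (𝓡∂ (n + 1)) q) p).basisAt
    (EuclideanSpace.basisFun (Fin (n + 1)) ℝ).toBasis (by simpa using hp)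

theorem coordBasis_apply (p r : B)
    (hp : r ∈ (chartAt (EuclideanHalfSpace (n + 1)) p).source) (i : Fin (n + 1)) :
    coordBasis p r hp i = coordField p i r := by
  rw [coordField, Trivialization.localFrame_apply_of_mem_baseSet _ _ (by simpa using hp)]
  rfl

theorem exists_coordChange (p q r : B)
    (hp : r ∈ (chartAt (EuclideanHalfSpace (n + 1)) p).source)
    (hq : r ∈ (chartAt (EuclideanHalfSpace (n + 1)) q).source) :
    ∃ P Q : Matrix (Fin (n + 1)) (Fin (n + 1)) ℝ, P * Q = 1 ∧
      ∀ i, coordField p i r = ∑ j, P j i • coordField q j r := by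
  refine ⟨(coordBasis q r hq).toMatrix (coordBasis p r hp),
    (coordBasis p r hp).toMatrix (coordBasis q r hq), ?_, fun i => ?_⟩
  · exact Module.Basis.toMatrix_mul_toMatrix_flip _ _
  · have := (coordBasis q r hq).sum_toMatrix_smul_self (coordBasis p r hp) i
    simpa only [coordBasis_apply] using this.symm

theorem gram_change (M : ConicManifold n B N) {p q r : B}
    {P : Matrix (Fin (n + 1)) (Fin (n + 1)) ℝ}
    (hP : ∀ i, coordField p i r = ∑ j, P j i • coordField q j r) :
    M.gram p r = P.transpose * M.gram q r * P := by
  ext i k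
  simp only [gram, Matrix.of_apply, Matrix.mul_apply, Matrix.transpose_apply, hP, map_sum, map_smul,
    sum_apply, smul_apply, smul_eq_mul, Finset.sum_mul,
    Finset.mul_sum]
  refine Finset.sum_congr rfl fun j _ => Finset.sum_congr rfl fun l _ => by ring

theorem gradInnerIn_eq (M : ConicManifold n B N) (p q r : B) (u v : B → ℂ)
    (hp : r ∈ (chartAt (EuclideanHalfSpace (n + 1)) p).source)
    (hq : r ∈ (chartAt (EuclideanHalfSpace (n + 1)) q).source) :
    M.gradInnerIn p u v r = M.gradInnerIn q u v r := by
  obtain ⟨P, Q, hPQ, hP⟩ := exists_coordChange p q r hp hq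
  have hinv : P⁻¹ = Q := Matrix.inv_eq_right_inv hPQ
  have hG : (M.gram q r)⁻¹ = P * (M.gram p r)⁻¹ * P.transpose := by
    rw [M.gram_change hP, Matrix.mul_inv_rev, Matrix.mul_inv_rev, ← Matrix.transpose_nonsing_inv, hinv]
    have h1 : Q.transpose * P.transpose = 1 := by rw [← Matrix.transpose_mul, hPQ]; simp
    rw [Matrix.mul_assoc, Matrix.mul_assoc, Matrix.mul_assoc, h1, Matrix.mul_one, ← Matrix.mul_assoc, hPQ,
      Matrix.one_mul]
  have hD : ∀ (w : B → ℂ) i, coordDeriv w p i r = ∑ j, (P j i : ℂ) * coordDeriv w q j r := by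
    intro w i
    simp only [coordDeriv, hP, map_sum, map_smul]
    exact Finset.sum_congr rfl fun j _ => Complex.real_smul
  have key : ∀ (A : Matrix (Fin (n + 1)) (Fin (n + 1)) ℝ) (x y : Fin (n + 1) → ℂ),
      ∑ i, ∑ k, ((A i k : ℝ) : ℂ) * x i * starRingEnd ℂ (y k) =
        x ⬝ᵥ (A.map Complex.ofRealHom).mulVec (fun k => starRingEnd ℂ (y k)) := by
    intro A x y
    simp only [dotProduct, Matrix.mulVec, Finset.mul_sum, Matrix.map_apply, Complex.ofRealHom_eq_coe]
    exact Finset.sum_congr rfl fun i _ => Finset.sum_congr rfl fun k _ => by ring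
  have hx : ∀ w : B → ℂ, (fun i => coordDeriv w p i r) =
      (P.map Complex.ofRealHom).transpose.mulVec (fun j => coordDeriv w q j r) := by
    intro w
    funext i
    simp [hD, Matrix.mulVec, dotProduct]
  have hy : (fun i => starRingEnd ℂ (coordDeriv v p i r)) =
      (P.map Complex.ofRealHom).transpose.mulVec (fun j => starRingEnd ℂ (coordDeriv v q j r)) := by
    funext i
    simp [hD, Matrix.mulVec, dotProduct, map_sum]
  rw [gradInnerIn, gradInnerIn, key _ (fun i => coordDeriv u p i r) (fun i => coordDeriv v p i r),
    key _ (fun i => coordDeriv u q i r) (fun i => coordDeriv v q i r), hx u, hy, hG,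
    Matrix.map_mul, Matrix.map_mul, Matrix.transpose_map, ← Matrix.mulVec_mulVec,
    ← Matrix.mulVec_mulVec, Matrix.mulVec_transpose, ← Matrix.dotProduct_mulVec]

theorem gram_isSymm (M : ConicManifold n B N) (p q : B) : (M.gram p q).IsSymm := by
  ext i k
  simp [gram, M.g_symm q (coordField p i q)]

theorem gram_posDef (M : ConicManifold n B N) (p : B) {q : B}
    (hq : q ∈ (chartAt (EuclideanHalfSpace (n + 1)) p).source)
    (hi : q ∈ (𝓡∂ (n + 1)).interior B) : (M.gram p q).PosDef := by
  refine Matrix.PosDef.of_dotProduct_mulVec_pos ?_ fun x hx => ?_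
  · rw [Matrix.IsHermitian, Matrix.conjTranspose_eq_transpose_of_trivial]; exact M.gram_isSymm p q
  · have hne : (∑ i, x i • coordField p i q) ≠ 0 := by
      intro h0
      apply hx
      have := Fintype.linearIndependent_iff.1 (coordBasis p q hq).linearIndependent x
        (by simpa only [coordBasis_apply] using h0)
      exact funext this
    have := M.g_pos q hi _ hne
    refine lt_of_lt_of_eq this ?_
    simp only [gram, dotProduct, Matrix.mulVec, Matrix.of_apply, map_sum, map_smul,
      sum_apply, smul_apply, smul_eq_mul, Finset.mul_sum, star_trivial]
    refine Finset.sum_congr rfl fun j _ => Finset.sum_congr rfl fun l _ => ?_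
    rw [M.g_symm q (coordField p l q)]
    ring

theorem continuousAt_gradInnerIn (M : ConicManifold n B N) (p : B) {u v : B → ℂ}
    (hu : ContMDiff (𝓡∂ (n + 1)) 𝓘(ℝ, ℂ) ∞ u) (hv : ContMDiff (𝓡∂ (n + 1)) 𝓘(ℝ, ℂ) ∞ v) {q : B}
    (hq : q ∈ (chartAt (EuclideanHalfSpace (n + 1)) p).source)
    (hi : q ∈ (𝓡∂ (n + 1)).interior B) : ContinuousAt (M.gradInnerIn p u v) q := by
  have hG : ContinuousAt (fun r => (M.gram p r)⁻¹) q := by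
    have hdet : (M.gram p q).det ≠ 0 := (M.gram_posDef p hq hi).det_pos.ne'
    have h1 := M.continuousAt_gram p hq
    simp only [Matrix.inv_def, Ring.inverse_eq_inv']
    have h2 : ContinuousAt (fun r => (M.gram p r).det) q :=
      (continuous_id.matrix_det (n := Fin (n+1)) (R := ℝ)).continuousAt.comp h1
    have h3 : ContinuousAt (fun r => (M.gram p r).adjugate) q :=
      (continuous_id.matrix_adjugate (n := Fin (n+1)) (R := ℝ)).continuousAt.comp h1
    exact (h2.inv₀ hdet).smul h3
  unfold gradInnerIn
  refine tendsto_finsetSum _ fun i _ => tendsto_finsetSum _ fun k _ => ?_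
  refine ContinuousAt.mul (ContinuousAt.mul ?_ (continuousAt_coordDeriv hu p i hq)) ?_
  · exact Complex.continuous_ofReal.continuousAt.comp
      (continuousAt_pi.1 (continuousAt_pi.1 hG i) k)
  · exact Complex.continuous_conj.continuousAt.comp (continuousAt_coordDeriv hv p k hq)

/-- Complex smooth functions on `B` with compact support in the interior of `B`
(as `B` is compact, the closed support is compact). -/
def testSubmodule (n : ℕ) (B : Type*) [TopologicalSpace B]
    [ChartedSpace (EuclideanHalfSpace (n + 1)) B] : Submodule ℂ (B → ℂ) where
  carrier := {u | ContMDiff (𝓡∂ (n + 1)) 𝓘(ℝ, ℂ) ∞ u ∧ HasCompactSupport u ∧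
    tsupport u ⊆ (𝓡∂ (n + 1)).interior B}
  add_mem' := by
    rintro u v ⟨hu, hu', hu''⟩ ⟨hv, hv', hv''⟩
    refine ⟨hu.add hv, hu'.add hv', (tsupport_add u v).trans (union_subset hu'' hv'')⟩
  zero_mem' := ⟨contMDiff_const, HasCompactSupport.zero, by simp [tsupport]⟩
  smul_mem' := by
    rintro c u ⟨hu, hu', hu''⟩
    refine ⟨?_, ?_, ?_⟩
    · exact (contDiff_const_smul c).contMDiff.comp hu
    · exact hu'.mono' ((Function.support_const_smul_subset c u).trans subset_closure)
    · exact (closure_mono (Function.support_const_smul_subset c u)).trans hu''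

theorem continuous_gradInner (M : ConicManifold n B N) {u v : B → ℂ}
    (hu : u ∈ testSubmodule n B) (hv : v ∈ testSubmodule n B) :
    Continuous (M.gradInner u v) := by
  refine continuous_iff_continuousAt.2 fun q => ?_
  have hmem : q ∈ (chartAt (EuclideanHalfSpace (n + 1)) q).source := mem_chart_source _ q
  by_cases hq : q ∈ tsupport u
  · refine (M.continuousAt_gradInnerIn q hu.1 hv.1
      hmem (hu.2.2 hq)).congr ?_
    filter_upwards [(chartAt (EuclideanHalfSpace (n + 1)) q).open_source.mem_nhds
      (mem_chart_source _ q)] with r hr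
    exact M.gradInnerIn_eq q r r u v hr (mem_chart_source (EuclideanHalfSpace (n + 1)) r)
  · have h0 : M.gradInner u v =ᶠ[𝓝 q] fun _ => 0 := by
      filter_upwards [(isClosed_tsupport u).isOpen_compl.mem_nhds hq] with r hr
      have h1 : u =ᶠ[𝓝 r] fun _ => 0 := notMem_tsupport_iff_eventuallyEq.1 hr
      have h2 : mfderiv (𝓡∂ (n + 1)) 𝓘(ℝ, ℂ) u r = 0 := by
        rw [h1.mfderiv_eq]; exact mfderiv_const
      have h3 : ∀ i : Fin (n + 1), coordDeriv u r i r = 0 := by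
        intro i; rw [coordDeriv, h2]; rfl
      simp [gradInner, gradInnerIn, h3]
    exact continuousAt_const.congr h0.symm

theorem coordDeriv_add {u v : B → ℂ} (hu : u ∈ testSubmodule n B) (hv : v ∈ testSubmodule n B)
    (p : B) (i : Fin (n + 1)) (q : B) :
    coordDeriv (u + v) p i q = coordDeriv u p i q + coordDeriv v p i q := by
  have hu' : MDifferentiableAt (𝓡∂ (n + 1)) 𝓘(ℝ, ℂ) u q := (hu.1 q).mdifferentiableAt (by simp)
  have hv' : MDifferentiableAt (𝓡∂ (n + 1)) 𝓘(ℝ, ℂ) v q := (hv.1 q).mdifferentiableAt (by simp)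
  rw [coordDeriv, mfderiv_add hu' hv']
  rfl

theorem coordDeriv_smul {u : B → ℂ} (hu : u ∈ testSubmodule n B) (c : ℂ)
    (p : B) (i : Fin (n + 1)) (q : B) :
    coordDeriv (c • u) p i q = c * coordDeriv u p i q := by
  have hu' : MDifferentiableAt (𝓡∂ (n + 1)) 𝓘(ℝ, ℂ) u q := (hu.1 q).mdifferentiableAt (by simp)
  have h1 : HasMFDerivAt (𝓡∂ (n + 1)) 𝓘(ℝ, ℂ) (c • u) q _ :=
    HasMFDerivAt.comp q (I' := 𝓘(ℝ, ℂ)) (g := fun z : ℂ => c • z)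
      ((c • ContinuousLinearMap.id ℝ ℂ).hasMFDerivAt) hu'.hasMFDerivAt
  rw [coordDeriv, h1.mfderiv]
  rfl

theorem gradInner_add (M : ConicManifold n B N) {u v w : B → ℂ}
    (hu : u ∈ testSubmodule n B) (hv : v ∈ testSubmodule n B) (q : B) :
    M.gradInner (u + v) w q = M.gradInner u w q + M.gradInner v w q := by
  simp only [gradInner, gradInnerIn, coordDeriv_add hu hv, mul_add, add_mul, Finset.sum_add_distrib]

theorem gradInner_smul (M : ConicManifold n B N) {u w : B → ℂ}
    (hu : u ∈ testSubmodule n B) (c : ℂ) (q : B) :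
    M.gradInner (c • u) w q = c * M.gradInner u w q := by
  simp only [gradInner, gradInnerIn, coordDeriv_smul hu, Finset.mul_sum]
  exact Finset.sum_congr rfl fun i _ => Finset.sum_congr rfl fun k _ => by ring

theorem gradInner_conj (M : ConicManifold n B N) (u v : B → ℂ) (q : B) :
    starRingEnd ℂ (M.gradInner u v q) = M.gradInner v u q := by
  have hs : ∀ i k, (M.gram q q)⁻¹ i k = (M.gram q q)⁻¹ k i := by
    intro i k
    have : ((M.gram q q)⁻¹).IsSymm := by
      rw [Matrix.IsSymm, Matrix.transpose_nonsing_inv, M.gram_isSymm q q]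
    exact (this.apply i k).symm
  simp only [gradInner, gradInnerIn, map_sum, map_mul, Complex.conj_ofReal, Complex.conj_conj]
  rw [Finset.sum_comm]
  refine Finset.sum_congr rfl fun i _ => Finset.sum_congr rfl fun k _ => ?_
  rw [hs k i]
  ring

theorem gradInner_self_nonneg (M : ConicManifold n B N) {u : B → ℂ}
    (hu : u ∈ testSubmodule n B) (q : B) : 0 ≤ (M.gradInner u u q).re := by
  by_cases hq : q ∈ tsupport u
  · have hpd := (M.gram_posDef q (mem_chart_source (EuclideanHalfSpace (n + 1)) q) (hu.2.2 hq)).inv.posSemidef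
    have h1 := hpd.dotProduct_mulVec_nonneg (fun i => (coordDeriv u q i q).re)
    have h2 := hpd.dotProduct_mulVec_nonneg (fun i => (coordDeriv u q i q).im)
    have h3 := add_nonneg h1 h2
    refine h3.trans_eq ?_
    simp only [gradInner, gradInnerIn, Complex.re_sum, dotProduct, Matrix.mulVec, Finset.mul_sum,
      star_trivial, ← Finset.sum_add_distrib]
    refine Finset.sum_congr rfl fun i _ => Finset.sum_congr rfl fun k _ => ?_
    simp
    ring
  · have h1 : u =ᶠ[𝓝 q] fun _ => 0 := notMem_tsupport_iff_eventuallyEq.1 hq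
    have h2 : mfderiv (𝓡∂ (n + 1)) 𝓘(ℝ, ℂ) u q = 0 := by
      rw [h1.mfderiv_eq]; exact mfderiv_const
    have h3 : ∀ i : Fin (n + 1), coordDeriv u q i q = 0 := by
      intro i; rw [coordDeriv, h2]; rfl
    simp [gradInner, gradInnerIn, h3]

section volume
variable [CompactSpace B] [T2Space B] [MeasurableSpace B] [BorelSpace B]

/-- The measure `√(det g) dz` of the chart of `B` at `p`, as a measure on `B`. -/
noncomputable def chartVolume (M : ConicManifold n B N) (p : B) : Measure B :=
  (((volume : Measure (Rd (n + 1))).restrict (extChartAt (𝓡∂ (n + 1)) p).target).withDensity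
    (fun z => ENNReal.ofReal
      (√ (M.gram p ((extChartAt (𝓡∂ (n + 1)) p).symm z)).det))).map
    (extChartAt (𝓡∂ (n + 1)) p).symm

/-- A smooth partition of unity subordinate to the domains of the charts of `B`. -/
noncomputable def chartPartition (n : ℕ) (B : Type*) [TopologicalSpace B]
    [ChartedSpace (EuclideanHalfSpace (n + 1)) B] [IsManifold (𝓡∂ (n + 1)) ∞ B] [CompactSpace B]
    [T2Space B] : SmoothPartitionOfUnity B (𝓡∂ (n + 1)) B univ :=
  (SmoothPartitionOfUnity.exists_isSubordinate_chartAt_source (𝓡∂ (n + 1)) B).choose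

theorem chartPartition_isSubordinate (n : ℕ) (B : Type*) [TopologicalSpace B]
    [ChartedSpace (EuclideanHalfSpace (n + 1)) B] [IsManifold (𝓡∂ (n + 1)) ∞ B] [CompactSpace B]
    [T2Space B] : (chartPartition n B).IsSubordinate
      (fun p => (chartAt (EuclideanHalfSpace (n + 1)) p).source) :=
  (SmoothPartitionOfUnity.exists_isSubordinate_chartAt_source (𝓡∂ (n + 1)) B).choose_spec

set_option linter.unusedSectionVars false in
theorem measurableSet_target (p : B) : MeasurableSet (extChartAt (𝓡∂ (n + 1)) p).target := by
  rw [extChartAt_target]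
  exact (((chartAt _ p).open_target.preimage (𝓡∂ (n + 1)).continuous_symm).measurableSet).inter
    (𝓡∂ (n + 1)).isClosed_range.measurableSet

theorem aemeasurable_symm (p : B) : AEMeasurable (extChartAt (𝓡∂ (n + 1)) p).symm
    ((volume : Measure (Rd (n + 1))).restrict (extChartAt (𝓡∂ (n + 1)) p).target) :=
  (continuousOn_extChartAt_symm p).aemeasurable (measurableSet_target p)

theorem chartVolume_lt_top (M : ConicManifold n B N) (p : B) {T : Set B} (hT : IsClosed T)
    (hTp : T ⊆ (chartAt (EuclideanHalfSpace (n + 1)) p).source) : M.chartVolume p T < ⊤ := by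
  have hTs : T ⊆ (extChartAt (𝓡∂ (n + 1)) p).source := by rwa [extChartAt_source]
  rw [chartVolume, Measure.map_apply_of_aemeasurable
    ((aemeasurable_symm p).mono_ac (withDensity_absolutelyContinuous _ _)) hT.measurableSet]
  set S := (extChartAt (𝓡∂ (n + 1)) p).symm ⁻¹' T with hS
  set K := extChartAt (𝓡∂ (n + 1)) p '' T with hKdef
  have hK : IsCompact K :=
    hT.isCompact.image_of_continuousOn ((continuousOn_extChartAt p).mono hTs)
  have hKt : K ⊆ (extChartAt (𝓡∂ (n + 1)) p).target := by
    rintro _ ⟨q, hq, rfl⟩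
    exact (extChartAt (𝓡∂ (n + 1)) p).map_source (hTs hq)
  have hden : ContinuousOn (fun z => (M.gram p ((extChartAt (𝓡∂ (n + 1)) p).symm z)).det) K := by
    intro z hz
    obtain ⟨q, hq, rfl⟩ := hz
    have h1 : ContinuousAt (fun r => (M.gram p r).det) q :=
      (continuous_id.matrix_det (n := Fin (n+1)) (R := ℝ)).continuousAt.comp
        (M.continuousAt_gram p (hTp hq))
    refine ContinuousAt.comp_continuousWithinAt (g := fun r => (M.gram p r).det) ?_
      (((continuousOn_extChartAt_symm p).mono hKt) _ ⟨q, hq, rfl⟩)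
    rwa [(extChartAt (𝓡∂ (n + 1)) p).left_inv (hTs hq)]
  obtain ⟨C, hC⟩ := hK.exists_bound_of_continuousOn hden
  have hSK : ∀ z ∈ (extChartAt (𝓡∂ (n + 1)) p).target, z ∈ S → z ∈ K := fun z hz hzS =>
    ⟨_, hzS, (extChartAt (𝓡∂ (n + 1)) p).right_inv hz⟩
  have hSK' : S ∩ (extChartAt (𝓡∂ (n + 1)) p).target = K := by
    ext z
    refine ⟨fun h => hSK z h.2 h.1, fun h => ⟨?_, hKt h⟩⟩
    obtain ⟨q, hq, rfl⟩ := h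
    simpa only [hS, mem_preimage, (extChartAt (𝓡∂ (n + 1)) p).left_inv (hTs hq)] using hq
  have hae : S =ᵐ[(volume : Measure (Rd (n + 1))).restrict (extChartAt (𝓡∂ (n + 1)) p).target] K := by
    filter_upwards [ae_restrict_mem (measurableSet_target p)] with z hz
    refine propext ⟨fun h => hSK z hz h, fun h => ?_⟩
    have : z ∈ S ∩ (extChartAt (𝓡∂ (n + 1)) p).target := hSK' ▸ h
    exact this.1
  rw [measure_congr ((withDensity_absolutelyContinuous _ _).ae_eq hae),
    withDensity_apply _ hK.measurableSet]
  calc _ ≤ ∫⁻ z in K, ENNReal.ofReal (√ C)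
          ∂((volume : Measure (Rd (n + 1))).restrict (extChartAt (𝓡∂ (n + 1)) p).target) := by
        refine setLIntegral_mono' hK.measurableSet fun z hz => ?_
        exact ENNReal.ofReal_le_ofReal (Real.sqrt_le_sqrt ((le_abs_self _).trans (hC z hz)))
    _ < ⊤ := by
        rw [setLIntegral_const]
        exact ENNReal.mul_lt_top ENNReal.ofReal_lt_top
          ((Measure.restrict_apply_le _ _).trans_lt hK.measure_lt_top)

/-- The Riemannian measure `μ_g = ∑ₚ ρₚ √(det g) dz`, for a partition of unity `ρₚ` subordinate to
the charts. (It does not depend on the partition of unity.) -/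
noncomputable def vol (M : ConicManifold n B N) : Measure B :=
  Measure.sum fun p => (M.chartVolume p).withDensity
    fun q => ENNReal.ofReal (chartPartition n B p q)

instance (M : ConicManifold n B N) : IsFiniteMeasure M.vol := by
  constructor
  rw [vol, Measure.sum_apply _ MeasurableSet.univ]
  have hfin := (chartPartition n B).locallyFinite.finite_nonempty_of_compact
  have hzero : ∀ p ∉ hfin.toFinset, ((M.chartVolume p).withDensity
      fun q => ENNReal.ofReal (chartPartition n B p q)) univ = 0 := by
    intro p hp
    have h0 : ∀ q, chartPartition n B p q = 0 := by
      intro q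
      by_contra hne
      exact hp (hfin.mem_toFinset.2 ⟨q, hne⟩)
    simp [h0]
  rw [tsum_eq_sum hzero]
  refine ENNReal.sum_lt_top.2 fun p _ => ?_
  rw [withDensity_apply _ MeasurableSet.univ, Measure.restrict_univ]
  refine lt_of_le_of_lt ?_ (M.chartVolume_lt_top p (isClosed_tsupport (chartPartition n B p))
    (chartPartition_isSubordinate n B p))
  rw [← lintegral_indicator_one (isClosed_tsupport _).measurableSet]
  refine lintegral_mono fun q => ?_
  by_cases hq : q ∈ tsupport (chartPartition n B p)
  · simpa [hq] using (chartPartition n B).le_one p q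
  · simp [hq, image_eq_zero_of_notMem_tsupport hq]

theorem integrable_mul_conj (M : ConicManifold n B N) {u v : B → ℂ}
    (hu : u ∈ testSubmodule n B) (hv : v ∈ testSubmodule n B) :
    Integrable (fun q => u q * starRingEnd ℂ (v q)) M.vol :=
  (hu.1.continuous.mul (Complex.continuous_conj.comp hv.1.continuous)).integrable_of_hasCompactSupport
    (HasCompactSupport.of_compactSpace _)

theorem integrable_gradInner (M : ConicManifold n B N) {u v : B → ℂ}
    (hu : u ∈ testSubmodule n B) (hv : v ∈ testSubmodule n B) :
    Integrable (M.gradInner u v) M.vol :=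
  (M.continuous_gradInner hu hv).integrable_of_hasCompactSupport
    (HasCompactSupport.of_compactSpace _)

/-- The inner product `∫ u v̄ dμ_g + ∫ ⟨∇u, ∇v̄⟩ dμ_g`. -/
noncomputable def energy (M : ConicManifold n B N) (u v : B → ℂ) : ℂ :=
  (∫ q, u q * starRingEnd ℂ (v q) ∂M.vol) + ∫ q, M.gradInner u v q ∂M.vol

/-- `C_c^∞` of the interior, to be normed by `energy`. -/
def TestFun (_M : ConicManifold n B N) : Type _ := testSubmodule n B

instance (M : ConicManifold n B N) : AddCommGroup M.TestFun :=
  inferInstanceAs (AddCommGroup (testSubmodule n B))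

instance (M : ConicManifold n B N) : Module ℂ M.TestFun :=
  inferInstanceAs (Module ℂ (testSubmodule n B))

/-- Mathlib's inner products are conjugate-linear in the first variable. -/
noncomputable instance (M : ConicManifold n B N) : PreInnerProductSpace.Core ℂ M.TestFun where
  inner u v := M.energy v.1 u.1
  conj_inner_symm u v := by
    simp only [energy, map_add, ← integral_conj, map_mul, Complex.conj_conj, gradInner_conj]
    congr 1
    exact integral_congr_ae (.of_forall fun q => mul_comm _ _)
  re_inner_nonneg u := by
    simp only [energy, map_add]
    refine add_nonneg ?_ ?_
    · rw [← integral_re (M.integrable_mul_conj u.2 u.2)]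
      refine integral_nonneg fun q => ?_
      simp [Complex.mul_conj, Complex.normSq_nonneg]
    · rw [← integral_re (M.integrable_gradInner u.2 u.2)]
      exact integral_nonneg fun q => M.gradInner_self_nonneg u.2 q
  add_left u v w := by
    have h1 : ∀ q, M.gradInner w.1 (u + v).1 q = M.gradInner w.1 u.1 q + M.gradInner w.1 v.1 q := by
      intro q
      rw [← gradInner_conj, show (u + v).1 = u.1 + v.1 from rfl, M.gradInner_add u.2 v.2, map_add,
        gradInner_conj, gradInner_conj]
    have h2 : ∀ q, w.1 q * starRingEnd ℂ ((u + v).1 q) =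
        w.1 q * starRingEnd ℂ (u.1 q) + w.1 q * starRingEnd ℂ (v.1 q) := by
      intro q
      rw [show (u + v).1 q = u.1 q + v.1 q from rfl, map_add, mul_add]
    simp only [energy, h1, h2]
    rw [integral_add (M.integrable_mul_conj w.2 u.2) (M.integrable_mul_conj w.2 v.2),
      integral_add (M.integrable_gradInner w.2 u.2) (M.integrable_gradInner w.2 v.2)]
    ring
  smul_left u v c := by
    have h1 : ∀ q, M.gradInner v.1 (c • u).1 q = starRingEnd ℂ c * M.gradInner v.1 u.1 q := by
      intro q
      rw [← gradInner_conj, show (c • u).1 = c • u.1 from rfl, M.gradInner_smul u.2, map_mul,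
        gradInner_conj]
    have h2 : ∀ q, v.1 q * starRingEnd ℂ ((c • u).1 q) =
        starRingEnd ℂ c * (v.1 q * starRingEnd ℂ (u.1 q)) := by
      intro q
      rw [show (c • u).1 q = c * u.1 q from rfl, map_mul]
      ring
    simp only [energy, h1, h2, integral_const_mul]
    ring

noncomputable instance (M : ConicManifold n B N) : SeminormedAddCommGroup M.TestFun :=
  InnerProductSpace.Core.toSeminormedAddCommGroup (𝕜 := ℂ)

noncomputable instance (M : ConicManifold n B N) : InnerProductSpace ℂ M.TestFun :=
  InnerProductSpace.ofCore inferInstance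

theorem norm_sq_testFun (M : ConicManifold n B N) (u : M.TestFun) :
    ‖u‖ ^ 2 = (M.energy u.1 u.1).re := by
  rw [← inner_self_eq_norm_sq (𝕜 := ℂ)]
  rfl

/-- The space `H¹(𝔹)`: the completion of `C_c^∞` of the interior for the inner product `energy`. -/
abbrev H1 (M : ConicManifold n B N) : Type _ := UniformSpace.Completion M.TestFun

theorem memLp_testFun (M : ConicManifold n B N) (u : M.TestFun) : MemLp u.1 2 M.vol :=
  u.2.1.continuous.memLp_of_hasCompactSupport (HasCompactSupport.of_compactSpace _)

/-- The identity `C_c^∞ → L²`, continuous for the norm of `H¹(𝔹)`. -/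
noncomputable def testToL2 (M : ConicManifold n B N) : M.TestFun →L[ℂ] Lp ℂ 2 M.vol :=
  LinearMap.mkContinuous
    { toFun := fun u => (M.memLp_testFun u).toLp u.1
      map_add' := fun _ _ => rfl
      map_smul' := fun _ _ => rfl } 1 (by
    intro u
    rw [one_mul]
    refine le_of_sq_le_sq ?_ (norm_nonneg _)
    rw [M.norm_sq_testFun, energy, Complex.add_re]
    have h1 : 0 ≤ (∫ q, M.gradInner u.1 u.1 q ∂M.vol).re := by
      rw [← Complex.reCLM_apply, ← Complex.reCLM.integral_comp_comm (M.integrable_gradInner u.2 u.2)]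
      exact integral_nonneg fun q => M.gradInner_self_nonneg u.2 q
    have h2 : ‖(M.memLp_testFun u).toLp u.1‖ ^ 2 =
        (∫ q, u.1 q * starRingEnd ℂ (u.1 q) ∂M.vol).re := by
      rw [← inner_self_eq_norm_sq (𝕜 := ℂ), L2.inner_def]
      have : (∫ q, inner ℂ ((M.memLp_testFun u).toLp u.1 q) ((M.memLp_testFun u).toLp u.1 q) ∂M.vol) =
          ∫ q, u.1 q * starRingEnd ℂ (u.1 q) ∂M.vol := by
        refine integral_congr_ae ?_
        filter_upwards [(M.memLp_testFun u).coeFn_toLp] with q hq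
        rw [hq, RCLike.inner_apply]
      rw [this]
      rfl
    have h3 := add_le_add h2.le h1
    rw [add_zero] at h3
    exact h3)

/-- The canonical map `H¹(𝔹) → L²(𝔹)`, the continuous extension of the identity of `C_c^∞`. -/
noncomputable def toL2 (M : ConicManifold n B N) : M.H1 →L[ℂ] Lp ℂ 2 M.vol :=
  M.testToL2.extend UniformSpace.Completion.toComplL

theorem toL2_coe (M : ConicManifold n B N) (u : M.TestFun) :
    M.toL2 (u : M.H1) = (M.memLp_testFun u).toLp u.1 := by
  exact ContinuousLinearMap.extend_eq _ (e := UniformSpace.Completion.toComplL)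
    UniformSpace.Completion.denseRange_coe (UniformSpace.Completion.isUniformInducing_coe _) u

end volume

end
end ConicManifold

/-! ### Sobolev norm of order one on `ℝᵈ` -/

/-- `G` is the `i`-th weak partial derivative of `f` on `ℝᵈ`. -/
def IsWeakPartial {d : ℕ} (i : Fin d) (f G : Rd d → ℂ) : Prop :=
  LocallyIntegrable f ∧ LocallyIntegrable G ∧
    ∀ φ : Rd d → ℝ, ContDiff ℝ ∞ φ → HasCompactSupport φ →
      ∫ z, fderiv ℝ φ z (EuclideanSpace.single i 1) • f z = - ∫ z, φ z • G z

/-- The norm of `H¹(ℝᵈ)`, namely `(‖f‖² + ∑ᵢ ‖∂ᵢ f‖²)^{1/2}` with `L²` norms and weak derivatives;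
it is `⊤` if some weak derivative does not exist. Weak derivatives are unique almost everywhere, so
the infimum is over a set with at most one element. -/
noncomputable def sobolevNorm {d : ℕ} (f : Rd d → ℂ) : ℝ≥0∞ :=
  (eLpNorm f 2 volume ^ 2 +
    ∑ i, ⨅ (G : Rd d → ℂ) (_ : IsWeakPartial i f G), eLpNorm G 2 volume ^ 2) ^ (1 / 2 : ℝ)

/-- The choices that enter the norm of the Mellin-Sobolev spaces: the cut-off function `ω`, a
finite atlas of `∂𝓑` and a finite atlas of `𝓑` with subordinate partitions of unity. -/
structure MellinData {n : ℕ} {B N : Type*}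
    [TopologicalSpace B] [ChartedSpace (EuclideanHalfSpace (n + 1)) B]
    [IsManifold (𝓡∂ (n + 1)) ∞ B]
    [TopologicalSpace N] [ChartedSpace (EuclideanSpace ℝ (Fin n)) N]
    [IsManifold (𝓡 n) ∞ N] (M : ConicManifold n B N) where
  /-- the cut-off function `ω` -/
  cutoff : B → ℝ
  contMDiff_cutoff : ContMDiff (𝓡∂ (n + 1)) 𝓘(ℝ, ℝ) ∞ cutoff
  cutoff_nonneg : ∀ p, 0 ≤ cutoff p
  tsupport_cutoff : tsupport cutoff ⊆ M.collar.target
  /-- on the collar `ω` depends only on `x` -/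
  cutoff_collar : ∀ x ∈ Ico (0 : ℝ) 1, ∀ y y' : N, cutoff (M.collar (x, y)) = cutoff (M.collar (x, y'))
  cutoff_eq_one : ∀ᶠ p in 𝓝ˢ ((𝓡∂ (n + 1)).boundary B), cutoff p = 1
  /-- number of charts of `∂𝓑` -/
  J : ℕ
  κ : Fin J → OpenPartialHomeomorph N (EuclideanSpace ℝ (Fin n))
  κ_mem : ∀ j, κ j ∈ IsManifold.maximalAtlas (𝓡 n) ∞ N
  φ : SmoothPartitionOfUnity (Fin J) (𝓡 n) N univ
  φ_subordinate : φ.IsSubordinate fun j => (κ j).source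
  /-- number of charts of `𝓑` -/
  L : ℕ
  χ : Fin L → OpenPartialHomeomorph B (EuclideanHalfSpace (n + 1))
  χ_mem : ∀ l, χ l ∈ IsManifold.maximalAtlas (𝓡∂ (n + 1)) ∞ B
  ψ : SmoothPartitionOfUnity (Fin L) (𝓡∂ (n + 1)) B univ
  ψ_subordinate : ψ.IsSubordinate fun l => (χ l).source

namespace MellinData
section
variable {n : ℕ} {B N : Type*}
    [TopologicalSpace B] [ChartedSpace (EuclideanHalfSpace (n + 1)) B]
    [IsManifold (𝓡∂ (n + 1)) ∞ B]
    [TopologicalSpace N] [ChartedSpace (EuclideanSpace ℝ (Fin n)) N]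
    [IsManifold (𝓡 n) ∞ N] {M : ConicManifold n B N}

/-- The last `n` coordinates of a point of `ℝⁿ⁺¹ = ℝ × ℝⁿ`. -/
def tail (z : Rd (n + 1)) : Rd n := WithLp.toLp 2 fun i => z i.succ

open scoped Classical in
/-- The function `M_γ (1 ⊗ κⱼ)_* (ω φⱼ u)` on `ℝ × ℝⁿ`, that is
`(t, η) ↦ e^{(γ - (n+1)/2) t} (ω φⱼ u)(e^{-t}, κⱼ⁻¹(η))`, extended by zero. -/
noncomputable def collarPiece (D : MellinData M) (γ : ℝ) (u : B → ℂ) (j : Fin D.J)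
    (z : Rd (n + 1)) : ℂ :=
  if 0 < z 0 ∧ tail z ∈ (D.κ j).target then
    (Real.exp ((γ - (n + 1) / 2) * z 0)
      * D.cutoff (M.collar (Real.exp (-z 0), (D.κ j).symm (tail z)))
      * D.φ j ((D.κ j).symm (tail z))) • u (M.collar (Real.exp (-z 0), (D.κ j).symm (tail z)))
  else 0

open scoped Classical in
/-- The function `ψₗ (1 - ω) u` in the chart `χₗ`, extended by zero to `ℝⁿ⁺¹`. -/
noncomputable def innerPiece (D : MellinData M) (u : B → ℂ) (l : Fin D.L) (z : Rd (n + 1)) : ℂ :=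
  if z ∈ ((D.χ l).extend (𝓡∂ (n + 1))).target then
    (D.ψ l (((D.χ l).extend (𝓡∂ (n + 1))).symm z)
      * (1 - D.cutoff (((D.χ l).extend (𝓡∂ (n + 1))).symm z)))
      • u (((D.χ l).extend (𝓡∂ (n + 1))).symm z)
  else 0

/-- The norm of the Mellin-Sobolev space `𝓗^{1,γ}(𝔹)`, with value `⊤` outside of the space:
`∑ⱼ ‖M_γ (1 ⊗ κⱼ)_* (ω φⱼ u)‖_{H¹(ℝⁿ⁺¹)} + ‖(1 - ω) u‖_{H¹}`, where the last norm is computed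
in the atlas `χ`. As `1 - ω` vanishes near the boundary, this is the norm of `H¹` of the double
of `𝓑`. -/
noncomputable def mellinNorm (D : MellinData M) (γ : ℝ) (u : B → ℂ) : ℝ≥0∞ :=
  ∑ j, sobolevNorm (D.collarPiece γ u j) + ∑ l, sobolevNorm (D.innerPiece u l)

/-- Membership in the Mellin-Sobolev space `𝓗^{1,γ}(𝔹)`. -/
def MemMellin (D : MellinData M) (γ : ℝ) (u : B → ℂ) : Prop := D.mellinNorm γ u < ⊤

/-- The element `∑ⱼ cⱼ ωⱼ` of `ℂ_ω`, where `ωⱼ` is the restriction of `ω` to the part of the collar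
over the `j`-th component of `∂𝓑`, extended by zero; the coefficients `cⱼ` are given as a locally
constant function on `∂𝓑`. Here `(M.collar.symm p).2` is the point `y` of `p = (x, y)`, and `ω`
vanishes off the collar. -/
noncomputable def cutoffConst (D : MellinData M) (c : LocallyConstant N ℂ) (p : B) : ℂ :=
  (D.cutoff p : ℂ) * c (M.collar.symm p).2

end
end MellinData

/-! On the collar put `x = e^{-t}`. The metric becomes `e^{-2t}(dt² + h)`, and since `h` is smooth
up to `x = 0` and `∂𝓑` is compact, it is uniformly comparable in charts to `e^{-2t}(dt² + dη²)`. So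
the squared norm of `H¹(𝔹)` is equivalent there to the integral of `e^{-(n+1)t}|u|² +
e^{-(n-1)t}|∂u|²` over half-cylinders, whereas the norm of `𝓗^{1,γ}` weighs both `|u|²` and `|∂u|²`
by `e^{-(n+1-2γ)t}`. All claims are comparisons of these weights. A `Piece` treats the collar (`τ =
1`) and the inner charts (`τ = 0`) in the same way; its localizations are the very functions whose
Sobolev norms add up to the Mellin–Sobolev norm.

For `γ = 1` both weights are `e^{-(n-1)t}`, so the norm of `𝓗^{1,1}` dominates the energy, and
mollification with truncation approximates by test functions (`exists_tendsto_of_isWeakPartial`,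
`Piece.exists_toL2_eq_smul`). A function that is constant near the boundary is the limit of its
truncations by `θ(t/k)`: the energy of the error is `O(∫_k^∞ t^{-2} dt)` even for `n = 1`, where the
gradient has weight `1` (`MellinData.exists_toL2_eq_cutoffConst`). For `n = 1` a nonzero constant is
not square integrable with weight `1` over an infinite cylinder, hence the trivial intersection.

For `β < 1` the exponent `α = n + 1 - 2β` exceeds `n - 1 ≥ 0`, so `hardy_inequality` bounds the
integral of `e^{-αt}|u|²` by that of `e^{-αt}|∂ₜu|²`, and `e^{-αt} ≤ e^{-(n-1)t}`
(`Piece.exists_lintegral_localize_le`). This gives the embedding into `𝓗^{1,β}`.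

Compactness: the estimate for `β = 1/2` makes the squared `L²` norm over `t ≥ R` of order `e^{-R}`,
and on the rest averages over fine grids approximate the identity
(`exists_isCompactOperator_approx`).

Injectivity: if `U` has zero image in `L²`, all its localizations and their weak derivatives vanish.
The energy over the support of a fixed test function `u` is controlled by the localizations
(`Piece.enorm_sq_le_of_cover`), which gives `‖u‖² ≤ 2‖u - U‖²` for every `u`, and `U = 0` by
density. -/

/-! ### Square integrals -/

section SquareIntegrals
variable {α E : Type*} [MeasurableSpace α] [NormedAddCommGroup E]

/-- Cauchy–Schwarz against the constant function `1`. It serves for probability densities, for the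
unit interval and for grid cells. -/
theorem sq_lintegral_le (ν : Measure α) {g : α → ℝ≥0∞} (hg : AEMeasurable g ν) :
    (∫⁻ x, g x ∂ν) ^ 2 ≤ ν univ * ∫⁻ x, g x ^ 2 ∂ν := by
  have h := ENNReal.lintegral_mul_le_Lp_mul_Lq ν Real.HolderConjugate.two_two hg
    (aemeasurable_const (b := (1 : ℝ≥0∞)))
  simp only [Pi.mul_apply, mul_one, ENNReal.one_rpow, lintegral_const, one_mul] at h
  calc (∫⁻ x, g x ∂ν) ^ 2 ≤ ((∫⁻ x, g x ^ (2 : ℝ) ∂ν) ^ (1 / 2 : ℝ) * ν univ ^ (1 / 2 : ℝ)) ^ 2 := by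
        gcongr
    _ = ν univ * ∫⁻ x, g x ^ 2 ∂ν := by
        rw [mul_pow, ← ENNReal.rpow_natCast, ← ENNReal.rpow_natCast, ← ENNReal.rpow_mul,
          ← ENNReal.rpow_mul]
        norm_num
        rw [mul_comm]

theorem eLpNorm_two_sq {μ : Measure α} (f : α → E) :
    eLpNorm f 2 μ ^ 2 = ∫⁻ x, ‖f x‖ₑ ^ 2 ∂μ := by
  rw [eLpNorm_eq_lintegral_rpow_enorm_toReal (by simp) (by simp), ← ENNReal.rpow_natCast,
    ← ENNReal.rpow_mul]
  norm_num

theorem enorm_add_sq_le (a b : E) : ‖a + b‖ₑ ^ 2 ≤ 2 * (‖a‖ₑ ^ 2 + ‖b‖ₑ ^ 2) := by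
  have h : ‖a + b‖ ^ 2 ≤ 2 * (‖a‖ ^ 2 + ‖b‖ ^ 2) := by
    nlinarith [norm_add_le a b, sq_nonneg (‖a‖ - ‖b‖), norm_nonneg a, norm_nonneg b,
      norm_nonneg (a + b)]
  have := ENNReal.ofReal_le_ofReal h
  rwa [ENNReal.ofReal_pow (norm_nonneg _), ofReal_norm, ENNReal.ofReal_mul (by norm_num),
    ENNReal.ofReal_add (by positivity) (by positivity), ENNReal.ofReal_pow (norm_nonneg _),
    ENNReal.ofReal_pow (norm_nonneg _), ofReal_norm, ofReal_norm, ENNReal.ofReal_ofNat] at this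

theorem enorm_sq_eq_ofReal (a : E) : ‖a‖ₑ ^ 2 = ENNReal.ofReal (‖a‖ ^ 2) := by
  rw [ENNReal.ofReal_pow (norm_nonneg _), ofReal_norm]

theorem enorm_sum_sq_le {ι : Type*} [Fintype ι] (a : ι → E) :
    ‖∑ i, a i‖ₑ ^ 2 ≤ Fintype.card ι * ∑ i, ‖a i‖ₑ ^ 2 := by
  have h : ‖∑ i, a i‖ ^ 2 ≤ Fintype.card ι * ∑ i, ‖a i‖ ^ 2 := by
    refine (pow_le_pow_left₀ (norm_nonneg _) (norm_sum_le _ _) 2).trans ?_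
    exact sq_sum_le_card_mul_sum_sq (s := Finset.univ) (f := fun i => ‖a i‖)
  have := ENNReal.ofReal_le_ofReal h
  rw [ENNReal.ofReal_mul (by positivity), ENNReal.ofReal_sum_of_nonneg (by intros; positivity)] at this
  simpa only [enorm_sq_eq_ofReal, ENNReal.ofReal_natCast] using this

/-- Almost everywhere convergence without gain of `L²` norm is convergence in `L²`. -/
theorem tendsto_lintegral_sub_sq_of_ae {μ : Measure α} {f : α → ℂ} {F : ℕ → α → ℂ}
    (hF : ∀ k, AEStronglyMeasurable (F k) μ) (hf : AEStronglyMeasurable f μ)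
    (hfin : ∫⁻ x, ‖f x‖ₑ ^ 2 ∂μ < ⊤)
    (hle : ∀ k, ∫⁻ x, ‖F k x‖ₑ ^ 2 ∂μ ≤ ∫⁻ x, ‖f x‖ₑ ^ 2 ∂μ)
    (hlim : ∀ᵐ x ∂μ, Filter.Tendsto (fun k => F k x) Filter.atTop (𝓝 (f x))) :
    Filter.Tendsto (fun k => ∫⁻ x, ‖F k x - f x‖ₑ ^ 2 ∂μ) Filter.atTop (𝓝 0) := by
  set I := ∫⁻ x, ‖f x‖ₑ ^ 2 ∂μ with hI
  have hpar : ∀ k, (∫⁻ x, ‖F k x + f x‖ₑ ^ 2 ∂μ) + ∫⁻ x, ‖F k x - f x‖ₑ ^ 2 ∂μ ≤ 4 * I := by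
    intro k
    have hm : AEMeasurable (fun x => ‖F k x + f x‖ₑ ^ 2) μ := ((hF k).add hf).enorm.pow_const 2
    rw [← lintegral_add_left' hm]
    have : ∀ x, ‖F k x + f x‖ₑ ^ 2 + ‖F k x - f x‖ₑ ^ 2 = 2 * ‖F k x‖ₑ ^ 2 + 2 * ‖f x‖ₑ ^ 2 := by
      intro x
      have h := parallelogram_law_with_norm ℂ (F k x) (f x)
      simp only [enorm_sq_eq_ofReal]
      rw [← ENNReal.ofReal_add (by positivity) (by positivity),
        show (2 : ℝ≥0∞) = ENNReal.ofReal 2 by simp, ← ENNReal.ofReal_mul (by norm_num),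
        ← ENNReal.ofReal_mul (by norm_num), ← ENNReal.ofReal_add (by positivity) (by positivity)]
      congr 1
      linarith
    simp only [this]
    rw [lintegral_add_left' ((hF k).enorm.pow_const 2 |>.const_mul 2),
      lintegral_const_mul'' _ ((hF k).enorm.pow_const 2), lintegral_const_mul'' _ (hf.enorm.pow_const 2)]
    calc _ ≤ 2 * I + 2 * I := by gcongr; exact hle k
      _ = 4 * I := by rw [← add_mul]; norm_num
  -- Fatou's lemma is applied to the sums `F k + f`, which tend to `2f`. By the parallelogram law
  -- and `hle`, sums and differences together have at most `4 * I`, so nothing is left for the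
  -- differences in the limit.
  have hfatou : 4 * I ≤ Filter.liminf (fun k => ∫⁻ x, ‖F k x + f x‖ₑ ^ 2 ∂μ) Filter.atTop := by
    refine le_trans (le_of_eq ?_) (lintegral_liminf_le' fun k => ((hF k).add hf).enorm.pow_const 2)
    rw [hI, ← lintegral_const_mul'' _ (hf.enorm.pow_const 2)]
    refine lintegral_congr_ae ?_
    filter_upwards [hlim] with x hx
    have h1 : Filter.Tendsto (fun k => ‖F k x + f x‖ₑ ^ 2) Filter.atTop (𝓝 (‖f x + f x‖ₑ ^ 2)) :=
      ((ENNReal.continuous_pow 2).tendsto _).comp (hx.add_const (f x)).enorm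
    refine Eq.trans ?_ h1.liminf_eq.symm
    rw [← two_mul, enorm_mul, mul_pow]
    congr 1
    simp [enorm_eq_nnnorm]
    norm_num
  rw [ENNReal.tendsto_nhds_zero]
  intro ε hε
  -- In `ℝ≥0∞` the inequality `4 * I - ε < 4 * I` needs `4 * I ≠ 0`.
  rcases eq_or_ne I 0 with h0 | h0
  · filter_upwards with k
    have := hpar k
    rw [h0, mul_zero, nonpos_iff_eq_zero, add_eq_zero] at this
    rw [this.2]; exact zero_le
  have h4 : 4 * I ≠ ⊤ := ENNReal.mul_ne_top (by simp) hfin.ne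
  have hlt : 4 * I - ε < 4 * I := ENNReal.sub_lt_self h4 (by simp [h0]) hε.ne'
  filter_upwards [Filter.eventually_lt_of_lt_liminf (hlt.trans_le hfatou)] with k hk
  have h5 : ∫⁻ x, ‖F k x + f x‖ₑ ^ 2 ∂μ ≠ ⊤ := ((le_self_add.trans (hpar k)).trans_lt h4.lt_top).ne
  have h6 : 4 * I ≤ (∫⁻ x, ‖F k x + f x‖ₑ ^ 2 ∂μ) + ε := tsub_le_iff_right.1 hk.le
  exact (ENNReal.add_le_add_iff_left h5).1 ((hpar k).trans h6)

end SquareIntegrals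

/-! ### Weak derivatives -/

section WeakDerivatives
variable {d : ℕ}

theorem IsWeakPartial.ae_eq {i : Fin d} {f G G' : Rd d → ℂ} (h : IsWeakPartial i f G)
    (h' : IsWeakPartial i f G') : G =ᵐ[volume] G' :=
  ae_eq_of_integral_contDiff_smul_eq h.2.1 h'.2.1 fun φ hφ hc => by
    have h1 := h.2.2 φ hφ hc
    rw [h'.2.2 φ hφ hc] at h1
    exact (neg_injective h1).symm

theorem IsWeakPartial.congr {i : Fin d} {f f' G G' : Rd d → ℂ} (h : IsWeakPartial i f G)
    (hf : f =ᵐ[volume] f') (hG : G =ᵐ[volume] G') : IsWeakPartial i f' G' := by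
  refine ⟨h.1.congr hf, h.2.1.congr hG, fun φ hφ hc => ?_⟩
  have h1 : (fun z => fderiv ℝ φ z (EuclideanSpace.single i 1) • f z) =ᵐ[volume]
      fun z => fderiv ℝ φ z (EuclideanSpace.single i 1) • f' z := by
    filter_upwards [hf] with z hz using by rw [hz]
  have h2 : (fun z => φ z • G z) =ᵐ[volume] fun z => φ z • G' z := by
    filter_upwards [hG] with z hz using by rw [hz]
  rw [← integral_congr_ae h1, ← integral_congr_ae h2]
  exact h.2.2 φ hφ hc

/-- The `i`-th partial derivative. -/
noncomputable def partialDeriv {F : Type*} [NormedAddCommGroup F] [NormedSpace ℝ F]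
    (i : Fin d) (f : Rd d → F) (z : Rd d) : F :=
  fderiv ℝ f z (EuclideanSpace.single i 1)

theorem continuous_partialDeriv {F : Type*} [NormedAddCommGroup F] [NormedSpace ℝ F]
    (i : Fin d) {f : Rd d → F} (hf : ContDiff ℝ ∞ f) : Continuous (partialDeriv i f) :=
  (hf.continuous_fderiv (by simp)).clm_apply continuous_const

theorem contDiff_partialDeriv {F : Type*} [NormedAddCommGroup F] [NormedSpace ℝ F]
    (i : Fin d) {f : Rd d → F} (hf : ContDiff ℝ ∞ f) : ContDiff ℝ ∞ (partialDeriv i f) :=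
  (hf.fderiv_right (m := ∞) (by simp)).clm_apply contDiff_const

theorem tsupport_partialDeriv_subset {F : Type*} [NormedAddCommGroup F] [NormedSpace ℝ F]
    (i : Fin d) (f : Rd d → F) : tsupport (partialDeriv i f) ⊆ tsupport f :=
  tsupport_fderiv_apply_subset ℝ _

theorem hasCompactSupport_partialDeriv {F : Type*} [NormedAddCommGroup F] [NormedSpace ℝ F]
    (i : Fin d) {f : Rd d → F} (hf : HasCompactSupport f) : HasCompactSupport (partialDeriv i f) :=
  hf.fderiv_apply ℝ _

theorem isWeakPartial_partialDeriv (i : Fin d) {f : Rd d → ℂ} (hf : ContDiff ℝ ∞ f) :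
    IsWeakPartial i f (partialDeriv i f) := by
  refine ⟨hf.continuous.locallyIntegrable, (continuous_partialDeriv i hf).locallyIntegrable,
    fun φ hφ hc => ?_⟩
  have h1 : Continuous fun z => fderiv ℝ φ z (EuclideanSpace.single i 1) :=
    continuous_partialDeriv i hφ
  have h := integral_smul_fderiv_eq_neg_fderiv_smul_of_integrable (μ := (volume : Measure (Rd d)))
    (f := φ) (g := f) (v := EuclideanSpace.single i 1)
    ((h1.smul hf.continuous).integrable_of_hasCompactSupport ((hc.fderiv_apply ℝ _).smul_right))
    ((hφ.continuous.smul (continuous_partialDeriv i hf)).integrable_of_hasCompactSupport hc.smul_right)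
    ((hφ.continuous.smul hf.continuous).integrable_of_hasCompactSupport hc.smul_right)
    (fun x _ => hφ.differentiable (by simp) x) (fun x _ => hf.differentiable (by simp) x)
  simp only [partialDeriv]
  rw [h, neg_neg]

/-- Weak derivatives are unique almost everywhere, so the infimum in `sobolevNorm` is attained by
whichever weak derivative is at hand. -/
theorem sobolevNorm_sq {f : Rd d → ℂ} {G : Fin d → Rd d → ℂ}
    (h : ∀ i, IsWeakPartial i f (G i)) :
    sobolevNorm f ^ 2 = (∫⁻ z, ‖f z‖ₑ ^ 2) + ∑ i, ∫⁻ z, ‖G i z‖ₑ ^ 2 := by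
  have hi : ∀ i, (⨅ (G' : Rd d → ℂ) (_ : IsWeakPartial i f G'), eLpNorm G' 2 volume ^ 2) =
      ∫⁻ z, ‖G i z‖ₑ ^ 2 := by
    intro i
    refine le_antisymm ((iInf₂_le (G i) (h i)).trans (eLpNorm_two_sq _).le)
      (le_iInf₂ fun G' hG' => ?_)
    rw [eLpNorm_congr_ae (hG'.ae_eq (h i)), eLpNorm_two_sq]
  rw [sobolevNorm, ← ENNReal.rpow_natCast, ← ENNReal.rpow_mul]
  rw [Finset.sum_congr rfl fun i _ => hi i, eLpNorm_two_sq]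
  norm_num

/-- An infimum over the empty set is `⊤`, so a finite norm forces weak derivatives to exist. -/
theorem exists_isWeakPartial_of_sobolevNorm_lt_top {f : Rd d → ℂ} (h : sobolevNorm f < ⊤)
    (i : Fin d) : ∃ G, IsWeakPartial i f G := by
  by_contra! hG
  refine h.ne ?_
  rw [sobolevNorm, ENNReal.rpow_eq_top_iff]
  refine Or.inr ⟨?_, by norm_num⟩
  refine ENNReal.add_eq_top.2 (Or.inr (ENNReal.sum_eq_top.2 ⟨i, Finset.mem_univ i, ?_⟩))
  simp [hG]

end WeakDerivatives

/-! ### Mollification -/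

section Mollification
open scoped Convolution
variable {d : ℕ}

/-- The mollification of `f` by a bump function. -/
noncomputable def mollify (ρ : ContDiffBump (0 : Rd d)) (f : Rd d → ℂ) : Rd d → ℂ :=
  ρ.normed volume ⋆[ContinuousLinearMap.lsmul ℝ ℝ, volume] f

theorem mollify_apply (ρ : ContDiffBump (0 : Rd d)) (f : Rd d → ℂ) (x : Rd d) :
    mollify ρ f x = ∫ t, ρ.normed volume t • f (x - t) := rfl

theorem contDiff_mollify (ρ : ContDiffBump (0 : Rd d)) {f : Rd d → ℂ} (hf : LocallyIntegrable f) :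
    ContDiff ℝ ∞ (mollify ρ f) :=
  ρ.hasCompactSupport_normed.contDiff_convolution_left _ ρ.contDiff_normed hf

/-- The bump is a probability density: Cauchy–Schwarz bounds the square of the average by the
average of the square, and Tonelli with translation invariance integrates the bump out. -/
theorem lintegral_mollify_sq_le (ρ : ContDiffBump (0 : Rd d)) {f : Rd d → ℂ}
    (hf : AEStronglyMeasurable f) :
    ∫⁻ x, ‖mollify ρ f x‖ₑ ^ 2 ≤ ∫⁻ x, ‖f x‖ₑ ^ 2 := by
  -- Tonelli needs joint measurability of `g (x - t)`, hence a measurable representative. It differs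
  -- from `f` on a null set only, and `t ↦ x - t` respects null sets.
  set g := hf.mk f with hg
  have hgm : Measurable g := hf.stronglyMeasurable_mk.measurable
  have hfg : f =ᵐ[volume] g := hf.ae_eq_mk
  have hρm : Measurable fun t => ENNReal.ofReal (ρ.normed volume t) :=
    ρ.continuous_normed.measurable.ennreal_ofReal
  have hρ1 : ∫⁻ t, ENNReal.ofReal (ρ.normed volume t) = 1 := by
    rw [← ofReal_integral_eq_lintegral_ofReal ρ.integrable_normed (.of_forall ρ.nonneg_normed),
      ρ.integral_normed, ENNReal.ofReal_one]
  have h1 : ∀ x, ‖mollify ρ f x‖ₑ ^ 2 ≤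
      ∫⁻ t, ENNReal.ofReal (ρ.normed volume t) * ‖g (x - t)‖ₑ ^ 2 := by
    intro x
    have hx : mollify ρ f x = ∫ t, ρ.normed volume t • g (x - t) := by
      rw [mollify_apply]
      refine integral_congr_ae ?_
      filter_upwards [(quasiMeasurePreserving_sub_left (volume : Measure (Rd d)) x).ae_eq_comp hfg]
        with t ht
      simp only [Function.comp_apply] at ht
      rw [ht]
    have hm : Measurable fun t => ‖g (x - t)‖ₑ := (hgm.comp (measurable_id.const_sub x)).enorm
    calc ‖mollify ρ f x‖ₑ ^ 2 ≤ (∫⁻ t, ‖ρ.normed volume t • g (x - t)‖ₑ) ^ 2 := by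
          rw [hx]; gcongr; exact enorm_integral_le_lintegral_enorm _
      _ = (∫⁻ t, ‖g (x - t)‖ₑ
            ∂(volume.withDensity fun t => ENNReal.ofReal (ρ.normed volume t))) ^ 2 := by
          rw [lintegral_withDensity_eq_lintegral_mul _ hρm hm]
          congr 1
          refine lintegral_congr fun t => ?_
          rw [enorm_smul, Real.enorm_eq_ofReal (ρ.nonneg_normed t)]
          rfl
      _ ≤ _ := sq_lintegral_le _ hm.aemeasurable
      _ = _ := by
          rw [withDensity_apply _ MeasurableSet.univ, Measure.restrict_univ, hρ1, one_mul,
            lintegral_withDensity_eq_lintegral_mul _ hρm (hm.pow_const 2)]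
          rfl
  calc ∫⁻ x, ‖mollify ρ f x‖ₑ ^ 2
      ≤ ∫⁻ x, ∫⁻ t, ENNReal.ofReal (ρ.normed volume t) * ‖g (x - t)‖ₑ ^ 2 := lintegral_mono h1
    _ = ∫⁻ t, ∫⁻ x, ENNReal.ofReal (ρ.normed volume t) * ‖g (x - t)‖ₑ ^ 2 := by
        refine lintegral_lintegral_swap (Measurable.aemeasurable ?_)
        exact (hρm.comp measurable_snd).mul
          ((hgm.comp (measurable_fst.sub measurable_snd)).enorm.pow_const 2)
    _ = ∫⁻ t, ENNReal.ofReal (ρ.normed volume t) * ∫⁻ x, ‖g x‖ₑ ^ 2 := by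
        refine lintegral_congr fun t => ?_
        have hm : Measurable fun x => ‖g (x - t)‖ₑ ^ 2 :=
          (hgm.comp (measurable_id.sub_const t)).enorm.pow_const 2
        rw [lintegral_const_mul _ hm, lintegral_sub_right_eq_self (fun x => ‖g x‖ₑ ^ 2) t]
    _ = ∫⁻ x, ‖g x‖ₑ ^ 2 := by rw [lintegral_mul_const _ hρm, hρ1, one_mul]
    _ = ∫⁻ x, ‖f x‖ₑ ^ 2 := lintegral_congr_ae (hfg.mono fun x hx => by simp only [hx])

/-- The derivative falls on the bump; the reflected bump `t ↦ ρ (x - t)` is then a test function for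
the weak derivative. -/
theorem partialDeriv_mollify (ρ : ContDiffBump (0 : Rd d)) {f G : Rd d → ℂ} {i : Fin d}
    (h : IsWeakPartial i f G) : partialDeriv i (mollify ρ f) = mollify ρ G := by
  funext x
  have h1 := (ρ.hasCompactSupport_normed (μ := volume)).hasFDerivAt_convolution_left
    (ContinuousLinearMap.lsmul ℝ ℝ : ℝ →L[ℝ] ℂ →L[ℝ] ℂ) (ρ.contDiff_normed (n := 1)) h.1 x
  have h2 : HasFDerivAt (mollify ρ f) _ x := h1
  rw [partialDeriv, h2.fderiv]
  have hint : Integrable (fun t => (ContinuousLinearMap.lsmul ℝ ℝ : ℝ →L[ℝ] ℂ →L[ℝ] ℂ).precompL (Rd d)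
      (fderiv ℝ (ρ.normed volume) t) (f (x - t))) :=
    ((ρ.hasCompactSupport_normed.fderiv ℝ).convolutionExists_left _
      ((ρ.contDiff_normed (n := 1)).continuous_fderiv one_ne_zero) h.1) x
  have h3 : (fderiv ℝ (ρ.normed volume) ⋆[(ContinuousLinearMap.lsmul ℝ ℝ : ℝ →L[ℝ] ℂ →L[ℝ] ℂ).precompL
      (Rd d), volume] f) x (EuclideanSpace.single i 1) =
      ∫ t, partialDeriv i (ρ.normed volume) t • f (x - t) := by
    rw [convolution_def, ContinuousLinearMap.integral_apply hint]
    rfl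
  refine h3.trans ?_
  set ψ : Rd d → ℝ := fun t => ρ.normed volume (x - t) with hψ
  have hψs : ContDiff ℝ ∞ ψ := ρ.contDiff_normed.comp (contDiff_const.sub contDiff_id)
  have hψc : HasCompactSupport ψ :=
    (ρ.hasCompactSupport_normed (μ := volume)).comp_homeomorph (Homeomorph.subLeft x)
  have h4 := h.2.2 ψ hψs hψc
  -- The sign of the reflection cancels the sign in the definition of a weak derivative.
  have h5 : ∀ t, fderiv ℝ ψ t (EuclideanSpace.single i 1) =
      - partialDeriv i (ρ.normed volume) (x - t) := by
    intro t
    have := ((ρ.contDiff_normed (n := 1) (μ := volume)).differentiable one_ne_zero (x - t)).hasFDerivAt.comp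
      t ((hasFDerivAt_id t).const_sub x)
    rw [HasFDerivAt.fderiv (f := ψ) this]
    simp [partialDeriv]
  simp only [h5, neg_smul, integral_neg, neg_inj] at h4
  rw [mollify, convolution_lsmul_swap, ← h4,
    ← integral_sub_left_eq_self (fun t => partialDeriv i (ρ.normed volume) t • f (x - t)) volume x]
  simp

theorem support_mollify_subset (ρ : ContDiffBump (0 : Rd d)) {f : Rd d → ℂ} {S : Set (Rd d)}
    (hS : ∀ z ∉ S, f z = 0) {ε : ℝ} (hε : ρ.rOut ≤ ε) :
    Function.support (mollify ρ f) ⊆ Metric.cthickening ε S := by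
  intro x hx
  have hS' : Function.support f ⊆ S := fun z hz => by_contra fun h => hz (hS z h)
  obtain ⟨a, ha, b, hb, rfl⟩ := Set.mem_add.1 (support_convolution_subset _ hx)
  rw [ρ.support_normed_eq, Metric.mem_ball, dist_zero_right] at ha
  refine Metric.mem_cthickening_of_dist_le _ b _ _ (hS' hb) ?_
  rw [dist_eq_norm, add_sub_cancel_right]
  linarith

/-- A smooth cut-off function that is `1` on the ball of radius `1`. -/
noncomputable def unitCutoff (d : ℕ) : ContDiffBump (0 : Rd d) := ⟨1, 2, one_pos, one_lt_two⟩

/-- Functions with square integrable weak derivatives are limits of test functions. -/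
theorem exists_tendsto_of_isWeakPartial {f : Rd d → ℂ} {G : Fin d → Rd d → ℂ}
    (hf : ∫⁻ z, ‖f z‖ₑ ^ 2 < ⊤) (hG : ∀ i, ∫⁻ z, ‖G i z‖ₑ ^ 2 < ⊤)
    (hfL : LocallyIntegrable f) (hw : ∀ i, IsWeakPartial i f (G i)) {S : Set (Rd d)}
    (hS : ∀ z ∉ S, f z = 0) {ε : ℝ} (hε : 0 < ε) :
    ∃ F : ℕ → Rd d → ℂ, (∀ k, ContDiff ℝ ∞ (F k)) ∧ (∀ k, HasCompactSupport (F k)) ∧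
      (∀ k, tsupport (F k) ⊆ Metric.cthickening ε S) ∧
      Filter.Tendsto (fun k => ∫⁻ z, ‖F k z - f z‖ₑ ^ 2) Filter.atTop (𝓝 0) ∧
      ∀ i, Filter.Tendsto (fun k => ∫⁻ z, ‖partialDeriv i (F k) z - G i z‖ₑ ^ 2)
        Filter.atTop (𝓝 0) := by
  -- Both radii shrink with the fixed ratio `2`, as almost everywhere convergence of mollifications
  -- requires, and the outer radius never exceeds `ε`, which controls the supports.
  let ρ : ℕ → ContDiffBump (0 : Rd d) := fun k =>
    ⟨ε / 2 * (1 / ((k : ℝ) + 1)), ε * (1 / ((k : ℝ) + 1)), by positivity, by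
      have : 0 < 1 / ((k : ℝ) + 1) := by positivity
      nlinarith⟩
  have hρ0 : Filter.Tendsto (fun k => (ρ k).rOut) Filter.atTop (𝓝 0) := by
    have := (tendsto_one_div_add_atTop_nhds_zero_nat (𝕜 := ℝ)).const_mul ε
    rwa [mul_zero] at this
  have hρε : ∀ k, (ρ k).rOut ≤ ε := by
    intro k
    refine mul_le_of_le_one_right hε.le ?_
    rw [div_le_one (by positivity)]
    linarith [Nat.cast_nonneg (α := ℝ) k]
  have hmol : ∀ {g : Rd d → ℂ}, LocallyIntegrable g → ∫⁻ z, ‖g z‖ₑ ^ 2 < ⊤ →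
      Filter.Tendsto (fun k => ∫⁻ z, ‖mollify (ρ k) g z - g z‖ₑ ^ 2) Filter.atTop (𝓝 0) := by
    intro g hg hg2
    refine tendsto_lintegral_sub_sq_of_ae
      (fun k => (contDiff_mollify (ρ k) hg).continuous.aestronglyMeasurable)
      hg.aestronglyMeasurable hg2 (fun k => lintegral_mollify_sq_le _ hg.aestronglyMeasurable) ?_
    refine ContDiffBump.ae_convolution_tendsto_right_of_locallyIntegrable (K := 2) hρ0 ?_ hg
    refine .of_forall fun k => le_of_eq ?_
    simp only [ρ]; ring
  -- The truncations `θ (r k • z)` tend to `1` pointwise, and their derivatives carry the factor `r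
  -- k → 0`.
  set θ := unitCutoff d
  let r : ℕ → ℝ := fun k => 1 / ((k : ℝ) + 1)
  have hr : ∀ k, 0 ≤ r k := fun k => by positivity
  have hr0 : Filter.Tendsto r Filter.atTop (𝓝 0) := tendsto_one_div_add_atTop_nhds_zero_nat
  have hθs : ContDiff ℝ ∞ (θ : Rd d → ℝ) := θ.contDiff
  have hθk : ∀ k, ContDiff ℝ ∞ fun z => θ (r k • z) := fun k =>
    hθs.comp (contDiff_const_smul (r k))
  have hcut : ∀ {g : Rd d → ℂ}, AEStronglyMeasurable g → ∫⁻ z, ‖g z‖ₑ ^ 2 < ⊤ →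
      Filter.Tendsto (fun k => ∫⁻ z, ‖(θ (r k • z) - 1) • g z‖ₑ ^ 2) Filter.atTop (𝓝 0) := by
    intro g hg hg2
    have h0 : (0 : ℝ≥0∞) = ∫⁻ z : Rd d, 0 := by simp
    rw [h0]
    refine tendsto_lintegral_of_dominated_convergence' (fun z => ‖g z‖ₑ ^ 2) (fun k => ?_)
      (fun k => .of_forall fun z => ?_) hg2.ne (.of_forall fun z => ?_)
    · exact ((((hθk k).continuous.sub continuous_const).aestronglyMeasurable.smul hg).enorm.pow_const 2)
    · refine pow_le_pow_left₀ zero_le ?_ 2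
      rw [enorm_smul]
      refine mul_le_of_le_one_left zero_le ?_
      rw [Real.enorm_eq_ofReal_abs, ENNReal.ofReal_le_one, abs_le]
      constructor <;> linarith [θ.nonneg' (r k • z), θ.le_one (x := r k • z)]
    · have hz : Filter.Tendsto (fun k => r k • z) Filter.atTop (𝓝 0) := by
        simpa using hr0.smul_const z
      refine tendsto_const_nhds.congr' ?_
      filter_upwards [hz.eventually (Metric.closedBall_mem_nhds 0 one_pos)] with k hk
      rw [θ.one_of_mem_closedBall hk]
      simp
  obtain ⟨C, hC⟩ : ∃ C : ℝ, ∀ i z, |partialDeriv i (θ : Rd d → ℝ) z| ≤ C := by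
    obtain ⟨C, hC⟩ := (hθs.continuous_fderiv (by simp)).bounded_above_of_compact_support
      (θ.hasCompactSupport.fderiv ℝ)
    refine ⟨C, fun i z => ?_⟩
    refine ((fderiv ℝ (θ : Rd d → ℝ) z).le_opNorm _).trans ?_
    simpa using hC z
  have hFs : ∀ k, ContDiff ℝ ∞ fun z => θ (r k • z) • mollify (ρ k) f z := fun k =>
    (hθk k).smul (contDiff_mollify (ρ k) hfL)
  refine ⟨fun k z => θ (r k • z) • mollify (ρ k) f z, hFs, fun k => ?_, fun k => ?_, ?_, fun i => ?_⟩
  · have hrk : r k ≠ 0 := by simp only [r]; positivity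
    exact (θ.hasCompactSupport.comp_homeomorph (Homeomorph.smulOfNeZero (r k) hrk)).smul_right
  · refine closure_minimal ?_ Metric.isClosed_cthickening
    exact (Function.support_smul_subset_right (fun z => θ (r k • z)) _).trans
      (support_mollify_subset _ hS (hρε k))
  · refine tendsto_of_tendsto_of_tendsto_of_le_of_le tendsto_const_nhds
      (h := fun k => 2 * ((∫⁻ z, ‖mollify (ρ k) f z - f z‖ₑ ^ 2) +
        ∫⁻ z, ‖(θ (r k • z) - 1) • f z‖ₑ ^ 2)) ?_ (fun _ => zero_le) fun k => ?_
    · have := ENNReal.Tendsto.const_mul (a := 2)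
        ((hmol hfL hf).add (hcut hfL.aestronglyMeasurable hf)) (Or.inr (by simp))
      simpa using this
    · simp only
      have hm : AEMeasurable (fun z => ‖mollify (ρ k) f z - f z‖ₑ ^ 2) :=
        ((contDiff_mollify (ρ k) hfL).continuous.aestronglyMeasurable.sub
          hfL.aestronglyMeasurable).enorm.pow_const 2
      rw [← lintegral_add_left' hm, ← lintegral_const_mul' _ _ (by simp)]
      refine lintegral_mono fun z => ?_
      have : θ (r k • z) • mollify (ρ k) f z - f z =
          θ (r k • z) • (mollify (ρ k) f z - f z) + (θ (r k • z) - 1) • f z := by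
        rw [smul_sub, sub_smul, one_smul]; abel
      rw [this]
      refine (enorm_add_sq_le _ _).trans ?_
      gcongr
      rw [enorm_smul]
      refine mul_le_of_le_one_left zero_le ?_
      rw [Real.enorm_eq_ofReal (θ.nonneg' _), ENNReal.ofReal_le_one]
      exact θ.le_one
  · have hGL := (hw i).2.1
    refine tendsto_of_tendsto_of_tendsto_of_le_of_le tendsto_const_nhds
      (h := fun k => 2 * (2 * ((∫⁻ z, ‖mollify (ρ k) (G i) z - G i z‖ₑ ^ 2) +
        ∫⁻ z, ‖(θ (r k • z) - 1) • G i z‖ₑ ^ 2) +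
        ENNReal.ofReal (r k * C) ^ 2 * ∫⁻ z, ‖f z‖ₑ ^ 2)) ?_ (fun _ => zero_le) fun k => ?_
    · have h1 := ENNReal.Tendsto.const_mul (a := 2)
        ((hmol hGL (hG i)).add (hcut hGL.aestronglyMeasurable (hG i))) (Or.inr (by simp))
      have h2 : Filter.Tendsto (fun k => ENNReal.ofReal (r k * C) ^ 2 * ∫⁻ z, ‖f z‖ₑ ^ 2)
          Filter.atTop (𝓝 0) := by
        have h3 : Filter.Tendsto (fun k => ENNReal.ofReal (r k * C)) Filter.atTop (𝓝 0) := by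
          simpa using ENNReal.tendsto_ofReal (hr0.mul_const C)
        have h4 := ((ENNReal.continuous_pow 2).tendsto _).comp h3
        have h5 := ENNReal.Tendsto.mul_const h4 (Or.inr hf.ne)
        simpa using h5
      have := ENNReal.Tendsto.const_mul (a := 2) (h1.add h2) (Or.inr (by simp))
      simpa using this
    · have hfm : AEMeasurable (fun z => ‖mollify (ρ k) f z‖ₑ ^ 2) :=
        (contDiff_mollify (ρ k) hfL).continuous.aestronglyMeasurable.enorm.pow_const 2
      have hGm : AEMeasurable (fun z => ‖mollify (ρ k) (G i) z - G i z‖ₑ ^ 2) :=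
        ((contDiff_mollify (ρ k) hGL).continuous.aestronglyMeasurable.sub
          hGL.aestronglyMeasurable).enorm.pow_const 2
      calc _ ≤ ∫⁻ z, 2 * (2 * (‖mollify (ρ k) (G i) z - G i z‖ₑ ^ 2 +
                ‖(θ (r k • z) - 1) • G i z‖ₑ ^ 2) +
                ENNReal.ofReal (r k * C) ^ 2 * ‖mollify (ρ k) f z‖ₑ ^ 2) := by
            refine lintegral_mono fun z => ?_
            have hd : partialDeriv i (fun z => θ (r k • z) • mollify (ρ k) f z) z =
                θ (r k • z) • mollify (ρ k) (G i) z +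
                  (r k * partialDeriv i (θ : Rd d → ℝ) (r k • z)) • mollify (ρ k) f z := by
              have h1 : HasFDerivAt (fun z => θ (r k • z))
                  ((fderiv ℝ θ (r k • z)).comp (r k • ContinuousLinearMap.id ℝ (Rd d))) z :=
                (hθs.differentiable (by simp) (r k • z)).hasFDerivAt.comp z
                  ((hasFDerivAt_id z).const_smul (r k))
              have h2 : HasFDerivAt (fun z => θ (r k • z) • mollify (ρ k) f z) _ z :=
                h1.smul ((contDiff_mollify (ρ k) hfL).differentiable (by simp) z).hasFDerivAt
              rw [partialDeriv, h2.fderiv, ← partialDeriv_mollify (ρ k) (hw i)]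
              simp [partialDeriv, ContinuousLinearMap.smulRight_apply]
            -- Three errors: the mollification of `G i`, the truncation of `G i`, and the derivative
            -- of the truncation. The last is at most `r k * C` times the mollified `f`.
            have : partialDeriv i (fun z => θ (r k • z) • mollify (ρ k) f z) z - G i z =
                (θ (r k • z) • (mollify (ρ k) (G i) z - G i z) + (θ (r k • z) - 1) • G i z) +
                (r k * partialDeriv i (θ : Rd d → ℝ) (r k • z)) • mollify (ρ k) f z := by
              rw [hd, smul_sub, sub_smul, one_smul]; abel
            simp only [this]
            refine (enorm_add_sq_le _ _).trans ?_
            gcongr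
            · refine (enorm_add_sq_le _ _).trans ?_
              gcongr
              rw [enorm_smul]
              refine mul_le_of_le_one_left zero_le ?_
              rw [Real.enorm_eq_ofReal (θ.nonneg' _), ENNReal.ofReal_le_one]
              exact θ.le_one
            · rw [enorm_smul, mul_pow]
              gcongr
              rw [Real.enorm_eq_ofReal_abs, abs_mul, abs_of_nonneg (hr k)]
              exact ENNReal.ofReal_le_ofReal (mul_le_mul_of_nonneg_left (hC i _) (hr k))
        _ = 2 * (2 * ((∫⁻ z, ‖mollify (ρ k) (G i) z - G i z‖ₑ ^ 2) +
              ∫⁻ z, ‖(θ (r k • z) - 1) • G i z‖ₑ ^ 2) +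
              ENNReal.ofReal (r k * C) ^ 2 * ∫⁻ z, ‖mollify (ρ k) f z‖ₑ ^ 2) := by
            rw [lintegral_const_mul' _ _ (by simp), lintegral_add_right' _ (hfm.const_mul _),
              lintegral_const_mul' _ _ (by simp), lintegral_add_left' hGm,
              lintegral_const_mul'' _ hfm]
        _ ≤ _ := by
            have := lintegral_mollify_sq_le (ρ k) hfL.aestronglyMeasurable
            beta_reduce
            gcongr

end Mollification

/-! ### Hardy's inequality -/

section Hardy
variable {d : ℕ}

/-- The integrand is half the derivative of `‖w‖²`: integration by parts and the symmetry of the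
real inner product make the integral its own negative. -/
theorem integral_inner_partialDeriv_self (i : Fin d) {w : Rd d → ℂ} (hw : ContDiff ℝ ∞ w)
    (hc : HasCompactSupport w) : ∫ z, inner ℝ (w z) (partialDeriv i w z) = 0 := by
  have h1 : Continuous fun z => inner ℝ (partialDeriv i w z) (w z) :=
    (continuous_partialDeriv i hw).inner hw.continuous
  have h2 : Continuous fun z => inner ℝ (w z) (partialDeriv i w z) :=
    hw.continuous.inner (continuous_partialDeriv i hw)
  have h3 : Continuous fun z => inner ℝ (w z) (w z) := hw.continuous.inner hw.continuous
  have hs : ∀ g : Rd d → ℂ, HasCompactSupport fun z => inner ℝ (w z) (g z) := fun g =>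
    hc.mono fun z hz => by
      contrapose! hz
      simp [Function.notMem_support.1 hz]
  have hs' : HasCompactSupport fun z => inner ℝ (partialDeriv i w z) (w z) :=
    hc.mono fun z hz => by
      contrapose! hz
      simp [Function.notMem_support.1 hz]
  have h := integral_bilinear_fderiv_right_eq_neg_left_of_integrable (μ := (volume : Measure (Rd d)))
    (f := w) (g := w) (v := EuclideanSpace.single i 1) (B := innerSL ℝ)
    (h1.integrable_of_hasCompactSupport hs') (h2.integrable_of_hasCompactSupport (hs _))
    (h3.integrable_of_hasCompactSupport (hs _))
    (fun x _ => hw.differentiable (by simp) x) (fun x _ => hw.differentiable (by simp) x)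
  have h' : ∫ z, inner ℝ (w z) (partialDeriv i w z) = - ∫ z, inner ℝ (partialDeriv i w z) (w z) := h
  simp only [real_inner_comm (w _)] at h' ⊢
  linarith

/-- Hardy's inequality with exponential weights. -/
theorem hardy_inequality (i : Fin d) {α : ℝ} (hα : 0 < α) {v : Rd d → ℂ} (hv : ContDiff ℝ ∞ v)
    (hc : HasCompactSupport v) :
    ∫⁻ z : Rd d, ENNReal.ofReal (Real.exp (-α * z i)) * ‖v z‖ₑ ^ 2 ≤
      ENNReal.ofReal (4 / α ^ 2) *
        ∫⁻ z : Rd d, ENNReal.ofReal (Real.exp (-α * z i)) * ‖partialDeriv i v z‖ₑ ^ 2 := by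
  obtain ⟨e, he, he2, hde⟩ : ∃ e : Rd d → ℝ, ContDiff ℝ ∞ e ∧
      (∀ z : Rd d, Real.exp (-α * z i) = e z ^ 2) ∧
      ∀ z, HasFDerivAt e ((e z * -(α / 2)) • (EuclideanSpace.proj i : Rd d →L[ℝ] ℝ)) z := by
    have hproj : ContDiff ℝ ∞ fun z : Rd d => z i := (EuclideanSpace.proj i : Rd d →L[ℝ] ℝ).contDiff
    refine ⟨fun z => Real.exp (-(α / 2) * z i), (contDiff_const.mul hproj).exp, fun z => ?_,
      fun z => ?_⟩
    · rw [← Real.exp_nat_mul]; congr 1; push_cast; ring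
    · have h1 : HasFDerivAt (fun z : Rd d => z i) (EuclideanSpace.proj i : Rd d →L[ℝ] ℝ) z :=
        (EuclideanSpace.proj i : Rd d →L[ℝ] ℝ).hasFDerivAt
      have h2 := (h1.const_mul (-(α / 2))).exp
      rwa [smul_smul] at h2
  obtain ⟨w, hwe⟩ : ∃ w : Rd d → ℂ, ∀ z, w z = e z • v z := ⟨_, fun _ => rfl⟩
  have hwe' : w = fun z => e z • v z := funext hwe
  have hw : ContDiff ℝ ∞ w := by rw [hwe']; exact he.smul hv
  have hwc : HasCompactSupport w := hc.mono fun z hz => by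
    contrapose! hz
    simp [hwe, Function.notMem_support.1 hz]
  -- Here `e ^ 2` is the weight and `w = e • v`. In the square of `∂w + (α / 2) w` the cross term `α
  -- ⟨w, ∂w⟩` integrates to zero, and dropping `‖∂w‖²` leaves the constant `α² / 4`.
  have hdw : ∀ z, e z • partialDeriv i v z = partialDeriv i w z + (α / 2) • w z := by
    intro z
    have h3 : HasFDerivAt (fun z => e z • v z) _ z :=
      (hde z).smul (hv.differentiable (by simp) z).hasFDerivAt
    have h4 : partialDeriv i w z = e z • partialDeriv i v z + (e z * -(α / 2)) • v z := by
      rw [hwe', partialDeriv, h3.fderiv]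
      simp [partialDeriv]
    rw [h4, hwe, smul_smul, add_assoc, ← add_smul]
    have : e z * -(α / 2) + α / 2 * e z = 0 := by ring
    rw [this, zero_smul, add_zero]
  have hpt : ∀ z, e z ^ 2 * ‖partialDeriv i v z‖ ^ 2 =
      ‖partialDeriv i w z‖ ^ 2 + α * inner ℝ (w z) (partialDeriv i w z) +
        α ^ 2 / 4 * (e z ^ 2 * ‖v z‖ ^ 2) := by
    intro z
    have h1 : e z ^ 2 * ‖partialDeriv i v z‖ ^ 2 = ‖e z • partialDeriv i v z‖ ^ 2 := by
      rw [norm_smul, mul_pow, Real.norm_eq_abs, sq_abs]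
    have h2 : e z ^ 2 * ‖v z‖ ^ 2 = ‖w z‖ ^ 2 := by
      rw [hwe, norm_smul, mul_pow, Real.norm_eq_abs, sq_abs]
    rw [h1, h2, hdw, norm_add_sq_real, real_inner_smul_right, real_inner_comm, norm_smul, mul_pow,
      Real.norm_eq_abs, sq_abs]
    ring
  have hcont : ∀ {g : Rd d → ℂ}, Continuous g → Continuous fun z => e z ^ 2 * ‖g z‖ ^ 2 :=
    fun hg => (he.continuous.pow 2).mul (hg.norm.pow 2)
  have hcs : ∀ {g : Rd d → ℂ}, HasCompactSupport g → HasCompactSupport fun z => e z ^ 2 * ‖g z‖ ^ 2 :=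
    fun hg => hg.mono fun z hz => by
      contrapose! hz
      simp [Function.notMem_support.1 hz]
  have hi1 : Integrable fun z => e z ^ 2 * ‖v z‖ ^ 2 :=
    (hcont hv.continuous).integrable_of_hasCompactSupport (hcs hc)
  have hi2 : Integrable fun z => e z ^ 2 * ‖partialDeriv i v z‖ ^ 2 :=
    (hcont (continuous_partialDeriv i hv)).integrable_of_hasCompactSupport
      (hcs (hasCompactSupport_partialDeriv i hc))
  have hi3 : Integrable fun z => ‖partialDeriv i w z‖ ^ 2 :=
    ((continuous_partialDeriv i hw).norm.pow 2).integrable_of_hasCompactSupport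
      ((hasCompactSupport_partialDeriv i hwc).mono fun z hz => by
        contrapose! hz
        simp [Function.notMem_support.1 hz])
  have hi4 : Integrable fun z => inner ℝ (w z) (partialDeriv i w z) :=
    (hw.continuous.inner (continuous_partialDeriv i hw)).integrable_of_hasCompactSupport
      (hwc.mono fun z hz => by
        contrapose! hz
        simp [Function.notMem_support.1 hz])
  have hreal : ∫ z, e z ^ 2 * ‖v z‖ ^ 2 ≤ 4 / α ^ 2 * ∫ z, e z ^ 2 * ‖partialDeriv i v z‖ ^ 2 := by
    have h5 : ∫ z, e z ^ 2 * ‖partialDeriv i v z‖ ^ 2 =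
        (∫ z, ‖partialDeriv i w z‖ ^ 2) + α * (∫ z, inner ℝ (w z) (partialDeriv i w z)) +
          α ^ 2 / 4 * ∫ z, e z ^ 2 * ‖v z‖ ^ 2 := by
      simp only [hpt]
      have hi5 : Integrable fun z =>
        ‖partialDeriv i w z‖ ^ 2 + α * inner ℝ (w z) (partialDeriv i w z) := hi3.add (hi4.const_mul α)
      rw [integral_add hi5 (hi1.const_mul _), integral_add hi3 (hi4.const_mul α),
        integral_const_mul, integral_const_mul]
    rw [integral_inner_partialDeriv_self i hw hwc, mul_zero, add_zero] at h5
    have h6 : 0 ≤ ∫ z, ‖partialDeriv i w z‖ ^ 2 := integral_nonneg fun z => by positivity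
    rw [h5, mul_add, ← mul_assoc, div_mul_div_comm, mul_comm 4 (α ^ 2), div_self (by positivity), one_mul]
    have : 0 ≤ 4 / α ^ 2 * ∫ z, ‖partialDeriv i w z‖ ^ 2 := mul_nonneg (by positivity) h6
    linarith
  have hconv : ∀ {g : Rd d → ℂ}, (Integrable fun z => e z ^ 2 * ‖g z‖ ^ 2) →
      ∫⁻ z : Rd d, ENNReal.ofReal (Real.exp (-α * z i)) * ‖g z‖ₑ ^ 2 =
        ENNReal.ofReal (∫ z, e z ^ 2 * ‖g z‖ ^ 2) := by
    intro g hg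
    rw [ofReal_integral_eq_lintegral_ofReal hg (.of_forall fun z => by positivity)]
    refine lintegral_congr fun z => ?_
    rw [he2, enorm_sq_eq_ofReal, ENNReal.ofReal_mul (by positivity)]
  rw [hconv hi1, hconv hi2, ← ENNReal.ofReal_mul (by positivity)]
  exact ENNReal.ofReal_le_ofReal hreal

end Hardy

/-! ### Rellich compactness by averages over grids -/

section Rellich
variable {d : ℕ}

theorem enorm_fderiv_apply_sq_le (f : Rd d → ℂ) (z y : Rd d) :
    ‖fderiv ℝ f z y‖ₑ ^ 2 ≤ d * ‖y‖ₑ ^ 2 * ∑ i, ‖partialDeriv i f z‖ₑ ^ 2 := by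
  have hy : fderiv ℝ f z y = ∑ i, y i • partialDeriv i f z := by
    conv_lhs => rw [← (EuclideanSpace.basisFun (Fin d) ℝ).sum_repr y]
    simp [partialDeriv]
  rw [hy]
  refine (enorm_sum_sq_le _).trans ?_
  rw [Fintype.card_fin, mul_assoc]
  refine mul_le_mul_right ?_ _
  rw [Finset.mul_sum]
  refine Finset.sum_le_sum fun i _ => ?_
  rw [enorm_smul, mul_pow]
  have hyi : ‖y i‖ₑ ≤ ‖y‖ₑ := enorm_le_iff_norm_le.2 (PiLp.norm_apply_le y i)
  gcongr

/-- Write the difference as the integral of `df(z + s y) y` over `0 ≤ s ≤ 1`, apply Cauchy–Schwarz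
in `s`, exchange the integrals and use translation invariance in `z`. -/
theorem lintegral_translate_sub_sq_le {f : Rd d → ℂ} (hf : ContDiff ℝ ∞ f) (y : Rd d) :
    ∫⁻ z, ‖f (z + y) - f z‖ₑ ^ 2 ≤ d * ‖y‖ₑ ^ 2 * ∑ i, ∫⁻ z, ‖partialDeriv i f z‖ₑ ^ 2 := by
  have hcd : Continuous fun p : Rd d × ℝ => fderiv ℝ f (p.1 + p.2 • y) y :=
    ((hf.continuous_fderiv (by simp)).comp
      (continuous_fst.add (continuous_snd.smul continuous_const))).clm_apply continuous_const
  have h1 : ∀ z, ‖f (z + y) - f z‖ₑ ^ 2 ≤ ∫⁻ s in Ioc (0 : ℝ) 1, ‖fderiv ℝ f (z + s • y) y‖ₑ ^ 2 := by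
    intro z
    have hc : Continuous fun s : ℝ => fderiv ℝ f (z + s • y) y :=
      hcd.comp (Continuous.prodMk_right z)
    have h2 : ∫ s in (0 : ℝ)..1, fderiv ℝ f (z + s • y) y = f (z + y) - f z := by
      have := intervalIntegral.integral_eq_sub_of_hasDerivAt (a := 0) (b := 1)
        (f := fun s : ℝ => f (z + s • y)) (f' := fun s => fderiv ℝ f (z + s • y) y) (fun s _ => ?_)
        (hc.intervalIntegrable _ _)
      · simpa using this
      · have h3 : HasDerivAt (fun s : ℝ => z + s • y) y s := by
          simpa using ((hasDerivAt_id s).smul_const y).const_add z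
        exact (hf.differentiable (by simp) _).hasFDerivAt.comp_hasDerivAt s h3
    rw [← h2, intervalIntegral.integral_of_le zero_le_one]
    calc _ ≤ (∫⁻ s in Ioc (0 : ℝ) 1, ‖fderiv ℝ f (z + s • y) y‖ₑ) ^ 2 := by
          gcongr; exact enorm_integral_le_lintegral_enorm _
      _ ≤ _ := sq_lintegral_le _ hc.enorm.aemeasurable
      _ = _ := by simp
  calc ∫⁻ z, ‖f (z + y) - f z‖ₑ ^ 2
      ≤ ∫⁻ z, ∫⁻ s in Ioc (0 : ℝ) 1, ‖fderiv ℝ f (z + s • y) y‖ₑ ^ 2 := lintegral_mono h1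
    _ = ∫⁻ s in Ioc (0 : ℝ) 1, ∫⁻ z, ‖fderiv ℝ f (z + s • y) y‖ₑ ^ 2 :=
        lintegral_lintegral_swap (hcd.enorm.measurable.pow_const 2).aemeasurable
    _ = ∫⁻ s in Ioc (0 : ℝ) 1, ∫⁻ z, ‖fderiv ℝ f z y‖ₑ ^ 2 := by
        refine lintegral_congr fun s => ?_
        exact lintegral_add_right_eq_self (fun z => ‖fderiv ℝ f z y‖ₑ ^ 2) (s • y)
    _ = ∫⁻ z, ‖fderiv ℝ f z y‖ₑ ^ 2 := by simp
    _ ≤ ∫⁻ z, d * ‖y‖ₑ ^ 2 * ∑ i, ‖partialDeriv i f z‖ₑ ^ 2 :=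
        lintegral_mono fun z => enorm_fderiv_apply_sq_le f z y
    _ = _ := by
        rw [lintegral_const_mul' _ _ (by finiteness), lintegral_finsetSum]
        exact fun i _ => (continuous_partialDeriv i hf).enorm.measurable.pow_const 2

/-- The cells of the grid of mesh `h` in `ℝᵈ`. -/
def gridCell (h : ℝ) (k : Fin d → ℤ) : Set (Rd d) := {z | ∀ i, ⌊z i / h⌋ = k i}

theorem measurableSet_gridCell (h : ℝ) (k : Fin d → ℤ) : MeasurableSet (gridCell h k) := by
  simp only [gridCell, ofPred_forall]
  refine MeasurableSet.iInter fun i => ?_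
  have : Measurable fun z : Rd d => ⌊z i / h⌋ :=
    Int.measurable_floor.comp (((EuclideanSpace.proj i : Rd d →L[ℝ] ℝ).continuous.measurable).div_const h)
  exact this (measurableSet_singleton (k i))

theorem volume_gridCell {h : ℝ} (hh : 0 < h) (k : Fin d → ℤ) :
    volume (gridCell h k) = ENNReal.ofReal h ^ d := by
  have h1 : gridCell h k = (WithLp.ofLp : Rd d → Fin d → ℝ) ⁻¹'
      (Set.pi univ fun i => Ico (k i * h) ((k i + 1) * h)) := by
    ext z
    simp only [gridCell, mem_ofPred_eq, mem_preimage, mem_pi, mem_univ, true_implies, mem_Ico,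
      Int.floor_eq_iff, le_div_iff₀ hh, div_lt_iff₀ hh]
  rw [h1, (PiLp.volume_preserving_ofLp (Fin d)).measure_preimage
    (MeasurableSet.univ_pi fun i => measurableSet_Ico).nullMeasurableSet, Real.volume_pi_Ico]
  have : ∀ i, (k i + 1) * h - k i * h = h := fun i => by ring
  simp [this]

/-- The diameter is `√d * h`; the cruder bound avoids roots. -/
theorem norm_sub_le_of_mem_gridCell {h : ℝ} (hh : 0 < h) {k : Fin d → ℤ} {z w : Rd d}
    (hz : z ∈ gridCell h k) (hw : w ∈ gridCell h k) : ‖w - z‖ ≤ (d + 1) * h := by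
  have h1 : ∀ i, (w i - z i) ^ 2 ≤ h ^ 2 := by
    intro i
    have h2 := hz i
    have h3 := hw i
    rw [Int.floor_eq_iff, le_div_iff₀ hh, div_lt_iff₀ hh] at h2 h3
    exact sq_le_sq' (by nlinarith) (by nlinarith)
  rw [EuclideanSpace.norm_eq]
  refine Real.sqrt_le_iff.2 ⟨by positivity, ?_⟩
  calc ∑ i, ‖(w - z) i‖ ^ 2 ≤ ∑ _i : Fin d, h ^ 2 := by
        refine Finset.sum_le_sum fun i _ => ?_
        simpa using h1 i
    _ = d * h ^ 2 := by simp
    _ ≤ ((d + 1) * h) ^ 2 := by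
        rw [mul_pow]
        gcongr
        nlinarith [Nat.cast_nonneg (α := ℝ) d]

/-- Average over the cells of a grid with index in a finite set. -/
noncomputable def gridAverage (h : ℝ) (hh : 0 < h) (I : Finset (Fin d → ℤ)) :
    Lp ℂ 2 (volume : Measure (Rd d)) →L[ℂ] Lp ℂ 2 (volume : Measure (Rd d)) :=
  ∑ k ∈ I, ((innerSL ℂ (indicatorConstLp 2 (measurableSet_gridCell h k)
    (by rw [volume_gridCell hh]; finiteness) (1 : ℂ))).smulRight
      (((h ^ d)⁻¹ : ℂ) • indicatorConstLp 2 (measurableSet_gridCell h k)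
        (by rw [volume_gridCell hh]; finiteness) (1 : ℂ)))

/-- A finite sum of operators that factor through `ℂ`. -/
theorem isCompactOperator_gridAverage {h : ℝ} (hh : 0 < h) (I : Finset (Fin d → ℤ)) :
    IsCompactOperator (gridAverage (d := d) h hh I) := by
  classical
  unfold gridAverage
  induction I using Finset.induction_on with
  | empty => simpa using isCompactOperator_zero
  | insert k I hk ih =>
    rw [Finset.sum_insert hk]
    refine IsCompactOperator.add ?_ ih
    set b := indicatorConstLp (μ := (volume : Measure (Rd d))) 2 (measurableSet_gridCell h k)
      (by rw [volume_gridCell hh]; finiteness) (1 : ℂ)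
    have h1 : IsCompactOperator (innerSL ℂ b : Lp ℂ 2 (volume : Measure (Rd d)) →L[ℂ] ℂ) :=
      isCompactOperator_of_locallyCompactSpace_dom _
    exact h1.clm_comp ((ContinuousLinearMap.id ℂ ℂ).smulRight (((h ^ d)⁻¹ : ℂ) • b))

theorem gridAverage_ae_eq {h : ℝ} (hh : 0 < h) (I : Finset (Fin d → ℤ))
    (f : Lp ℂ 2 (volume : Measure (Rd d))) :
    gridAverage h hh I f =ᵐ[volume] fun z =>
      ∑ k ∈ I, (gridCell h k).indicator (fun _ => ((h ^ d)⁻¹ : ℂ) * ∫ w in gridCell h k, f w) z := by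
  have h1 : ∀ k ∈ I, (((innerSL ℂ (indicatorConstLp 2 (measurableSet_gridCell h k)
      (by rw [volume_gridCell hh]; finiteness) (1 : ℂ))).smulRight
      (((h ^ d)⁻¹ : ℂ) • indicatorConstLp 2 (measurableSet_gridCell h k)
        (by rw [volume_gridCell hh]; finiteness) (1 : ℂ))) f :
        Lp ℂ 2 (volume : Measure (Rd d))) =ᵐ[volume]
      fun z => (gridCell h k).indicator (fun _ => ((h ^ d)⁻¹ : ℂ) * ∫ w in gridCell h k, f w) z := by
    intro k _
    rw [ContinuousLinearMap.smulRight_apply, innerSL_apply_apply, L2.inner_indicatorConstLp_one,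
      smul_smul]
    have hfin : volume (gridCell (d := d) h k) ≠ ⊤ := by rw [volume_gridCell hh]; finiteness
    filter_upwards [Lp.coeFn_smul ((∫ w in gridCell h k, f w) * ((h : ℂ) ^ d)⁻¹)
      (indicatorConstLp (μ := (volume : Measure (Rd d))) 2 (measurableSet_gridCell h k) hfin (1 : ℂ)),
      indicatorConstLp_coeFn (p := 2) (hs := measurableSet_gridCell h k) (hμs := hfin) (c := (1 : ℂ))]
      with z hz1 hz2
    rw [hz1, Pi.smul_apply, hz2]
    by_cases hz : z ∈ gridCell h k <;> simp [hz, mul_comm]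
  rw [gridAverage, sum_apply]
  refine (Lp.coeFn_finsetSum _ _).trans ?_
  filter_upwards [(Finset.eventually_all I).2 h1] with z hz
  rw [Finset.sum_apply]
  exact Finset.sum_congr rfl hz

/-- On functions with square integrable derivative the identity is approximated by averages over
the cells of a fine grid. -/
theorem exists_isCompactOperator_approx (d : ℕ) : ∃ K : ℝ≥0, ∀ (h : ℝ), 0 < h → ∀ R : ℝ,
    ∃ A : Lp ℂ 2 (volume : Measure (Rd d)) →L[ℂ] Lp ℂ 2 (volume : Measure (Rd d)),
      IsCompactOperator A ∧ ∀ (f : Rd d → ℂ), ContDiff ℝ ∞ f → ∀ hm : MemLp f 2 volume,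
        ‖hm.toLp f - A (hm.toLp f)‖ₑ ^ 2 ≤
          K * ENNReal.ofReal h ^ 2 * (∑ i, ∫⁻ z, ‖partialDeriv i f z‖ₑ ^ 2) +
            ∫⁻ z in {z | R ≤ ‖z‖}, ‖f z‖ₑ ^ 2 := by
  set V := volume (Metric.closedBall (0 : Rd d) 1) with hV
  have hVfin : V ≠ ⊤ := (isCompact_closedBall _ _).measure_lt_top.ne
  -- The ball of radius `(d + 1) * h` has volume `(d + 1) ^ d * V * h ^ d`. The factor `h ^ d`
  -- cancels against the volume of a cell, and a translation within that ball costs `d * (d + 1) ^ 2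
  -- * h ^ 2`.
  have hKfin : ((d + 1 : ℝ≥0∞) ^ d * V * (d * (d + 1) ^ 2)) ≠ ⊤ := by finiteness
  refine ⟨((d + 1 : ℝ≥0∞) ^ d * V * (d * (d + 1) ^ 2)).toNNReal, fun h hh R => ?_⟩
  rw [ENNReal.coe_toNNReal hKfin]
  -- All cells that meet the open ball of radius `R` have their indices in `[-m, m)`.
  set m : ℤ := ⌈R / h⌉
  set I : Finset (Fin d → ℤ) := Fintype.piFinset fun _ => Finset.Ico (-m) m
  refine ⟨gridAverage h hh I, isCompactOperator_gridAverage hh I, fun f hf hm => ?_⟩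
  set r : ℝ := (d + 1) * h
  have hr : 0 ≤ r := by positivity
  have hhd : ENNReal.ofReal h ^ d ≠ 0 := pow_ne_zero _ (by simpa using hh)
  have hhd' : ENNReal.ofReal h ^ d ≠ ⊤ := by finiteness
  have hmeasA : Measurable fun p : Rd d × Rd d => ‖f (p.1 + p.2) - f p.1‖ₑ ^ 2 :=
    ((hf.continuous.comp (continuous_fst.add continuous_snd)).sub
      (hf.continuous.comp continuous_fst)).enorm.measurable.pow_const 2
  -- On a cell, `f z` minus the mean of `f` is the mean of `f z - f w`, and the cell lies in the
  -- ball of radius `r` around `z`.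
  have hcell : ∀ k, ∀ z ∈ gridCell h k,
      ‖f z - ((h ^ d)⁻¹ : ℂ) * ∫ w in gridCell h k, f w‖ₑ ^ 2 ≤
        (ENNReal.ofReal h ^ d)⁻¹ * ∫⁻ y in Metric.closedBall (0 : Rd d) r, ‖f (z + y) - f z‖ₑ ^ 2 := by
    intro k z hz
    have hfin : volume (gridCell (d := d) h k) ≠ ⊤ := by rw [volume_gridCell hh]; exact hhd'
    have hint : IntegrableOn f (gridCell h k) :=
      ((hf.continuous.continuousOn (s := Metric.closedBall z r)).integrableOn_compact
        (isCompact_closedBall _ _)).mono_set fun w hw => by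
          rw [Metric.mem_closedBall, dist_eq_norm]
          exact norm_sub_le_of_mem_gridCell hh hz hw
    have hreal : (volume : Measure (Rd d)).real (gridCell h k) = h ^ d := by
      rw [Measure.real, volume_gridCell hh, ENNReal.toReal_pow, ENNReal.toReal_ofReal hh.le]
    have h1 : f z - ((h ^ d)⁻¹ : ℂ) * ∫ w in gridCell h k, f w =
        ((h ^ d)⁻¹ : ℝ) • ∫ w in gridCell h k, (f z - f w) := by
      rw [integral_sub (integrableOn_const (C := f z) hfin) hint, setIntegral_const, hreal, smul_sub, smul_smul,
        inv_mul_cancel₀ (by positivity), one_smul, Complex.real_smul]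
      push_cast
      rfl
    have hdisj : ∫⁻ w in gridCell h k, ‖f z - f w‖ₑ ^ 2 ≤
        ∫⁻ y in Metric.closedBall (0 : Rd d) r, ‖f (z + y) - f z‖ₑ ^ 2 := by
      rw [← lintegral_indicator (measurableSet_gridCell h k),
        ← lintegral_indicator measurableSet_closedBall,
        ← lintegral_add_left_eq_self _ z]
      refine lintegral_mono fun y => ?_
      by_cases hy : z + y ∈ gridCell h k
      · have hy' : y ∈ Metric.closedBall (0 : Rd d) r := by
          have := norm_sub_le_of_mem_gridCell hh hz hy
          rw [add_sub_cancel_left] at this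
          simpa using this
        rw [indicator_of_mem hy, indicator_of_mem hy', ← enorm_neg, neg_sub]
      · rw [indicator_of_notMem hy]; exact zero_le
    rw [h1, enorm_smul, mul_pow, Real.enorm_eq_ofReal (by positivity),
      ENNReal.ofReal_inv_of_pos (by positivity), ENNReal.ofReal_pow hh.le]
    calc _ ≤ ((ENNReal.ofReal h ^ d)⁻¹) ^ 2 * (∫⁻ w in gridCell h k, ‖f z - f w‖ₑ) ^ 2 := by
          gcongr; exact enorm_integral_le_lintegral_enorm _
      _ ≤ ((ENNReal.ofReal h ^ d)⁻¹) ^ 2 *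
            (ENNReal.ofReal h ^ d * ∫⁻ w in gridCell h k, ‖f z - f w‖ₑ ^ 2) := by
          gcongr
          refine (sq_lintegral_le _ ?_).trans_eq ?_
          · exact (continuous_const.sub hf.continuous).enorm.measurable.aemeasurable
          · rw [Measure.restrict_apply_univ, volume_gridCell hh]
      _ = (ENNReal.ofReal h ^ d)⁻¹ * ∫⁻ w in gridCell h k, ‖f z - f w‖ₑ ^ 2 := by
          rw [sq, mul_assoc, ← mul_assoc (ENNReal.ofReal h ^ d)⁻¹ (ENNReal.ofReal h ^ d),
            ENNReal.inv_mul_cancel hhd hhd', one_mul]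
      _ ≤ _ := by gcongr
  have hae := gridAverage_ae_eq hh I (hm.toLp f)
  -- Outside of the selected cells the average is zero and the error is `f` itself; the tail term
  -- absorbs it.
  have hpt : ∀ᵐ z, ‖(hm.toLp f - gridAverage h hh I (hm.toLp f) : Lp ℂ 2 (volume : Measure (Rd d))) z‖ₑ ^ 2
      ≤ (ENNReal.ofReal h ^ d)⁻¹ * (∫⁻ y in Metric.closedBall (0 : Rd d) r, ‖f (z + y) - f z‖ₑ ^ 2) +
        {z : Rd d | R ≤ ‖z‖}.indicator (fun z => ‖f z‖ₑ ^ 2) z := by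
    have hint : ∀ k, ∫ w in gridCell h k, hm.toLp f w = ∫ w in gridCell h k, f w := fun k =>
      integral_congr_ae (ae_restrict_of_ae hm.coeFn_toLp)
    simp only [hint] at hae
    filter_upwards [hae, hm.coeFn_toLp, Lp.coeFn_sub (hm.toLp f) (gridAverage h hh I (hm.toLp f))]
      with z h1 h2 h3
    rw [h3, Pi.sub_apply, h1, h2]
    set k : Fin d → ℤ := fun i => ⌊z i / h⌋ with hk
    have hzk : z ∈ gridCell h k := fun i => rfl
    have hother : ∀ k', k' ≠ k → z ∉ gridCell h k' := fun k' hne hz' => hne (funext fun i => (hz' i).symm)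
    by_cases hkI : k ∈ I
    · rw [Finset.sum_eq_single_of_mem k hkI fun k' _ hne => indicator_of_notMem (hother k' hne) _,
        indicator_of_mem hzk]
      exact (hcell k z hzk).trans le_self_add
    · rw [Finset.sum_eq_zero fun k' hk' => indicator_of_notMem (hother k' fun h => hkI (h ▸ hk')) _,
        sub_zero]
      have hz : R ≤ ‖z‖ := by
        by_contra! hlt
        refine hkI (Fintype.mem_piFinset.2 fun i => Finset.mem_Ico.2 ?_)
        have h4 : |z i| < R := (PiLp.norm_apply_le z i).trans_lt hlt
        have h5 : R / h ≤ m := Int.le_ceil _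
        rw [div_le_iff₀ hh] at h5
        rw [abs_lt] at h4
        refine ⟨Int.le_floor.2 ?_, Int.floor_lt.2 ?_⟩
        · rw [le_div_iff₀ hh]; push_cast; nlinarith
        · rw [div_lt_iff₀ hh]; linarith
      rw [indicator_of_mem (show z ∈ {z : Rd d | R ≤ ‖z‖} from hz)]
      exact le_add_self
  have hRm : MeasurableSet {z : Rd d | R ≤ ‖z‖} := measurableSet_le measurable_const measurable_norm
  rw [Lp.enorm_def, eLpNorm_two_sq]
  refine (lintegral_mono_ae hpt).trans ?_
  rw [lintegral_add_right _ ((hf.continuous.enorm.measurable.pow_const 2).indicator hRm),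
    lintegral_indicator hRm]
  gcongr
  rw [lintegral_const_mul' _ _ (ENNReal.inv_ne_top.2 hhd),
    lintegral_lintegral_swap hmeasA.aemeasurable]
  calc _ ≤ (ENNReal.ofReal h ^ d)⁻¹ * ∫⁻ y in Metric.closedBall (0 : Rd d) r,
          (d * ENNReal.ofReal r ^ 2 * ∑ i, ∫⁻ z, ‖partialDeriv i f z‖ₑ ^ 2) := by
        refine mul_le_mul_right ?_ _
        refine setLIntegral_mono' measurableSet_closedBall fun y hy => ?_
        refine (lintegral_translate_sub_sq_le hf y).trans ?_
        gcongr
        rw [← ofReal_norm]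
        exact ENNReal.ofReal_le_ofReal (by simpa using hy)
    _ = _ := by
        rw [setLIntegral_const, Measure.addHaar_closedBall' _ _ hr, ← hV, finrank_euclideanSpace_fin]
        have h1 : ENNReal.ofReal r = (d + 1) * ENNReal.ofReal h := by
          rw [ENNReal.ofReal_mul (by positivity)]
          congr 1
          rw [ENNReal.ofReal_add (by positivity) zero_le_one]
          simp
        rw [ENNReal.ofReal_pow hr, h1, mul_pow, mul_pow]
        have h2 : (ENNReal.ofReal h ^ d)⁻¹ * ENNReal.ofReal h ^ d = 1 := ENNReal.inv_mul_cancel hhd hhd'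
        generalize (∑ i, ∫⁻ z, ‖partialDeriv i f z‖ₑ ^ 2) = X
        calc _ = ((ENNReal.ofReal h ^ d)⁻¹ * ENNReal.ofReal h ^ d) *
              ((d + 1 : ℝ≥0∞) ^ d * V * (d * (d + 1) ^ 2)) * ENNReal.ofReal h ^ 2 * X := by ring
          _ = _ := by rw [h2, one_mul]

end Rellich

/-! ### Parametrizations of the interior and the metric in them -/

/-- A smooth parametrization of an open subset of the interior of `B`, with smooth inverse. -/
structure InteriorParam (n : ℕ) (B : Type*) [TopologicalSpace B]
    [ChartedSpace (EuclideanHalfSpace (n + 1)) B] where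
  dom : Set (Rd (n + 1))
  toFun : Rd (n + 1) → B
  inv : B → Rd (n + 1)
  isOpen_dom : IsOpen dom
  isOpen_image : IsOpen (toFun '' dom)
  image_subset : toFun '' dom ⊆ (𝓡∂ (n + 1)).interior B
  left_inv : ∀ z ∈ dom, inv (toFun z) = z
  contMDiffOn : ContMDiffOn 𝓘(ℝ, Rd (n + 1)) (𝓡∂ (n + 1)) ∞ toFun dom
  contMDiffOn_inv : ContMDiffOn (𝓡∂ (n + 1)) 𝓘(ℝ, Rd (n + 1)) ∞ inv (toFun '' dom)

/-- Invariance of the inverse quadratic form under a change of frame. -/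
theorem inv_form_change {m : ℕ} {P G G' : Matrix (Fin m) (Fin m) ℝ} (hP : IsUnit P)
    (hG : G' = P.transpose * G * P) {x x' y y' : Fin m → ℂ}
    (hx : ∀ i, x' i = ∑ j, (P j i : ℂ) * x j) (hy : ∀ i, y' i = ∑ j, (P j i : ℂ) * y j) :
    ∑ i, ∑ k, ((G'⁻¹ i k : ℝ) : ℂ) * x' i * starRingEnd ℂ (y' k) =
      ∑ i, ∑ k, ((G⁻¹ i k : ℝ) : ℂ) * x i * starRingEnd ℂ (y k) := by
  obtain ⟨Q, hPQ⟩ : ∃ Q, P * Q = 1 := hP.exists_right_inv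
  have hinv : P⁻¹ = Q := Matrix.inv_eq_right_inv hPQ
  have hG' : G⁻¹ = P * G'⁻¹ * P.transpose := by
    rw [hG, Matrix.mul_inv_rev, Matrix.mul_inv_rev, ← Matrix.transpose_nonsing_inv, hinv]
    have h1 : Q.transpose * P.transpose = 1 := by rw [← Matrix.transpose_mul, hPQ]; simp
    rw [Matrix.mul_assoc, Matrix.mul_assoc, Matrix.mul_assoc, h1, Matrix.mul_one, ← Matrix.mul_assoc, hPQ,
      Matrix.one_mul]
  have key : ∀ (A : Matrix (Fin m) (Fin m) ℝ) (x y : Fin m → ℂ),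
      ∑ i, ∑ k, ((A i k : ℝ) : ℂ) * x i * starRingEnd ℂ (y k) =
        x ⬝ᵥ (A.map Complex.ofRealHom).mulVec (fun k => starRingEnd ℂ (y k)) := by
    intro A x y
    simp only [dotProduct, Matrix.mulVec, Finset.mul_sum, Matrix.map_apply, Complex.ofRealHom_eq_coe]
    exact Finset.sum_congr rfl fun i _ => Finset.sum_congr rfl fun k _ => by ring
  have hx' : x' = (P.map Complex.ofRealHom).transpose.mulVec x := by
    funext i
    simp [hx, Matrix.mulVec, dotProduct]
  have hy' : (fun i => starRingEnd ℂ (y' i)) =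
      (P.map Complex.ofRealHom).transpose.mulVec (fun j => starRingEnd ℂ (y j)) := by
    funext i
    simp [hy, Matrix.mulVec, dotProduct, map_sum]
  rw [key, key, hx', hy', hG', Matrix.map_mul, Matrix.map_mul, Matrix.transpose_map,
    ← Matrix.mulVec_mulVec, ← Matrix.mulVec_mulVec, Matrix.mulVec_transpose, ← Matrix.dotProduct_mulVec]

theorem eq_sum_smul_single {m : ℕ} (v : Rd m) :
    v = ∑ j, v j • (EuclideanSpace.single j 1 : Rd m) := by
  conv_lhs => rw [← (EuclideanSpace.basisFun (Fin m) ℝ).sum_repr v]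
  simp

namespace InteriorParam
variable {n : ℕ} {B N : Type*}
    [TopologicalSpace B] [ChartedSpace (EuclideanHalfSpace (n + 1)) B]
    [IsManifold (𝓡∂ (n + 1)) ∞ B]
    [TopologicalSpace N] [ChartedSpace (EuclideanSpace ℝ (Fin n)) N]
    [IsManifold (𝓡 n) ∞ N] (Φ : InteriorParam n B)

/-- The vector field `∂ᵢ` of the parametrization. -/
noncomputable def frame (i : Fin (n + 1)) (z : Rd (n + 1)) : TangentSpace (𝓡∂ (n + 1)) (Φ.toFun z) :=
  mfderiv 𝓘(ℝ, Rd (n + 1)) (𝓡∂ (n + 1)) Φ.toFun z (EuclideanSpace.single i 1 : Rd (n + 1))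

/-- The Gram matrix of `g` in the parametrization. -/
noncomputable def gram (M : ConicManifold n B N) (z : Rd (n + 1)) :
    Matrix (Fin (n + 1)) (Fin (n + 1)) ℝ :=
  Matrix.of fun i k => M.g (Φ.toFun z) (Φ.frame i z) (Φ.frame k z)

/-- The parametrization read in the chart of `B` at `p`. -/
noncomputable def inChart (p : B) (z : Rd (n + 1)) : Rd (n + 1) := extChartAt (𝓡∂ (n + 1)) p (Φ.toFun z)

/-- The Jacobian matrix of `inChart`. -/
noncomputable def jacobian (p : B) (z : Rd (n + 1)) : Matrix (Fin (n + 1)) (Fin (n + 1)) ℝ :=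
  LinearMap.toMatrix (EuclideanSpace.basisFun (Fin (n + 1)) ℝ).toBasis
    (EuclideanSpace.basisFun (Fin (n + 1)) ℝ).toBasis (fderiv ℝ (Φ.inChart p) z : Rd (n + 1) →ₗ[ℝ] Rd (n + 1))

variable {Φ}


set_option linter.unusedSectionVars false in
theorem contMDiffAt {z : Rd (n + 1)} (hz : z ∈ Φ.dom) :
    ContMDiffAt 𝓘(ℝ, Rd (n + 1)) (𝓡∂ (n + 1)) ∞ Φ.toFun z :=
  Φ.contMDiffOn.contMDiffAt (Φ.isOpen_dom.mem_nhds hz)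

theorem differentiableAt_inChart {p : B} {z : Rd (n + 1)} (hz : z ∈ Φ.dom)
    (hp : Φ.toFun z ∈ (chartAt (EuclideanHalfSpace (n + 1)) p).source) :
    DifferentiableAt ℝ (Φ.inChart p) z := by
  have h1 : ContMDiffAt 𝓘(ℝ, Rd (n + 1)) 𝓘(ℝ, Rd (n + 1)) ∞ (Φ.inChart p) z :=
    (contMDiffAt_extChartAt' hp).comp z (contMDiffAt hz)
  exact h1.contDiffAt.differentiableAt (by simp)

/-- Near `z` the parametrization is the inverse chart composed with `inChart p`, and the chain rule
applies. The inverse chart is differentiated within the range of the model, to match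
`coordField_eq`. -/
theorem frame_eq {p : B} {z : Rd (n + 1)} (hz : z ∈ Φ.dom)
    (hp : Φ.toFun z ∈ (chartAt (EuclideanHalfSpace (n + 1)) p).source) (i : Fin (n + 1)) :
    Φ.frame i z = ∑ j, Φ.jacobian p z j i • ConicManifold.coordField p j (Φ.toFun z) := by
  set e := extChartAt (𝓡∂ (n + 1)) p with he
  have hps : Φ.toFun z ∈ e.source := by rwa [he, extChartAt_source]
  have h1 : HasMFDerivWithinAt 𝓘(ℝ, Rd (n + 1)) (𝓡∂ (n + 1)) e.symm (range (𝓡∂ (n + 1))) (Φ.inChart p z)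
      (mfderivWithin 𝓘(ℝ, Rd (n + 1)) (𝓡∂ (n + 1)) e.symm (range (𝓡∂ (n + 1))) (Φ.inChart p z)) :=
    (mdifferentiableWithinAt_extChartAt_symm (e.map_source hps)).hasMFDerivWithinAt
  have h2 : HasMFDerivWithinAt 𝓘(ℝ, Rd (n + 1)) 𝓘(ℝ, Rd (n + 1)) (Φ.inChart p) univ z
      (fderiv ℝ (Φ.inChart p) z) :=
    (differentiableAt_inChart hz hp).hasFDerivAt.hasMFDerivAt.hasMFDerivWithinAt
  have h3 := h1.comp z h2 (fun w _ => by
    have : e (Φ.toFun w) ∈ range (𝓡∂ (n + 1)) := mem_range_self _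
    exact this)
  rw [hasMFDerivWithinAt_univ] at h3
  have h4 : Φ.toFun =ᶠ[𝓝 z] e.symm ∘ Φ.inChart p := by
    filter_upwards [(contMDiffAt hz).continuousAt.preimage_mem_nhds
      ((chartAt (EuclideanHalfSpace (n + 1)) p).open_source.mem_nhds hp)] with w hw
    exact (e.left_inv (by rw [he, extChartAt_source]; exact hw)).symm
  have h5 := h3.congr_of_eventuallyEq h4
  have hcf : ∀ j, ConicManifold.coordField p j (Φ.toFun z) =
      (mfderivWithin 𝓘(ℝ, Rd (n + 1)) (𝓡∂ (n + 1)) e.symm (range (𝓡∂ (n + 1))) (Φ.inChart p z) :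
        Rd (n + 1) →L[ℝ] Rd (n + 1)) (EuclideanSpace.single j 1) :=
    fun j => ConicManifold.coordField_eq p j hp

  rw [frame, h5.mfderiv]
  set L : Rd (n + 1) →L[ℝ] Rd (n + 1) :=
    mfderivWithin 𝓘(ℝ, Rd (n + 1)) (𝓡∂ (n + 1)) e.symm (range (𝓡∂ (n + 1))) (Φ.inChart p z)
  have h7 : L (fderiv ℝ (Φ.inChart p) z (EuclideanSpace.single i 1)) =
      ∑ j, Φ.jacobian p z j i • L (EuclideanSpace.single j 1) := by
    conv_lhs => rw [eq_sum_smul_single (fderiv ℝ (Φ.inChart p) z (EuclideanSpace.single i 1))]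
    rw [map_sum]
    refine Finset.sum_congr rfl fun j _ => ?_
    rw [map_smul]
    congr 1
  refine Eq.trans h7 ?_
  exact Finset.sum_congr rfl fun j _ => by rw [hcf j]; rfl

/-- The smooth left inverse makes the derivative of the parametrization injective, which is enough
for a square matrix. -/
theorem isUnit_jacobian {p : B} {z : Rd (n + 1)} (hz : z ∈ Φ.dom)
    (hp : Φ.toFun z ∈ (chartAt (EuclideanHalfSpace (n + 1)) p).source) : IsUnit (Φ.jacobian p z) := by
  have h1 : HasMFDerivAt 𝓘(ℝ, Rd (n + 1)) (𝓡∂ (n + 1)) Φ.toFun z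
      (mfderiv 𝓘(ℝ, Rd (n + 1)) (𝓡∂ (n + 1)) Φ.toFun z) :=
    ((contMDiffAt hz).mdifferentiableAt (by simp)).hasMFDerivAt
  have h2 : HasMFDerivAt (𝓡∂ (n + 1)) 𝓘(ℝ, Rd (n + 1)) Φ.inv (Φ.toFun z)
      (mfderiv (𝓡∂ (n + 1)) 𝓘(ℝ, Rd (n + 1)) Φ.inv (Φ.toFun z)) :=
    ((Φ.contMDiffOn_inv.contMDiffAt
      (Φ.isOpen_image.mem_nhds (mem_image_of_mem _ hz))).mdifferentiableAt (by simp)).hasMFDerivAt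
  have h3 := h2.comp z h1
  have h4 : Φ.inv ∘ Φ.toFun =ᶠ[𝓝 z] id := by
    filter_upwards [Φ.isOpen_dom.mem_nhds hz] with w hw using Φ.left_inv w hw
  have h5 := (h3.congr_of_eventuallyEq h4.symm).mfderiv
  rw [mfderiv_id] at h5
  have hinj : ∀ v : Rd (n + 1), (mfderiv 𝓘(ℝ, Rd (n + 1)) (𝓡∂ (n + 1)) Φ.toFun z) v = 0 → v = 0 := by
    intro v hv
    have h6 := congrArg (fun T : Rd (n + 1) →L[ℝ] Rd (n + 1) => T v) h5
    refine h6.trans ?_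
    refine (congrArg (mfderiv (𝓡∂ (n + 1)) 𝓘(ℝ, Rd (n + 1)) Φ.inv (Φ.toFun z)) hv).trans ?_
    exact map_zero _
  rw [← Matrix.mulVec_injective_iff_isUnit]
  refine (injective_iff_map_eq_zero (Φ.jacobian p z).mulVecLin).2 fun x hx => ?_
  have h7 : (mfderiv 𝓘(ℝ, Rd (n + 1)) (𝓡∂ (n + 1)) Φ.toFun z)
      (∑ i, x i • (EuclideanSpace.single i 1 : Rd (n + 1))) = 0 := by
    have h8 : (mfderiv 𝓘(ℝ, Rd (n + 1)) (𝓡∂ (n + 1)) Φ.toFun z)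
      (∑ i, x i • (EuclideanSpace.single i 1 : Rd (n + 1))) = ∑ i, x i • Φ.frame i z := by
      refine (map_sum _ _ _).trans (Finset.sum_congr rfl fun i _ => ?_)
      exact map_smul _ _ _
    rw [h8]
    simp only [frame_eq hz hp, Finset.smul_sum, smul_smul]
    rw [Finset.sum_comm]
    simp only [← Finset.sum_smul]
    refine Finset.sum_eq_zero fun j _ => ?_
    have h9 : ∑ i, x i * Φ.jacobian p z j i = 0 := by
      have := congrFun hx j
      simpa [Matrix.mulVec, dotProduct, mul_comm] using this
    rw [h9, zero_smul]
  have h10 := (eq_sum_smul_single (WithLp.toLp 2 x)).trans (hinj _ h7)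
  funext i
  exact congrArg (fun v : Rd (n + 1) => v i) h10

theorem gram_eq (M : ConicManifold n B N) {p : B} {z : Rd (n + 1)} (hz : z ∈ Φ.dom)
    (hp : Φ.toFun z ∈ (chartAt (EuclideanHalfSpace (n + 1)) p).source) :
    Φ.gram M z = (Φ.jacobian p z).transpose * M.gram p (Φ.toFun z) * Φ.jacobian p z := by
  ext i k
  simp only [gram, ConicManifold.gram, Matrix.of_apply, Matrix.mul_apply, Matrix.transpose_apply,
    frame_eq hz hp, map_sum, map_smul, sum_apply, smul_apply, smul_eq_mul, Finset.sum_mul,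
    Finset.mul_sum]
  refine Finset.sum_congr rfl fun j _ => Finset.sum_congr rfl fun l _ => by ring

theorem partialDeriv_comp {u : B → ℂ} {p : B} {z : Rd (n + 1)} (hz : z ∈ Φ.dom)
    (hp : Φ.toFun z ∈ (chartAt (EuclideanHalfSpace (n + 1)) p).source)
    (hu : MDifferentiableAt (𝓡∂ (n + 1)) 𝓘(ℝ, ℂ) u (Φ.toFun z)) (i : Fin (n + 1)) :
    partialDeriv i (u ∘ Φ.toFun) z =
      ∑ j, (Φ.jacobian p z j i : ℂ) * ConicManifold.coordDeriv u p j (Φ.toFun z) := by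
  have h1 : HasMFDerivAt 𝓘(ℝ, Rd (n + 1)) 𝓘(ℝ, ℂ) (u ∘ Φ.toFun) z _ :=
    hu.hasMFDerivAt.comp z ((contMDiffAt hz).mdifferentiableAt (by simp)).hasMFDerivAt
  rw [partialDeriv, ← mfderiv_eq_fderiv, h1.mfderiv]
  have h3 : (mfderiv (𝓡∂ (n + 1)) 𝓘(ℝ, ℂ) u (Φ.toFun z)) (Φ.frame i z) =
      ∑ j, (Φ.jacobian p z j i : ℂ) * ConicManifold.coordDeriv u p j (Φ.toFun z) := by
    rw [frame_eq hz hp]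
    refine (map_sum _ _ _).trans (Finset.sum_congr rfl fun j _ => ?_)
    refine (map_smul _ _ _).trans ?_
    exact Complex.real_smul
  exact h3

/-- `⟨∇u, ∇v̄⟩_g` in the parametrization. -/
theorem gradInner_eq (M : ConicManifold n B N) {u v : B → ℂ} {z : Rd (n + 1)} (hz : z ∈ Φ.dom)
    (hu : MDifferentiableAt (𝓡∂ (n + 1)) 𝓘(ℝ, ℂ) u (Φ.toFun z))
    (hv : MDifferentiableAt (𝓡∂ (n + 1)) 𝓘(ℝ, ℂ) v (Φ.toFun z)) :
    M.gradInner u v (Φ.toFun z) =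
      ∑ i, ∑ k, (((Φ.gram M z)⁻¹ i k : ℝ) : ℂ) * partialDeriv i (u ∘ Φ.toFun) z *
        starRingEnd ℂ (partialDeriv k (v ∘ Φ.toFun) z) := by
  have hp := mem_chart_source (EuclideanHalfSpace (n + 1)) (Φ.toFun z)
  exact (inv_form_change (isUnit_jacobian hz hp) (gram_eq M hz hp) (partialDeriv_comp hz hp hu)
    (partialDeriv_comp hz hp hv)).symm

theorem gram_posDef (M : ConicManifold n B N) {z : Rd (n + 1)} (hz : z ∈ Φ.dom) :
    (Φ.gram M z).PosDef := by
  have hp := mem_chart_source (EuclideanHalfSpace (n + 1)) (Φ.toFun z)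
  rw [gram_eq M hz hp]
  have h := (M.gram_posDef (Φ.toFun z) hp (Φ.image_subset (mem_image_of_mem _ hz)))
  have := h.conjTranspose_mul_mul_same (B := Φ.jacobian (Φ.toFun z) z)
    (Matrix.mulVec_injective_iff_isUnit.2 (isUnit_jacobian hz hp))
  rwa [Matrix.conjTranspose_eq_transpose_of_trivial] at this

/-- The determinant on the right is the Jacobian of the change of variables `inChart p`; this is
what makes the density `√det g` independent of coordinates in `lintegral_image`. -/
theorem sqrt_det_gram (M : ConicManifold n B N) {p : B} {z : Rd (n + 1)} (hz : z ∈ Φ.dom)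
    (hp : Φ.toFun z ∈ (chartAt (EuclideanHalfSpace (n + 1)) p).source) :
    √(Φ.gram M z).det = |(fderiv ℝ (Φ.inChart p) z).det| * √(M.gram p (Φ.toFun z)).det := by
  have h1 : (fderiv ℝ (Φ.inChart p) z).det = (Φ.jacobian p z).det :=
    (LinearMap.det_toMatrix _ _).symm
  rw [gram_eq M hz hp, Matrix.det_mul, Matrix.det_mul, Matrix.det_transpose, h1,
    show ∀ a b : ℝ, a * b * a = a ^ 2 * b by intro a b; ring, Real.sqrt_mul (sq_nonneg _),
    Real.sqrt_sq_eq_abs]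

/-- With the chart `p` frozen, `gram_eq` holds in a whole neighbourhood of `z`, and each of its
three factors is continuous. -/
theorem continuousAt_gram (M : ConicManifold n B N) {z : Rd (n + 1)} (hz : z ∈ Φ.dom) :
    ContinuousAt (Φ.gram M) z := by
  set p := Φ.toFun z with hpz
  have hp : Φ.toFun z ∈ (chartAt (EuclideanHalfSpace (n + 1)) p).source := mem_chart_source _ _
  have h0 : ContMDiffAt 𝓘(ℝ, Rd (n + 1)) 𝓘(ℝ, Rd (n + 1)) ∞ (Φ.inChart p) z :=
    (contMDiffAt_extChartAt' hp).comp z (contMDiffAt hz)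
  have h1 : ContinuousAt (fderiv ℝ (Φ.inChart p)) z :=
    (h0.contDiffAt.fderiv_right (m := 0) (by simp)).continuousAt
  have h2 : ContinuousAt (Φ.jacobian p) z := by
    refine continuousAt_pi.2 fun j => continuousAt_pi.2 fun i => ?_
    have h3 : ContinuousAt (fun w => (fderiv ℝ (Φ.inChart p) w (EuclideanSpace.single i 1)) j) z :=
      (EuclideanSpace.proj j : Rd (n + 1) →L[ℝ] ℝ).continuous.continuousAt.comp
        (h1.clm_apply continuousAt_const)
    refine h3.congr (.of_forall fun w => ?_)
    simp [jacobian, LinearMap.toMatrix_apply]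
  have h4 : ContinuousAt (fun w => M.gram p (Φ.toFun w)) z :=
    (M.continuousAt_gram p hp).comp (contMDiffAt hz).continuousAt
  have h5 : ContinuousAt (fun w => (Φ.jacobian p w).transpose * M.gram p (Φ.toFun w) *
      Φ.jacobian p w) z := by
    have h6 : ∀ j i, ContinuousAt (fun w => Φ.jacobian p w j i) z := fun j i =>
      continuousAt_pi.1 (continuousAt_pi.1 h2 j) i
    have h7 : ∀ j i, ContinuousAt (fun w => M.gram p (Φ.toFun w) j i) z := fun j i =>
      continuousAt_pi.1 (continuousAt_pi.1 h4 j) i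
    refine continuousAt_pi.2 fun i => continuousAt_pi.2 fun k => ?_
    simp only [Matrix.mul_apply, Matrix.transpose_apply]
    exact tendsto_finsetSum _ fun l _ => (tendsto_finsetSum _ fun m _ =>
      (h6 m i).mul (h7 m l)).mul (h6 l k)
  refine h5.congr ?_
  filter_upwards [Φ.isOpen_dom.mem_nhds hz, (contMDiffAt hz).continuousAt.preimage_mem_nhds
      ((chartAt (EuclideanHalfSpace (n + 1)) p).open_source.mem_nhds hp)] with w hw hw'
  exact (gram_eq M hw hw').symm

theorem continuousAt_det_gram (M : ConicManifold n B N) {z : Rd (n + 1)} (hz : z ∈ Φ.dom) :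
    ContinuousAt (fun z => (Φ.gram M z).det) z :=
  (continuous_id.matrix_det (n := Fin (n + 1)) (R := ℝ)).continuousAt.comp (continuousAt_gram M hz)

end InteriorParam

/-! ### The Riemannian measure in a parametrization -/

section Volume
variable {n : ℕ} {B N : Type*}
    [TopologicalSpace B] [ChartedSpace (EuclideanHalfSpace (n + 1)) B]
    [IsManifold (𝓡∂ (n + 1)) ∞ B]
    [TopologicalSpace N] [ChartedSpace (EuclideanSpace ℝ (Fin n)) N]
    [IsManifold (𝓡 n) ∞ N]
    [CompactSpace B] [T2Space B] [MeasurableSpace B] [BorelSpace B]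

namespace ConicManifold

theorem aemeasurable_chartDensity (M : ConicManifold n B N) (p : B) :
    AEMeasurable (fun w => ENNReal.ofReal (√ (M.gram p ((extChartAt (𝓡∂ (n + 1)) p).symm w)).det))
      ((volume : Measure (Rd (n + 1))).restrict (extChartAt (𝓡∂ (n + 1)) p).target) := by
  have h : ContinuousOn (fun w => (M.gram p ((extChartAt (𝓡∂ (n + 1)) p).symm w)).det)
      (extChartAt (𝓡∂ (n + 1)) p).target := by
    intro w hw
    have hq : (extChartAt (𝓡∂ (n + 1)) p).symm w ∈ (chartAt (EuclideanHalfSpace (n + 1)) p).source := by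
      have := (extChartAt (𝓡∂ (n + 1)) p).map_target hw
      rwa [extChartAt_source] at this
    have h1 : ContinuousAt (fun r => (M.gram p r).det) ((extChartAt (𝓡∂ (n + 1)) p).symm w) :=
      (continuous_id.matrix_det (n := Fin (n+1)) (R := ℝ)).continuousAt.comp (M.continuousAt_gram p hq)
    exact h1.comp_continuousWithinAt (continuousOn_extChartAt_symm p w hw)
  exact (h.aemeasurable (measurableSet_target p)).sqrt.ennreal_ofReal

theorem lintegral_chartVolume (M : ConicManifold n B N) (p : B) {f : B → ℝ≥0∞} (hf : Measurable f) :
    ∫⁻ q, f q ∂(M.chartVolume p) = ∫⁻ w in (extChartAt (𝓡∂ (n + 1)) p).target,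
      ENNReal.ofReal (√ (M.gram p ((extChartAt (𝓡∂ (n + 1)) p).symm w)).det) *
        f ((extChartAt (𝓡∂ (n + 1)) p).symm w) := by
  rw [chartVolume, lintegral_map' hf.aemeasurable
    ((aemeasurable_symm p).mono_ac (withDensity_absolutelyContinuous _ _)),
    lintegral_withDensity_eq_lintegral_mul₀ (M.aemeasurable_chartDensity p)
      (g := fun w => f ((extChartAt (𝓡∂ (n + 1)) p).symm w))
      (hf.comp_aemeasurable (aemeasurable_symm p))]
  rfl

theorem measurable_chartPartition (p : B) :
    Measurable fun q => ENNReal.ofReal (chartPartition n B p q) :=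
  (chartPartition n B p).2.continuous.measurable.ennreal_ofReal

theorem finite_support_chartPartition (n : ℕ) (B : Type*) [TopologicalSpace B]
    [ChartedSpace (EuclideanHalfSpace (n + 1)) B] [IsManifold (𝓡∂ (n + 1)) ∞ B] [CompactSpace B]
    [T2Space B] : {p | (Function.support (chartPartition n B p)).Nonempty}.Finite :=
  (chartPartition n B).locallyFinite.finite_nonempty_of_compact

theorem lintegral_vol (M : ConicManifold n B N) {f : B → ℝ≥0∞} (hf : Measurable f) :
    ∫⁻ q, f q ∂M.vol = ∑ p ∈ (finite_support_chartPartition n B).toFinset,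
      ∫⁻ w in (extChartAt (𝓡∂ (n + 1)) p).target,
        ENNReal.ofReal (√ (M.gram p ((extChartAt (𝓡∂ (n + 1)) p).symm w)).det) *
          (ENNReal.ofReal (chartPartition n B p ((extChartAt (𝓡∂ (n + 1)) p).symm w)) *
            f ((extChartAt (𝓡∂ (n + 1)) p).symm w)) := by
  have h1 : ∀ p, ∫⁻ q, f q ∂((M.chartVolume p).withDensity
      fun q => ENNReal.ofReal (chartPartition n B p q)) = ∫⁻ w in (extChartAt (𝓡∂ (n + 1)) p).target,
        ENNReal.ofReal (√ (M.gram p ((extChartAt (𝓡∂ (n + 1)) p).symm w)).det) *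
          (ENNReal.ofReal (chartPartition n B p ((extChartAt (𝓡∂ (n + 1)) p).symm w)) *
            f ((extChartAt (𝓡∂ (n + 1)) p).symm w)) := by
    intro p
    rw [lintegral_withDensity_eq_lintegral_mul _ (measurable_chartPartition p) hf,
      M.lintegral_chartVolume p ((measurable_chartPartition p).mul hf)]
    rfl
  rw [vol, lintegral_sum_measure, tsum_eq_sum]
  · exact Finset.sum_congr rfl fun p _ => h1 p
  · intro p hp
    have h0 : ∀ q, chartPartition n B p q = 0 := by
      intro q
      by_contra hne
      exact hp ((finite_support_chartPartition n B).mem_toFinset.2 ⟨q, hne⟩)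
    rw [h1]
    simp [h0]

/-- In every chart the boundary is mapped into the frontier of the half-space, and the frontier of a
convex set is a null set. The localizations cover only the interior, so this is needed for every
statement that holds almost everywhere. -/
theorem vol_boundary (M : ConicManifold n B N) : M.vol ((𝓡∂ (n + 1)).boundary B) = 0 := by
  have hm : MeasurableSet ((𝓡∂ (n + 1)).boundary B) :=
    (ModelWithCorners.isClosed_boundary (n := ∞) (I := 𝓡∂ (n + 1)) (M := B) (by simp)).measurableSet
  rw [← lintegral_indicator_one hm, M.lintegral_vol (measurable_one.indicator hm)]
  refine Finset.sum_eq_zero fun p _ => ?_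
  refine (lintegral_eq_zero_iff' ?_).2 ?_
  · exact (M.aemeasurable_chartDensity p).mul
      (((measurable_chartPartition p).mul (measurable_one.indicator hm)).comp_aemeasurable
        (aemeasurable_symm p))
  · have hfr : volume (frontier (range (𝓡∂ (n + 1)))) = 0 :=
      (𝓡∂ (n + 1)).convex_range.addHaar_frontier _
    filter_upwards [ae_restrict_mem (measurableSet_target p),
      ae_restrict_of_ae (measure_eq_zero_iff_ae_notMem.1 hfr)] with w hw hwf
    have : (extChartAt (𝓡∂ (n + 1)) p).symm w ∉ (𝓡∂ (n + 1)).boundary B := by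
      intro hb
      have hs := (extChartAt (𝓡∂ (n + 1)) p).map_target hw
      rw [extChartAt_source] at hs
      have h1 := (ModelWithCorners.isInteriorPoint_iff_of_mem_atlas (n := ∞) (I := 𝓡∂ (n + 1))
        (by simp) (chart_mem_atlas _ p) hs).not
      rw [← ModelWithCorners.isBoundaryPoint_iff_not_isInteriorPoint] at h1
      have h2 := h1.1 hb
      have h3 : (extChartAt (𝓡∂ (n + 1)) p) ((extChartAt (𝓡∂ (n + 1)) p).symm w) = w :=
        (extChartAt (𝓡∂ (n + 1)) p).right_inv hw
      refine hwf ⟨subset_closure (extChartAt_target_subset_range p hw), fun hi => h2 ?_⟩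
      change extChartAt (𝓡∂ (n + 1)) p _ ∈ interior (extChartAt (𝓡∂ (n + 1)) p).target
      rw [h3]
      rw [extChartAt_target, interior_inter]
      refine ⟨?_, hi⟩
      rw [((chartAt (EuclideanHalfSpace (n + 1)) p).open_target.preimage
        (𝓡∂ (n + 1)).continuous_symm).interior_eq]
      rw [extChartAt_target] at hw
      exact hw.1
    simp only [indicator_of_notMem this, mul_zero, Pi.zero_apply]

end ConicManifold

namespace InteriorParam
open ConicManifold
variable {Φ : InteriorParam n B}

set_option linter.unusedSectionVars false in
theorem injOn (Φ : InteriorParam n B) : InjOn Φ.toFun Φ.dom := fun z hz w hw h => by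
  rw [← Φ.left_inv z hz, ← Φ.left_inv w hw, h]

set_option linter.unusedSectionVars false in
theorem measurableSet_image (Φ : InteriorParam n B) {S : Set (Rd (n + 1))} (hS : MeasurableSet S)
    (hSd : S ⊆ Φ.dom) : MeasurableSet (Φ.toFun '' S) :=
  hS.image_of_continuousOn_injOn (Φ.contMDiffOn.continuousOn.mono hSd) (Φ.injOn.mono hSd)

/-- The Riemannian measure in a parametrization. -/
theorem lintegral_image (M : ConicManifold n B N) {f : B → ℝ≥0∞} (hf : Measurable f)
    {S : Set (Rd (n + 1))} (hS : MeasurableSet S) (hSd : S ⊆ Φ.dom) :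
    ∫⁻ q in Φ.toFun '' S, f q ∂M.vol =
      ∫⁻ z in S, ENNReal.ofReal (√(Φ.gram M z).det) * f (Φ.toFun z) := by
  have hm := Φ.measurableSet_image hS hSd
  have hcont : ContinuousOn Φ.toFun S := Φ.contMDiffOn.continuousOn.mono hSd
  rw [← lintegral_indicator hm, M.lintegral_vol (hf.indicator hm)]
  set T := (finite_support_chartPartition n B).toFinset
  -- The part of `S` that the chart at `p` sees; the transition map `inChart p` is injective on it,
  -- so the change of variables formula applies.
  let D : B → Set (Rd (n + 1)) := fun p =>
    {z ∈ S | Φ.toFun z ∈ (chartAt (EuclideanHalfSpace (n + 1)) p).source}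
  have hDm : ∀ p, MeasurableSet (D p) := by
    intro p
    have hU := Φ.contMDiffOn.continuousOn.isOpen_inter_preimage Φ.isOpen_dom
      (chartAt (EuclideanHalfSpace (n + 1)) p).open_source
    have : D p = S ∩ (Φ.dom ∩ Φ.toFun ⁻¹' (chartAt (EuclideanHalfSpace (n + 1)) p).source) := by
      ext z
      exact ⟨fun h => ⟨h.1, hSd h.1, h.2⟩, fun h => ⟨h.1, h.2.2⟩⟩
    rw [this]
    exact hS.inter hU.measurableSet
  have hterm : ∀ p, (∫⁻ w in (extChartAt (𝓡∂ (n + 1)) p).target,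
        ENNReal.ofReal (√ (M.gram p ((extChartAt (𝓡∂ (n + 1)) p).symm w)).det) *
          (ENNReal.ofReal (chartPartition n B p ((extChartAt (𝓡∂ (n + 1)) p).symm w)) *
            (Φ.toFun '' S).indicator f ((extChartAt (𝓡∂ (n + 1)) p).symm w))) =
      ∫⁻ z in S, ENNReal.ofReal (chartPartition n B p (Φ.toFun z)) *
        (ENNReal.ofReal (√(Φ.gram M z).det) * f (Φ.toFun z)) := by
    intro p
    set e := extChartAt (𝓡∂ (n + 1)) p with he
    have hes : ∀ z ∈ D p, Φ.toFun z ∈ e.source := fun z hz => by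
      rw [he, extChartAt_source]; exact hz.2
    have hsub : Φ.inChart p '' D p ⊆ e.target := by
      rintro _ ⟨z, hz, rfl⟩
      exact e.map_source (hes z hz)
    have hinj : InjOn (Φ.inChart p) (D p) := by
      intro z hz w hw h
      exact Φ.injOn (hSd hz.1) (hSd hw.1) (e.injOn (hes z hz) (hes w hw) h)
    have hder : ∀ z ∈ D p, HasFDerivWithinAt (Φ.inChart p) (fderiv ℝ (Φ.inChart p) z) (D p) z :=
      fun z hz => (differentiableAt_inChart (hSd hz.1) hz.2).hasFDerivAt.hasFDerivWithinAt
    have himm : MeasurableSet (Φ.inChart p '' D p) :=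
      measurable_image_of_fderivWithin (hDm p) hder hinj
    calc _ = ∫⁻ w in Φ.inChart p '' D p, ENNReal.ofReal (√ (M.gram p (e.symm w)).det) *
          (ENNReal.ofReal (chartPartition n B p (e.symm w)) * f (e.symm w)) := by
          rw [← lintegral_indicator (measurableSet_target p), ← lintegral_indicator himm]
          refine lintegral_congr fun w => ?_
          by_cases hw : w ∈ Φ.inChart p '' D p
          · rw [indicator_of_mem hw, indicator_of_mem (hsub hw)]
            obtain ⟨z, hz, rfl⟩ := hw
            have : e.symm (Φ.inChart p z) = Φ.toFun z := e.left_inv (hes z hz)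
            rw [this, indicator_of_mem (mem_image_of_mem _ hz.1)]
          · rw [indicator_of_notMem hw]
            by_cases hw' : w ∈ e.target
            · rw [indicator_of_mem hw', indicator_of_notMem, mul_zero, mul_zero]
              rintro ⟨z, hz, hzw⟩
              refine hw ⟨z, ⟨hz, ?_⟩, ?_⟩
              · have := e.map_target hw'
                rwa [← hzw, he, extChartAt_source] at this
              · change e (Φ.toFun z) = w
                rw [hzw, e.right_inv hw']
            · rw [indicator_of_notMem hw']
      _ = ∫⁻ z in D p, ENNReal.ofReal |(fderiv ℝ (Φ.inChart p) z).det| *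
          (ENNReal.ofReal (√ (M.gram p (e.symm (Φ.inChart p z))).det) *
          (ENNReal.ofReal (chartPartition n B p (e.symm (Φ.inChart p z))) *
            f (e.symm (Φ.inChart p z)))) :=
          lintegral_image_eq_lintegral_abs_det_fderiv_mul _ (hDm p) hder hinj _
      _ = ∫⁻ z in D p, ENNReal.ofReal (chartPartition n B p (Φ.toFun z)) *
        (ENNReal.ofReal (√(Φ.gram M z).det) * f (Φ.toFun z)) := by
          refine setLIntegral_congr_fun (hDm p) fun z hz => ?_
          have : e.symm (Φ.inChart p z) = Φ.toFun z := e.left_inv (hes z hz)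
          simp only [this]
          rw [sqrt_det_gram M (hSd hz.1) hz.2, ENNReal.ofReal_mul (abs_nonneg _)]
          ring
      _ = _ := by
          rw [← lintegral_indicator (hDm p), ← lintegral_indicator hS]
          refine lintegral_congr fun z => ?_
          by_cases hz : z ∈ S
          · by_cases hz' : z ∈ D p
            · rw [indicator_of_mem hz, indicator_of_mem hz']
            · rw [indicator_of_mem hz, indicator_of_notMem hz']
              have : chartPartition n B p (Φ.toFun z) = 0 := by
                by_contra hne
                exact hz' ⟨hz, chartPartition_isSubordinate n B p (subset_tsupport _ hne)⟩
              rw [this]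
              simp
          · rw [indicator_of_notMem hz, indicator_of_notMem fun h => hz h.1]
  -- Every chart yields the same integrand, weighted by the partition of unity, so the sum over the
  -- charts returns the integrand itself.
  rw [Finset.sum_congr rfl fun p _ => hterm p]
  have hg : AEMeasurable (fun z => ENNReal.ofReal (√(Φ.gram M z).det) * f (Φ.toFun z))
      (volume.restrict S) := by
    refine AEMeasurable.mul ?_ (hf.comp_aemeasurable (hcont.aemeasurable hS))
    have : ContinuousOn (fun z => (Φ.gram M z).det) S := fun z hz =>
      (continuousAt_det_gram M (hSd hz)).continuousWithinAt
    exact (this.aemeasurable hS).sqrt.ennreal_ofReal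
  have hT : ∀ p ∈ T, AEMeasurable (fun z => ENNReal.ofReal (chartPartition n B p (Φ.toFun z)) *
      (ENNReal.ofReal (√(Φ.gram M z).det) * f (Φ.toFun z))) (volume.restrict S) := fun p _ =>
    ((measurable_chartPartition p).comp_aemeasurable (hcont.aemeasurable hS)).mul hg
  rw [← lintegral_finsetSum' T hT]
  refine setLIntegral_congr_fun hS fun z _ => ?_
  rw [← Finset.sum_mul]
  have hsum : ∑ p ∈ T, ENNReal.ofReal (chartPartition n B p (Φ.toFun z)) = 1 := by
    rw [← ENNReal.ofReal_sum_of_nonneg fun p _ => (chartPartition n B).nonneg p _]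
    have h1 := (chartPartition n B).sum_eq_one (mem_univ (Φ.toFun z))
    rw [finsum_eq_sum_of_support_subset (s := T)] at h1
    · rw [h1, ENNReal.ofReal_one]
    · intro p hp
      exact (finite_support_chartPartition n B).mem_toFinset.2 ⟨_, hp⟩
  rw [hsum, one_mul]

end InteriorParam
end Volume

/-! ### Uniform bounds for positive definite matrices -/

/-- Both `f` and `1 / f` are continuous on the compact set. The lower bound is kept as `1 ≤ C * f
x`, a form that survives enlarging `C`. -/
theorem IsCompact.exists_bounds_of_pos {X : Type*} [TopologicalSpace X] {K : Set X} (hK : IsCompact K)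
    {f : X → ℝ} (hf : ContinuousOn f K) (hpos : ∀ x ∈ K, 0 < f x) :
    ∃ C, 1 ≤ C ∧ ∀ x ∈ K, f x ≤ C ∧ 1 ≤ C * f x := by
  obtain ⟨C₁, h₁⟩ := hK.exists_bound_of_continuousOn hf
  obtain ⟨C₂, h₂⟩ := hK.exists_bound_of_continuousOn (hf.inv₀ fun x hx => (hpos x hx).ne')
  refine ⟨max 1 (max C₁ C₂), le_max_left _ _, fun x hx => ⟨?_, ?_⟩⟩
  · exact (le_abs_self _).trans ((h₁ x hx).trans ((le_max_left _ _).trans (le_max_right _ _)))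
  · have h := (le_abs_self _).trans ((h₂ x hx).trans ((le_max_right C₁ C₂).trans (le_max_right 1 _)))
    calc (1 : ℝ) = (f x)⁻¹ * f x := (inv_mul_cancel₀ (hpos x hx).ne').symm
      _ ≤ _ := mul_le_mul_of_nonneg_right h (hpos x hx).le

/-- The real part of the sesquilinear form of a real matrix, on the diagonal. -/
noncomputable def sesqForm {m : ℕ} (A : Matrix (Fin m) (Fin m) ℝ) (ξ : Fin m → ℂ) : ℝ :=
  (∑ i, ∑ k, ((A i k : ℝ) : ℂ) * ξ i * starRingEnd ℂ (ξ k)).re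

theorem sesqForm_eq {m : ℕ} (A : Matrix (Fin m) (Fin m) ℝ) (ξ : Fin m → ℂ) :
    sesqForm A ξ = ∑ i, ∑ k, A i k * ((ξ i).re * (ξ k).re + (ξ i).im * (ξ k).im) := by
  simp only [sesqForm, Complex.re_sum]
  refine Finset.sum_congr rfl fun i _ => Finset.sum_congr rfl fun k _ => ?_
  simp
  ring

theorem sesqForm_smul {m : ℕ} (A : Matrix (Fin m) (Fin m) ℝ) (a : ℝ) (ξ : Fin m → ℂ) :
    sesqForm A (fun i => (a : ℂ) * ξ i) = a ^ 2 * sesqForm A ξ := by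
  simp only [sesqForm_eq, Finset.mul_sum]
  refine Finset.sum_congr rfl fun i _ => Finset.sum_congr rfl fun k _ => ?_
  simp
  ring

theorem sesqForm_smul_left {m : ℕ} (A : Matrix (Fin m) (Fin m) ℝ) (a : ℝ) (ξ : Fin m → ℂ) :
    sesqForm (a • A) ξ = a * sesqForm A ξ := by
  simp only [sesqForm_eq, Finset.mul_sum, Matrix.smul_apply, smul_eq_mul, mul_assoc]

theorem sesqForm_pos {m : ℕ} {A : Matrix (Fin m) (Fin m) ℝ} (hA : A.PosDef) {ξ : Fin m → ℂ}
    (hξ : ξ ≠ 0) : 0 < sesqForm A ξ := by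
  have h : sesqForm A ξ = (fun i => (ξ i).re) ⬝ᵥ A.mulVec (fun i => (ξ i).re) +
      (fun i => (ξ i).im) ⬝ᵥ A.mulVec (fun i => (ξ i).im) := by
    simp only [sesqForm_eq, dotProduct, Matrix.mulVec, Finset.mul_sum, ← Finset.sum_add_distrib]
    exact Finset.sum_congr rfl fun i _ => Finset.sum_congr rfl fun k _ => by ring
  rw [h]
  have h1 := hA.posSemidef.dotProduct_mulVec_nonneg (fun i => (ξ i).re)
  have h2 := hA.posSemidef.dotProduct_mulVec_nonneg (fun i => (ξ i).im)
  simp only [star_trivial] at h1 h2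
  by_cases hr : (fun i => (ξ i).re) = 0
  · have hi : (fun i => (ξ i).im) ≠ 0 := by
      intro hi
      exact hξ (funext fun i => Complex.ext (congrFun hr i) (congrFun hi i))
    have := hA.dotProduct_mulVec_pos hi
    simp only [star_trivial] at this
    linarith
  · have := hA.dotProduct_mulVec_pos hr
    simp only [star_trivial] at this
    linarith

/-- Uniform bounds for a continuous family of positive definite matrices over a compact set. -/
theorem exists_bounds_of_posDef {X : Type*} [TopologicalSpace X] {K : Set X} (hK : IsCompact K) {m : ℕ}
    {H : X → Matrix (Fin m) (Fin m) ℝ} (hH : ContinuousOn H K) (hpos : ∀ x ∈ K, (H x).PosDef) :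
    ∃ C : ℝ, 1 ≤ C ∧ ∀ x ∈ K, √(H x).det ≤ C ∧ 1 ≤ C * √(H x).det ∧ ∀ ξ : Fin m → ℂ,
      sesqForm (H x)⁻¹ ξ ≤ C * ∑ i, ‖ξ i‖ ^ 2 ∧ ∑ i, ‖ξ i‖ ^ 2 ≤ C * sesqForm (H x)⁻¹ ξ := by
  have hdet : ContinuousOn (fun x => (H x).det) K :=
    (continuous_id.matrix_det (n := Fin m) (R := ℝ)).comp_continuousOn hH
  obtain ⟨C₁, hC₁, h₁⟩ := hK.exists_bounds_of_pos (f := fun x => √(H x).det) hdet.sqrt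
    fun x hx => Real.sqrt_pos.2 (hpos x hx).det_pos
  have hinv : ContinuousOn (fun x => (H x)⁻¹) K := by
    simp only [Matrix.inv_def, Ring.inverse_eq_inv']
    exact (hdet.inv₀ fun x hx => (hpos x hx).det_pos.ne').smul
      ((continuous_id.matrix_adjugate (n := Fin m) (R := ℝ)).comp_continuousOn hH)
  have hinv' : ∀ i k, ContinuousOn (fun x => (H x)⁻¹ i k) K := fun i k =>
    continuousOn_pi.1 (continuousOn_pi.1 hinv i) k
  -- The form is positive and continuous on `K` times the unit sphere of `ℂᵐ`, which is compact;
  -- homogeneity of degree two carries the bounds over to all vectors.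
  obtain ⟨C₂, hC₂, h₂⟩ := (hK.prod (isCompact_sphere (0 : EuclideanSpace ℂ (Fin m)) 1)).exists_bounds_of_pos
    (f := fun y : X × EuclideanSpace ℂ (Fin m) => sesqForm (H y.1)⁻¹ (fun i => y.2 i)) (by
      simp only [sesqForm_eq]
      have hc : ∀ i, Continuous fun y : X × EuclideanSpace ℂ (Fin m) => y.2 i := fun i =>
        (EuclideanSpace.proj i : EuclideanSpace ℂ (Fin m) →L[ℂ] ℂ).continuous.comp continuous_snd
      refine continuousOn_finsetSum _ fun i _ => continuousOn_finsetSum _ fun k _ => ?_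
      refine ((hinv' i k).comp continuousOn_fst fun y hy => hy.1).mul ?_
      exact (((Complex.continuous_re.comp (hc i)).mul (Complex.continuous_re.comp (hc k))).add
        ((Complex.continuous_im.comp (hc i)).mul (Complex.continuous_im.comp (hc k)))).continuousOn)
    (fun y hy => sesqForm_pos (hpos _ hy.1).inv fun h0 => by
      have : y.2 = 0 := by ext i; exact congrFun h0 i
      have h1 := hy.2
      rw [this] at h1
      simp at h1)
  refine ⟨max C₁ C₂, hC₁.trans (le_max_left _ _), fun x hx => ⟨(h₁ x hx).1.trans (le_max_left _ _), ?_,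
    fun ξ => ?_⟩⟩
  · exact (h₁ x hx).2.trans (mul_le_mul_of_nonneg_right (le_max_left _ _) (Real.sqrt_nonneg _))
  · set v : EuclideanSpace ℂ (Fin m) := WithLp.toLp 2 ξ with hv
    have hnorm : ∑ i, ‖ξ i‖ ^ 2 = ‖v‖ ^ 2 := (EuclideanSpace.norm_sq_eq v).symm
    by_cases h0 : v = 0
    · have hz : ∀ i, ξ i = 0 := fun i => congrArg (fun v : EuclideanSpace ℂ (Fin m) => v i) h0
      simp [sesqForm, hz]
    · have hvp : 0 < ‖v‖ := norm_pos_iff.2 h0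
      have h3 := h₂ (x, ((‖v‖⁻¹ : ℝ) : ℂ) • v) ⟨hx, by
        rw [mem_sphere_zero_iff_norm, norm_smul, Complex.norm_real, norm_inv, norm_norm,
          inv_mul_cancel₀ hvp.ne']⟩
      have h4 : sesqForm (H x)⁻¹ (fun i => (((‖v‖⁻¹ : ℝ) : ℂ) • v) i) =
          (‖v‖⁻¹) ^ 2 * sesqForm (H x)⁻¹ ξ := sesqForm_smul _ _ _
      simp only [h4] at h3
      rw [hnorm]
      have h5 : 0 < sesqForm (H x)⁻¹ ξ := sesqForm_pos (hpos x hx).inv fun h => h0 (by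
        rw [hv, h]; rfl)
      have h6 : sesqForm (H x)⁻¹ ξ = ‖v‖ ^ 2 * (‖v‖⁻¹ ^ 2 * sesqForm (H x)⁻¹ ξ) := by
        field_simp
      constructor
      · rw [h6, mul_comm (max C₁ C₂)]
        exact mul_le_mul_of_nonneg_left (h3.1.trans (le_max_right _ _)) (by positivity)
      · have h7 := mul_le_mul_of_nonneg_left h3.2 (sq_nonneg ‖v‖)
        rw [mul_one] at h7
        refine h7.trans ?_
        rw [show ‖v‖ ^ 2 * (C₂ * (‖v‖⁻¹ ^ 2 * sesqForm (H x)⁻¹ ξ)) = C₂ * sesqForm (H x)⁻¹ ξ by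
          field_simp]
        exact mul_le_mul_of_nonneg_right (le_max_right _ _) h5.le

/-! ### The energy density and its comparison with the model cone -/

section Energy
variable {n : ℕ} {B N : Type*}
    [TopologicalSpace B] [ChartedSpace (EuclideanHalfSpace (n + 1)) B]
    [IsManifold (𝓡∂ (n + 1)) ∞ B]
    [TopologicalSpace N] [ChartedSpace (EuclideanSpace ℝ (Fin n)) N]
    [IsManifold (𝓡 n) ∞ N]

namespace ConicManifold

/-- The density `|u|² + |∇u|²`. -/
noncomputable def eDensity (M : ConicManifold n B N) (u : B → ℂ) (q : B) : ℝ≥0∞ :=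
  ENNReal.ofReal (‖u q‖ ^ 2 + (M.gradInner u u q).re)

theorem eDensity_of_notMem_tsupport (M : ConicManifold n B N) {u : B → ℂ} {q : B}
    (hq : q ∉ tsupport u) : M.eDensity u q = 0 := by
  have h1 : u =ᶠ[𝓝 q] fun _ => (0 : ℂ) := notMem_tsupport_iff_eventuallyEq.1 hq
  have h2 : ∀ i, coordDeriv (n := n) u q i q = 0 := by
    intro i
    rw [coordDeriv, h1.mfderiv_eq, mfderiv_const]
    rfl
  simp [eDensity, h1.self_of_nhds, gradInner, gradInnerIn, h2]

/-- The gradient form is nonnegative at `u - v`, and its values at `u + v` and `u - v` add up to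
twice the values at `u` and `v`. -/
theorem eDensity_add_le (M : ConicManifold n B N) {u v : B → ℂ} (hu : u ∈ testSubmodule n B)
    (hv : v ∈ testSubmodule n B) (q : B) :
    M.eDensity (u + v) q ≤ 2 * M.eDensity u q + 2 * M.eDensity v q := by
  have hv' : (-1 : ℂ) • v ∈ testSubmodule n B := Submodule.smul_mem _ _ hv
  have hr : ∀ a b c : B → ℂ, a ∈ testSubmodule n B → b ∈ testSubmodule n B →
      M.gradInner c (a + b) q = M.gradInner c a q + M.gradInner c b q := by
    intro a b c ha hb
    rw [← gradInner_conj, M.gradInner_add ha hb, map_add, gradInner_conj, gradInner_conj]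
  have hs : ∀ a c : B → ℂ, a ∈ testSubmodule n B →
      M.gradInner c ((-1 : ℂ) • a) q = - M.gradInner c a q := by
    intro a c ha
    rw [← gradInner_conj, M.gradInner_smul ha, map_mul, gradInner_conj]
    simp
  have h1 := M.gradInner_self_nonneg (Submodule.add_mem _ hu hv') q
  have h2 := M.gradInner_self_nonneg hu q
  have h3 := M.gradInner_self_nonneg hv q
  rw [M.gradInner_add hu hv', hr _ _ _ hu hv', hr _ _ _ hu hv', M.gradInner_smul hv,
    M.gradInner_smul hv, hs _ _ hv, hs _ _ hv] at h1
  have h4 : M.gradInner (u + v) (u + v) q = M.gradInner u u q + M.gradInner u v q +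
      (M.gradInner v u q + M.gradInner v v q) := by
    rw [M.gradInner_add hu hv, hr _ _ _ hu hv, hr _ _ _ hu hv]
  have h5 : ‖(u + v) q‖ ^ 2 ≤ 2 * ‖u q‖ ^ 2 + 2 * ‖v q‖ ^ 2 := by
    have := norm_add_le (u q) (v q)
    have h6 : ‖(u + v) q‖ ^ 2 ≤ (‖u q‖ + ‖v q‖) ^ 2 := by gcongr; exact this
    nlinarith [sq_nonneg (‖u q‖ - ‖v q‖)]
  rw [eDensity, eDensity, eDensity, ← ENNReal.ofReal_ofNat 2, ← ENNReal.ofReal_mul (by norm_num),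
    ← ENNReal.ofReal_mul (by norm_num), ← ENNReal.ofReal_add (by positivity) (by positivity)]
  refine ENNReal.ofReal_le_ofReal ?_
  rw [h4]
  simp only [Complex.add_re, Complex.neg_re, neg_mul, one_mul, neg_neg] at h1 ⊢
  linarith

section
variable [CompactSpace B] [T2Space B] [MeasurableSpace B] [BorelSpace B]

set_option linter.unusedSectionVars false in
theorem measurable_eDensity (M : ConicManifold n B N) {u : B → ℂ} (hu : u ∈ testSubmodule n B) :
    Measurable (M.eDensity u) :=
  ((hu.1.continuous.norm.pow 2).add
    (Complex.continuous_re.comp (M.continuous_gradInner hu hu))).measurable.ennreal_ofReal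

/-- As the integral of a nonnegative density, the norm can be restricted to subsets and estimated
over covers. -/
theorem enorm_sq_eq_lintegral (M : ConicManifold n B N) (u : M.TestFun) :
    ‖u‖ₑ ^ 2 = ∫⁻ q, M.eDensity u.1 q ∂M.vol := by
  have h1 : Integrable (fun q => ‖u.1 q‖ ^ 2 + (M.gradInner u.1 u.1 q).re) M.vol :=
    ((u.2.1.continuous.norm.pow 2).add
      (Complex.continuous_re.comp (M.continuous_gradInner u.2 u.2))).integrable_of_hasCompactSupport
      (HasCompactSupport.of_compactSpace _)
  have h0 : ‖u‖ₑ ^ 2 = ENNReal.ofReal (‖u‖ ^ 2) := by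
    rw [← ofReal_norm, ENNReal.ofReal_pow (norm_nonneg _)]
  rw [h0, M.norm_sq_testFun, energy]
  simp only [eDensity]
  rw [← ofReal_integral_eq_lintegral_ofReal h1
    (.of_forall fun q => add_nonneg (sq_nonneg _) (M.gradInner_self_nonneg u.2 q))]
  congr 1
  have h2 : Integrable (fun q => u.1 q * starRingEnd ℂ (u.1 q) + M.gradInner u.1 u.1 q) M.vol :=
    (M.integrable_mul_conj u.2 u.2).add (M.integrable_gradInner u.2 u.2)
  rw [← integral_add (M.integrable_mul_conj u.2 u.2) (M.integrable_gradInner u.2 u.2)]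
  refine (Complex.reCLM.integral_comp_comm h2).symm.trans ?_
  refine integral_congr_ae (.of_forall fun q => ?_)
  simp only [Complex.reCLM_apply, Complex.add_re, Complex.mul_conj, Complex.normSq_eq_norm_sq,
    Complex.ofReal_re]

end
end ConicManifold

/-- The conic weight `e^{-τ a t}`, where `t` is the first coordinate. -/
noncomputable def conicWeight (τ a : ℝ) (z : Rd (n + 1)) : ℝ := Real.exp (-(τ * a * z 0))

/-- The energy of a function on a part of the model cone. -/
noncomputable def modelEnergy (τ : ℝ) (f : Rd (n + 1) → ℂ) (z : Rd (n + 1)) : ℝ≥0∞ :=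
  ENNReal.ofReal (conicWeight τ (n + 1) z) * ‖f z‖ₑ ^ 2 +
    ENNReal.ofReal (conicWeight τ (n - 1) z) * ∑ i, ‖partialDeriv i f z‖ₑ ^ 2

namespace InteriorParam

/-- On `S` the metric is comparable to the model metric `e^{-2τt}(dt² + dη²)`. -/
def TameOn (Φ : InteriorParam n B) (M : ConicManifold n B N) (τ : ℝ) (S : Set (Rd (n + 1))) : Prop :=
  ∃ C : ℝ, 1 ≤ C ∧ ∀ z ∈ S, √(Φ.gram M z).det ≤ C * conicWeight τ (n + 1) z ∧
    conicWeight τ (n + 1) z ≤ C * √(Φ.gram M z).det ∧ ∀ ξ : Fin (n + 1) → ℂ,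
      conicWeight τ 2 z * sesqForm (Φ.gram M z)⁻¹ ξ ≤ C * ∑ i, ‖ξ i‖ ^ 2 ∧
      ∑ i, ‖ξ i‖ ^ 2 ≤ C * (conicWeight τ 2 z * sesqForm (Φ.gram M z)⁻¹ ξ)

variable {Φ : InteriorParam n B} {M : ConicManifold n B N} {τ : ℝ} {S : Set (Rd (n + 1))}

theorem eDensity_bounds (h : Φ.TameOn M τ S) (hS : S ⊆ Φ.dom) : ∃ C : ℝ≥0, ∀ u : B → ℂ,
    u ∈ ConicManifold.testSubmodule n B → ∀ z ∈ S,
      ENNReal.ofReal (√(Φ.gram M z).det) * M.eDensity u (Φ.toFun z) ≤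
        C * modelEnergy τ (u ∘ Φ.toFun) z ∧
      modelEnergy τ (u ∘ Φ.toFun) z ≤
        C * (ENNReal.ofReal (√(Φ.gram M z).det) * M.eDensity u (Φ.toFun z)) := by
  obtain ⟨C, hC, h⟩ := h
  -- One factor `C` comes from the volume density, the other from the inverse metric.
  refine ⟨(C ^ 2).toNNReal, fun u hu z hz => ?_⟩
  obtain ⟨h1, h2, h3⟩ := h z hz
  obtain ⟨h4, h5⟩ := h3 fun i => partialDeriv i (u ∘ Φ.toFun) z
  have hd := (hu.1 (Φ.toFun z)).mdifferentiableAt (by simp)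
  have hg : (M.gradInner u u (Φ.toFun z)).re =
      sesqForm (Φ.gram M z)⁻¹ (fun i => partialDeriv i (u ∘ Φ.toFun) z) := by
    rw [gradInner_eq M (hS hz) hd hd]; rfl
  set a := √(Φ.gram M z).det
  set Q := sesqForm (Φ.gram M z)⁻¹ (fun i => partialDeriv i (u ∘ Φ.toFun) z)
  set X := ∑ i, ‖partialDeriv i (u ∘ Φ.toFun) z‖ ^ 2 with hX
  have hXn : 0 ≤ X := Finset.sum_nonneg fun i _ => sq_nonneg _
  set d := conicWeight τ (n - 1) z with hd'
  set e := conicWeight τ 2 z with he'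
  -- The volume carries the weight `n + 1`, the inverse metric the reciprocal of the weight `2`;
  -- hence the gradient has the weight `n - 1`.
  have hde : conicWeight τ (n + 1) z = d * e := by
    rw [hd', he', conicWeight, conicWeight, conicWeight, ← Real.exp_add]; congr 1; ring
  have hdp : 0 < d := Real.exp_pos _
  have hep : 0 < e := Real.exp_pos _
  rw [hde] at h1 h2
  have ha : 0 ≤ a := Real.sqrt_nonneg _
  have hQ : 0 ≤ Q := by rw [← hg]; exact M.gradInner_self_nonneg hu _
  have hmodel : modelEnergy τ (u ∘ Φ.toFun) z = ENNReal.ofReal (d * e * ‖u (Φ.toFun z)‖ ^ 2 + d * X) := by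
    rw [modelEnergy, hde, ENNReal.ofReal_add (by positivity) (by positivity),
      ENNReal.ofReal_mul (q := ‖u (Φ.toFun z)‖ ^ 2) (by positivity), ENNReal.ofReal_mul (q := X) hdp.le, hX,
      ENNReal.ofReal_sum_of_nonneg fun i _ => sq_nonneg _]
    simp only [enorm_sq_eq_ofReal]
    rfl
  have hC2 : ((C ^ 2).toNNReal : ℝ≥0∞) = ENNReal.ofReal (C ^ 2) := rfl
  rw [hmodel, ConicManifold.eDensity, hg, hC2, ← ENNReal.ofReal_mul ha,
    ← ENNReal.ofReal_mul (by positivity), ← ENNReal.ofReal_mul (by positivity)]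
  set f := ‖u (Φ.toFun z)‖ ^ 2
  have hf : 0 ≤ f := sq_nonneg _
  have hC' : C ≤ C ^ 2 := by nlinarith
  constructor <;> refine ENNReal.ofReal_le_ofReal ?_
  · have i1 : a * f ≤ C ^ 2 * (d * e * f) := by
      calc a * f ≤ (C * (d * e)) * f := by gcongr
        _ = C * (d * e * f) := by ring
        _ ≤ _ := by gcongr
    have i2 : a * Q ≤ C ^ 2 * (d * X) := by
      calc a * Q ≤ (C * (d * e)) * Q := by gcongr
        _ = C * d * (e * Q) := by ring
        _ ≤ C * d * (C * X) := by gcongr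
        _ = _ := by ring
    linarith
  · have i1 : d * e * f ≤ C ^ 2 * (a * f) := by
      calc d * e * f ≤ (C * a) * f := by gcongr
        _ = C * (a * f) := by ring
        _ ≤ _ := by gcongr
    have i2 : d * X ≤ C ^ 2 * (a * Q) := by
      calc d * X ≤ d * (C * (e * Q)) := by gcongr
        _ = C * (d * e * Q) := by ring
        _ ≤ C * ((C * a) * Q) := by gcongr
        _ = _ := by ring
    linarith

section
variable [CompactSpace B] [T2Space B] [MeasurableSpace B] [BorelSpace B]

theorem exists_modelEnergy_bounds (h : Φ.TameOn M τ S) (hS : S ⊆ Φ.dom) : ∃ C : ℝ≥0, ∀ u : B → ℂ,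
    u ∈ ConicManifold.testSubmodule n B → ∀ Z ⊆ S, MeasurableSet Z →
      ∫⁻ q in Φ.toFun '' Z, M.eDensity u q ∂M.vol ≤ C * ∫⁻ z in Z, modelEnergy τ (u ∘ Φ.toFun) z ∧
      ∫⁻ z in Z, modelEnergy τ (u ∘ Φ.toFun) z ≤ C * ∫⁻ q in Φ.toFun '' Z, M.eDensity u q ∂M.vol := by
  obtain ⟨C, hC⟩ := eDensity_bounds h hS
  refine ⟨C, fun u hu Z hZ hZm => ?_⟩
  rw [lintegral_image M (M.measurable_eDensity hu) hZm (hZ.trans hS),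
    ← lintegral_const_mul' _ _ ENNReal.coe_ne_top, ← lintegral_const_mul' _ _ ENNReal.coe_ne_top]
  exact ⟨setLIntegral_mono' hZm fun z hz => (hC u hu z (hZ hz)).1,
    setLIntegral_mono' hZm fun z hz => (hC u hu z (hZ hz)).2⟩

/-- Null sets in a parametrization. -/
theorem volume_preimage_eq_zero {E : Set B} (hE : M.vol E = 0) : volume (Φ.dom ∩ Φ.toFun ⁻¹' E) = 0 := by
  obtain ⟨E', hEE', hE'm, hE'0⟩ := exists_measurable_superset_of_null hE
  have hm : MeasurableSet (Φ.dom ∩ Φ.toFun ⁻¹' E') :=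
    by
    have h := (continuousOn_iff_continuous_domRestrict.1 Φ.contMDiffOn.continuousOn).measurable hE'm
    have := Φ.isOpen_dom.measurableSet.subtype_image h
    refine this.congr (Set.ext fun z => ⟨?_, fun hz => ⟨⟨z, hz.1⟩, hz.2, rfl⟩⟩)
    rintro ⟨w, hw, rfl⟩
    exact ⟨w.2, hw⟩
  refine measure_mono_null (inter_subset_inter_right _ (preimage_mono hEE')) ?_
  have h1 := lintegral_image (Φ := Φ) M (f := 1) measurable_one hm inter_subset_left
  have h2 : ∫⁻ q in Φ.toFun '' (Φ.dom ∩ Φ.toFun ⁻¹' E'), (1 : B → ℝ≥0∞) q ∂M.vol = 0 := by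
    simp only [Pi.one_apply, lintegral_one, Measure.restrict_apply_univ]
    refine measure_mono_null ?_ hE'0
    rintro _ ⟨z, hz, rfl⟩
    exact hz.2
  rw [h2] at h1
  simp only [Pi.one_apply, mul_one] at h1
  have hc : ContinuousOn (fun z => (Φ.gram M z).det) (Φ.dom ∩ Φ.toFun ⁻¹' E') := fun z hz =>
      (continuousAt_det_gram M hz.1).continuousWithinAt
  rw [eq_comm, lintegral_eq_zero_iff' ((hc.aemeasurable hm).sqrt.ennreal_ofReal)] at h1
  -- The density `√det g` is positive on the domain, so its integral vanishes only over a null set.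
  have h3 : ∀ᵐ z ∂(volume.restrict (Φ.dom ∩ Φ.toFun ⁻¹' E')), False := by
    filter_upwards [h1, ae_restrict_mem hm] with z hz hzm
    have := Real.sqrt_pos.2 (gram_posDef M hzm.1).det_pos
    simp only [Pi.zero_apply, ENNReal.ofReal_eq_zero] at hz
    linarith
  simpa [ae_iff] using h3

theorem vol_image_eq_zero {E : Set (Rd (n + 1))} (hE : volume E = 0) :
    M.vol (Φ.toFun '' (Φ.dom ∩ E)) = 0 := by
  obtain ⟨E', hEE', hE'm, hE'0⟩ := exists_measurable_superset_of_null hE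
  refine measure_mono_null (image_mono (inter_subset_inter_right _ hEE')) ?_
  have h1 := lintegral_image (Φ := Φ) M (f := 1) measurable_one
    (Φ.isOpen_dom.measurableSet.inter hE'm) inter_subset_left
  simp only [Pi.one_apply, lintegral_one, Measure.restrict_apply_univ, mul_one] at h1
  rw [h1]
  exact setLIntegral_measure_zero _ _ (measure_mono_null inter_subset_right hE'0)

end
end InteriorParam
end Energy

/-! ### Calculus of the conic weight -/

section Weight
variable {n : ℕ}

theorem conicWeight_pos (τ a : ℝ) (z : Rd (n + 1)) : 0 < conicWeight τ a z := Real.exp_pos _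

theorem conicWeight_mul (τ a b : ℝ) (z : Rd (n + 1)) :
    conicWeight τ a z * conicWeight τ b z = conicWeight τ (a + b) z := by
  rw [conicWeight, conicWeight, conicWeight, ← Real.exp_add]; congr 1; ring

theorem conicWeight_sq (τ a : ℝ) (z : Rd (n + 1)) :
    conicWeight τ a z ^ 2 = conicWeight τ (2 * a) z := by
  rw [sq, conicWeight_mul, two_mul]

theorem conicWeight_anti {τ a b : ℝ} {z : Rd (n + 1)} (hz : 0 ≤ τ * z 0) (h : a ≤ b) :
    conicWeight τ b z ≤ conicWeight τ a z := by
  rw [conicWeight, conicWeight]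
  refine Real.exp_le_exp.2 ?_
  nlinarith

theorem contDiff_conicWeight (τ a : ℝ) : ContDiff ℝ ∞ (conicWeight (n := n) τ a) := by
  have h : ContDiff ℝ ∞ fun z : Rd (n + 1) => z 0 :=
    (EuclideanSpace.proj (0 : Fin (n + 1)) : Rd (n + 1) →L[ℝ] ℝ).contDiff
  exact ((contDiff_const.mul h).neg).exp

theorem partialDeriv_conicWeight (τ a : ℝ) (i : Fin (n + 1)) (z : Rd (n + 1)) :
    partialDeriv i (conicWeight τ a) z = (if i = 0 then -(τ * a) else 0) * conicWeight τ a z := by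
  have h : HasFDerivAt (fun z : Rd (n + 1) => z 0)
      (EuclideanSpace.proj (0 : Fin (n + 1)) : Rd (n + 1) →L[ℝ] ℝ) z :=
    (EuclideanSpace.proj (0 : Fin (n + 1)) : Rd (n + 1) →L[ℝ] ℝ).hasFDerivAt
  have h1 := ((h.const_mul (τ * a)).neg).exp
  have h2 : fderiv ℝ (conicWeight τ a) z = _ := h1.fderiv
  rw [partialDeriv, h2]
  by_cases hi : i = 0
  · subst hi
    simp [conicWeight]
    ring
  · simp [hi]

theorem modelEnergy_eq (τ : ℝ) (f : Rd (n + 1) → ℂ) (z : Rd (n + 1)) :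
    modelEnergy τ f z = ENNReal.ofReal (conicWeight τ (n + 1) z * ‖f z‖ ^ 2 +
      conicWeight τ (n - 1) z * ∑ i, ‖partialDeriv i f z‖ ^ 2) := by
  have h1 := (conicWeight_pos τ (n + 1) z).le
  have h2 := (conicWeight_pos τ (n - 1) z).le
  have h3 : 0 ≤ ∑ i, ‖partialDeriv i f z‖ ^ 2 := Finset.sum_nonneg fun i _ => sq_nonneg _
  rw [modelEnergy, ENNReal.ofReal_add (by positivity) (by positivity), ENNReal.ofReal_mul h1,
    ENNReal.ofReal_mul h2, ENNReal.ofReal_sum_of_nonneg fun i _ => sq_nonneg _]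
  simp only [enorm_sq_eq_ofReal]

theorem partialDeriv_smul {d : ℕ} {F : Type*} [NormedAddCommGroup F] [NormedSpace ℝ F] (i : Fin d)
    {ρ : Rd d → ℝ} {f : Rd d → F} {z : Rd d}
    (hρ : DifferentiableAt ℝ ρ z) (hf : DifferentiableAt ℝ f z) :
    partialDeriv i (fun z => ρ z • f z) z = partialDeriv i ρ z • f z + ρ z • partialDeriv i f z := by
  rw [partialDeriv, fderiv_fun_smul hρ hf]
  simp [partialDeriv, add_comm]

theorem partialDeriv_of_notMem_tsupport {d : ℕ} {F : Type*} [NormedAddCommGroup F] [NormedSpace ℝ F]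
    (i : Fin d) {f : Rd d → F} {z : Rd d} (hz : z ∉ tsupport f) : partialDeriv i f z = 0 :=
  image_eq_zero_of_notMem_tsupport fun h => hz (tsupport_partialDeriv_subset i f h)

end Weight

/-! ### Localizations and Hardy's inequality in them -/

section Piece
variable {n : ℕ} {B N : Type*}
    [TopologicalSpace B] [ChartedSpace (EuclideanHalfSpace (n + 1)) B]
    [IsManifold (𝓡∂ (n + 1)) ∞ B]
    [TopologicalSpace N] [ChartedSpace (EuclideanSpace ℝ (Fin n)) N]
    [IsManifold (𝓡 n) ∞ N]

/-- A localization: a parametrization on which the metric is comparable to a model metric, together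
with a cut-off function. -/
structure Piece (M : ConicManifold n B N) where
  Φ : InteriorParam n B
  τ : ℝ
  τ_nonneg : 0 ≤ τ
  -- `S₀` contains the support of the cut-off; `S` leaves a margin `ε` around it, so that mollified
  -- functions still live where the metric is under control.
  S₀ : Set (Rd (n + 1))
  S : Set (Rd (n + 1))
  isClosed_S : IsClosed S
  isClosed_S₀ : IsClosed S₀
  S_subset : S ⊆ Φ.dom
  ε : ℝ
  ε_pos : 0 < ε
  cthickening_subset : Metric.cthickening ε S₀ ⊆ S
  S_nonneg : ∀ z ∈ S, 0 ≤ τ * z 0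
  tame : Φ.TameOn M τ S
  s : B → ℝ
  σ : Rd (n + 1) → ℝ
  contDiff_σ : ContDiff ℝ ∞ σ
  tsupport_σ : tsupport σ ⊆ S₀
  σ_eq : ∀ z ∈ Φ.dom, σ z = s (Φ.toFun z)
  s_eq_zero : ∀ q ∈ (𝓡∂ (n + 1)).interior B, q ∉ Φ.toFun '' S₀ → s q = 0
  -- In the direction of `t` the cut-off may vary only by `O(e^{-τt})`: the terms with its
  -- derivative are then paid for by the `L²` part of the energy, whose weight `n + 1` exceeds that
  -- of the gradient by `2`.
  bounded : ∃ K : ℝ, ∀ z, |σ z| ≤ K ∧ (∀ i, |partialDeriv i σ z| ≤ K) ∧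
    |partialDeriv 0 σ z| ≤ K * conicWeight τ 1 z ∧
    ∀ i, |partialDeriv 0 (partialDeriv i σ) z| ≤ K * conicWeight τ 1 z
  -- This makes the localizations of test functions compactly supported.
  proper : ∀ K ⊆ (𝓡∂ (n + 1)).interior B, IsCompact K → IsCompact (S₀ ∩ Φ.toFun ⁻¹' K)
  -- Infinity is reached in `S₀` only with `τ * t → ∞`; for `τ = 0` this forces `S₀` to be bounded.
  tail : ∀ R₀ : ℝ, ∃ R : ℝ, ∀ z ∈ S₀, R ≤ ‖z‖ → R₀ ≤ τ * z 0

namespace Piece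
variable {M : ConicManifold n B N} (P : Piece M)

theorem S₀_subset_S : P.S₀ ⊆ P.S := (Metric.self_subset_cthickening _).trans P.cthickening_subset

theorem S₀_subset : P.S₀ ⊆ P.Φ.dom := P.S₀_subset_S.trans P.S_subset

/-- A function in the parametrization, multiplied by a cut-off function. -/
noncomputable def lift (ρ : Rd (n + 1) → ℝ) (u : B → ℂ) (z : Rd (n + 1)) : ℂ := ρ z • u (P.Φ.toFun z)

theorem support_lift_subset (ρ : Rd (n + 1) → ℝ) (u : B → ℂ) :
    Function.support (P.lift ρ u) ⊆ Function.support ρ := fun z hz hz' => hz (by simp [lift, hz'])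

theorem tsupport_lift_subset (ρ : Rd (n + 1) → ℝ) (u : B → ℂ) :
    tsupport (P.lift ρ u) ⊆ tsupport ρ := closure_mono (P.support_lift_subset ρ u)

theorem differentiableAt_comp {u : B → ℂ} (hu : u ∈ ConicManifold.testSubmodule n B)
    {z : Rd (n + 1)} (hz : z ∈ P.Φ.dom) : ContDiffAt ℝ ∞ (u ∘ P.Φ.toFun) z :=
  ((hu.1 (P.Φ.toFun z)).comp z (InteriorParam.contMDiffAt hz)).contDiffAt

variable {ρ : Rd (n + 1) → ℝ} {u : B → ℂ}

theorem contDiff_lift (hρ : ContDiff ℝ ∞ ρ) (hs : tsupport ρ ⊆ P.S₀)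
    (hu : u ∈ ConicManifold.testSubmodule n B) : ContDiff ℝ ∞ (P.lift ρ u) := by
  refine contDiff_iff_contDiffAt.2 fun z => ?_
  by_cases hz : z ∈ tsupport ρ
  · exact hρ.contDiffAt.smul (P.differentiableAt_comp hu (P.S₀_subset (hs hz)))
  · have h := notMem_tsupport_iff_eventuallyEq.1 fun h => hz (P.tsupport_lift_subset ρ u h)
    exact contDiffAt_const.congr_of_eventuallyEq h

theorem hasCompactSupport_lift (hs : tsupport ρ ⊆ P.S₀)
    (hu : u ∈ ConicManifold.testSubmodule n B) : HasCompactSupport (P.lift ρ u) := by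
  refine HasCompactSupport.of_support_subset_isCompact (P.proper _ hu.2.2 hu.2.1) fun z hz => ?_
  refine ⟨hs (subset_tsupport _ (P.support_lift_subset ρ u hz)), subset_tsupport _ fun h => hz ?_⟩
  simp [lift, h]

theorem partialDeriv_lift (hρ : ContDiff ℝ ∞ ρ) (hu : u ∈ ConicManifold.testSubmodule n B)
    {z : Rd (n + 1)} (hz : z ∈ P.Φ.dom) (i : Fin (n + 1)) :
    partialDeriv i (P.lift ρ u) z = P.lift (partialDeriv i ρ) u z +
      ρ z • partialDeriv i (u ∘ P.Φ.toFun) z :=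
  partialDeriv_smul i (hρ.differentiable (by simp)).differentiableAt
    ((P.differentiableAt_comp hu hz).differentiableAt (by simp))

/-- Hardy's inequality in a parametrization. -/
theorem exists_lintegral_lift_le (hn : 1 ≤ n) (hρ : ContDiff ℝ ∞ ρ) (hs : tsupport ρ ⊆ P.S₀) {K : ℝ}
    (hK : ∀ z, |ρ z| ≤ K) (hK' : ∀ z, |partialDeriv 0 ρ z| ≤ K * conicWeight P.τ 1 z) {β : ℝ}
    (hβ : β < 1) : ∃ C : ℝ≥0, ∀ u ∈ ConicManifold.testSubmodule n B,
      ∫⁻ z, ENNReal.ofReal (conicWeight P.τ (n + 1 - 2 * β) z) * ‖P.lift ρ u z‖ₑ ^ 2 ≤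
        C * ∫⁻ z in P.S, modelEnergy P.τ (u ∘ P.Φ.toFun) z := by
  have hn' : (1 : ℝ) ≤ n := by exact_mod_cast hn
  have hK0 : 0 ≤ K := (abs_nonneg _).trans (hK 0)
  -- For `τ = 0` all weights are `1` and the `L²` part of the energy suffices; only `τ > 0` needs
  -- Hardy's inequality.
  rcases P.τ_nonneg.eq_or_lt with h0 | hτ
  · refine ⟨(K ^ 2).toNNReal, fun u _ => ?_⟩
    rw [← lintegral_const_mul' _ _ ENNReal.coe_ne_top, ← lintegral_indicator P.isClosed_S.measurableSet]
    refine lintegral_mono fun z => ?_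
    by_cases hz : z ∈ P.S
    · rw [indicator_of_mem hz, enorm_sq_eq_ofReal, ← ENNReal.ofReal_mul (conicWeight_pos _ _ _).le,
        modelEnergy_eq, show ((K ^ 2).toNNReal : ℝ≥0∞) = ENNReal.ofReal (K ^ 2) from rfl,
        ← ENNReal.ofReal_mul (sq_nonneg _)]
      refine ENNReal.ofReal_le_ofReal ?_
      have h1 : ∀ a, conicWeight P.τ a z = 1 := fun a => by simp [conicWeight, ← h0]
      have h3 : 0 ≤ ∑ i, ‖partialDeriv i (u ∘ P.Φ.toFun) z‖ ^ 2 :=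
        Finset.sum_nonneg fun i _ => sq_nonneg _
      simp only [h1, one_mul, lift, norm_smul, mul_pow, mul_add, Function.comp]
      have h4 : ‖ρ z‖ ^ 2 ≤ K ^ 2 := by gcongr; exact hK z
      have h5 := mul_le_mul_of_nonneg_right h4 (sq_nonneg ‖u (P.Φ.toFun z)‖)
      have h6 := mul_nonneg (sq_nonneg K) h3
      simp only [Function.comp_def] at h6 ⊢
      linarith
    · have h7 : ρ z = 0 :=
        image_eq_zero_of_notMem_tsupport fun h => hz (P.S₀_subset_S (hs h))
      simp [lift, h7]
  -- The exponent is positive because it exceeds `τ * (n - 1) ≥ 0`; here `n ≥ 1` and `β < 1` enter.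
  · have hα : 0 < P.τ * (n + 1 - 2 * β) := mul_pos hτ (by linarith)
    refine ⟨(4 / (P.τ * (n + 1 - 2 * β)) ^ 2).toNNReal * (2 * K ^ 2).toNNReal, fun u hu => ?_⟩
    have h1 := hardy_inequality 0 hα (P.contDiff_lift hρ hs hu) (P.hasCompactSupport_lift hs hu)
    have h2 : ∀ z, ENNReal.ofReal (Real.exp (-(P.τ * (n + 1 - 2 * β)) * z 0)) *
        ‖partialDeriv 0 (P.lift ρ u) z‖ₑ ^ 2 ≤
        P.S.indicator (fun z => ENNReal.ofReal (2 * K ^ 2) * modelEnergy P.τ (u ∘ P.Φ.toFun) z) z := by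
      intro z
      by_cases hz : z ∈ P.S
      · rw [indicator_of_mem hz, enorm_sq_eq_ofReal, ← ENNReal.ofReal_mul (Real.exp_pos _).le,
          modelEnergy_eq, ← ENNReal.ofReal_mul (by positivity)]
        refine ENNReal.ofReal_le_ofReal ?_
        have hw : Real.exp (-(P.τ * (n + 1 - 2 * β)) * z 0) = conicWeight P.τ (n + 1 - 2 * β) z := by
          rw [conicWeight]; congr 1; ring
        rw [hw, P.partialDeriv_lift hρ hu (P.S_subset hz)]
        set w := conicWeight P.τ (n + 1 - 2 * β) z
        have hwp : 0 < w := conicWeight_pos _ _ _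
        have hz0 := P.S_nonneg z hz
        -- The derivative of the cut-off comes with the weight `n + 3 - 2β`, the derivative of `u`
        -- with `n + 1 - 2β`. As `β < 1`, they are dominated by the weights `n + 1` and `n - 1` of
        -- the energy.
        have e1 : w * conicWeight P.τ 1 z ^ 2 ≤ conicWeight P.τ (n + 1) z := by
          rw [conicWeight_sq, conicWeight_mul]
          exact conicWeight_anti hz0 (by linarith)
        have e2 : w ≤ conicWeight P.τ (n - 1) z := conicWeight_anti hz0 (by linarith)
        have e3 : ‖partialDeriv 0 (u ∘ P.Φ.toFun) z‖ ^ 2 ≤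
            ∑ i, ‖partialDeriv i (u ∘ P.Φ.toFun) z‖ ^ 2 :=
          Finset.single_le_sum (f := fun i => ‖partialDeriv i (u ∘ P.Φ.toFun) z‖ ^ 2)
            (fun i _ => sq_nonneg _) (Finset.mem_univ 0)
        set X := ∑ i, ‖partialDeriv i (u ∘ P.Φ.toFun) z‖ ^ 2
        set a := P.lift (partialDeriv 0 ρ) u z with ha
        set b := ρ z • partialDeriv 0 (u ∘ P.Φ.toFun) z with hb
        have e4 : ‖a + b‖ ^ 2 ≤ 2 * ‖a‖ ^ 2 + 2 * ‖b‖ ^ 2 := by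
          have h6 : ‖a + b‖ ^ 2 ≤ (‖a‖ + ‖b‖) ^ 2 := by gcongr; exact norm_add_le a b
          nlinarith [sq_nonneg (‖a‖ - ‖b‖)]
        have e5 : ‖a‖ ^ 2 ≤ (K * conicWeight P.τ 1 z) ^ 2 * ‖(u ∘ P.Φ.toFun) z‖ ^ 2 := by
          rw [ha, lift, norm_smul, mul_pow]
          gcongr
          · exact hK' z
          · exact le_rfl
        have e6 : ‖b‖ ^ 2 ≤ K ^ 2 * X := by
          rw [hb, norm_smul, mul_pow]
          gcongr
          exact hK z
        calc w * ‖a + b‖ ^ 2 ≤ w * (2 * ((K * conicWeight P.τ 1 z) ^ 2 * ‖(u ∘ P.Φ.toFun) z‖ ^ 2) +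
                2 * (K ^ 2 * X)) := by gcongr; linarith
          _ = 2 * K ^ 2 * ((w * conicWeight P.τ 1 z ^ 2) * ‖(u ∘ P.Φ.toFun) z‖ ^ 2 + w * X) := by ring
          _ ≤ _ := by
            have hX : 0 ≤ X := Finset.sum_nonneg fun i _ => sq_nonneg _
            gcongr
      · rw [partialDeriv_of_notMem_tsupport 0 fun h =>
          hz (P.S₀_subset_S (hs (P.tsupport_lift_subset ρ u h)))]
        simp
    have h3 := h1.trans (mul_le_mul_right (lintegral_mono h2) _)
    rw [lintegral_indicator P.isClosed_S.measurableSet,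
      lintegral_const_mul' _ _ ENNReal.ofReal_ne_top, ← mul_assoc] at h3
    rw [ENNReal.coe_mul]
    refine le_trans (le_of_eq (lintegral_congr fun z => ?_)) h3
    rw [conicWeight]
    congr 4
    ring

/-- The multiplier in the weighted localization. -/
noncomputable def mult (γ : ℝ) (z : Rd (n + 1)) : ℝ := conicWeight P.τ ((n + 1) / 2 - γ) z * P.σ z

/-- The weighted localization. -/
noncomputable def localize (γ : ℝ) (u : B → ℂ) : Rd (n + 1) → ℂ := P.lift (P.mult γ) u

theorem contDiff_mult (γ : ℝ) : ContDiff ℝ ∞ (P.mult γ) := (contDiff_conicWeight _ _).mul P.contDiff_σ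

theorem tsupport_mult (γ : ℝ) : tsupport (P.mult γ) ⊆ P.S₀ :=
  (tsupport_mul_subset_right (f := conicWeight P.τ ((n + 1) / 2 - γ))).trans P.tsupport_σ

theorem contDiff_localize (γ : ℝ) (hu : u ∈ ConicManifold.testSubmodule n B) :
    ContDiff ℝ ∞ (P.localize γ u) := P.contDiff_lift (P.contDiff_mult γ) (P.tsupport_mult γ) hu

theorem hasCompactSupport_localize (γ : ℝ) (hu : u ∈ ConicManifold.testSubmodule n B) :
    HasCompactSupport (P.localize γ u) := P.hasCompactSupport_lift (P.tsupport_mult γ) hu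

theorem enorm_lift_mul_conicWeight (γ : ℝ) (ρ : Rd (n + 1) → ℝ) (u : B → ℂ) (z : Rd (n + 1)) :
    ‖P.lift (fun z => conicWeight P.τ ((n + 1) / 2 - γ) z * ρ z) u z‖ₑ ^ 2 =
      ENNReal.ofReal (conicWeight P.τ (n + 1 - 2 * γ) z) * ‖P.lift ρ u z‖ₑ ^ 2 := by
  rw [enorm_sq_eq_ofReal, enorm_sq_eq_ofReal, ← ENNReal.ofReal_mul (conicWeight_pos _ _ _).le]
  congr 1
  simp only [lift, norm_smul, norm_mul, Real.norm_eq_abs, abs_of_pos (conicWeight_pos _ _ _)]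
  rw [show (n + 1 - 2 * γ : ℝ) = 2 * ((n + 1) / 2 - γ) by ring, ← conicWeight_sq]
  ring

theorem partialDeriv_localize (γ : ℝ) (hu : u ∈ ConicManifold.testSubmodule n B)
    {z : Rd (n + 1)} (hz : z ∈ P.Φ.dom) (i : Fin (n + 1)) :
    partialDeriv i (P.localize γ u) z =
      (if i = 0 then -(P.τ * ((n + 1) / 2 - γ)) else 0 : ℝ) • P.localize γ u z +
      P.lift (fun z => conicWeight P.τ ((n + 1) / 2 - γ) z * partialDeriv i P.σ z) u z +
      P.mult γ z • partialDeriv i (u ∘ P.Φ.toFun) z := by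
  rw [localize, P.partialDeriv_lift (P.contDiff_mult γ) hu hz]
  congr 1
  have h1 : partialDeriv i (P.mult γ) z = _ :=
    partialDeriv_smul (F := ℝ) i ((contDiff_conicWeight P.τ ((n + 1) / 2 - γ)).differentiable (by simp)).differentiableAt
      (P.contDiff_σ.differentiable (by simp)).differentiableAt
  rw [lift, h1, partialDeriv_conicWeight]
  simp only [lift, mult, smul_eq_mul, ← smul_assoc, ← add_smul]
  congr 1
  ring

/-- A derivative of the localization has three terms. Where it falls on the weight or on the
cut-off, Hardy's inequality with the cut-off `σ` or `∂ᵢσ` applies; where it falls on `u`, the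
gradient part of the energy does, since `n - 1 ≤ n + 1 - 2β`. -/
theorem exists_lintegral_localize_le (hn : 1 ≤ n) {β : ℝ} (hβ : β < 1) : ∃ C : ℝ≥0,
    ∀ u ∈ ConicManifold.testSubmodule n B,
      ∫⁻ z, ‖P.localize β u z‖ₑ ^ 2 ≤ C * ∫⁻ z in P.S, modelEnergy P.τ (u ∘ P.Φ.toFun) z ∧
      ∀ i, ∫⁻ z, ‖partialDeriv i (P.localize β u) z‖ₑ ^ 2 ≤
        C * ∫⁻ z in P.S, modelEnergy P.τ (u ∘ P.Φ.toFun) z := by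
  obtain ⟨K, hK⟩ := P.bounded
  obtain ⟨C₀, hC₀⟩ := P.exists_lintegral_lift_le hn P.contDiff_σ P.tsupport_σ (fun z => (hK z).1)
    (fun z => (hK z).2.2.1) hβ
  have h1 := fun i : Fin (n + 1) => P.exists_lintegral_lift_le hn (contDiff_partialDeriv i P.contDiff_σ)
    ((tsupport_partialDeriv_subset i _).trans P.tsupport_σ) (fun z => (hK z).2.1 i)
    (fun z => (hK z).2.2.2 i) hβ
  choose C₁ hC₁ using h1
  set a : ℝ≥0 := ((P.τ * ((n + 1) / 2 - β)) ^ 2).toNNReal with ha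
  set C₂ : ℝ≥0 := 4 * (a * C₀ + ∑ i, C₁ i) + 2 * (K ^ 2).toNNReal
  refine ⟨C₀ + C₂, fun u hu => ⟨?_, fun i => ?_⟩⟩
  · have h2 := hC₀ u hu
    simp only [← P.enorm_lift_mul_conicWeight] at h2
    exact h2.trans (by gcongr; simp)
  · set E := ∫⁻ z in P.S, modelEnergy P.τ (u ∘ P.Φ.toFun) z with hE
    set A := P.localize β u with hA
    set A' := P.lift (fun z => conicWeight P.τ ((n + 1) / 2 - β) z * partialDeriv i P.σ z) u with hA'
    have i0 : ∫⁻ z, ‖A z‖ₑ ^ 2 ≤ C₀ * E := by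
      have h2 := hC₀ u hu
      simp only [← P.enorm_lift_mul_conicWeight] at h2
      exact h2
    have i1 : ∫⁻ z, ‖A' z‖ₑ ^ 2 ≤ C₁ i * E := by
      have h2 := hC₁ i u hu
      simpa only [← P.enorm_lift_mul_conicWeight] using h2
    have cA : Continuous A := (P.contDiff_localize β hu).continuous
    have cA' : Continuous A' := (P.contDiff_lift ((contDiff_conicWeight _ _).mul
      (contDiff_partialDeriv i P.contDiff_σ)) (tsupport_mul_subset_right.trans ((tsupport_partialDeriv_subset i _).trans P.tsupport_σ)) hu).continuous
    -- The three terms are separated by two uses of `|a + b|² ≤ 2 (|a|² + |b|²)`, whence the factors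
    -- `4` and `2`.
    have key : ∀ z, ‖partialDeriv i A z‖ₑ ^ 2 ≤ 4 * (a * ‖A z‖ₑ ^ 2 + ‖A' z‖ₑ ^ 2) +
        P.S.indicator (fun z => 2 * ((K ^ 2).toNNReal * modelEnergy P.τ (u ∘ P.Φ.toFun) z)) z := by
      intro z
      by_cases hz : z ∈ P.S
      · rw [indicator_of_mem hz, hA, P.partialDeriv_localize β hu (P.S_subset hz)]
        refine (enorm_add_sq_le _ _).trans ?_
        rw [mul_add]
        refine add_le_add ?_ ?_
        · rw [show (4 : ℝ≥0∞) = 2 * 2 by norm_num, mul_assoc]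
          refine mul_le_mul_right ((enorm_add_sq_le _ _).trans ?_) _
          gcongr
          rw [enorm_smul, mul_pow]
          gcongr
          rw [enorm_sq_eq_ofReal, ha]
          refine ENNReal.ofReal_le_ofReal ?_
          split_ifs
          · rw [norm_neg, Real.norm_eq_abs, sq_abs]
          · rw [norm_zero, zero_pow two_ne_zero]; positivity
        · gcongr
          rw [enorm_sq_eq_ofReal, modelEnergy_eq,
            show ((K ^ 2).toNNReal : ℝ≥0∞) = ENNReal.ofReal (K ^ 2) from rfl,
            ← ENNReal.ofReal_mul (sq_nonneg _)]
          refine ENNReal.ofReal_le_ofReal ?_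
          have hw := conicWeight_pos P.τ (n + 1) z
          have e3 : ‖partialDeriv i (u ∘ P.Φ.toFun) z‖ ^ 2 ≤
              ∑ i, ‖partialDeriv i (u ∘ P.Φ.toFun) z‖ ^ 2 :=
            Finset.single_le_sum (f := fun i => ‖partialDeriv i (u ∘ P.Φ.toFun) z‖ ^ 2)
              (fun i _ => sq_nonneg _) (Finset.mem_univ i)
          have e4 : P.mult β z ^ 2 ≤ conicWeight P.τ (n - 1) z * K ^ 2 := by
            rw [mult, mul_pow, conicWeight_sq]
            rw [← sq_abs (P.σ z)]
            exact mul_le_mul (conicWeight_anti (P.S_nonneg z hz) (by linarith))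
              (pow_le_pow_left₀ (abs_nonneg _) (hK z).1 2) (sq_nonneg _) (conicWeight_pos _ _ _).le
          rw [norm_smul, mul_pow, Real.norm_eq_abs, sq_abs]
          set X := ∑ i, ‖partialDeriv i (u ∘ P.Φ.toFun) z‖ ^ 2
          have hw' := conicWeight_pos P.τ (n - 1) z
          calc P.mult β z ^ 2 * ‖partialDeriv i (u ∘ P.Φ.toFun) z‖ ^ 2
              ≤ (conicWeight P.τ (n - 1) z * K ^ 2) * X := by gcongr
            _ = K ^ 2 * (0 + conicWeight P.τ (n - 1) z * X) := by ring
            _ ≤ _ := by gcongr; positivity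
      · have h3 : partialDeriv i A z = 0 := partialDeriv_of_notMem_tsupport i fun h =>
          hz (P.S₀_subset_S (P.tsupport_mult β (P.tsupport_lift_subset _ u h)))
        rw [h3]
        simp
    refine (lintegral_mono key).trans ?_
    have m1 : Measurable fun z => 4 * (a * ‖A z‖ₑ ^ 2 + ‖A' z‖ₑ ^ 2) := by
      have := cA.measurable; have := cA'.measurable; fun_prop
    have m2 : Measurable fun z => (a : ℝ≥0∞) * ‖A z‖ₑ ^ 2 := by
      have := cA.measurable; fun_prop
    rw [lintegral_add_left m1, lintegral_const_mul' _ _ (by norm_num), lintegral_add_left m2,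
      lintegral_const_mul' _ _ ENNReal.coe_ne_top, lintegral_indicator P.isClosed_S.measurableSet,
      lintegral_const_mul' _ _ (by norm_num), lintegral_const_mul' _ _ ENNReal.coe_ne_top, ← hE]
    have i2 : (C₁ i : ℝ≥0∞) ≤ ((∑ i, C₁ i : ℝ≥0) : ℝ≥0∞) := by
      exact_mod_cast Finset.single_le_sum (f := C₁) (fun i _ => zero_le) (Finset.mem_univ i)
    calc _ ≤ 4 * (a * (C₀ * E) + ((∑ i, C₁ i : ℝ≥0) : ℝ≥0∞) * E) + 2 * ((K ^ 2).toNNReal * E) := by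
            gcongr
            exact i1.trans (mul_le_mul_left i2 _)
      _ = (C₂ : ℝ≥0∞) * E := by
            simp only [C₂, ENNReal.coe_add, ENNReal.coe_mul, ENNReal.coe_ofNat]
            ring
      _ ≤ _ := by gcongr; simp

end Piece
end Piece

/-! ### Sequences and pairings in `L²` -/

section Lp
variable {α : Type*} [MeasurableSpace α] {μ : Measure α}

theorem enorm_Lp_sq (f : Lp ℂ 2 μ) : ‖f‖ₑ ^ 2 = ∫⁻ z, ‖f z‖ₑ ^ 2 ∂μ := by
  rw [Lp.enorm_def, eLpNorm_two_sq]

theorem enorm_toLp_sq {f : α → ℂ} (hf : MemLp f 2 μ) : ‖hf.toLp f‖ₑ ^ 2 = ∫⁻ z, ‖f z‖ₑ ^ 2 ∂μ := by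
  rw [Lp.enorm_def, eLpNorm_congr_ae hf.coeFn_toLp, eLpNorm_two_sq]

theorem exists_seq_tendsto_ae_of_tendsto_Lp {f : ℕ → Lp ℂ 2 μ} {g : Lp ℂ 2 μ}
    (h : Filter.Tendsto f Filter.atTop (𝓝 g)) : ∃ ns : ℕ → ℕ, StrictMono ns ∧
      ∀ᵐ x ∂μ, Filter.Tendsto (fun i => f (ns i) x) Filter.atTop (𝓝 (g x)) :=
  (tendstoInMeasure_of_tendsto_Lp h).exists_seq_tendsto_ae

/-- The pairing is the inner product with a fixed element. It carries the defining identity of weak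
derivatives through limits in `L²`. -/
theorem continuous_integral_smul_Lp {g : α → ℝ} (hg : MemLp (fun z => (g z : ℂ)) 2 μ) :
    Continuous fun f : Lp ℂ 2 μ => ∫ z, g z • f z ∂μ := by
  have h : (fun f : Lp ℂ 2 μ => ∫ z, g z • f z ∂μ) = fun f => inner ℂ (hg.toLp _) f := by
    funext f
    rw [L2.inner_def]
    refine integral_congr_ae ?_
    filter_upwards [hg.coeFn_toLp] with z hz
    rw [hz, RCLike.inner_apply]
    simp [mul_comm]
  rw [h]
  fun_prop

end Lp

/-! ### Localizations as bounded operators on `H¹(𝔹)` -/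

section Operators
variable {n : ℕ} {B N : Type*}
    [TopologicalSpace B] [ChartedSpace (EuclideanHalfSpace (n + 1)) B]
    [IsManifold (𝓡∂ (n + 1)) ∞ B]
    [TopologicalSpace N] [ChartedSpace (EuclideanSpace ℝ (Fin n)) N]
    [IsManifold (𝓡 n) ∞ N]
    [CompactSpace B] [T2Space B] [MeasurableSpace B] [BorelSpace B]
    {M : ConicManifold n B N}

namespace ConicManifold

theorem exists_seq_testFun (U : M.H1) : ∃ u : ℕ → M.TestFun,
    Filter.Tendsto (fun k => (u k : M.H1)) Filter.atTop (𝓝 U) := by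
  have h : U ∈ closure (Set.range ((↑) : M.TestFun → M.H1)) :=
    UniformSpace.Completion.denseRange_coe U
  obtain ⟨x, hx, hxU⟩ := mem_closure_iff_seq_limit.1 h
  choose u hu using hx
  exact ⟨u, by simpa only [hu] using hxU⟩

/-- Extension by continuity of an operator on test functions. -/
theorem exists_extension {α : Type*} [MeasurableSpace α] {μ : Measure α} (F : M.TestFun → α → ℂ)
    (hadd : ∀ u v, F (u + v) = F u + F v) (hsmul : ∀ (c : ℂ) u, F (c • u) = c • F u)
    (hmem : ∀ u, MemLp (F u) 2 μ) {C : ℝ≥0} (hC : ∀ u, ∫⁻ z, ‖F u z‖ₑ ^ 2 ∂μ ≤ C * ‖u‖ₑ ^ 2) :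
    ∃ T : M.H1 →L[ℂ] Lp ℂ 2 μ, ∀ u : M.TestFun, T u = (hmem u).toLp (F u) := by
  let T₀ : M.TestFun →ₗ[ℂ] Lp ℂ 2 μ :=
    { toFun := fun u => (hmem u).toLp (F u)
      map_add' := fun u v => by
        rw [← MemLp.toLp_add]
        exact MemLp.toLp_congr _ _ (.of_forall fun z => congrFun (hadd u v) z)
      map_smul' := fun c u => by
        rw [RingHom.id_apply, ← MemLp.toLp_const_smul]
        exact MemLp.toLp_congr _ _ (.of_forall fun z => congrFun (hsmul c u) z) }
  let T₁ : M.TestFun →L[ℂ] Lp ℂ 2 μ := T₀.mkContinuous (NNReal.sqrt C) fun u => by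
    have h : ‖T₀ u‖ₑ ^ 2 ≤ (NNReal.sqrt C * ‖u‖ₑ) ^ 2 := by
      rw [mul_pow, ← ENNReal.coe_pow, NNReal.sq_sqrt]
      exact (enorm_toLp_sq (hmem u)).trans_le (hC u)
    have h' := (ENNReal.pow_le_pow_left_iff two_ne_zero).1 h
    have h'' := ENNReal.toReal_mono (ENNReal.mul_ne_top ENNReal.coe_ne_top enorm_ne_top) h'
    rwa [toReal_enorm, ENNReal.toReal_mul, toReal_enorm] at h''
  exact ⟨T₁.extend UniformSpace.Completion.toComplL, fun u =>
    ContinuousLinearMap.extend_eq _ (e := UniformSpace.Completion.toComplL)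
      UniformSpace.Completion.denseRange_coe (UniformSpace.Completion.isUniformInducing_coe _) u⟩

end ConicManifold

namespace Piece
variable (P : Piece M)

theorem exists_lintegral_modelEnergy_le : ∃ C : ℝ≥0, ∀ u : M.TestFun,
    ∫⁻ z in P.S, modelEnergy P.τ (u.1 ∘ P.Φ.toFun) z ≤ C * ‖u‖ₑ ^ 2 := by
  obtain ⟨C, hC⟩ := InteriorParam.exists_modelEnergy_bounds P.tame P.S_subset
  refine ⟨C, fun u => ((hC u.1 u.2 P.S subset_rfl P.isClosed_S.measurableSet).2).trans ?_⟩
  rw [M.enorm_sq_eq_lintegral]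
  gcongr
  exact Measure.restrict_le_self

set_option linter.unusedSectionVars false in
theorem partialDeriv_localize_add (γ : ℝ) (i : Fin (n + 1)) {u v : B → ℂ}
    (hu : u ∈ ConicManifold.testSubmodule n B) (hv : v ∈ ConicManifold.testSubmodule n B) :
    partialDeriv i (P.localize γ (u + v)) =
      partialDeriv i (P.localize γ u) + partialDeriv i (P.localize γ v) := by
  have h : P.localize γ (u + v) = P.localize γ u + P.localize γ v :=
    funext fun z => smul_add _ _ _
  funext z
  rw [h, partialDeriv, fderiv_add ((P.contDiff_localize γ hu).differentiable (by simp)).differentiableAt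
    ((P.contDiff_localize γ hv).differentiable (by simp)).differentiableAt]
  rfl

set_option linter.unusedSectionVars false in
theorem partialDeriv_localize_smul (γ : ℝ) (i : Fin (n + 1)) (c : ℂ) {u : B → ℂ}
    (hu : u ∈ ConicManifold.testSubmodule n B) :
    partialDeriv i (P.localize γ (c • u)) = c • partialDeriv i (P.localize γ u) := by
  have h : P.localize γ (c • u) = c • P.localize γ u := funext fun z =>
    smul_comm (P.mult γ z) c (u (P.Φ.toFun z))
  funext z
  rw [h, partialDeriv, fderiv_const_smul ((P.contDiff_localize γ hu).differentiable (by simp)).differentiableAt]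
  rfl

/-- The weighted localization and its weak derivatives as bounded operators on `H¹(𝔹)`. -/
theorem exists_localizeOp (hn : 1 ≤ n) {β : ℝ} (hβ : β < 1) :
    ∃ (T : M.H1 →L[ℂ] Lp ℂ 2 (volume : Measure (Rd (n + 1))))
      (T' : Fin (n + 1) → M.H1 →L[ℂ] Lp ℂ 2 (volume : Measure (Rd (n + 1)))),
      (∀ u : M.TestFun, T u =ᵐ[volume] P.localize β u.1) ∧
      (∀ (u : M.TestFun) i, T' i u =ᵐ[volume] partialDeriv i (P.localize β u.1)) ∧
      (∀ U, T U =ᵐ[volume] P.localize β (M.toL2 U)) ∧ ∀ U i, IsWeakPartial i (T U) (T' i U) := by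
  obtain ⟨C₀, hC₀⟩ := P.exists_lintegral_localize_le hn hβ
  obtain ⟨C₁, hC₁⟩ := P.exists_lintegral_modelEnergy_le
  have hmem : ∀ u : M.TestFun, MemLp (P.localize β u.1) 2 (volume : Measure (Rd (n + 1))) := fun u =>
    (P.contDiff_localize β u.2).continuous.memLp_of_hasCompactSupport (P.hasCompactSupport_localize β u.2)
  have hmem' : ∀ i, ∀ u : M.TestFun, MemLp (partialDeriv i (P.localize β u.1)) 2
      (volume : Measure (Rd (n + 1))) := fun i u =>
    (continuous_partialDeriv i (P.contDiff_localize β u.2)).memLp_of_hasCompactSupport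
      (hasCompactSupport_partialDeriv i (P.hasCompactSupport_localize β u.2))
  obtain ⟨T, hT⟩ := ConicManifold.exists_extension (fun u : M.TestFun => P.localize β u.1)
    (fun u v => funext fun z => smul_add _ _ _) (fun c u => funext fun z => smul_comm (P.mult β z) c (u.1 (P.Φ.toFun z))) hmem
    (C := C₀ * C₁) fun u => by
      rw [ENNReal.coe_mul, mul_assoc]
      exact (hC₀ u.1 u.2).1.trans (by gcongr; exact hC₁ u)
  have hT' := fun i => ConicManifold.exists_extension
    (fun u : M.TestFun => partialDeriv i (P.localize β u.1))
    (fun u v => P.partialDeriv_localize_add β i u.2 v.2)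
    (fun c u => P.partialDeriv_localize_smul β i c u.2) (hmem' i)
    (C := C₀ * C₁) fun u => by
      rw [ENNReal.coe_mul, mul_assoc]
      exact ((hC₀ u.1 u.2).2 i).trans (by gcongr; exact hC₁ u)
  choose T' hT' using hT'
  have hTae : ∀ u : M.TestFun, T u =ᵐ[volume] P.localize β u.1 := fun u => by
    rw [hT u]; exact (hmem u).coeFn_toLp
  have hTae' : ∀ (u : M.TestFun) i, T' i u =ᵐ[volume] partialDeriv i (P.localize β u.1) := fun u i => by
    rw [hT' i u]; exact (hmem' i u).coeFn_toLp
  refine ⟨T, T', hTae, hTae', fun U => ?_, fun U i => ?_⟩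
  -- Along a common subsequence of approximating test functions, the images in `L²(𝔹)` and the
  -- localizations both converge almost everywhere, and null sets of `𝓑` pull back to null sets.
  -- Hence `T U` is the localization of the function `toL2 U`.
  · obtain ⟨u, hu⟩ := ConicManifold.exists_seq_testFun U
    obtain ⟨ns, hns, h1⟩ := exists_seq_tendsto_ae_of_tendsto_Lp ((M.toL2.continuous.tendsto U).comp hu)
    obtain ⟨ms, hms, h2⟩ := exists_seq_tendsto_ae_of_tendsto_Lp
      (((T.continuous.tendsto U).comp hu).comp hns.tendsto_atTop)
    have h3 : ∀ᵐ q ∂M.vol, Filter.Tendsto (fun k => (u (ns (ms k))).1 q) Filter.atTop (𝓝 (M.toL2 U q)) := by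
      have h4 : ∀ᵐ q ∂M.vol, ∀ k, M.toL2 (u k : M.H1) q = (u k).1 q :=
        ae_all_iff.2 fun k => by rw [M.toL2_coe]; exact (M.memLp_testFun (u k)).coeFn_toLp
      filter_upwards [h1, h4] with q hq hq'
      have := hq.comp hms.tendsto_atTop
      simpa only [Function.comp_def, hq'] using this
    have h5 := InteriorParam.volume_preimage_eq_zero (Φ := P.Φ) (M := M) h3
    have h6 : ∀ᵐ z, ∀ k, T (u k) z = P.localize β (u k).1 z := ae_all_iff.2 fun k => hTae (u k)
    filter_upwards [h2, measure_eq_zero_iff_ae_notMem.1 h5, h6] with z hz hz5 hz6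
    refine tendsto_nhds_unique hz ?_
    simp only [Function.comp_def, hz6]
    by_cases hzd : z ∈ P.Φ.dom
    · have : Filter.Tendsto (fun k => (u (ns (ms k))).1 (P.Φ.toFun z)) Filter.atTop
          (𝓝 (M.toL2 U (P.Φ.toFun z))) := by
        by_contra h
        exact hz5 ⟨hzd, h⟩
      exact this.const_smul _
    · have h0 : P.mult β z = 0 := image_eq_zero_of_notMem_tsupport fun h =>
        hzd (P.S₀_subset (P.tsupport_mult β h))
      simp [localize, lift, h0]
  · have hl : ∀ f : Lp ℂ 2 (volume : Measure (Rd (n + 1))), LocallyIntegrable f volume :=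
      fun f => (Lp.memLp f).locallyIntegrable one_le_two
    refine ⟨hl _, hl _, fun φ hφ hc => ?_⟩
    have hc1 : MemLp (fun z => ((fderiv ℝ φ z (EuclideanSpace.single i 1) : ℝ) : ℂ)) 2
        (volume : Measure (Rd (n + 1))) :=
      (Complex.continuous_ofReal.comp (continuous_partialDeriv i hφ)).memLp_of_hasCompactSupport
        ((hasCompactSupport_partialDeriv i hc).comp_left Complex.ofReal_zero)
    have hc2 : MemLp (fun z => (φ z : ℂ)) 2 (volume : Measure (Rd (n + 1))) :=
      (Complex.continuous_ofReal.comp hφ.continuous).memLp_of_hasCompactSupport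
        (hc.comp_left Complex.ofReal_zero)
    -- Both sides of the weak identity are continuous in `U`, so test functions suffice.
    refine UniformSpace.Completion.induction_on U (isClosed_eq
      ((continuous_integral_smul_Lp hc1).comp T.continuous)
      ((continuous_integral_smul_Lp hc2).comp (T' i).continuous).neg) fun u => ?_
    exact ((isWeakPartial_partialDeriv i (P.contDiff_localize β u.2)).congr (hTae u).symm
      (hTae' u i).symm).2.2 φ hφ hc

theorem exists_sobolevNorm_localize_le (hn : 1 ≤ n) {β : ℝ} (hβ : β < 1) : ∃ C : ℝ≥0, ∀ U : M.H1,
    sobolevNorm (P.localize β (M.toL2 U)) ≤ C * ‖U‖ₑ := by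
  obtain ⟨T, T', -, -, h1, h2⟩ := P.exists_localizeOp hn hβ
  -- With `X` the sum of the squared operator norms, the squared Sobolev norm is at most `X * ‖U‖²`;
  -- the inequality `X ≤ (1 + X) ^ 2` avoids a square root.
  refine ⟨1 + (‖T‖₊ ^ 2 + ∑ i, ‖T' i‖₊ ^ 2), fun U => ?_⟩
  rw [← ENNReal.pow_le_pow_left_iff two_ne_zero,
    sobolevNorm_sq fun i => (h2 U i).congr (h1 U) .rfl, lintegral_congr_ae ((h1 U).symm.mono fun z hz => by
      rw [hz]), ← enorm_Lp_sq]
  simp only [← enorm_Lp_sq]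
  have hb : ∀ A : M.H1 →L[ℂ] Lp ℂ 2 (volume : Measure (Rd (n + 1))),
      ‖A U‖ₑ ^ 2 ≤ (‖A‖₊ ^ 2 : ℝ≥0) * ‖U‖ₑ ^ 2 := by
    intro A
    rw [ENNReal.coe_pow, ← mul_pow]
    gcongr
    exact A.le_opENorm U
  calc _ ≤ (‖T‖₊ ^ 2 : ℝ≥0) * ‖U‖ₑ ^ 2 + ∑ i, (‖T' i‖₊ ^ 2 : ℝ≥0) * ‖U‖ₑ ^ 2 :=
        add_le_add (hb T) (Finset.sum_le_sum fun i _ => hb (T' i))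
    _ = ((‖T‖₊ ^ 2 + ∑ i, ‖T' i‖₊ ^ 2 : ℝ≥0) : ℝ≥0∞) * ‖U‖ₑ ^ 2 := by
        rw [← Finset.sum_mul, ← add_mul]; push_cast; rfl
    _ ≤ _ := by
        rw [mul_pow, ← ENNReal.coe_pow]
        gcongr
        nlinarith [zero_le (a := ‖T‖₊ ^ 2 + ∑ i, ‖T' i‖₊ ^ 2)]

end Piece
end Operators

/-! ### A criterion for compactness -/

/-- The joint image of the unit ball under all `T a` is totally bounded in the finite product; a
finite net for it pulls back to points of the ball whose images form a net for the image under `A`.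
-/
theorem isCompactOperator_of_enorm_sq_le {E F G ι : Type*} [SeminormedAddCommGroup E] [NormedSpace ℂ E]
    [NormedAddCommGroup F] [NormedSpace ℂ F] [CompleteSpace F] [NormedAddCommGroup G] [NormedSpace ℂ G]
    [Fintype ι] {A : E →L[ℂ] F} {T : ι → E →L[ℂ] G} (hT : ∀ a, IsCompactOperator (T a)) {C : ℝ≥0}
    (h : ∀ x, ‖A x‖ₑ ^ 2 ≤ C * ∑ a, ‖T a x‖ₑ ^ 2) : IsCompactOperator A := by
  have h' : ∀ x, ‖A x‖ ^ 2 ≤ C * ∑ a, ‖T a x‖ ^ 2 := by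
    intro x
    have h1 : (C : ℝ≥0∞) * ∑ a, ‖T a x‖ₑ ^ 2 = ENNReal.ofReal (C * ∑ a, ‖T a x‖ ^ 2) := by
      rw [ENNReal.ofReal_mul C.coe_nonneg, ENNReal.ofReal_coe_nnreal,
        ENNReal.ofReal_sum_of_nonneg fun a _ => sq_nonneg _]
      simp only [enorm_sq_eq_ofReal]
    have h2 := h x
    rw [h1, enorm_sq_eq_ofReal] at h2
    exact (ENNReal.ofReal_le_ofReal_iff
      (mul_nonneg C.coe_nonneg (Finset.sum_nonneg fun a _ => sq_nonneg _))).1 h2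
  refine (isCompactOperator_iff_isCompact_closure_image_ball (A : E →ₗ[ℂ] F) one_pos).2 ?_
  choose K hK hTK using fun a =>
    (isCompactOperator_iff_image_ball_subset_compact (T a : E →ₗ[ℂ] G) one_pos).1 (hT a)
  have htb : TotallyBounded ((fun x a => T a x) '' Metric.ball (0 : E) 1) := by
    refine (isCompact_univ_pi hK).totallyBounded.subset ?_
    rintro _ ⟨x, hx, rfl⟩ a _
    exact hTK a ⟨x, hx, rfl⟩
  refine isCompact_iff_totallyBounded_isComplete.2 ⟨TotallyBounded.closure ?_, isClosed_closure.isComplete⟩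
  refine Metric.totallyBounded_iff.2 fun ε hε => ?_
  -- Distance `r` in each of the `card ι` components gives a squared distance of at most `C * card ι
  -- * r ^ 2` under `A`; the `+ 1` makes `D` positive and the final inequality strict.
  set D : ℝ := C * Fintype.card ι + 1 with hD
  have hDp : 0 < D := by positivity
  set r := ε / √D with hr
  have hrp : 0 < r := div_pos hε (Real.sqrt_pos.2 hDp)
  obtain ⟨t, hts, htf, ht⟩ := Metric.finite_approx_of_totallyBounded htb r hrp
  have hch : ∀ y : ι → G, ∃ x : E, y ∈ t → x ∈ Metric.ball (0 : E) 1 ∧ (fun a => T a x) = y := by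
    intro y
    by_cases hy : y ∈ t
    · obtain ⟨x, hx, hxy⟩ := hts hy
      exact ⟨x, fun _ => ⟨hx, hxy⟩⟩
    · exact ⟨0, fun h => absurd h hy⟩
  choose p hp using hch
  refine ⟨(fun y => A (p y)) '' t, htf.image _, ?_⟩
  rintro _ ⟨x, hx, rfl⟩
  obtain ⟨y, hy, hxy⟩ := mem_iUnion₂.1 (ht ⟨x, hx, rfl⟩)
  refine mem_iUnion₂.2 ⟨_, ⟨y, hy, rfl⟩, ?_⟩
  rw [Metric.mem_ball, dist_eq_norm] at hxy ⊢
  have h3 : ∀ a, ‖T a (x - p y)‖ ≤ r := by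
    intro a
    have h4 : T a (p y) = y a := congrFun (hp y hy).2 a
    rw [map_sub, h4]
    exact (norm_le_pi_norm ((fun a => T a x) - y) a).trans hxy.le
  have h5 := h' (x - p y)
  have h6 : ∑ a, ‖T a (x - p y)‖ ^ 2 ≤ Fintype.card ι * r ^ 2 := by
    refine (Finset.sum_le_sum fun a _ => pow_le_pow_left₀ (norm_nonneg _) (h3 a) 2).trans ?_
    simp
  have h7 : ‖A (x - p y)‖ ^ 2 < ε ^ 2 := by
    calc _ ≤ (C : ℝ) * (Fintype.card ι * r ^ 2) := h5.trans (by gcongr)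
      _ < D * r ^ 2 := by rw [hD]; nlinarith [sq_pos_of_pos hrp]
      _ = ε ^ 2 := by rw [hr, div_pow, Real.sq_sqrt hDp.le]; field_simp
  have h8 := lt_of_pow_lt_pow_left₀ 2 hε.le h7
  rwa [map_sub] at h8

/-! ### Covering by cores and injectivity of the canonical map -/

section Cover
variable {n : ℕ} {B N : Type*}
    [TopologicalSpace B] [ChartedSpace (EuclideanHalfSpace (n + 1)) B]
    [IsManifold (𝓡∂ (n + 1)) ∞ B]
    [TopologicalSpace N] [ChartedSpace (EuclideanSpace ℝ (Fin n)) N]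
    [IsManifold (𝓡 n) ∞ N]
    {M : ConicManifold n B N}

namespace Piece
variable {ι : Type*} [Fintype ι]

/-- The part of a localization where the cut-off function is not small. -/
def core (P : Piece M) (δ : ℝ) : Set (Rd (n + 1)) := {z ∈ P.S₀ | δ ≤ |P.σ z|}

theorem isClosed_core (P : Piece M) (δ : ℝ) : IsClosed (P.core δ) :=
  P.isClosed_S₀.inter (isClosed_le continuous_const P.contDiff_σ.continuous.abs)

theorem core_subset (P : Piece M) (δ : ℝ) : P.core δ ⊆ P.S₀ := sep_subset _ _

/-- Pigeonhole: numbers that sum to `1` cannot all be smaller than `1 / (card ι + 1)`. The `+ 1`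
keeps the threshold meaningful and the comparison strict. -/
theorem exists_mem_image_core {P : ι → Piece M} {q : B} (hi : q ∈ (𝓡∂ (n + 1)).interior B)
    (hs : ∑ a, (P a).s q = 1) :
    ∃ a, ∃ z ∈ (P a).core (1 / (Fintype.card ι + 1)), (P a).Φ.toFun z = q := by
  set δ : ℝ := 1 / (Fintype.card ι + 1) with hδ
  have hδp : 0 < δ := by positivity
  have h1 : ∃ a, δ ≤ |(P a).s q| := by
    by_contra! h
    have h2 : ∑ a, (P a).s q ≤ Fintype.card ι * δ := by
      refine (Finset.sum_le_sum fun a _ => (le_abs_self _).trans (h a).le).trans ?_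
      simp
    rw [hs, hδ, mul_one_div, le_div_iff₀ (by positivity)] at h2
    linarith
  obtain ⟨a, ha⟩ := h1
  have h3 : q ∈ (P a).Φ.toFun '' (P a).S₀ := by
    by_contra h
    rw [(P a).s_eq_zero q hi h, abs_zero] at ha
    linarith
  obtain ⟨z, hz, rfl⟩ := h3
  exact ⟨a, z, ⟨hz, by rwa [(P a).σ_eq z ((P a).S₀_subset hz)]⟩, rfl⟩

/-- On a compact set where `σ` does not vanish the multiplier can be divided out, and the product
rule recovers the derivatives of `u`. All factors that occur are bounded there by one constant `A`.
-/
theorem exists_modelEnergy_le_localize (P : Piece M) {Z : Set (Rd (n + 1))} (hZ : IsCompact Z)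
    (hZS : Z ⊆ P.S₀) (hσ : ∀ z ∈ Z, P.σ z ≠ 0) : ∃ C : ℝ≥0, ∀ u ∈ ConicManifold.testSubmodule n B,
      ∀ z ∈ Z, modelEnergy P.τ (u ∘ P.Φ.toFun) z ≤
        C * (‖P.localize 0 u z‖ₑ ^ 2 + ∑ i, ‖partialDeriv i (P.localize 0 u) z‖ₑ ^ 2) := by
  have hc := fun a => (contDiff_conicWeight (n := n) P.τ a).continuous.continuousOn (s := Z)
  have hρ := (P.contDiff_mult 0).continuous
  obtain ⟨A₁, h₁⟩ := hZ.exists_bound_of_continuousOn (hc (n + 1))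
  obtain ⟨A₂, h₂⟩ := hZ.exists_bound_of_continuousOn (hc (n - 1))
  obtain ⟨A₃, h₃⟩ := hZ.exists_bound_of_continuousOn (f := fun z => (P.mult 0 z)⁻¹)
    (hρ.continuousOn.inv₀ fun z hz => mul_ne_zero (conicWeight_pos _ _ _).ne' (hσ z hz))
  choose A₄ h₄ using fun i : Fin (n + 1) => hZ.exists_bound_of_continuousOn
    (continuous_partialDeriv i (P.contDiff_mult 0)).continuousOn
  obtain ⟨A, hA0, hA1, hA2, hA3, hA4⟩ : ∃ A : ℝ, 1 ≤ A ∧ A₁ ≤ A ∧ A₂ ≤ A ∧ A₃ ≤ A ∧ ∀ i, A₄ i ≤ A := by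
    refine ⟨1 + |A₁| + |A₂| + |A₃| + ∑ i, |A₄ i|, ?_, ?_, ?_, ?_, fun i => ?_⟩
    all_goals have := Finset.sum_nonneg fun i (_ : i ∈ Finset.univ) => abs_nonneg (A₄ i)
    on_goal 5 => have h5 := Finset.single_le_sum (f := fun i => |A₄ i|)
                    (fun i _ => abs_nonneg (A₄ i)) (Finset.mem_univ i)
                 have := le_abs_self (A₄ i)
    all_goals linarith [abs_nonneg A₁, abs_nonneg A₂, abs_nonneg A₃, le_abs_self A₁,
      le_abs_self A₂, le_abs_self A₃]
  refine ⟨(A ^ 7 * (2 * (n + 2))).toNNReal, fun u hu z hz => ?_⟩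
  have hzd := P.S₀_subset (hZS hz)
  have e1 : conicWeight P.τ (n + 1) z ≤ A := (le_abs_self _).trans ((h₁ z hz).trans hA1)
  have e2 : conicWeight P.τ (n - 1) z ≤ A := (le_abs_self _).trans ((h₂ z hz).trans hA2)
  have e3 : ‖(P.mult 0 z)⁻¹‖ ≤ A := (h₃ z hz).trans hA3
  have hne : P.mult 0 z ≠ 0 := mul_ne_zero (conicWeight_pos _ _ _).ne' (hσ z hz)
  set F := P.localize 0 u with hF
  set f := u ∘ P.Φ.toFun with hf
  have f1 : f z = (P.mult 0 z)⁻¹ • F z := by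
    rw [hF, localize, lift, smul_smul, inv_mul_cancel₀ hne, one_smul]; rfl
  have f2 : ∀ i, partialDeriv i f z =
      (P.mult 0 z)⁻¹ • (partialDeriv i F z - partialDeriv i (P.mult 0) z • f z) := by
    intro i
    have : partialDeriv i F z = partialDeriv i (P.mult 0) z • f z + P.mult 0 z • partialDeriv i f z :=
      P.partialDeriv_lift (P.contDiff_mult 0) hu hzd i
    rw [this, add_sub_cancel_left, smul_smul, inv_mul_cancel₀ hne, one_smul]
  have hAp : 0 < A := by linarith
  have g1 : ‖f z‖ ≤ A * ‖F z‖ := by rw [f1, norm_smul]; gcongr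
  have g2 : ∀ i, ‖partialDeriv i f z‖ ^ 2 ≤ 2 * A ^ 6 * (‖partialDeriv i F z‖ ^ 2 + ‖F z‖ ^ 2) := by
    intro i
    have g3 : ‖partialDeriv i f z‖ ≤ A * (‖partialDeriv i F z‖ + A * (A * ‖F z‖)) := by
      rw [f2, norm_smul]
      gcongr
      refine (norm_sub_le _ _).trans ?_
      rw [norm_smul]
      gcongr
      exact (h₄ i z hz).trans (hA4 i)
    have g4 : A * (‖partialDeriv i F z‖ + A * (A * ‖F z‖)) ≤ A ^ 3 * (‖partialDeriv i F z‖ + ‖F z‖) := by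
      have : A * ‖partialDeriv i F z‖ ≤ A ^ 3 * ‖partialDeriv i F z‖ := by
        gcongr
        exact le_self_pow₀ hA0 three_ne_zero
      nlinarith
    have g5 : ‖partialDeriv i f z‖ ^ 2 ≤ (A ^ 3 * (‖partialDeriv i F z‖ + ‖F z‖)) ^ 2 := by
      gcongr; exact g3.trans g4
    refine g5.trans ?_
    rw [mul_pow]
    nlinarith [sq_nonneg (‖partialDeriv i F z‖ - ‖F z‖), pow_pos hAp 6, sq_nonneg (A ^ 3),
      mul_nonneg (pow_pos hAp 6).le (sq_nonneg (‖partialDeriv i F z‖ - ‖F z‖))]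
  have hcast : ((A ^ 7 * (2 * (n + 2))).toNNReal : ℝ≥0∞) = ENNReal.ofReal (A ^ 7 * (2 * (n + 2))) := rfl
  simp only [enorm_sq_eq_ofReal]
  rw [modelEnergy_eq, hcast, ← ENNReal.ofReal_sum_of_nonneg fun i _ => sq_nonneg _,
    ← ENNReal.ofReal_add (sq_nonneg _) (Finset.sum_nonneg fun i _ => sq_nonneg _),
    ← ENNReal.ofReal_mul (by positivity)]
  refine ENNReal.ofReal_le_ofReal ?_
  have hsum := Finset.sum_le_sum fun i (_ : i ∈ Finset.univ) => g2 i
  rw [← Finset.mul_sum, Finset.sum_add_distrib] at hsum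
  simp only [Finset.sum_const, Finset.card_univ, Fintype.card_fin, nsmul_eq_mul, Nat.cast_add,
    Nat.cast_one] at hsum
  set X := ∑ i, ‖partialDeriv i F z‖ ^ 2
  have hX : 0 ≤ X := Finset.sum_nonneg fun i _ => sq_nonneg _
  have g6 : ‖f z‖ ^ 2 ≤ A ^ 2 * ‖F z‖ ^ 2 := by rw [← mul_pow]; gcongr
  have g7 : A ^ 3 ≤ A ^ 7 := pow_le_pow_right₀ hA0 (by norm_num)
  calc conicWeight P.τ (n + 1) z * ‖f z‖ ^ 2 + conicWeight P.τ (n - 1) z * ∑ i, ‖partialDeriv i f z‖ ^ 2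
      ≤ A * (A ^ 2 * ‖F z‖ ^ 2) + A * (2 * A ^ 6 * (X + (n + 1) * ‖F z‖ ^ 2)) := by gcongr
    _ = A ^ 3 * ‖F z‖ ^ 2 + A ^ 7 * (2 * (X + (n + 1) * ‖F z‖ ^ 2)) := by ring
    _ ≤ A ^ 7 * ‖F z‖ ^ 2 + A ^ 7 * (2 * (X + (n + 1) * ‖F z‖ ^ 2)) := by gcongr
    _ ≤ A ^ 7 * (2 * (n + 2)) * (‖F z‖ ^ 2 + X) := by
      have : 0 ≤ A ^ 7 * (‖F z‖ ^ 2 + 2 * (n + 1) * X) := by positivity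
      nlinarith

variable [CompactSpace B] [T2Space B] [MeasurableSpace B] [BorelSpace B]

/-- The energy over a compact part of the core of a localization is controlled by the localization. -/
theorem exists_lintegral_eDensity_le (P : Piece M) {Z : Set (Rd (n + 1))} (hZ : IsCompact Z)
    (hZS : Z ⊆ P.S₀) (hσ : ∀ z ∈ Z, P.σ z ≠ 0) : ∃ C : ℝ≥0, ∀ u ∈ ConicManifold.testSubmodule n B,
      ∫⁻ q in P.Φ.toFun '' Z, M.eDensity u q ∂M.vol ≤ C * ((∫⁻ z, ‖P.localize 0 u z‖ₑ ^ 2) +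
        ∑ i, ∫⁻ z, ‖partialDeriv i (P.localize 0 u) z‖ₑ ^ 2) := by
  obtain ⟨C₁, h₁⟩ := InteriorParam.exists_modelEnergy_bounds P.tame P.S_subset
  obtain ⟨C₂, h₂⟩ := P.exists_modelEnergy_le_localize hZ hZS hσ
  refine ⟨C₁ * C₂, fun u hu => ?_⟩
  refine ((h₁ u hu Z (hZS.trans P.S₀_subset_S) hZ.measurableSet).1).trans ?_
  rw [ENNReal.coe_mul, mul_assoc]
  refine mul_le_mul_right ((setLIntegral_mono' hZ.measurableSet fun z hz => h₂ u hu z hz).trans ?_) _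
  rw [lintegral_const_mul' _ _ ENNReal.coe_ne_top]
  refine mul_le_mul_right ((setLIntegral_le_lintegral _ _).trans ?_) _
  have hm : Measurable fun z => ‖P.localize 0 u z‖ₑ ^ 2 := by
    have := (P.contDiff_localize 0 hu).continuous.measurable; fun_prop
  have hm' : ∀ i ∈ Finset.univ, Measurable fun z => ‖partialDeriv i (P.localize 0 u) z‖ₑ ^ 2 := by
    intro i _
    have := (continuous_partialDeriv i (P.contDiff_localize 0 hu)).measurable; fun_prop
  rw [lintegral_add_left hm, lintegral_finsetSum _ hm']

/-- Split `u = (u - m) + m`. The energy of `m` matters only over the support of `u`, a compact part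
of the interior that is covered by compact parts of finitely many cores. The constant depends on `u`
but not on `m`, so `m` may tend to any element of `H¹(𝔹)`. -/
theorem enorm_sq_le_of_cover {P : ι → Piece M}
    (hs : ∀ q ∈ (𝓡∂ (n + 1)).interior B, ∑ a, (P a).s q = 1) (u : M.TestFun) : ∃ C : ℝ≥0,
    ∀ m : M.TestFun, ‖u‖ₑ ^ 2 ≤ 2 * ‖u - m‖ₑ ^ 2 + C * ∑ a, ((∫⁻ z, ‖(P a).localize 0 m.1 z‖ₑ ^ 2) +
        ∑ i, ∫⁻ z, ‖partialDeriv i ((P a).localize 0 m.1) z‖ₑ ^ 2) := by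
  set δ : ℝ := 1 / (Fintype.card ι + 1) with hδ
  have hδp : 0 < δ := by positivity
  set K := tsupport u.1 with hK
  set Z : ι → Set (Rd (n + 1)) := fun a => (P a).core δ ∩ ((P a).S₀ ∩ (P a).Φ.toFun ⁻¹' K) with hZ
  have hZc : ∀ a, IsCompact (Z a) := fun a =>
    ((P a).proper K u.2.2.2 u.2.2.1).inter_left ((P a).isClosed_core δ)
  have hcov : K ⊆ ⋃ a, (P a).Φ.toFun '' Z a := by
    intro q hq
    obtain ⟨a, z, hz, rfl⟩ := exists_mem_image_core (u.2.2.2 hq) (hs q (u.2.2.2 hq))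
    exact mem_iUnion.2 ⟨a, z, ⟨hz, (P a).core_subset δ hz, hq⟩, rfl⟩
  choose C hC using fun a => (P a).exists_lintegral_eDensity_le (hZc a)
    (fun z hz => (P a).core_subset δ hz.1) (fun z hz h0 => by
      have := hz.1.2
      rw [h0, abs_zero] at this
      linarith)
  refine ⟨2 * ∑ a, C a, fun m => ?_⟩
  have hKm : MeasurableSet K := (isClosed_tsupport _).measurableSet
  have h1 : ‖u‖ₑ ^ 2 = ∫⁻ q in K, M.eDensity u.1 q ∂M.vol := by
    rw [M.enorm_sq_eq_lintegral, ← lintegral_indicator hKm]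
    refine lintegral_congr fun q => ?_
    by_cases hq : q ∈ K
    · rw [indicator_of_mem hq]
    · rw [indicator_of_notMem hq, M.eDensity_of_notMem_tsupport hq]
  have h2 : ∀ q, M.eDensity u.1 q ≤ 2 * M.eDensity (u - m : M.TestFun).1 q + 2 * M.eDensity m.1 q := by
    intro q
    have h3 := M.eDensity_add_le (u - m : M.TestFun).2 m.2 q
    have h4 : (u - m : M.TestFun).1 + m.1 = u.1 := sub_add_cancel u.1 m.1
    rwa [h4] at h3
  have hm1 : Measurable fun q => 2 * M.eDensity (u - m : M.TestFun).1 q :=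
    (M.measurable_eDensity (u - m : M.TestFun).2).const_mul 2
  rw [h1]
  refine (lintegral_mono h2).trans ?_
  rw [lintegral_add_left hm1, lintegral_const_mul' _ _ (by norm_num),
    lintegral_const_mul' _ _ (by norm_num), M.enorm_sq_eq_lintegral]
  refine add_le_add (mul_le_mul_right (setLIntegral_le_lintegral _ _) _) ?_
  rw [ENNReal.coe_mul, ENNReal.coe_ofNat, mul_assoc]
  refine mul_le_mul_right ?_ _
  refine (lintegral_mono_set hcov).trans ((lintegral_iUnion_le _ _).trans ?_)
  rw [tsum_fintype, Finset.mul_sum]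
  refine Finset.sum_le_sum fun a _ => (hC a m.1 m.2).trans ?_
  gcongr
  exact Finset.single_le_sum (f := C) (fun i _ => zero_le) (Finset.mem_univ a)

/-- The canonical map `H¹(𝔹) → L²(𝔹)` is injective. -/
theorem injective_toL2 (hn : 1 ≤ n) {P : ι → Piece M}
    (hs : ∀ q ∈ (𝓡∂ (n + 1)).interior B, ∑ a, (P a).s q = 1) : Function.Injective M.toL2 := by
  refine (injective_iff_map_eq_zero M.toL2).2 fun U hU => ?_
  choose T T' hT hT' hTU hw using fun a => (P a).exists_localizeOp hn (β := 0) one_pos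
  -- `T a U` is determined by the function `toL2 U`, which is zero; the weak derivatives then vanish
  -- by uniqueness.
  have hT0 : ∀ a, T a U = 0 := by
    intro a
    have h1 : T a U =ᵐ[volume] T a 0 := by
      have h2 := hTU a U
      have h3 := hTU a 0
      rw [hU, ← map_zero M.toL2] at h2
      exact h2.trans h3.symm
    rw [Lp.ext h1, map_zero]
  have hT0' : ∀ a i, T' a i U = 0 := by
    intro a i
    have h2 := hw a U i
    have h3 := hw a 0 i
    rw [hT0 a, ← map_zero (T a)] at h2
    rw [Lp.ext (h2.ae_eq h3), map_zero]
  -- For fixed `u` the covering estimate extends from test functions `m` to all `V` by density, and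
  -- at `V = U` the localization terms disappear. What remains has no constant depending on `u`, so
  -- afterwards `u` may tend to `U`.
  have key : ∀ u : M.TestFun, ‖(u : M.H1)‖ₑ ^ 2 ≤ 2 * ‖(u : M.H1) - U‖ₑ ^ 2 := by
    intro u
    obtain ⟨C, hC⟩ := enorm_sq_le_of_cover hs u
    have hall : ∀ V : M.H1, ‖(u : M.H1)‖ₑ ^ 2 ≤ 2 * ‖(u : M.H1) - V‖ₑ ^ 2 +
        C * ∑ a, (‖T a V‖ₑ ^ 2 + ∑ i, ‖T' a i V‖ₑ ^ 2) := by
      intro V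
      refine UniformSpace.Completion.induction_on V (isClosed_le continuous_const ?_) fun m => ?_
      · have c1 : Continuous fun V : M.H1 => ‖(u : M.H1) - V‖ₑ ^ 2 :=
          (ENNReal.continuous_pow 2).comp (continuous_enorm.comp (continuous_const.sub continuous_id))
        have c2 : Continuous fun V : M.H1 => ∑ a, (‖T a V‖ₑ ^ 2 + ∑ i, ‖T' a i V‖ₑ ^ 2) :=
          continuous_finsetSum _ fun a _ => ((ENNReal.continuous_pow 2).comp (continuous_enorm.comp (T a).continuous)).add
            (continuous_finsetSum _ fun i _ => (ENNReal.continuous_pow 2).comp (continuous_enorm.comp (T' a i).continuous))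
        exact ((ENNReal.continuous_const_mul (by norm_num)).comp c1).add
          ((ENNReal.continuous_const_mul ENNReal.coe_ne_top).comp c2)
      · rw [← UniformSpace.Completion.coe_sub, UniformSpace.Completion.enorm_coe,
          UniformSpace.Completion.enorm_coe]
        refine (hC m).trans (le_of_eq ?_)
        congr 2
        refine Finset.sum_congr rfl fun a _ => ?_
        rw [enorm_Lp_sq]
        congr 1
        · exact lintegral_congr_ae ((hT a m).symm.mono fun z hz => by simp only [hz])
        · refine Finset.sum_congr rfl fun i _ => ?_
          rw [enorm_Lp_sq]
          exact lintegral_congr_ae ((hT' a m i).symm.mono fun z hz => by simp only [hz])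
    have h4 := hall U
    simpa [hT0, hT0'] using h4
  have hU2 : ‖U‖ₑ ^ 2 ≤ 2 * ‖U - U‖ₑ ^ 2 := by
    refine UniformSpace.Completion.induction_on (p := fun V : M.H1 => ‖V‖ₑ ^ 2 ≤ 2 * ‖V - U‖ₑ ^ 2) U
      (isClosed_le ((ENNReal.continuous_pow 2).comp continuous_enorm) ?_) key
    exact (ENNReal.continuous_const_mul (by norm_num)).comp
      ((ENNReal.continuous_pow 2).comp (continuous_enorm.comp (continuous_id.sub continuous_const)))
  simpa using hU2

end Piece
end Cover

/-! ### Compactness of the canonical map -/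

section Compact
variable {n : ℕ} {B N : Type*}
    [TopologicalSpace B] [ChartedSpace (EuclideanHalfSpace (n + 1)) B]
    [IsManifold (𝓡∂ (n + 1)) ∞ B]
    [TopologicalSpace N] [ChartedSpace (EuclideanSpace ℝ (Fin n)) N]
    [IsManifold (𝓡 n) ∞ N]
    {M : ConicManifold n B N}
    [CompactSpace B] [T2Space B] [MeasurableSpace B] [BorelSpace B]

theorem ConicManifold.norm_le_of_testFun {F : Type*} [NormedAddCommGroup F] [NormedSpace ℂ F]
    (A : M.H1 →L[ℂ] F) (b : ℝ≥0) (h : ∀ u : M.TestFun, ‖A u‖ₑ ^ 2 ≤ b * ‖u‖ₑ ^ 2) :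
    ‖A‖ ≤ NNReal.sqrt b := by
  refine A.opNorm_le_bound (NNReal.sqrt b).coe_nonneg fun U => ?_
  have hb : IsClosed {U : M.H1 | ‖A U‖ ≤ NNReal.sqrt b * ‖U‖} :=
    isClosed_le (by fun_prop) (by fun_prop)
  refine UniformSpace.Completion.induction_on U hb fun u => ?_
  have h1 : ‖A u‖ₑ ^ 2 ≤ (NNReal.sqrt b * ‖(u : M.H1)‖ₑ) ^ 2 := by
    rw [mul_pow, ← ENNReal.coe_pow, NNReal.sq_sqrt, UniformSpace.Completion.enorm_coe]
    exact h u
  have h2 := ENNReal.toReal_mono (ENNReal.mul_ne_top ENNReal.coe_ne_top enorm_ne_top)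
    ((ENNReal.pow_le_pow_left_iff two_ne_zero).1 h1)
  rwa [toReal_enorm, ENNReal.toReal_mul, toReal_enorm] at h2

namespace Piece

set_option linter.unusedSectionVars false in
theorem enorm_localize_sq_eq (P : Piece M) (γ γ' : ℝ) (u : B → ℂ) (z : Rd (n + 1)) :
    ‖P.localize γ u z‖ₑ ^ 2 =
      ENNReal.ofReal (conicWeight P.τ (2 * (γ' - γ)) z) * ‖P.localize γ' u z‖ₑ ^ 2 := by
  have h : P.mult γ z = conicWeight P.τ (γ' - γ) z * P.mult γ' z := by
    rw [mult, mult, ← mul_assoc, conicWeight_mul]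
    congr 2
    ring
  rw [enorm_sq_eq_ofReal, enorm_sq_eq_ofReal, ← ENNReal.ofReal_mul (conicWeight_pos _ _ _).le,
    localize, localize, lift, lift, h, mul_smul, norm_smul, mul_pow, Real.norm_eq_abs, sq_abs,
    conicWeight_sq]

/-- The squared localization with exponent `0` is `e^{-τt}` times that with exponent `1/2`, which is
still bounded by the energy. On `S₀`, far out means large `τ * t`, and this is the gain. -/
theorem exists_lintegral_tail_le (P : Piece M) (hn : 1 ≤ n) : ∃ C : ℝ≥0, ∀ R₀ : ℝ, ∃ R : ℝ,
    ∀ u : M.TestFun, ∫⁻ z in {z | R ≤ ‖z‖}, ‖P.localize 0 u.1 z‖ₑ ^ 2 ≤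
      ENNReal.ofReal (Real.exp (-R₀)) * (C * ‖u‖ₑ ^ 2) := by
  obtain ⟨C₀, hC₀⟩ := P.exists_lintegral_localize_le hn (β := 1 / 2) (by norm_num)
  obtain ⟨C₁, hC₁⟩ := P.exists_lintegral_modelEnergy_le
  refine ⟨C₀ * C₁, fun R₀ => ?_⟩
  obtain ⟨R, hR⟩ := P.tail R₀
  refine ⟨R, fun u => ?_⟩
  have h1 : ∫⁻ z in {z : Rd (n + 1) | R ≤ ‖z‖}, ‖P.localize 0 u.1 z‖ₑ ^ 2 ≤
      ∫⁻ z in {z : Rd (n + 1) | R ≤ ‖z‖}, ENNReal.ofReal (Real.exp (-R₀)) *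
        ‖P.localize (1 / 2) u.1 z‖ₑ ^ 2 := by
    refine setLIntegral_mono' (isClosed_le continuous_const continuous_norm).measurableSet fun z hz => ?_
    by_cases hzS : z ∈ P.S₀
    · rw [P.enorm_localize_sq_eq 0 (1 / 2)]
      gcongr
      rw [conicWeight]
      refine Real.exp_le_exp.2 ?_
      have := hR z hzS hz
      linarith
    · have h0 : P.localize 0 u.1 z = 0 := image_eq_zero_of_notMem_tsupport fun h =>
        hzS (P.tsupport_mult 0 (P.tsupport_lift_subset _ _ h))
      simp [h0]
  refine h1.trans ?_
  rw [lintegral_const_mul' _ _ ENNReal.ofReal_ne_top]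
  refine mul_le_mul_right ((setLIntegral_le_lintegral _ _).trans ((hC₀ u.1 u.2).1.trans ?_)) _
  rw [ENNReal.coe_mul, mul_assoc]
  exact mul_le_mul_right (hC₁ u) _

/-- The localization is a compact operator. -/
theorem exists_isCompactOperator_localizeOp (P : Piece M) (hn : 1 ≤ n) :
    ∃ T : M.H1 →L[ℂ] Lp ℂ 2 (volume : Measure (Rd (n + 1))), IsCompactOperator T ∧
      ∀ u : M.TestFun, T u =ᵐ[volume] P.localize 0 u.1 := by
  obtain ⟨T, T', hT, -, -, -⟩ := P.exists_localizeOp hn (β := 0) one_pos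
  refine ⟨T, ?_, hT⟩
  obtain ⟨K, hK⟩ := exists_isCompactOperator_approx (n + 1)
  obtain ⟨C, hC⟩ := P.exists_lintegral_tail_le hn
  obtain ⟨C₀, hC₀⟩ := P.exists_lintegral_localize_le hn (β := 0) one_pos
  obtain ⟨C₁, hC₁⟩ := P.exists_lintegral_modelEnergy_le
  choose R hR using fun k : ℕ => hC k
  choose A hA hA' using fun k : ℕ => hK (1 / ((k : ℝ) + 1)) (by positivity) (R k)
  -- A bound for the squared norm of `T - A k ∘ T`: the mesh `1 / (k + 1)` gives the first term, and
  -- the tail beyond the radius `R k`, chosen for the factor `e^{-k}`, gives the second.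
  let b : ℕ → ℝ≥0 := fun k => K * (1 / ((k : ℝ) + 1)).toNNReal ^ 2 * ((n + 1) * (C₀ * C₁)) +
    (Real.exp (-k)).toNNReal * C
  have hb : Filter.Tendsto b Filter.atTop (𝓝 0) := by
    have h1 : Filter.Tendsto (fun k : ℕ => (1 / ((k : ℝ) + 1)).toNNReal) Filter.atTop (𝓝 0) := by
      have := (continuous_real_toNNReal.tendsto 0).comp (tendsto_one_div_add_atTop_nhds_zero_nat (𝕜 := ℝ))
      simpa [Function.comp_def] using this
    have h2 : Filter.Tendsto (fun k : ℕ => (Real.exp (-k)).toNNReal) Filter.atTop (𝓝 0) := by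
      have := (continuous_real_toNNReal.tendsto 0).comp
        (Real.tendsto_exp_neg_atTop_nhds_zero.comp tendsto_natCast_atTop_atTop)
      simpa [Function.comp_def] using this
    have h3 := ((((h1.pow 2).const_mul K).mul_const ((n + 1) * (C₀ * C₁))).add (h2.mul_const C))
    simpa [b] using h3
  have hnorm : ∀ k, ‖T - (A k).comp T‖ ≤ NNReal.sqrt (b k) := by
    intro k
    refine ConicManifold.norm_le_of_testFun _ _ fun u => ?_
    have hm : MemLp (P.localize 0 u.1) 2 (volume : Measure (Rd (n + 1))) :=
      (P.contDiff_localize 0 u.2).continuous.memLp_of_hasCompactSupport (P.hasCompactSupport_localize 0 u.2)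
    have hTu : T u = hm.toLp _ := Lp.ext ((hT u).trans hm.coeFn_toLp.symm)
    rw [sub_apply, ContinuousLinearMap.comp_apply, hTu]
    refine (hA' k _ (P.contDiff_localize 0 u.2) hm).trans ?_
    have h1 : ∑ i, ∫⁻ z, ‖partialDeriv i (P.localize 0 u.1) z‖ₑ ^ 2 ≤
        (n + 1) * (C₀ * C₁ * ‖u‖ₑ ^ 2) := by
      refine (Finset.sum_le_sum fun i _ => ((hC₀ u.1 u.2).2 i).trans
        (mul_le_mul_right (hC₁ u) _)).trans ?_
      simp [mul_assoc]
    refine (add_le_add (mul_le_mul_right h1 _) (hR k u)).trans (le_of_eq ?_)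
    simp only [b, ENNReal.coe_add, ENNReal.coe_mul, ENNReal.coe_pow, ENNReal.ofReal, ENNReal.coe_natCast,
      ENNReal.coe_one]
    ring
  refine isCompactOperator_of_tendsto (l := Filter.atTop) (F := fun k : ℕ => (A k).comp T) ?_
    (.of_forall fun k => (hA k).comp_clm T)
  rw [tendsto_iff_norm_sub_tendsto_zero]
  have h4 : Filter.Tendsto (fun k => (NNReal.sqrt (b k) : ℝ)) Filter.atTop (𝓝 0) := by
    have := (NNReal.continuous_coe.comp NNReal.continuous_sqrt).tendsto 0 |>.comp hb
    simpa [Function.comp_def] using this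
  exact squeeze_zero (fun k => norm_nonneg _) (fun k => by rw [norm_sub_rev]; exact hnorm k) h4

/-- For the exponent `0` the squared multiplier is the volume weight times `σ²`, and `|σ| ≥ δ` on
the core; so the `L²` norm of the localization controls that of `u` there. -/
theorem exists_lintegral_image_core_le (P : Piece M) {δ : ℝ} (hδ : 0 < δ) : ∃ C : ℝ≥0, ∀ u : M.TestFun,
    ∫⁻ q in P.Φ.toFun '' P.core δ, ‖u.1 q‖ₑ ^ 2 ∂M.vol ≤ C * ∫⁻ z, ‖P.localize 0 u.1 z‖ₑ ^ 2 := by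
  obtain ⟨C, hC, h⟩ := P.tame
  refine ⟨(C * (δ⁻¹) ^ 2).toNNReal, fun u => ?_⟩
  have hm : Measurable fun q => ‖u.1 q‖ₑ ^ 2 := by
    have := u.2.1.continuous.measurable; fun_prop
  rw [InteriorParam.lintegral_image M hm (P.isClosed_core δ).measurableSet
    ((P.core_subset δ).trans P.S₀_subset), ← lintegral_const_mul' _ _ ENNReal.coe_ne_top]
  refine (setLIntegral_mono' (P.isClosed_core δ).measurableSet fun z hz => ?_).trans
    (setLIntegral_le_lintegral _ _)
  have h1 := (h z (P.S₀_subset_S (P.core_subset δ hz))).1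
  have hcast : ((C * (δ⁻¹) ^ 2).toNNReal : ℝ≥0∞) = ENNReal.ofReal (C * (δ⁻¹) ^ 2) := rfl
  rw [enorm_sq_eq_ofReal, enorm_sq_eq_ofReal, hcast, ← ENNReal.ofReal_mul (Real.sqrt_nonneg _),
    ← ENNReal.ofReal_mul (by positivity)]
  refine ENNReal.ofReal_le_ofReal ?_
  have h2 : ‖P.localize 0 u.1 z‖ ^ 2 = conicWeight P.τ (n + 1) z * |P.σ z| ^ 2 * ‖u.1 (P.Φ.toFun z)‖ ^ 2 := by
    rw [localize, lift, norm_smul, mul_pow, mult, norm_mul, mul_pow, Real.norm_eq_abs, sq_abs,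
      conicWeight_sq, Real.norm_eq_abs]
    congr 3
    ring
  have h3 : 1 ≤ δ⁻¹ ^ 2 * |P.σ z| ^ 2 := by
    rw [← mul_pow]
    refine one_le_pow₀ ?_
    rw [inv_mul_eq_div, one_le_div hδ]
    exact hz.2
  rw [h2]
  have hw := conicWeight_pos P.τ (n + 1) z
  have hC0 : 0 < C := by linarith
  calc √(P.Φ.gram M z).det * ‖u.1 (P.Φ.toFun z)‖ ^ 2
      ≤ (C * conicWeight P.τ (n + 1) z) * ‖u.1 (P.Φ.toFun z)‖ ^ 2 := by gcongr
    _ = (C * conicWeight P.τ (n + 1) z) * ‖u.1 (P.Φ.toFun z)‖ ^ 2 * 1 := by ring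
    _ ≤ (C * conicWeight P.τ (n + 1) z) * ‖u.1 (P.Φ.toFun z)‖ ^ 2 * (δ⁻¹ ^ 2 * |P.σ z| ^ 2) := by gcongr
    _ = _ := by ring

/-- The canonical map `H¹(𝔹) → L²(𝔹)` is compact. -/
theorem isCompactOperator_toL2 {ι : Type*} [Fintype ι] (hn : 1 ≤ n) {P : ι → Piece M}
    (hs : ∀ q ∈ (𝓡∂ (n + 1)).interior B, ∑ a, (P a).s q = 1) : IsCompactOperator M.toL2 := by
  set δ : ℝ := 1 / (Fintype.card ι + 1) with hδ
  have hδp : 0 < δ := by positivity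
  choose T hTc hT using fun a => (P a).exists_isCompactOperator_localizeOp hn
  choose C hC using fun a => (P a).exists_lintegral_image_core_le hδp
  refine isCompactOperator_of_enorm_sq_le hTc (C := ∑ a, C a) fun U => ?_
  refine UniformSpace.Completion.induction_on U (isClosed_le ?_ ?_) fun u => ?_
  · exact (ENNReal.continuous_pow 2).comp (continuous_enorm.comp M.toL2.continuous)
  · exact (ENNReal.continuous_const_mul ENNReal.coe_ne_top).comp (continuous_finsetSum _ fun a _ =>
      (ENNReal.continuous_pow 2).comp (continuous_enorm.comp (T a).continuous))
  · rw [M.toL2_coe, enorm_toLp_sq]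
    -- The cores cover the interior, and the boundary is a null set.
    have hcov : (univ : Set B) ≤ᵐ[M.vol] ⋃ a, (P a).Φ.toFun '' (P a).core δ := by
      filter_upwards [measure_eq_zero_iff_ae_notMem.1 M.vol_boundary] with q hq _
      have hi : q ∈ (𝓡∂ (n + 1)).interior B := by
        rw [← ModelWithCorners.compl_boundary]
        exact hq
      obtain ⟨a, z, hz, rfl⟩ := exists_mem_image_core hi (hs q hi)
      exact mem_iUnion.2 ⟨a, z, hz, rfl⟩
    rw [← setLIntegral_univ]
    refine (lintegral_mono' (Measure.restrict_mono_ae hcov) le_rfl).trans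
      ((lintegral_iUnion_le _ _).trans ?_)
    rw [tsum_fintype, Finset.mul_sum]
    refine Finset.sum_le_sum fun a _ => (hC a u).trans ?_
    rw [enorm_Lp_sq, lintegral_congr_ae ((hT a u).mono fun z hz => congrArg (fun w : ℂ => ‖w‖ₑ ^ 2) hz)]
    gcongr
    exact Finset.single_le_sum (f := C) (fun i _ => zero_le) (Finset.mem_univ a)

end Piece
end Compact

/-! ### From weighted Sobolev functions to elements of `H¹(𝔹)` -/

section Push
variable {n : ℕ} {B N : Type*}
    [TopologicalSpace B] [ChartedSpace (EuclideanHalfSpace (n + 1)) B]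
    [IsManifold (𝓡∂ (n + 1)) ∞ B]
    [TopologicalSpace N] [ChartedSpace (EuclideanSpace ℝ (Fin n)) N]
    [IsManifold (𝓡 n) ∞ N]
    {M : ConicManifold n B N}

namespace InteriorParam

open scoped Classical in
/-- A function in the parametrization as a function on `B`, extended by zero. -/
noncomputable def push (Φ : InteriorParam n B) (F : Rd (n + 1) → ℂ) (q : B) : ℂ :=
  if q ∈ Φ.toFun '' Φ.dom then F (Φ.inv q) else 0

variable {Φ : InteriorParam n B} {F : Rd (n + 1) → ℂ}

set_option linter.unusedSectionVars false in
theorem push_apply {z : Rd (n + 1)} (hz : z ∈ Φ.dom) : Φ.push F (Φ.toFun z) = F z := by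
  rw [push, if_pos (mem_image_of_mem _ hz), Φ.left_inv z hz]

set_option linter.unusedSectionVars false in
theorem push_of_notMem {q : B} (hq : q ∉ Φ.toFun '' Φ.dom) : Φ.push F q = 0 := if_neg hq

set_option linter.unusedSectionVars false in
theorem tsupport_push_subset [T2Space B] (hc : HasCompactSupport F) (hs : tsupport F ⊆ Φ.dom) :
    tsupport (Φ.push F) ⊆ Φ.toFun '' tsupport F := by
  have hK : IsClosed (Φ.toFun '' tsupport F) :=
    (hc.isCompact.image_of_continuousOn (Φ.contMDiffOn.continuousOn.mono hs)).isClosed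
  refine closure_minimal (fun q hq => ?_) hK
  by_cases h : q ∈ Φ.toFun '' Φ.dom
  · obtain ⟨z, hz, rfl⟩ := h
    rw [Function.mem_support, push_apply hz] at hq
    exact mem_image_of_mem _ (subset_tsupport _ hq)
  · exact absurd (push_of_notMem h) hq

set_option linter.unusedSectionVars false in
-- The image of the compact support is closed and lies in the open image of the domain, so the
-- extension by zero is smooth everywhere.
theorem push_mem_testSubmodule [CompactSpace B] [T2Space B] (hF : ContDiff ℝ ∞ F)
    (hc : HasCompactSupport F) (hs : tsupport F ⊆ Φ.dom) :
    Φ.push F ∈ ConicManifold.testSubmodule n B := by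
  have hsub := tsupport_push_subset hc hs
  refine ⟨fun q => ?_, HasCompactSupport.of_compactSpace _, (hsub.trans (image_mono hs)).trans Φ.image_subset⟩
  by_cases h : q ∈ Φ.toFun '' Φ.dom
  · have h1 : ContMDiffAt (𝓡∂ (n + 1)) 𝓘(ℝ, ℂ) ∞ (F ∘ Φ.inv) q :=
      hF.contMDiff.contMDiffAt.comp q (Φ.contMDiffOn_inv.contMDiffAt (Φ.isOpen_image.mem_nhds h))
    refine h1.congr_of_eventuallyEq ?_
    filter_upwards [Φ.isOpen_image.mem_nhds h] with r hr
    rw [push, if_pos hr]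
    rfl
  · have h1 : q ∉ tsupport (Φ.push F) := fun h' => h (image_mono hs (hsub h'))
    exact contMDiffAt_const.congr_of_eventuallyEq (notMem_tsupport_iff_eventuallyEq.1 h1)

set_option linter.unusedSectionVars false in
theorem partialDeriv_push {z : Rd (n + 1)} (hz : z ∈ Φ.dom) (i : Fin (n + 1)) :
    partialDeriv i (Φ.push F ∘ Φ.toFun) z = partialDeriv i F z := by
  have h : Φ.push F ∘ Φ.toFun =ᶠ[𝓝 z] F := by
    filter_upwards [Φ.isOpen_dom.mem_nhds hz] with w hw using push_apply hw
  rw [partialDeriv, partialDeriv, h.fderiv_eq]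

theorem modelEnergy_push (τ : ℝ) {z : Rd (n + 1)} (hz : z ∈ Φ.dom) :
    modelEnergy τ (Φ.push F ∘ Φ.toFun) z = modelEnergy τ F z := by
  simp only [modelEnergy, partialDeriv_push hz, Function.comp_apply, push_apply hz]

end InteriorParam

variable [CompactSpace B] [T2Space B] [MeasurableSpace B] [BorelSpace B]

namespace ConicManifold

theorem exists_tendsto_of_cauchy {v : ℕ → M.TestFun} {b : ℕ → ℝ≥0∞}
    (hb : Filter.Tendsto b Filter.atTop (𝓝 0)) (h : ∀ k l, ‖v k - v l‖ₑ ^ 2 ≤ b k + b l) :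
    ∃ V : M.H1, Filter.Tendsto (fun k => (v k : M.H1)) Filter.atTop (𝓝 V) := by
  refine cauchySeq_tendsto_of_complete (EMetric.cauchySeq_iff.2 fun ε hε => ?_)
  have hε2 : 0 < ε ^ 2 / 2 := ENNReal.half_pos (pow_ne_zero 2 hε.ne')
  obtain ⟨K, hK⟩ := Filter.eventually_atTop.1 (hb.eventually (gt_mem_nhds hε2))
  refine ⟨K, fun k hk l hl => ?_⟩
  rw [edist_eq_enorm_sub, ← UniformSpace.Completion.coe_sub, UniformSpace.Completion.enorm_coe,
    ← ENNReal.pow_lt_pow_left_iff two_ne_zero]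
  calc _ ≤ b k + b l := h k l
    _ < ε ^ 2 / 2 + ε ^ 2 / 2 := ENNReal.add_lt_add (hK k hk) (hK l hl)
    _ = ε ^ 2 := ENNReal.add_halves _

/-- Pointwise convergence is asked for along a further subsequence of any subsequence, because the
proof first passes to one along which the images in `L²` converge almost everywhere. -/
theorem toL2_ae_eq_of_tendsto {v : ℕ → M.TestFun} {V : M.H1}
    (hV : Filter.Tendsto (fun k => (v k : M.H1)) Filter.atTop (𝓝 V)) {w : B → ℂ}
    (hw : ∀ ns : ℕ → ℕ, StrictMono ns → ∃ ms : ℕ → ℕ, StrictMono ms ∧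
      ∀ᵐ q ∂M.vol, Filter.Tendsto (fun k => (v (ns (ms k))).1 q) Filter.atTop (𝓝 (w q))) :
    M.toL2 V =ᵐ[M.vol] w := by
  obtain ⟨ns, hns, h1⟩ := exists_seq_tendsto_ae_of_tendsto_Lp ((M.toL2.continuous.tendsto V).comp hV)
  obtain ⟨ms, hms, h2⟩ := hw ns hns
  have h4 : ∀ᵐ q ∂M.vol, ∀ k, M.toL2 (v k : M.H1) q = (v k).1 q :=
    ae_all_iff.2 fun k => by rw [M.toL2_coe]; exact (M.memLp_testFun (v k)).coeFn_toLp
  filter_upwards [h1, h2, h4] with q hq hq2 hq4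
  refine tendsto_nhds_unique (hq.comp hms.tendsto_atTop) ?_
  simpa only [Function.comp_def, hq4] using hq2

end ConicManifold

namespace Piece

theorem exists_enorm_push_le (P : Piece M) : ∃ C : ℝ≥0, ∀ v : M.TestFun, ∀ F : Rd (n + 1) → ℂ,
    HasCompactSupport F → tsupport F ⊆ P.S → v.1 = P.Φ.push F →
      ‖v‖ₑ ^ 2 ≤ C * ∫⁻ z in P.S, modelEnergy P.τ F z := by
  obtain ⟨C, hC⟩ := InteriorParam.exists_modelEnergy_bounds P.tame P.S_subset
  refine ⟨C, fun v F hc hs hv => ?_⟩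
  have hm := P.Φ.measurableSet_image P.isClosed_S.measurableSet P.S_subset
  have h1 : ‖v‖ₑ ^ 2 = ∫⁻ q in P.Φ.toFun '' P.S, M.eDensity v.1 q ∂M.vol := by
    rw [M.enorm_sq_eq_lintegral, ← lintegral_indicator hm]
    refine lintegral_congr fun q => ?_
    by_cases hq : q ∈ P.Φ.toFun '' P.S
    · rw [indicator_of_mem hq]
    · rw [indicator_of_notMem hq, M.eDensity_of_notMem_tsupport fun h => hq ?_]
      rw [hv] at h
      exact image_mono hs (InteriorParam.tsupport_push_subset hc (hs.trans P.S_subset) h)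
  rw [h1]
  refine ((hC v.1 v.2 P.S subset_rfl P.isClosed_S.measurableSet).1).trans (le_of_eq ?_)
  rw [hv]
  congr 1
  exact setLIntegral_congr_fun P.isClosed_S.measurableSet fun z hz =>
    InteriorParam.modelEnergy_push _ (P.S_subset hz)

set_option linter.unusedSectionVars false in
-- The factor `e^{τ(n-1)t/2}` undoes the weight of the localization for `γ = 1`. Its square cancels
-- the gradient weight `n - 1` exactly and leaves a factor of at most `1` of the weight `n + 1`;
-- differentiating it only adds a multiple of `F`.
theorem modelEnergy_conicWeight_smul_le (P : Piece M) {z : Rd (n + 1)} (hz : z ∈ P.S)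
    {F : Rd (n + 1) → ℂ} (hF : ContDiff ℝ ∞ F) :
    modelEnergy P.τ (fun z => conicWeight P.τ (-((n - 1) / 2)) z • F z) z ≤
      ((1 + 2 * (P.τ * (-((n - 1) / 2))) ^ 2 * (n + 1) + 2).toNNReal : ℝ≥0) *
        (‖F z‖ₑ ^ 2 + ∑ i, ‖partialDeriv i F z‖ₑ ^ 2) := by
  set a : ℝ := -((n - 1) / 2) with ha
  have hcast : ((1 + 2 * (P.τ * a) ^ 2 * (n + 1) + 2).toNNReal : ℝ≥0∞) =
    ENNReal.ofReal (1 + 2 * (P.τ * a) ^ 2 * (n + 1) + 2) := rfl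
  rw [modelEnergy_eq, hcast]
  simp only [enorm_sq_eq_ofReal]
  rw [← ENNReal.ofReal_sum_of_nonneg fun i _ => sq_nonneg _,
    ← ENNReal.ofReal_add (sq_nonneg _) (Finset.sum_nonneg fun i _ => sq_nonneg _),
    ← ENNReal.ofReal_mul (by positivity)]
  refine ENNReal.ofReal_le_ofReal ?_
  set X := ∑ i, ‖partialDeriv i F z‖ ^ 2
  have hX : 0 ≤ X := Finset.sum_nonneg fun i _ => sq_nonneg _
  have hwp := conicWeight_pos P.τ a z
  have e1 : conicWeight P.τ (n + 1) z * ‖conicWeight P.τ a z • F z‖ ^ 2 ≤ ‖F z‖ ^ 2 := by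
    rw [norm_smul, mul_pow, Real.norm_eq_abs, sq_abs, conicWeight_sq, ← mul_assoc, conicWeight_mul]
    have h0 : conicWeight P.τ (n + 1 + 2 * a) z ≤ conicWeight P.τ 0 z :=
      conicWeight_anti (P.S_nonneg z hz) (by rw [ha]; linarith)
    have h1 : conicWeight P.τ 0 z = 1 := by simp [conicWeight]
    rw [h1] at h0
    nlinarith [sq_nonneg ‖F z‖]
  have e2 : ∀ i, conicWeight P.τ (n - 1) z * ‖partialDeriv i (fun z => conicWeight P.τ a z • F z) z‖ ^ 2 ≤
      2 * (P.τ * a) ^ 2 * ‖F z‖ ^ 2 + 2 * ‖partialDeriv i F z‖ ^ 2 := by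
    intro i
    rw [partialDeriv_smul i ((contDiff_conicWeight P.τ a).differentiable (by simp)).differentiableAt
      (hF.differentiable (by simp)).differentiableAt, partialDeriv_conicWeight]
    set c : ℝ := if i = 0 then -(P.τ * a) else 0 with hc
    have hc2 : c ^ 2 ≤ (P.τ * a) ^ 2 := by
      rw [hc]; split_ifs
      · rw [neg_sq]
      · rw [zero_pow two_ne_zero]; positivity
    have h2 : (c * conicWeight P.τ a z) • F z + conicWeight P.τ a z • partialDeriv i F z =
        conicWeight P.τ a z • (c • F z + partialDeriv i F z) := by
      rw [smul_add, smul_smul, mul_comm c]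
    rw [h2, norm_smul, mul_pow, Real.norm_eq_abs, sq_abs, conicWeight_sq, ← mul_assoc, conicWeight_mul]
    have h1 : conicWeight P.τ (n - 1 + 2 * a) z = 1 := by
      rw [show ((n : ℝ) - 1 + 2 * a) = 0 by rw [ha]; ring]; simp [conicWeight]
    rw [h1, one_mul]
    have h3 : ‖c • F z + partialDeriv i F z‖ ≤ |c| * ‖F z‖ + ‖partialDeriv i F z‖ :=
      (norm_add_le _ _).trans (by rw [norm_smul, Real.norm_eq_abs])
    have h4 : ‖c • F z + partialDeriv i F z‖ ^ 2 ≤ (|c| * ‖F z‖ + ‖partialDeriv i F z‖) ^ 2 := by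
      gcongr
    have h5 : (|c| * ‖F z‖ + ‖partialDeriv i F z‖) ^ 2 ≤
        2 * (|c| ^ 2 * ‖F z‖ ^ 2) + 2 * ‖partialDeriv i F z‖ ^ 2 := by
      nlinarith [sq_nonneg (|c| * ‖F z‖ - ‖partialDeriv i F z‖)]
    rw [sq_abs] at h5
    nlinarith [mul_le_mul_of_nonneg_right hc2 (sq_nonneg ‖F z‖)]
  have hsum := Finset.sum_le_sum fun i (_ : i ∈ Finset.univ) => e2 i
  rw [← Finset.mul_sum, Finset.sum_add_distrib, ← Finset.mul_sum, ← Finset.mul_sum] at hsum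
  simp only [Finset.sum_const, Finset.card_univ, Fintype.card_fin, nsmul_eq_mul, Nat.cast_add,
    Nat.cast_one] at hsum
  have hy : 0 ≤ 2 * ‖F z‖ ^ 2 + (1 + 2 * (P.τ * a) ^ 2 * (n + 1)) * X := by positivity
  nlinarith

/-- A function with finite weighted Sobolev norm in a localization is in `H¹(𝔹)`. -/
theorem exists_toL2_eq_smul (P : Piece M) : ∃ C : ℝ≥0, ∀ u : B → ℂ, sobolevNorm (P.localize 1 u) < ⊤ →
    ∃ V : M.H1, M.toL2 V =ᵐ[M.vol] (fun q => P.s q • u q) ∧ ‖V‖ₑ ≤ C * sobolevNorm (P.localize 1 u) := by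
  obtain ⟨C, hC⟩ := P.exists_enorm_push_le
  set a : ℝ := -((n - 1) / 2) with ha
  set C₁ : ℝ≥0 := (1 + 2 * (P.τ * a) ^ 2 * (n + 1) + 2).toNNReal with hC₁
  set C₂ : ℝ≥0 := 2 * (C * C₁) with hC₂
  refine ⟨1 + C₂, fun u hu => ?_⟩
  set f := P.localize 1 u with hf
  choose G hG using fun i => exists_isWeakPartial_of_sobolevNorm_lt_top hu i
  have hsq := sobolevNorm_sq hG
  have hlt : sobolevNorm f ^ 2 < ⊤ := ENNReal.pow_lt_top hu
  rw [hsq, ENNReal.add_lt_top, ENNReal.sum_lt_top] at hlt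
  have hS : ∀ z ∉ P.S₀, f z = 0 := fun z hz => image_eq_zero_of_notMem_tsupport fun h =>
    hz (P.tsupport_mult 1 (P.tsupport_lift_subset _ _ h))
  -- The approximants stay within distance `ε` of `S₀`, hence in `S`, where the metric is comparable
  -- to the model.
  obtain ⟨F, hFs, hFc, hFt, hF0, hF1⟩ := exists_tendsto_of_isWeakPartial hlt.1
    (fun i => hlt.2 i (Finset.mem_univ i)) (hG 0).1 hG hS P.ε_pos
  have hFS : ∀ k, tsupport (F k) ⊆ P.S := fun k => (hFt k).trans P.cthickening_subset
  set W : (Rd (n + 1) → ℂ) → Rd (n + 1) → ℂ := fun F z => conicWeight P.τ a z • F z with hW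
  have hWt : ∀ F, tsupport (W F) ⊆ tsupport F := fun F => closure_mono fun z hz hz' => hz (by
    simp only [hW, hz', smul_zero])
  have hWs : ∀ k, ContDiff ℝ ∞ (W (F k)) := fun k => (contDiff_conicWeight _ _).smul (hFs k)
  have hWc : ∀ k, HasCompactSupport (W (F k)) := fun k =>
    (hFc k).mono fun z hz hz' => hz (by simp only [hW, hz', smul_zero])
  have hWS : ∀ k, tsupport (W (F k)) ⊆ P.S := fun k => (hWt _).trans (hFS k)
  -- The approximants of the localization, freed of the weight and transported to `𝓑`, are test
  -- functions; their limit will be `s • u`.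
  let v : ℕ → M.TestFun := fun k => ⟨P.Φ.push (W (F k)),
    InteriorParam.push_mem_testSubmodule (hWs k) (hWc k) ((hWS k).trans P.S_subset)⟩
  let E : (Rd (n + 1) → ℂ) → ℝ≥0∞ := fun F => (∫⁻ z, ‖F z‖ₑ ^ 2) + ∑ i, ∫⁻ z, ‖partialDeriv i F z‖ₑ ^ 2
  have hE : ∀ F, ContDiff ℝ ∞ F → ∫⁻ z in P.S, modelEnergy P.τ (W F) z ≤ C₁ * E F := by
    intro F hF
    refine (setLIntegral_mono' P.isClosed_S.measurableSet fun z hz =>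
      P.modelEnergy_conicWeight_smul_le hz hF).trans ?_
    rw [lintegral_const_mul' _ _ ENNReal.coe_ne_top]
    refine mul_le_mul_right ((setLIntegral_le_lintegral _ _).trans (le_of_eq ?_)) _
    have hm : Measurable fun z => ‖F z‖ₑ ^ 2 := by
      have := hF.continuous.measurable; fun_prop
    have hm' : ∀ i ∈ Finset.univ, Measurable fun z => ‖partialDeriv i F z‖ₑ ^ 2 := by
      intro i _
      have := (continuous_partialDeriv i hF).measurable; fun_prop
    rw [lintegral_add_left hm, lintegral_finsetSum _ hm']
  let d : ℕ → ℝ≥0∞ := fun k => (∫⁻ z, ‖F k z - f z‖ₑ ^ 2) + ∑ i, ∫⁻ z, ‖partialDeriv i (F k) z - G i z‖ₑ ^ 2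
  have hd : Filter.Tendsto d Filter.atTop (𝓝 0) := by
    have := hF0.add (tendsto_finsetSum Finset.univ fun i _ => hF1 i)
    simpa using this
  have hfm : AEStronglyMeasurable f volume := (hG 0).1.aestronglyMeasurable
  have hGm : ∀ i, AEStronglyMeasurable (G i) volume := fun i => (hG i).2.1.aestronglyMeasurable
  have hsplit : ∀ (x y w : Rd (n + 1) → ℂ), AEStronglyMeasurable x volume → AEStronglyMeasurable w volume →
      ∫⁻ z, ‖x z - y z‖ₑ ^ 2 ≤ 2 * ((∫⁻ z, ‖x z - w z‖ₑ ^ 2) + ∫⁻ z, ‖y z - w z‖ₑ ^ 2) := by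
    intro x y w hx hw
    have hm : AEMeasurable (fun z => ‖x z - w z‖ₑ ^ 2) volume := ((hx.sub hw).enorm).pow_const 2
    rw [← lintegral_add_left' hm, ← lintegral_const_mul' _ _ (by norm_num)]
    refine lintegral_mono fun z => ?_
    have h := enorm_add_sq_le (x z - w z) (-(y z - w z))
    rw [enorm_neg] at h
    convert h using 3
    ring
  have hEsub : ∀ k l, E (F k - F l) ≤ 2 * (d k + d l) := by
    intro k l
    have h1 := hsplit (F k) (F l) f (hFs k).continuous.aestronglyMeasurable hfm
    have h2 := fun i => hsplit (partialDeriv i (F k)) (partialDeriv i (F l)) (G i)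
      (continuous_partialDeriv i (hFs k)).aestronglyMeasurable (hGm i)
    have h3 : ∀ i z, partialDeriv i (F k - F l) z = partialDeriv i (F k) z - partialDeriv i (F l) z := by
      intro i z
      rw [partialDeriv, fderiv_sub ((hFs k).differentiable (by simp)).differentiableAt
        ((hFs l).differentiable (by simp)).differentiableAt]
      rfl
    simp only [E, h3, Pi.sub_apply]
    refine (add_le_add h1 (Finset.sum_le_sum fun i _ => h2 i)).trans (le_of_eq ?_)
    rw [← Finset.mul_sum, Finset.sum_add_distrib]
    ring
  have hEk : ∀ k, E (F k) ≤ 2 * (d k + sobolevNorm f ^ 2) := by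
    intro k
    have h1 := hsplit (F k) 0 f (hFs k).continuous.aestronglyMeasurable hfm
    have h2 := fun i => hsplit (partialDeriv i (F k)) 0 (G i)
      (continuous_partialDeriv i (hFs k)).aestronglyMeasurable (hGm i)
    simp only [Pi.zero_apply, sub_zero, zero_sub, enorm_neg] at h1 h2
    rw [hsq]
    refine (add_le_add h1 (Finset.sum_le_sum fun i _ => h2 i)).trans (le_of_eq ?_)
    rw [← Finset.mul_sum, Finset.sum_add_distrib]
    ring
  have hvsub : ∀ k l, ‖v k - v l‖ₑ ^ 2 ≤ C₂ * d k + C₂ * d l := by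
    intro k l
    have h1 : (v k - v l : M.TestFun).1 = P.Φ.push (W (F k - F l)) := by
      funext q
      change P.Φ.push (W (F k)) q - P.Φ.push (W (F l)) q = _
      simp only [InteriorParam.push]
      split_ifs
      · simp only [hW, Pi.sub_apply, smul_sub]
      · simp
    have hcs : HasCompactSupport (F k - F l) := by
      simpa only [sub_eq_add_neg] using (hFc k).add (hFc l).neg
    have hts : tsupport (F k - F l) ⊆ P.S := (tsupport_sub _ _).trans (union_subset (hFS k) (hFS l))
    have h2 := hC (v k - v l) (W (F k - F l))
      (hcs.mono fun z hz hz' => hz (by simp only [hW, hz', smul_zero])) ((hWt _).trans hts) h1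
    refine h2.trans ((mul_le_mul_right ((hE _ ((hFs k).sub (hFs l))).trans
      (mul_le_mul_right (hEsub k l) _)) _).trans (le_of_eq ?_))
    rw [hC₂]; push_cast; ring
  have hb : Filter.Tendsto (fun k => (C₂ : ℝ≥0∞) * d k) Filter.atTop (𝓝 0) := by
    have := ENNReal.Tendsto.const_mul (a := (C₂ : ℝ≥0∞)) hd (Or.inr ENNReal.coe_ne_top)
    simpa using this
  obtain ⟨V, hV⟩ := ConicManifold.exists_tendsto_of_cauchy hb hvsub
  refine ⟨V, ConicManifold.toL2_ae_eq_of_tendsto hV fun ns hns => ?_, ?_⟩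
  · have hT : TendstoInMeasure volume (fun k => F (ns k)) Filter.atTop f := by
      refine tendstoInMeasure_of_tendsto_eLpNorm (p := 2) two_ne_zero
        (fun k => (hFs (ns k)).continuous.aestronglyMeasurable) hfm ?_
      have h1 := (ENNReal.continuous_rpow_const (y := 1 / 2)).tendsto 0 |>.comp
        (hF0.comp hns.tendsto_atTop)
      rw [ENNReal.zero_rpow_of_pos (by norm_num)] at h1
      refine h1.congr fun k => ?_
      have h2 : ∫⁻ z, ‖F (ns k) z - f z‖ₑ ^ 2 = eLpNorm (F (ns k) - f) 2 volume ^ 2 :=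
        (eLpNorm_two_sq (F (ns k) - f)).symm
      rw [Function.comp_apply, Function.comp_apply, h2, ← ENNReal.rpow_natCast, ← ENNReal.rpow_mul]
      norm_num
    obtain ⟨ms, hms, hae⟩ := hT.exists_seq_tendsto_ae
    refine ⟨ms, hms, ?_⟩
    have hnull := InteriorParam.vol_image_eq_zero (Φ := P.Φ) (M := M) hae
    filter_upwards [measure_eq_zero_iff_ae_notMem.1 hnull,
      measure_eq_zero_iff_ae_notMem.1 M.vol_boundary] with q hq hqb
    have hi : q ∈ (𝓡∂ (n + 1)).interior B := by
      rw [← ModelWithCorners.compl_boundary]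
      exact hqb
    by_cases hqd : q ∈ P.Φ.toFun '' P.Φ.dom
    · obtain ⟨z, hz, rfl⟩ := hqd
      have h1 : Filter.Tendsto (fun k => F (ns (ms k)) z) Filter.atTop (𝓝 (f z)) := by
        by_contra h
        exact hq ⟨z, ⟨hz, h⟩, rfl⟩
      -- The exponents `a` and `(n + 1) / 2 - 1` cancel, so only the cut-off is left in front of
      -- `u`.
      have h2 : P.s (P.Φ.toFun z) • u (P.Φ.toFun z) = conicWeight P.τ a z • f z := by
        rw [hf, localize, lift, mult, smul_smul, ← mul_assoc, conicWeight_mul,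
          show a + ((n + 1) / 2 - 1) = 0 by rw [ha]; ring, P.σ_eq z hz]
        simp [conicWeight]
      rw [h2]
      refine (h1.const_smul (conicWeight P.τ a z)).congr fun k => ?_
      exact (InteriorParam.push_apply (F := W (F (ns (ms k)))) hz).symm
    · have h1 : P.s q = 0 := P.s_eq_zero q hi fun h => hqd (image_mono P.S₀_subset h)
      rw [h1, zero_smul]
      refine tendsto_const_nhds.congr fun k => ?_
      exact (InteriorParam.push_of_notMem (F := W (F (ns (ms k)))) hqd).symm
  · rw [← ENNReal.pow_le_pow_left_iff two_ne_zero]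
    have h1 : Filter.Tendsto (fun k => ‖(v k : M.H1)‖ₑ ^ 2) Filter.atTop (𝓝 (‖V‖ₑ ^ 2)) :=
      ((ENNReal.continuous_pow 2).comp continuous_enorm).tendsto V |>.comp hV
    have h2 : Filter.Tendsto (fun k => (C₂ : ℝ≥0∞) * d k + C₂ * sobolevNorm f ^ 2) Filter.atTop
        (𝓝 (0 + C₂ * sobolevNorm f ^ 2)) := hb.add_const _
    have h3 := le_of_tendsto_of_tendsto' h1 h2 fun k => by
      rw [UniformSpace.Completion.enorm_coe]
      refine (hC (v k) _ (hWc k) (hWS k) rfl).trans ((mul_le_mul_right ((hE _ (hFs k)).trans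
        (mul_le_mul_right (hEk k) _)) _).trans (le_of_eq ?_))
      rw [hC₂]; push_cast; ring
    rw [zero_add] at h3
    refine h3.trans ?_
    rw [mul_pow]
    gcongr
    rw [← ENNReal.coe_pow]
    exact_mod_cast (by nlinarith [zero_le (a := C₂)] : C₂ ≤ (1 + C₂) ^ 2)

end Piece
end Push

/-! ### Coordinates of `ℝⁿ⁺¹ = ℝ × ℝⁿ` -/
section Coordinates
variable {n : ℕ}

/-- The projection `ℝⁿ⁺¹ → ℝⁿ` to the last coordinates. -/
noncomputable def tailCLM (n : ℕ) : Rd (n + 1) →L[ℝ] Rd n :=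
  LinearMap.toContinuousLinearMap
    { toFun := MellinData.tail
      map_add' := fun _ _ => rfl
      map_smul' := fun _ _ => rfl }

theorem tailCLM_apply (z : Rd (n + 1)) : tailCLM n z = MellinData.tail z := rfl

/-- The point `(t, η)` of `ℝⁿ⁺¹ = ℝ × ℝⁿ`. -/
noncomputable def consCLM (n : ℕ) : ℝ × Rd n →L[ℝ] Rd (n + 1) :=
  LinearMap.toContinuousLinearMap
    { toFun := fun p => WithLp.toLp 2 (Fin.cons p.1 p.2)
      map_add' := fun p q => by
        ext i
        refine Fin.cases ?_ (fun j => ?_) i <;> simp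
      map_smul' := fun c p => by
        ext i
        refine Fin.cases ?_ (fun j => ?_) i <;> simp }

@[simp] theorem consCLM_zero (p : ℝ × Rd n) : consCLM n p 0 = p.1 := rfl

@[simp] theorem tail_consCLM (p : ℝ × Rd n) : MellinData.tail (consCLM n p) = p.2 := rfl

theorem consCLM_tail (z : Rd (n + 1)) : consCLM n (z 0, MellinData.tail z) = z := by
  ext i
  refine Fin.cases ?_ (fun j => ?_) i <;> rfl

theorem abs_apply_zero_le (z : Rd (n + 1)) : |z 0| ≤ ‖z‖ := PiLp.norm_apply_le z 0

theorem norm_tail_le (z : Rd (n + 1)) : ‖MellinData.tail z‖ ≤ ‖z‖ := by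
  rw [EuclideanSpace.norm_eq, EuclideanSpace.norm_eq]
  refine Real.sqrt_le_sqrt ?_
  rw [Fin.sum_univ_succ]
  have : 0 ≤ ‖z 0‖ ^ 2 := sq_nonneg _
  exact le_add_of_nonneg_left this

theorem tail_single_zero : MellinData.tail (EuclideanSpace.single (0 : Fin (n + 1)) (1 : ℝ)) = 0 := by
  ext i
  simp [MellinData.tail, Fin.succ_ne_zero]

theorem continuous_apply_zero : Continuous fun z : Rd (n + 1) => z 0 :=
  (EuclideanSpace.proj (0 : Fin (n + 1)) : Rd (n + 1) →L[ℝ] ℝ).continuous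

theorem continuous_tail : Continuous (MellinData.tail (n := n)) := (tailCLM n).continuous

theorem isCompact_slab (a b : ℝ) {K : Set (Rd n)} (hK : IsCompact K) :
    IsCompact {z : Rd (n + 1) | a ≤ z 0 ∧ z 0 ≤ b ∧ MellinData.tail z ∈ K} := by
  have h := ((isCompact_Icc (a := a) (b := b)).prod hK).image (consCLM n).continuous
  refine h.of_isClosed_subset ?_ fun z hz => ⟨(z 0, MellinData.tail z), ⟨⟨hz.1, hz.2.1⟩, hz.2.2⟩, consCLM_tail z⟩
  exact (isClosed_le continuous_const continuous_apply_zero).inter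
    ((isClosed_le continuous_apply_zero continuous_const).inter (hK.isClosed.preimage continuous_tail))

/-- In a proper space the closed thickening of a closed set is the union of closed balls around its
points, and both coordinate projections are contractions. -/
theorem cthickening_slab_subset (a ε : ℝ) (hε : 0 ≤ ε) {K : Set (Rd n)} (hK : IsClosed K) :
    Metric.cthickening ε {z : Rd (n + 1) | a ≤ z 0 ∧ MellinData.tail z ∈ K} ⊆
      {z | a - ε ≤ z 0 ∧ MellinData.tail z ∈ Metric.cthickening ε K} := by
  have hc : IsClosed {z : Rd (n + 1) | a ≤ z 0 ∧ MellinData.tail z ∈ K} :=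
    (isClosed_le continuous_const continuous_apply_zero).inter (hK.preimage continuous_tail)
  rw [hc.cthickening_eq_biUnion_closedBall hε]
  intro z hz
  obtain ⟨w, hw, hzw⟩ := mem_iUnion₂.1 hz
  rw [Metric.mem_closedBall, dist_eq_norm] at hzw
  have h1 : |z 0 - w 0| ≤ ε := (abs_apply_zero_le (z - w)).trans hzw
  have h2 : ‖MellinData.tail z - MellinData.tail w‖ ≤ ε := (norm_tail_le (z - w)).trans hzw
  refine ⟨?_, ?_⟩
  · have := (abs_le.1 h1).1
    linarith [hw.1]
  · exact Metric.mem_cthickening_of_dist_le _ _ _ _ hw.2 (by rwa [dist_eq_norm])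

/-- Bounds for a cut-off function that does not depend on the first coordinate where it is large. -/
theorem exists_bound_of_invariant {τ : ℝ} (hτ : 0 ≤ τ) {σ : Rd (n + 1) → ℝ} (hσ : ContDiff ℝ ∞ σ) {T : ℝ}
    (hK : IsCompact {z ∈ tsupport σ | z 0 ≤ T + 1})
    (hT : ∀ z, T ≤ z 0 → ∀ s : ℝ, 0 ≤ s → σ (z + s • EuclideanSpace.single 0 1) = σ z) :
    ∃ K : ℝ, ∀ z, |σ z| ≤ K ∧ (∀ i, |partialDeriv i σ z| ≤ K) ∧
      |partialDeriv 0 σ z| ≤ K * conicWeight τ 1 z ∧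
      ∀ i, |partialDeriv 0 (partialDeriv i σ) z| ≤ K * conicWeight τ 1 z := by
  set e : Rd (n + 1) := EuclideanSpace.single 0 1 with he
  have he0 : ∀ (z : Rd (n + 1)) (s : ℝ), (z + s • e) 0 = z 0 + s := by
    intro z s; simp [he]
  have hopen : IsOpen {z : Rd (n + 1) | T < z 0} := isOpen_lt continuous_const continuous_apply_zero
  have hσ' : ∀ z, T < z 0 → ∀ s : ℝ, 0 ≤ s → σ (z + s • e) = σ z := fun z hz => hT z hz.le
  have hd : ∀ i z, T < z 0 → ∀ s : ℝ, 0 ≤ s → partialDeriv i σ (z + s • e) = partialDeriv i σ z := by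
    intro i z hz s hs
    have h1 : (fun w => σ (w + s • e)) =ᶠ[𝓝 z] σ := by
      filter_upwards [hopen.mem_nhds hz] with w hw using hσ' w hw s hs
    rw [partialDeriv, partialDeriv, ← h1.fderiv_eq, fderiv_comp_add_right]
  have key : ∀ f : Rd (n + 1) → ℝ, ContDiff ℝ ∞ f → tsupport f ⊆ tsupport σ →
      (∀ z, T < z 0 → ∀ s : ℝ, 0 ≤ s → f (z + s • e) = f z) →
      ∃ K : ℝ, ∀ z, |f z| ≤ K ∧ |partialDeriv 0 f z| ≤ K * conicWeight τ 1 z := by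
    intro f hf hfs hinv
    obtain ⟨K₀, hK₀⟩ := hK.exists_bound_of_continuousOn hf.continuous.continuousOn
    obtain ⟨K₁, hK₁⟩ := hK.exists_bound_of_continuousOn (continuous_partialDeriv 0 hf).continuousOn
    have h0 : ∀ z, z 0 ≤ T + 1 → |f z| ≤ |K₀| := by
      intro z hz
      by_cases hzs : z ∈ tsupport f
      · exact (hK₀ z ⟨hfs hzs, hz⟩).trans (le_abs_self _)
      · rw [image_eq_zero_of_notMem_tsupport hzs, abs_zero]; exact abs_nonneg _
    have h1 : ∀ z, z 0 ≤ T + 1 → |partialDeriv 0 f z| ≤ |K₁| := by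
      intro z hz
      by_cases hzs : z ∈ tsupport f
      · exact (hK₁ z ⟨hfs hzs, hz⟩).trans (le_abs_self _)
      · rw [partialDeriv_of_notMem_tsupport 0 hzs, abs_zero]; exact abs_nonneg _
    -- For `z 0 ≤ T + 1` the weight is at least `e^{-τ(T+1)}`, which the exponential factor offsets.
    -- Beyond, `f` does not depend on `t`: its value is the one at `z 0 = T + 1` and its
    -- `t`-derivative vanishes.
    refine ⟨|K₀| + |K₁| * Real.exp (τ * (T + 1)), fun z => ?_⟩
    have hpos : 0 ≤ |K₁| * Real.exp (τ * (T + 1)) := by positivity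
    by_cases hz : z 0 ≤ T + 1
    · refine ⟨(h0 z hz).trans (by linarith), (h1 z hz).trans ?_⟩
      have h3 : 1 ≤ Real.exp (τ * (T + 1)) * conicWeight τ 1 z := by
        rw [conicWeight, ← Real.exp_add]
        refine Real.one_le_exp ?_
        nlinarith
      have h4 : 0 ≤ |K₀| * conicWeight τ 1 z := mul_nonneg (abs_nonneg _) (conicWeight_pos _ _ _).le
      nlinarith [abs_nonneg K₁, mul_le_mul_of_nonneg_left h3 (abs_nonneg K₁)]
    · push Not at hz
      constructor
      · have h2 := hinv (z - (z 0 - (T + 1)) • e) (by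
          have := he0 z (-(z 0 - (T + 1)))
          rw [neg_smul, ← sub_eq_add_neg] at this
          rw [this]; linarith) (z 0 - (T + 1)) (by linarith)
        rw [sub_add_cancel] at h2
        rw [h2]
        refine (h0 _ ?_).trans (by linarith)
        have := he0 z (-(z 0 - (T + 1)))
        rw [neg_smul, ← sub_eq_add_neg] at this
        rw [this]; linarith
      · have h2 : partialDeriv 0 f z = 0 := by
          have h3 : HasDerivAt (fun s : ℝ => f (z + s • e)) (fderiv ℝ f z e) 0 := by
            have h4 : HasDerivAt (fun s : ℝ => z + s • e) e 0 := by
              simpa using ((hasDerivAt_id (0 : ℝ)).smul_const e).const_add z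
            have h5 : HasFDerivAt f (fderiv ℝ f z) (z + (0 : ℝ) • e) := by
              rw [zero_smul, add_zero]
              exact (hf.differentiable (by simp)).differentiableAt.hasFDerivAt
            exact h5.comp_hasDerivAt 0 h4
          have h6 : (fun s : ℝ => f (z + s • e)) =ᶠ[𝓝 0] fun _ => f z := by
            have h7 : ∀ᶠ s : ℝ in 𝓝 0, -1 < s := lt_mem_nhds (by norm_num)
            filter_upwards [h7] with s hs
            rcases le_total 0 s with h | h
            · exact hinv z (by linarith) s h
            · have h8 := hinv (z + s • e) (by rw [he0]; linarith) (-s) (by linarith)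
              rw [add_assoc, ← add_smul, add_neg_cancel, zero_smul, add_zero] at h8
              exact h8.symm
          exact h3.unique ((hasDerivAt_const (0 : ℝ) (f z)).congr_of_eventuallyEq h6)
        rw [h2, abs_zero]
        exact mul_nonneg (by positivity) (conicWeight_pos _ _ _).le
  obtain ⟨K₀, hK₀⟩ := key σ hσ subset_rfl hσ'
  choose K₁ hK₁ using fun i => key (partialDeriv i σ) (contDiff_partialDeriv i hσ)
    (tsupport_partialDeriv_subset i σ) (hd i)
  have hle : ∀ i, K₁ i ≤ |K₀| + ∑ i, |K₁ i| := fun i => by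
    have h1 := Finset.single_le_sum (f := fun i => |K₁ i|) (fun i _ => abs_nonneg _) (Finset.mem_univ i)
    have h2 := le_abs_self (K₁ i)
    have h3 := abs_nonneg K₀
    linarith
  have hle0 : K₀ ≤ |K₀| + ∑ i, |K₁ i| := by
    have h1 := Finset.sum_nonneg fun i (_ : i ∈ Finset.univ) => abs_nonneg (K₁ i)
    linarith [le_abs_self K₀]
  refine ⟨|K₀| + ∑ i, |K₁ i|, fun z => ⟨(hK₀ z).1.trans hle0, fun i => (hK₁ i z).1.trans (hle i),
    (hK₀ z).2.trans ?_, fun i => (hK₁ i z).2.trans ?_⟩⟩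
  · exact mul_le_mul_of_nonneg_right hle0 (conicWeight_pos _ _ _).le
  · exact mul_le_mul_of_nonneg_right (hle i) (conicWeight_pos _ _ _).le

end Coordinates

/-! ### Pieces from charts -/
section ChartPiece
variable {n : ℕ} {B N : Type*}
    [TopologicalSpace B] [ChartedSpace (EuclideanHalfSpace (n + 1)) B]
    [IsManifold (𝓡∂ (n + 1)) ∞ B]
    [TopologicalSpace N] [ChartedSpace (EuclideanSpace ℝ (Fin n)) N]
    [IsManifold (𝓡 n) ∞ N]

set_option linter.unusedSectionVars false in
-- A chart of the maximal atlas is a local diffeomorphism, and these preserve interior points.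
theorem mem_interior_iff_of_mem_maximalAtlas {χ : OpenPartialHomeomorph B (EuclideanHalfSpace (n + 1))}
    (hχ : χ ∈ IsManifold.maximalAtlas (𝓡∂ (n + 1)) ∞ B) {q : B} (hq : q ∈ χ.source) :
    q ∈ (𝓡∂ (n + 1)).interior B ↔ (𝓡∂ (n + 1)) (χ q) ∈ interior (range (𝓡∂ (n + 1))) := by
  have h : IsLocalDiffeomorphAt (𝓡∂ (n + 1)) (𝓡∂ (n + 1)) ∞ χ q :=
    ⟨{ toPartialEquiv := χ.toPartialEquiv
       open_source := χ.open_source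
       open_target := χ.open_target
       contMDiffOn_toFun := contMDiffOn_of_mem_maximalAtlas hχ
       contMDiffOn_invFun := contMDiffOn_symm_of_mem_maximalAtlas hχ }, hq, fun _ _ => rfl⟩
  exact h.isInteriorPoint_iff (by simp)

/-- The inverse of a chart as a parametrization of a part of the interior. -/
noncomputable def chartParam (χ : OpenPartialHomeomorph B (EuclideanHalfSpace (n + 1)))
    (hχ : χ ∈ IsManifold.maximalAtlas (𝓡∂ (n + 1)) ∞ B) : InteriorParam n B where
  -- The target may contain points of the wall of the half-space; they belong to the boundary of `𝓑`
  -- and are removed.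
  dom := (χ.extend (𝓡∂ (n + 1))).target ∩ interior (range (𝓡∂ (n + 1)))
  toFun := (χ.extend (𝓡∂ (n + 1))).symm
  inv := χ.extend (𝓡∂ (n + 1))
  isOpen_dom := by
    have : (χ.extend (𝓡∂ (n + 1))).target ∩ interior (range (𝓡∂ (n + 1))) =
        (𝓡∂ (n + 1)).symm ⁻¹' χ.target ∩ interior (range (𝓡∂ (n + 1))) := by
      rw [OpenPartialHomeomorph.extend_target, inter_assoc, inter_eq_self_of_subset_right interior_subset]
    rw [this]
    exact (χ.open_target.preimage (𝓡∂ (n + 1)).continuous_symm).inter isOpen_interior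
  isOpen_image := by
    have : (χ.extend (𝓡∂ (n + 1))).symm '' ((χ.extend (𝓡∂ (n + 1))).target ∩
        interior (range (𝓡∂ (n + 1)))) = χ.source ∩ (𝓡∂ (n + 1)).interior B := by
      ext q
      constructor
      · rintro ⟨z, hz, rfl⟩
        have h1 := (χ.extend (𝓡∂ (n + 1))).map_target hz.1
        rw [OpenPartialHomeomorph.extend_source] at h1
        refine ⟨h1, (mem_interior_iff_of_mem_maximalAtlas hχ h1).2 ?_⟩
        have h2 := (χ.extend (𝓡∂ (n + 1))).right_inv hz.1
        rw [OpenPartialHomeomorph.extend_coe, Function.comp_apply] at h2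
        rw [h2]
        exact hz.2
      · rintro ⟨h1, h2⟩
        have h3 : q ∈ (χ.extend (𝓡∂ (n + 1))).source := by
          rwa [OpenPartialHomeomorph.extend_source]
        exact ⟨_, ⟨(χ.extend (𝓡∂ (n + 1))).map_source h3,
          (mem_interior_iff_of_mem_maximalAtlas hχ h1).1 h2⟩, (χ.extend (𝓡∂ (n + 1))).left_inv h3⟩
    rw [this]
    exact χ.open_source.inter (ModelWithCorners.isOpen_interior (n := ∞) (by simp))
  image_subset := by
    rintro _ ⟨z, hz, rfl⟩
    have h1 := (χ.extend (𝓡∂ (n + 1))).map_target hz.1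
    rw [OpenPartialHomeomorph.extend_source] at h1
    refine (mem_interior_iff_of_mem_maximalAtlas hχ h1).2 ?_
    have h2 := (χ.extend (𝓡∂ (n + 1))).right_inv hz.1
    rw [OpenPartialHomeomorph.extend_coe, Function.comp_apply] at h2
    rw [h2]
    exact hz.2
  left_inv z hz := (χ.extend (𝓡∂ (n + 1))).right_inv hz.1
  contMDiffOn := by
    refine (contMDiffOn_extend_symm hχ).mono ?_
    rintro z hz
    rw [OpenPartialHomeomorph.extend_target] at hz
    exact ⟨_, hz.1.1, (𝓡∂ (n + 1)).right_inv hz.1.2⟩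
  contMDiffOn_inv := by
    refine (χ.contMDiffOn_extend hχ).mono ?_
    rintro _ ⟨z, hz, rfl⟩
    have h1 := (χ.extend (𝓡∂ (n + 1))).map_target hz.1
    rwa [OpenPartialHomeomorph.extend_source] at h1

end ChartPiece

/-- The open sets `U` and the complement of `S` cover the space; the extension agrees with `f` on
the first and vanishes on the second. -/
theorem contDiff_indicator_of_eq_zero {d : ℕ} {f : Rd d → ℝ} {U S : Set (Rd d)} (hU : IsOpen U)
    (hS : IsClosed S) (hSU : S ⊆ U) (hf : ∀ z ∈ U, ContDiffAt ℝ ∞ f z)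
    (h0 : ∀ z ∈ U, z ∉ S → f z = 0) :
    ContDiff ℝ ∞ (U.indicator f) ∧ tsupport (U.indicator f) ⊆ S := by
  have hs : tsupport (U.indicator f) ⊆ S := by
    refine closure_minimal (fun z hz => ?_) hS
    by_contra hzS
    refine hz ?_
    by_cases hzU : z ∈ U
    · rw [indicator_of_mem hzU, h0 z hzU hzS]
    · rw [indicator_of_notMem hzU]
  refine ⟨contDiff_iff_contDiffAt.2 fun z => ?_, hs⟩
  by_cases hz : z ∈ U
  · refine (hf z hz).congr_of_eventuallyEq ?_
    filter_upwards [hU.mem_nhds hz] with w hw using indicator_of_mem hw f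
  · have h := notMem_tsupport_iff_eventuallyEq.1 fun h => hz (hSU (hs h))
    exact contDiffAt_const.congr_of_eventuallyEq h

section ChartPiece
variable {n : ℕ} {B N : Type*}
    [TopologicalSpace B] [ChartedSpace (EuclideanHalfSpace (n + 1)) B]
    [IsManifold (𝓡∂ (n + 1)) ∞ B]
    [TopologicalSpace N] [ChartedSpace (EuclideanSpace ℝ (Fin n)) N]
    [IsManifold (𝓡 n) ∞ N]

theorem InteriorParam.tameOn_zero_of_isCompact (Φ : InteriorParam n B) (M : ConicManifold n B N)
    {S : Set (Rd (n + 1))} (hS : IsCompact S) (hSd : S ⊆ Φ.dom) : Φ.TameOn M 0 S := by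
  obtain ⟨C, hC1, hC⟩ := exists_bounds_of_posDef hS (H := Φ.gram M)
    (fun z hz => (InteriorParam.continuousAt_gram M (hSd hz)).continuousWithinAt)
    (fun z hz => InteriorParam.gram_posDef M (hSd hz))
  refine ⟨C, hC1, fun z hz => ?_⟩
  have hw : ∀ a, conicWeight 0 a z = 1 := fun a => by simp [conicWeight]
  simp only [hw, one_mul, mul_one]
  exact hC z hz

variable [CompactSpace B] [T2Space B] {M : ConicManifold n B N}

set_option linter.unusedSectionVars false in
theorem MellinData.notMem_tsupport_one_sub_cutoff (D : MellinData M) {q : B}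
    (hq : q ∈ (𝓡∂ (n + 1)).boundary B) : q ∉ tsupport fun p => 1 - D.cutoff p := by
  rw [notMem_tsupport_iff_eventuallyEq]
  filter_upwards [Filter.Eventually.filter_mono (nhds_le_nhdsSet hq) D.cutoff_eq_one] with p hp
  simp [hp]

/-- As `ω = 1` near the boundary, `ψₗ (1 - ω)` lives on a compact part of the interior inside the
chart domain. There the metric is comparable to the Euclidean one, so `τ = 0`, and properness and
the tail condition follow from compactness. -/
theorem MellinData.exists_chartPiece (D : MellinData M) (l : Fin D.L) : ∃ P : Piece M,
    (∀ q, P.s q = D.ψ l q * (1 - D.cutoff q)) ∧ ∀ γ u, P.localize γ u = D.innerPiece u l := by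
  set Φ := chartParam (D.χ l) (D.χ_mem l) with hΦ
  set C₀ : Set B := tsupport (D.ψ l) ∩ tsupport fun p => 1 - D.cutoff p with hC₀
  have hC₀c : IsCompact C₀ :=
    ((isClosed_tsupport _).inter (isClosed_tsupport _)).isCompact
  have hC₀s : C₀ ⊆ (D.χ l).source := fun q hq => D.ψ_subordinate l hq.1
  have hC₀i : C₀ ⊆ (𝓡∂ (n + 1)).interior B := fun q hq => by
    by_contra h
    exact D.notMem_tsupport_one_sub_cutoff
      (by rwa [← ModelWithCorners.compl_interior]) hq.2
  set S₀ := (D.χ l).extend (𝓡∂ (n + 1)) '' C₀ with hS₀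
  have hS₀c : IsCompact S₀ := by
    refine hC₀c.image_of_continuousOn ?_
    exact ((D.χ l).continuousOn_extend (I := 𝓡∂ (n + 1))).mono
      (by rwa [OpenPartialHomeomorph.extend_source])
  have hS₀d : S₀ ⊆ Φ.dom := by
    rintro _ ⟨q, hq, rfl⟩
    have h3 : q ∈ ((D.χ l).extend (𝓡∂ (n + 1))).source := by
      rw [OpenPartialHomeomorph.extend_source]; exact hC₀s hq
    exact ⟨((D.χ l).extend (𝓡∂ (n + 1))).map_source h3,
      (mem_interior_iff_of_mem_maximalAtlas (D.χ_mem l) (hC₀s hq)).1 (hC₀i hq)⟩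
  have hmem : ∀ z ∈ Φ.dom, Φ.toFun z ∈ C₀ → z ∈ S₀ := fun z hz hzC =>
    ⟨_, hzC, Φ.left_inv z hz⟩
  have himg : ∀ q ∈ C₀, q ∈ Φ.toFun '' S₀ := fun q hq => by
    refine ⟨_, ⟨q, hq, rfl⟩, ((D.χ l).extend (𝓡∂ (n + 1))).left_inv ?_⟩
    rw [OpenPartialHomeomorph.extend_source]; exact hC₀s hq
  obtain ⟨ε, hε, hεd⟩ := hS₀c.exists_cthickening_subset_open Φ.isOpen_dom hS₀d
  set s : B → ℝ := fun q => D.ψ l q * (1 - D.cutoff q) with hs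
  have hs0 : ∀ q, q ∉ C₀ → s q = 0 := fun q hq => by
    by_contra h
    exact hq ⟨subset_tsupport _ (left_ne_zero_of_mul h), subset_tsupport _ (right_ne_zero_of_mul h)⟩
  have hsm : ContMDiff (𝓡∂ (n + 1)) 𝓘(ℝ, ℝ) ∞ s :=
    (D.ψ l).contMDiff.mul (contMDiff_const.sub D.contMDiff_cutoff)
  obtain ⟨hσ, hσs⟩ := contDiff_indicator_of_eq_zero (f := s ∘ Φ.toFun) Φ.isOpen_dom hS₀c.isClosed hS₀d
    (fun z hz => ((hsm (Φ.toFun z)).comp z (InteriorParam.contMDiffAt hz)).contDiffAt)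
    (fun z hz h => hs0 _ fun hC => h (hmem z hz hC))
  obtain ⟨R, hR⟩ := hS₀c.isBounded.exists_norm_le
  have hσ0 : ∀ z, R < z 0 → Φ.dom.indicator (s ∘ Φ.toFun) z = 0 := fun z hz => by
    by_contra h
    have h1 := hR z (hσs (subset_tsupport _ h))
    linarith [le_abs_self (z 0), abs_apply_zero_le z]
  have hSc : IsCompact (Metric.cthickening ε S₀) := hS₀c.cthickening
  refine ⟨{
    Φ := Φ
    τ := 0
    τ_nonneg := le_rfl
    S₀ := S₀
    S := Metric.cthickening ε S₀
    isClosed_S := Metric.isClosed_cthickening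
    isClosed_S₀ := hS₀c.isClosed
    S_subset := hεd
    ε := ε
    ε_pos := hε
    cthickening_subset := subset_rfl
    S_nonneg := fun z _ => by simp
    tame := Φ.tameOn_zero_of_isCompact M hSc hεd
    s := s
    σ := Φ.dom.indicator (s ∘ Φ.toFun)
    contDiff_σ := hσ
    tsupport_σ := hσs
    σ_eq := fun z hz => indicator_of_mem hz _
    s_eq_zero := fun q _ hq' => hs0 q fun h => hq' (himg q h)
    bounded := ?_
    proper := ?_
    tail := ?_ }, fun q => rfl, fun γ u => ?_⟩
  -- The cut-off vanishes for `z 0 > R`, so it is trivially invariant under translations there.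
  · refine exists_bound_of_invariant le_rfl hσ (T := R + 1) ?_ ?_
    · exact hS₀c.of_isClosed_subset ((isClosed_tsupport _).inter
        (isClosed_le continuous_apply_zero continuous_const)) fun z hz => hσs hz.1
    · intro z hz t ht
      rw [hσ0 z (by linarith), hσ0 _ _]
      have : (z + t • EuclideanSpace.single (0 : Fin (n + 1)) (1 : ℝ)) 0 = z 0 + t := by simp
      rw [this]; linarith
  · intro K _ hK
    have hc : ContinuousOn Φ.toFun S₀ := Φ.contMDiffOn.continuousOn.mono hS₀d
    exact hS₀c.of_isClosed_subset (hc.preimage_isClosed_of_isClosed hS₀c.isClosed hK.isClosed)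
      inter_subset_left
  · exact fun R₀ => ⟨R + 1, fun z hz h => by linarith [hR z hz]⟩
  · funext z
    simp only [Piece.localize, Piece.lift, Piece.mult, MellinData.innerPiece, conicWeight, zero_mul,
      neg_zero, Real.exp_zero, one_mul]
    by_cases hz : z ∈ Φ.dom
    · rw [indicator_of_mem hz, if_pos hz.1]; rfl
    · rw [indicator_of_notMem hz, zero_smul]
      -- A point of the target outside of `Φ.dom` parametrizes a boundary point, where `1 - ω`
      -- vanishes.
      split_ifs with ht
      · have h1 := ((D.χ l).extend (𝓡∂ (n + 1))).map_target ht
        rw [OpenPartialHomeomorph.extend_source] at h1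
        have h2 : ((D.χ l).extend (𝓡∂ (n + 1))).symm z ∈ (𝓡∂ (n + 1)).boundary B := by
          rw [← ModelWithCorners.compl_interior]
          intro h3
          have h4 := (mem_interior_iff_of_mem_maximalAtlas (D.χ_mem l) h1).1 h3
          have h5 := ((D.χ l).extend (𝓡∂ (n + 1))).right_inv ht
          rw [OpenPartialHomeomorph.extend_coe, Function.comp_apply] at h5
          rw [h5] at h4
          exact hz ⟨ht, h4⟩
        have h6 := image_eq_zero_of_notMem_tsupport (D.notMem_tsupport_one_sub_cutoff h2)
        rw [h6, mul_zero, zero_smul]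
      · rfl

end ChartPiece

/-! ### The collar in logarithmic coordinates -/

section CollarParam
set_option linter.unusedSectionVars false
variable {n : ℕ} {B N : Type*}
    [TopologicalSpace B] [ChartedSpace (EuclideanHalfSpace (n + 1)) B]
    [IsManifold (𝓡∂ (n + 1)) ∞ B]
    [TopologicalSpace N] [ChartedSpace (EuclideanSpace ℝ (Fin n)) N]
    [IsManifold (𝓡 n) ∞ N] (M : ConicManifold n B N)

theorem ConicManifold.collar_mem_interior {x : ℝ} (hx : x ∈ Ioo (0 : ℝ) 1) (y : N) :
    M.collar (x, y) ∈ (𝓡∂ (n + 1)).interior B := by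
  by_contra h
  have h1 : M.collar (x, y) ∈ (𝓡∂ (n + 1)).boundary B := by
    rwa [← ModelWithCorners.compl_interior]
  rw [← M.collar_boundary] at h1
  obtain ⟨⟨x', y'⟩, h2, h3⟩ := h1
  have h4 : (x', y') = (x, y) := M.collar.injOn
    (by rw [M.collar_source]; exact ⟨⟨h2.1.ge, h2.1.trans_lt one_pos⟩, mem_univ _⟩)
    (by rw [M.collar_source]; exact ⟨⟨hx.1.le, hx.2⟩, mem_univ _⟩) h3
  have h5 : x' = x := congrArg Prod.fst h4
  have h6 : x' = 0 := h2.1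
  exact hx.1.ne (h6.symm.trans h5)

theorem exp_neg_mem_Ioo {t : ℝ} (ht : 0 < t) : Real.exp (-t) ∈ Ioo (0 : ℝ) 1 :=
  ⟨Real.exp_pos _, by rw [Real.exp_lt_one_iff]; linarith⟩

variable (κ : OpenPartialHomeomorph N (EuclideanSpace ℝ (Fin n)))

/-- The coordinates `(t, η)` as coordinates of `[0,1) × N`, with `x = e^{-t}`. -/
noncomputable def logCoord (z : Rd (n + 1)) : ℝ × N := (Real.exp (-z 0), κ.symm (MellinData.tail z))

theorem logCoord_mem_source {z : Rd (n + 1)} (hz : 0 < z 0) :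
    logCoord κ z ∈ (Ico 0 1 ×ˢ univ : Set (ℝ × N)) :=
  ⟨⟨(Real.exp_pos _).le, (exp_neg_mem_Ioo hz).2⟩, mem_univ _⟩

variable {κ}

theorem contMDiffOn_logCoord (hκ : κ ∈ IsManifold.maximalAtlas (𝓡 n) ∞ N) :
    ContMDiffOn 𝓘(ℝ, Rd (n + 1)) (𝓘(ℝ, ℝ).prod (𝓡 n)) ∞ (logCoord κ)
      {z | 0 < z 0 ∧ MellinData.tail z ∈ κ.target} := by
  have h1 : ContDiff ℝ ∞ fun z : Rd (n + 1) => Real.exp (-z 0) :=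
    ((EuclideanSpace.proj (0 : Fin (n + 1)) : Rd (n + 1) →L[ℝ] ℝ).contDiff.neg).exp
  refine ContMDiffOn.prodMk h1.contMDiff.contMDiffOn ?_
  exact (contMDiffOn_symm_of_mem_maximalAtlas hκ).comp (tailCLM n).contDiff.contMDiff.contMDiffOn
    fun z hz => hz.2

/-- The parametrization `(t, η) ↦ (e^{-t}, κ⁻¹(η))` of a part of the collar. -/
noncomputable def collarParam (hκ : κ ∈ IsManifold.maximalAtlas (𝓡 n) ∞ N) : InteriorParam n B where
  dom := {z | 0 < z 0 ∧ MellinData.tail z ∈ κ.target}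
  toFun z := M.collar (logCoord κ z)
  inv q := consCLM n (-Real.log (M.collar.symm q).1, κ (M.collar.symm q).2)
  isOpen_dom := (isOpen_lt continuous_const continuous_apply_zero).inter
    (κ.open_target.preimage continuous_tail)
  isOpen_image := by
    have : (fun z => M.collar (logCoord κ z)) '' {z | 0 < z 0 ∧ MellinData.tail z ∈ κ.target} =
        M.collar.target ∩ M.collar.symm ⁻¹' (Ioo 0 1 ×ˢ κ.source) := by
      ext q
      constructor
      · rintro ⟨z, hz, rfl⟩
        have h1 : logCoord κ z ∈ M.collar.source := by
          rw [M.collar_source]; exact logCoord_mem_source κ hz.1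
        refine ⟨M.collar.map_source h1, ?_⟩
        rw [mem_preimage, M.collar.left_inv h1]
        exact ⟨exp_neg_mem_Ioo hz.1, κ.map_target hz.2⟩
      · rintro ⟨h1, h2, h3⟩
        refine ⟨consCLM n (-Real.log (M.collar.symm q).1, κ (M.collar.symm q).2), ⟨?_, ?_⟩, ?_⟩
        · simpa using Real.log_neg h2.1 h2.2
        · simpa using κ.map_source h3
        · simp only [logCoord, consCLM_zero, tail_consCLM, neg_neg, Real.exp_log h2.1, κ.left_inv h3]
          exact M.collar.right_inv h1
    rw [this]
    exact M.contMDiffOn_collar_symm.continuousOn.isOpen_inter_preimage M.isOpen_target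
      (isOpen_Ioo.prod κ.open_source)
  image_subset := by
    rintro _ ⟨z, hz, rfl⟩
    exact M.collar_mem_interior (exp_neg_mem_Ioo hz.1) _
  left_inv z hz := by
    have h1 : logCoord κ z ∈ M.collar.source := by
      rw [M.collar_source]; exact logCoord_mem_source κ hz.1
    rw [M.collar.left_inv h1]
    simp only [logCoord, Real.log_exp, neg_neg, κ.right_inv hz.2]
    exact consCLM_tail z
  contMDiffOn := M.contMDiffOn_collar.comp (contMDiffOn_logCoord hκ) fun z hz =>
    logCoord_mem_source κ hz.1
  contMDiffOn_inv := by
    rintro _ ⟨z, hz, rfl⟩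
    have h1 : logCoord κ z ∈ M.collar.source := by
      rw [M.collar_source]; exact logCoord_mem_source κ hz.1
    have h2 := M.contMDiffOn_collar_symm _ (M.collar.map_source h1)
    have h3 := (h2.contMDiffAt (M.isOpen_target.mem_nhds (M.collar.map_source h1)))
    have h4 : ContMDiffAt (𝓡∂ (n + 1)) 𝓘(ℝ, ℝ) ∞ (fun q => -Real.log (M.collar.symm q).1)
        (M.collar (logCoord κ z)) := by
      have h6 : ContDiffAt ℝ ∞ (fun x => -Real.log x) (M.collar.symm (M.collar (logCoord κ z))).1 := by
        refine (Real.contDiffAt_log.2 ?_).neg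
        rw [M.collar.left_inv h1]
        exact (Real.exp_pos _).ne'
      exact ContMDiffAt.comp (f := fun q => (M.collar.symm q).1) _ h6.contMDiffAt h3.fst
    have h5 : ContMDiffAt (𝓡∂ (n + 1)) 𝓘(ℝ, Rd n) ∞ (fun q => κ (M.collar.symm q).2)
        (M.collar (logCoord κ z)) := by
      have h6 : ContMDiffAt (𝓡 n) (𝓡 n) ∞ κ (M.collar.symm (M.collar (logCoord κ z))).2 := by
        refine contMDiffAt_of_mem_maximalAtlas hκ ?_
        rw [M.collar.left_inv h1]
        exact κ.map_target hz.2
      exact ContMDiffAt.comp (f := fun q => (M.collar.symm q).2) _ h6 h3.snd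
    have h7 := (consCLM n).contDiff (n := ∞)
    exact (h7.contMDiff.contMDiffAt.comp _ (h4.prodMk_space h5)).contMDiffWithinAt

/-- The coordinate vector `∂_η` of `N` in the direction `e`. -/
noncomputable def sideField (κ : OpenPartialHomeomorph N (EuclideanSpace ℝ (Fin n))) (e η : Rd n) :
    TangentSpace (𝓡 n) (κ.symm η) :=
  mfderiv 𝓘(ℝ, Rd n) (𝓡 n) κ.symm η e

/-- The Gram matrix of `dt² + h(x)` in the coordinates `(t, η)`. -/
noncomputable def sideGram (κ : OpenPartialHomeomorph N (EuclideanSpace ℝ (Fin n))) (p : ℝ × Rd n) :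
    Matrix (Fin (n + 1)) (Fin (n + 1)) ℝ :=
  Matrix.of fun i k => (EuclideanSpace.single (0 : Fin (n + 1)) (1 : ℝ) : Rd (n + 1)) i *
      (EuclideanSpace.single (0 : Fin (n + 1)) (1 : ℝ) : Rd (n + 1)) k +
    (M.h p.1).inner (κ.symm p.2)
      (sideField κ (MellinData.tail (EuclideanSpace.single i 1)) p.2)
      (sideField κ (MellinData.tail (EuclideanSpace.single k 1)) p.2)

theorem contMDiffOn_sideField (hκ : κ ∈ IsManifold.maximalAtlas (𝓡 n) ∞ N) (e : Rd n) :
    ContMDiffOn 𝓘(ℝ, Rd n) ((𝓡 n).prod 𝓘(ℝ, Rd n)) 0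
      (fun η => TotalSpace.mk' (Rd n) (E := fun y : N => TangentSpace (𝓡 n) y) (κ.symm η)
        (sideField κ e η)) κ.target := by
  have h1 := (contMDiffOn_symm_of_mem_maximalAtlas hκ).contMDiffOn_tangentMapWithin (m := 0) (by simp)
    κ.open_target.uniqueMDiffOn
  have h2 : ContMDiff 𝓘(ℝ, Rd n) 𝓘(ℝ, Rd n).tangent 0
      (fun η : Rd n => (⟨η, e⟩ : TangentBundle 𝓘(ℝ, Rd n) (Rd n))) :=
    contMDiff_vectorSpace_iff_contDiff.2 contDiff_const
  refine (h1.comp h2.contMDiffOn fun η hη => hη).congr fun η hη => ?_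
  simp only [tangentMapWithin, Function.comp, sideField]
  rw [mfderivWithin_of_isOpen κ.open_target hη]

theorem continuousOn_sideGram (hκ : κ ∈ IsManifold.maximalAtlas (𝓡 n) ∞ N) :
    ContinuousOn (sideGram M κ) (Ico 0 1 ×ˢ κ.target) := by
  refine continuousOn_pi.2 fun i => continuousOn_pi.2 fun k => ?_
  refine continuousOn_const.add ?_
  have hf : ContMDiffOn (𝓘(ℝ, ℝ).prod 𝓘(ℝ, Rd n)) (𝓘(ℝ, ℝ).prod (𝓡 n)) 0
      (fun p : ℝ × Rd n => (p.1, κ.symm p.2)) (Ico 0 1 ×ˢ κ.target) :=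
    contMDiffOn_fst.prodMk (((contMDiffOn_symm_of_mem_maximalAtlas hκ).of_le (by simp)).comp
      contMDiffOn_snd fun p hp => hp.2)
  have h0 := (M.contMDiffOn_h.of_le (m := 0) (by simp)).comp hf fun p hp => ⟨hp.1, mem_univ _⟩
  have hv : ∀ e, ContMDiffOn (𝓘(ℝ, ℝ).prod 𝓘(ℝ, Rd n)) ((𝓡 n).prod 𝓘(ℝ, Rd n)) 0
      (fun p : ℝ × Rd n => TotalSpace.mk' (Rd n) (E := fun y : N => TangentSpace (𝓡 n) y) (κ.symm p.2)
        (sideField κ e p.2)) (Ico 0 1 ×ˢ κ.target) := fun e =>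
    (contMDiffOn_sideField hκ e).comp contMDiffOn_snd fun p hp => hp.2
  have h := ContMDiffOn.clm_bundle_apply₂ (F₁ := Rd n) (F₂ := Rd n) (F₃ := ℝ)
    (E₁ := fun y : N => TangentSpace (𝓡 n) y) (E₂ := fun y : N => TangentSpace (𝓡 n) y)
    (E₃ := Bundle.Trivial N ℝ) (b := fun p : ℝ × Rd n => κ.symm p.2)
    (ψ := fun p => (M.h p.1).inner (κ.symm p.2)) h0
    (hv (MellinData.tail (EuclideanSpace.single i 1))) (hv (MellinData.tail (EuclideanSpace.single k 1)))
  intro p hp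
  have h2 := (h p hp).continuousWithinAt
  rw [FiberBundle.continuousWithinAt_totalSpace] at h2
  exact h2.2

theorem sideField_eq_zero_iff (hκ : κ ∈ IsManifold.maximalAtlas (𝓡 n) ∞ N) {e η : Rd n} (hη : η ∈ κ.target)
    (h : sideField κ e η = 0) : e = 0 := by
  have hm : κ.symm.MDifferentiable 𝓘(ℝ, Rd n) (𝓡 n) :=
    ⟨(contMDiffOn_symm_of_mem_maximalAtlas hκ).mdifferentiableOn (by simp),
      (contMDiffOn_of_mem_maximalAtlas hκ).mdifferentiableOn (by simp)⟩
  exact hm.mfderiv_injective hη (h.trans (map_zero _).symm)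

theorem frame_collarParam (hκ : κ ∈ IsManifold.maximalAtlas (𝓡 n) ∞ N) {z : Rd (n + 1)}
    (hz : z ∈ (collarParam M hκ).dom) (i : Fin (n + 1)) :
    (collarParam M hκ).frame i z =
      mfderivWithin (𝓘(ℝ, ℝ).prod (𝓡 n)) (𝓡∂ (n + 1)) M.collar (Ico 0 1 ×ˢ univ) (logCoord κ z)
        (-(Real.exp (-z 0) * (EuclideanSpace.single i (1 : ℝ) : Rd (n + 1)) 0),
          sideField κ (MellinData.tail (EuclideanSpace.single i 1)) (MellinData.tail z)) := by
  have h1 : HasMFDerivAt 𝓘(ℝ, Rd (n + 1)) 𝓘(ℝ, ℝ) (fun z : Rd (n + 1) => Real.exp (-z 0)) z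
      (Real.exp (-z 0) • -(EuclideanSpace.proj (0 : Fin (n + 1)) : Rd (n + 1) →L[ℝ] ℝ)) :=
    ((EuclideanSpace.proj (0 : Fin (n + 1)) : Rd (n + 1) →L[ℝ] ℝ).hasFDerivAt.neg.exp).hasMFDerivAt
  have h2 : HasMFDerivAt 𝓘(ℝ, Rd n) (𝓡 n) κ.symm (MellinData.tail z)
      (mfderiv 𝓘(ℝ, Rd n) (𝓡 n) κ.symm (MellinData.tail z)) :=
    (((contMDiffOn_symm_of_mem_maximalAtlas hκ).contMDiffAt
      (κ.open_target.mem_nhds hz.2)).mdifferentiableAt (by simp)).hasMFDerivAt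
  have h3 := h2.comp z (tailCLM n).hasFDerivAt.hasMFDerivAt
  have h4 := (h1.prodMk h3).hasMFDerivWithinAt (s := (collarParam M hκ).dom)
  have h5 : HasMFDerivWithinAt (𝓘(ℝ, ℝ).prod (𝓡 n)) (𝓡∂ (n + 1)) M.collar (Ico 0 1 ×ˢ univ)
      (logCoord κ z) (mfderivWithin (𝓘(ℝ, ℝ).prod (𝓡 n)) (𝓡∂ (n + 1)) M.collar (Ico 0 1 ×ˢ univ)
        (logCoord κ z)) :=
    ((M.contMDiffOn_collar _ (logCoord_mem_source κ hz.1)).mdifferentiableWithinAt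
      (by simp)).hasMFDerivWithinAt
  have h6 := (HasMFDerivWithinAt.comp z h5 h4 fun w hw => logCoord_mem_source κ hw.1).hasMFDerivAt
    ((collarParam M hκ).isOpen_dom.mem_nhds hz)
  have h7 : mfderiv 𝓘(ℝ, Rd (n + 1)) (𝓡∂ (n + 1)) (collarParam M hκ).toFun z = _ := h6.mfderiv
  rw [InteriorParam.frame, h7]
  refine congrArg (mfderivWithin (𝓘(ℝ, ℝ).prod (𝓡 n)) (𝓡∂ (n + 1)) M.collar (Ico 0 1 ×ˢ univ)
        (logCoord κ z)) ?_
  refine Prod.ext ?_ rfl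
  change Real.exp (-z 0) * -((EuclideanSpace.single i (1 : ℝ) : Rd (n + 1)) 0) = _
  ring

/-- `x = e^{-t}` gives `dx = -x dt`, so `dx² + x² h` is `x²` times the cylindrical metric `dt² + h`.
-/
theorem gram_collarParam (hκ : κ ∈ IsManifold.maximalAtlas (𝓡 n) ∞ N) {z : Rd (n + 1)}
    (hz : z ∈ (collarParam M hκ).dom) : (collarParam M hκ).gram M z =
      Real.exp (-z 0) ^ 2 • sideGram M κ (Real.exp (-z 0), MellinData.tail z) := by
  ext i k
  rw [InteriorParam.gram, Matrix.of_apply, frame_collarParam M hκ hz, frame_collarParam M hκ hz]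
  refine (M.g_collar _ (logCoord_mem_source κ hz.1).1 _ _ _ _ _).trans ?_
  have hs : ∀ i : Fin (n + 1), (EuclideanSpace.single i (1 : ℝ) : Rd (n + 1)) 0 =
      (EuclideanSpace.single (0 : Fin (n + 1)) (1 : ℝ) : Rd (n + 1)) i := fun i => by
    simp [eq_comm]
  have hl : (logCoord κ z).1 = Real.exp (-z 0) := rfl
  simp only [Matrix.smul_apply, sideGram, Matrix.of_apply, hs, smul_eq_mul, hl]
  ring

/-- The quadratic form at a vector is the square of its `t`-component plus the squared `h`-length of
its tangential part; if the latter is zero, the `t`-component is not. -/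
theorem posDef_sideGram (hκ : κ ∈ IsManifold.maximalAtlas (𝓡 n) ∞ N) {p : ℝ × Rd n}
    (hp : p.2 ∈ κ.target) : (sideGram M κ p).PosDef := by
  set V : Fin (n + 1) → TangentSpace (𝓡 n) (κ.symm p.2) := fun i =>
    sideField κ (MellinData.tail (EuclideanSpace.single i 1)) p.2 with hV
  have hsymm : (sideGram M κ p).IsHermitian := by
    rw [Matrix.IsHermitian, Matrix.conjTranspose_eq_transpose_of_trivial]
    ext i k
    simp only [sideGram, Matrix.transpose_apply, Matrix.of_apply]
    rw [(M.h p.1).symm, mul_comm]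
  refine Matrix.PosDef.of_dotProduct_mulVec_pos hsymm fun x hx => ?_
  have hsum : ∑ i, x i • V i = sideField κ (MellinData.tail (WithLp.toLp 2 x)) p.2 := by
    have h1 : MellinData.tail (WithLp.toLp 2 x) =
        ∑ i, x i • MellinData.tail (EuclideanSpace.single i (1 : ℝ)) := by
      conv_lhs => rw [eq_sum_smul_single (WithLp.toLp 2 x)]
      rw [← tailCLM_apply, map_sum]
      rfl
    rw [h1]
    refine Eq.symm ((map_sum (mfderiv 𝓘(ℝ, Rd n) (𝓡 n) κ.symm p.2) _ _).trans ?_)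
    exact Finset.sum_congr rfl fun i _ => map_smul _ _ _
  have hval : star x ⬝ᵥ (sideGram M κ p).mulVec x = x 0 ^ 2 +
      (M.h p.1).inner (κ.symm p.2) (∑ i, x i • V i) (∑ i, x i • V i) := by
    have h0 : ∑ i, x i * (EuclideanSpace.single (0 : Fin (n + 1)) (1 : ℝ) : Rd (n + 1)) i = x 0 := by
      simp
    have h1 : (M.h p.1).inner (κ.symm p.2) (∑ i, x i • V i) (∑ i, x i • V i) =
        ∑ i, ∑ k, x i * x k * (M.h p.1).inner (κ.symm p.2) (V i) (V k) := by
      simp only [map_sum, map_smul, sum_apply, smul_apply, smul_eq_mul, Finset.mul_sum]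
      rw [Finset.sum_comm]
      exact Finset.sum_congr rfl fun i _ => Finset.sum_congr rfl fun k _ => by ring
    rw [h1, sq]
    conv_rhs => rw [← h0]
    rw [Finset.sum_mul_sum, ← Finset.sum_add_distrib]
    simp only [dotProduct, Matrix.mulVec, sideGram, Matrix.of_apply, star_trivial, Finset.mul_sum]
    refine Finset.sum_congr rfl fun i _ => ?_
    rw [← Finset.sum_add_distrib]
    exact Finset.sum_congr rfl fun k _ => by ring
  refine lt_of_lt_of_eq ?_ hval.symm
  by_cases h : MellinData.tail (WithLp.toLp 2 x) = 0
  · have hx0 : x 0 ≠ 0 := by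
      intro h0
      refine hx (funext fun i => ?_)
      refine Fin.cases h0 (fun j => ?_) i
      exact congrArg (fun v : Rd n => v j) h
    rw [hsum, h]
    have : sideField κ (0 : Rd n) p.2 = 0 := map_zero _
    rw [this, map_zero, add_zero]
    positivity
  · rw [hsum]
    have := (M.h p.1).pos (κ.symm p.2) _ fun h' => h (sideField_eq_zero_iff hκ hp h')
    positivity

/-- The Gram matrix of `dt² + h(x)` is continuous up to `x = 0`, so compactness of `[0, e^{-a}] × K`
bounds it from above and below uniformly as `t → ∞`; the scalar factor `x²` produces exactly the
conic weights. The condition `a > 0` keeps `x` away from `1`. -/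
theorem tameOn_collarParam (hκ : κ ∈ IsManifold.maximalAtlas (𝓡 n) ∞ N) {a : ℝ} (ha : 0 < a)
    {K : Set (Rd n)} (hK : IsCompact K) (hKt : K ⊆ κ.target) :
    (collarParam M hκ).TameOn M 1 {z | a ≤ z 0 ∧ MellinData.tail z ∈ K} := by
  obtain ⟨C, hC1, hC⟩ := exists_bounds_of_posDef
    ((isCompact_Icc (a := (0 : ℝ)) (b := Real.exp (-a))).prod hK)
    ((continuousOn_sideGram M hκ).mono (prod_mono
      (fun x hx => ⟨hx.1, hx.2.trans_lt (exp_neg_mem_Ioo ha).2⟩) hKt))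
    (fun p hp => posDef_sideGram M hκ (hKt hp.2))
  refine ⟨C, hC1, fun z hz => ?_⟩
  have hz0 : z ∈ (collarParam M hκ).dom := ⟨ha.trans_le hz.1, hKt hz.2⟩
  obtain ⟨h1, h2, h3⟩ := hC (Real.exp (-z 0), MellinData.tail z)
    ⟨⟨(Real.exp_pos _).le, Real.exp_le_exp.2 (neg_le_neg hz.1)⟩, hz.2⟩
  rw [gram_collarParam M hκ hz0]
  set x := Real.exp (-z 0)
  set H := sideGram M κ (x, MellinData.tail z)
  have hx : 0 < x := Real.exp_pos _
  have hw : conicWeight 1 (n + 1) z = x ^ (n + 1) := by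
    rw [conicWeight, ← Real.exp_nat_mul]; congr 1; push_cast; ring
  have hw2 : conicWeight 1 2 z = x ^ 2 := by
    rw [conicWeight, ← Real.exp_nat_mul]; congr 1; push_cast; ring
  have hd : √(x ^ 2 • H).det = x ^ (n + 1) * √H.det := by
    rw [Matrix.det_smul, Fintype.card_fin, ← pow_mul, mul_comm 2, pow_mul,
      Real.sqrt_mul (sq_nonneg _), Real.sqrt_sq (by positivity)]
  have hdet : IsUnit H.det := (posDef_sideGram M hκ (hKt hz.2)).det_pos.ne'.isUnit
  have hinv : (x ^ 2 • H)⁻¹ = (x ^ 2)⁻¹ • H⁻¹ := by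
    refine Matrix.inv_eq_right_inv ?_
    rw [Matrix.smul_mul, Matrix.mul_smul, smul_smul, Matrix.mul_nonsing_inv _ hdet,
      mul_inv_cancel₀ (by positivity), one_smul]
  rw [hd, hw, hw2]
  refine ⟨?_, ?_, fun ξ => ?_⟩
  · rw [mul_comm]; gcongr
  · calc x ^ (n + 1) = x ^ (n + 1) * 1 := (mul_one _).symm
      _ ≤ x ^ (n + 1) * (C * √H.det) := by gcongr
      _ = _ := by ring
  · rw [hinv, sesqForm_smul_left, mul_inv_cancel_left₀ (by positivity)]
    exact h3 ξ

end CollarParam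

/-! ### Localizations on the collar -/

section CollarPiece
set_option linter.unusedSectionVars false
variable {n : ℕ} {B N : Type*}
    [TopologicalSpace B] [ChartedSpace (EuclideanHalfSpace (n + 1)) B]
    [IsManifold (𝓡∂ (n + 1)) ∞ B] [CompactSpace B] [T2Space B]
    [TopologicalSpace N] [ChartedSpace (EuclideanSpace ℝ (Fin n)) N]
    [IsManifold (𝓡 n) ∞ N] [CompactSpace N] [T2Space N] {M : ConicManifold n B N}

/-- The tube lemma over the compact `N`: a neighbourhood of the boundary contains a whole strip of
the collar. -/
theorem ConicManifold.exists_collar_mem (M : ConicManifold n B N) {W : Set B}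
    (hW : W ∈ 𝓝ˢ ((𝓡∂ (n + 1)).boundary B)) :
    ∃ x₀ ∈ Ioo (0 : ℝ) 1, ∀ x ∈ Icc 0 x₀, ∀ y, M.collar (x, y) ∈ W := by
  obtain ⟨O, hO, hO'⟩ := (continuousOn_iff'.1 M.contMDiffOn_collar.continuousOn) _
    (isOpen_interior (s := W))
  have h0 : ({0} : Set ℝ) ×ˢ (univ : Set N) ⊆ O := by
    rintro ⟨x, y⟩ ⟨hx, -⟩
    have hx0 : x = 0 := hx
    subst hx0
    have h1 : M.collar ((0 : ℝ), y) ∈ (𝓡∂ (n + 1)).boundary B := by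
      rw [← M.collar_boundary]; exact ⟨(0, y), ⟨rfl, mem_univ _⟩, rfl⟩
    have h2 : ((0 : ℝ), y) ∈ M.collar ⁻¹' interior W ∩ Ico 0 1 ×ˢ univ :=
      ⟨subset_interior_iff_mem_nhdsSet.2 hW h1, ⟨le_rfl, one_pos⟩, mem_univ _⟩
    rw [hO'] at h2
    exact h2.1
  obtain ⟨u, v, hu, -, hu0, hv, huv⟩ := generalized_tube_lemma isCompact_singleton isCompact_univ hO h0
  obtain ⟨δ, hδ, hδu⟩ := Metric.isOpen_iff.1 hu 0 (hu0 rfl)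
  refine ⟨min (δ / 2) (1 / 2), ⟨by positivity, (min_le_right _ _).trans_lt (by norm_num)⟩,
    fun x hx y => ?_⟩
  have h3 : (x, y) ∈ O ∩ Ico 0 1 ×ˢ univ := by
    refine ⟨huv ⟨hδu ?_, hv (mem_univ _)⟩,
      ⟨hx.1, (hx.2.trans (min_le_right _ _)).trans_lt (by norm_num)⟩, mem_univ _⟩
    rw [Metric.mem_ball, Real.dist_eq, sub_zero, abs_of_nonneg hx.1]
    linarith [hx.2.trans (min_le_left _ _)]
  rw [← hO'] at h3
  exact interior_subset h3.1

theorem MellinData.exists_cutoff_eq_one (D : MellinData M) :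
    ∃ T : ℝ, 0 < T ∧ ∀ t, T ≤ t → ∀ y, D.cutoff (M.collar (Real.exp (-t), y)) = 1 := by
  obtain ⟨x₀, hx₀, h⟩ := M.exists_collar_mem D.cutoff_eq_one
  refine ⟨-Real.log x₀, by linarith [Real.log_neg hx₀.1 hx₀.2], fun t ht y => h _ ⟨(Real.exp_pos _).le, ?_⟩ y⟩
  rw [← Real.exp_log hx₀.1]
  exact Real.exp_le_exp.2 (by linarith)

/-- The support of `ω` is compact inside the collar, so `1 - x` has a positive lower bound on it,
and `t ≥ 1 - e^{-t}`. -/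
theorem MellinData.exists_le_of_mem_tsupport_cutoff (D : MellinData M) :
    ∃ a : ℝ, 0 < a ∧ ∀ t y, 0 < t → M.collar (Real.exp (-t), y) ∈ tsupport D.cutoff → a ≤ t := by
  have hc : ContinuousOn (fun q => 1 - (M.collar.symm q).1) (tsupport D.cutoff) :=
    continuousOn_const.sub (continuous_fst.comp_continuousOn
      (M.contMDiffOn_collar_symm.continuousOn.mono D.tsupport_cutoff))
  obtain ⟨C, hC, h⟩ := (isClosed_tsupport D.cutoff).isCompact.exists_bounds_of_pos hc fun q hq => by
    have := M.collar.map_target (D.tsupport_cutoff hq)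
    rw [M.collar_source] at this
    exact sub_pos.2 this.1.2
  refine ⟨C⁻¹, by positivity, fun t y ht hq => ?_⟩
  obtain ⟨-, h2⟩ := h _ hq
  rw [M.collar.left_inv (by rw [M.collar_source]
                            exact ⟨⟨(Real.exp_pos _).le, (exp_neg_mem_Ioo ht).2⟩, mem_univ _⟩)] at h2
  rw [inv_le_iff_one_le_mul₀ (by positivity)]
  have h3 := Real.add_one_le_exp (-t)
  simp only at h2
  nlinarith

theorem ConicManifold.exists_logCoord (M : ConicManifold n B N) {q : B} (hq : q ∈ (𝓡∂ (n + 1)).interior B)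
    (hq' : q ∈ M.collar.target) {κ : OpenPartialHomeomorph N (EuclideanSpace ℝ (Fin n))}
    (hκ : (M.collar.symm q).2 ∈ κ.source) : ∃ z : Rd (n + 1), 0 < z 0 ∧
      MellinData.tail z = κ (M.collar.symm q).2 ∧ M.collar (logCoord κ z) = q := by
  have h1 := M.collar.map_target hq'
  rw [M.collar_source] at h1
  have hx : 0 < (M.collar.symm q).1 := by
    refine h1.1.1.lt_of_ne fun h0 => ?_
    have h2 : q ∈ (𝓡∂ (n + 1)).boundary B := by
      rw [← M.collar_boundary]
      exact ⟨M.collar.symm q, ⟨h0.symm, mem_univ _⟩, M.collar.right_inv hq'⟩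
    rw [← ModelWithCorners.compl_interior] at h2
    exact h2 hq
  refine ⟨consCLM n (-Real.log (M.collar.symm q).1, κ (M.collar.symm q).2), ?_, rfl, ?_⟩
  · simpa using Real.log_neg hx h1.1.2
  · simp only [logCoord, consCLM_zero, tail_consCLM, neg_neg, Real.exp_log hx, κ.left_inv hκ]
    exact M.collar.right_inv hq'

theorem MellinData.isCompact_image_tsupport (D : MellinData M) (j : Fin D.J) :
    IsCompact (D.κ j '' tsupport (D.φ j)) :=
  (isClosed_tsupport _).isCompact.image_of_continuousOn
    ((D.κ j).continuousOn.mono (D.φ_subordinate j))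

theorem MellinData.image_tsupport_subset (D : MellinData M) (j : Fin D.J) :
    D.κ j '' tsupport (D.φ j) ⊆ (D.κ j).target := by
  rintro _ ⟨y, hy, rfl⟩
  exact (D.κ j).map_source (D.φ_subordinate j hy)

/-- Here `τ = 1`, and `S₀` is the half-cylinder `t ≥ a` over a compact set. For large `t` the
cut-off reduces to `φⱼ` and no longer depends on `t`, as the bounds require. A compact subset of the
interior stays away from `x = 0`, which bounds `t` and gives properness. -/
theorem MellinData.exists_collarPiece (D : MellinData M) (j : Fin D.J) : ∃ P : Piece M,
    (∀ q, P.s q = D.cutoff q * D.φ j (M.collar.symm q).2) ∧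
      ∀ γ u, P.localize γ u = D.collarPiece γ u j := by
  set κ := D.κ j with hκ
  set Φ := collarParam M (D.κ_mem j) with hΦ
  obtain ⟨a, ha, haω⟩ := D.exists_le_of_mem_tsupport_cutoff
  obtain ⟨T, hT0, hT⟩ := D.exists_cutoff_eq_one
  set K₀ := κ '' tsupport (D.φ j) with hK₀
  have hK₀c : IsCompact K₀ := D.isCompact_image_tsupport j
  have hK₀t : K₀ ⊆ κ.target := D.image_tsupport_subset j
  obtain ⟨δ, hδ, hδt⟩ := hK₀c.exists_cthickening_subset_open κ.open_target hK₀t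
  -- The first bound keeps the thickened set in the chart of `N`, the second keeps `t` positive.
  set ε := min δ (a / 2) with hε
  have hε0 : 0 < ε := lt_min hδ (by linarith)
  have hεt : Metric.cthickening ε K₀ ⊆ κ.target :=
    (Metric.cthickening_mono (min_le_left _ _) _).trans hδt
  have haε : 0 < a - ε := by linarith [min_le_right δ (a / 2)]
  set S₀ : Set (Rd (n + 1)) := {z | a ≤ z 0 ∧ MellinData.tail z ∈ K₀} with hS₀
  have hS₀c : IsClosed S₀ := (isClosed_le continuous_const continuous_apply_zero).inter
    (hK₀c.isClosed.preimage continuous_tail)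
  have hS₀d : S₀ ⊆ Φ.dom := fun z hz => ⟨ha.trans_le hz.1, hK₀t hz.2⟩
  have hcol : ∀ z : Rd (n + 1), 0 < z 0 → logCoord κ z ∈ M.collar.source := fun z hz => by
    rw [M.collar_source]; exact logCoord_mem_source κ hz
  set s : B → ℝ := fun q => D.cutoff q * D.φ j (M.collar.symm q).2 with hs
  have hsΦ : ∀ z ∈ Φ.dom, s (Φ.toFun z) =
      D.cutoff (Φ.toFun z) * D.φ j (κ.symm (MellinData.tail z)) := fun z hz => by
    have h1 : M.collar.symm (Φ.toFun z) = logCoord κ z := M.collar.left_inv (hcol z hz.1)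
    simp only [hs, h1]
    rfl
  obtain ⟨hσ, hσs⟩ := contDiff_indicator_of_eq_zero (f := s ∘ Φ.toFun) Φ.isOpen_dom hS₀c hS₀d
    (fun z hz => by
      have h1 : ContDiffAt ℝ ∞ (D.cutoff ∘ Φ.toFun) z :=
        ((D.contMDiff_cutoff _).comp z (InteriorParam.contMDiffAt hz)).contDiffAt
      have h2 : ContMDiffAt 𝓘(ℝ, Rd (n + 1)) (𝓡 n) ∞ (fun z => κ.symm (MellinData.tail z)) z :=
        ((contMDiffOn_symm_of_mem_maximalAtlas (D.κ_mem j)).contMDiffAt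
          (κ.open_target.mem_nhds hz.2)).comp z (tailCLM n).contDiff.contMDiff.contMDiffAt
      have h3 : ContDiffAt ℝ ∞ (fun z => D.φ j (κ.symm (MellinData.tail z))) z :=
        (((D.φ j).contMDiff _).comp z h2).contDiffAt
      refine (h1.mul h3).congr_of_eventuallyEq ?_
      filter_upwards [Φ.isOpen_dom.mem_nhds hz] with w hw using hsΦ w hw)
    (fun z hz hzS => by
      by_contra h
      rw [Function.comp_apply, hsΦ z hz] at h
      refine hzS ⟨haω _ _ hz.1 (subset_tsupport _ (left_ne_zero_of_mul h)), ?_⟩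
      exact ⟨_, subset_tsupport _ (right_ne_zero_of_mul h), κ.right_inv hz.2⟩)
  have hΦc : ContinuousOn Φ.toFun S₀ := Φ.contMDiffOn.continuousOn.mono hS₀d
  refine ⟨{
    Φ := Φ
    τ := 1
    τ_nonneg := zero_le_one
    S₀ := S₀
    S := {z | a - ε ≤ z 0 ∧ MellinData.tail z ∈ Metric.cthickening ε K₀}
    isClosed_S := (isClosed_le continuous_const continuous_apply_zero).inter
      (Metric.isClosed_cthickening.preimage continuous_tail)
    isClosed_S₀ := hS₀c
    S_subset := fun z hz => ⟨haε.trans_le hz.1, hεt hz.2⟩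
    ε := ε
    ε_pos := hε0
    cthickening_subset := cthickening_slab_subset a ε hε0.le hK₀c.isClosed
    S_nonneg := fun z hz => by rw [one_mul]; exact haε.le.trans hz.1
    tame := tameOn_collarParam M (D.κ_mem j) haε hK₀c.cthickening hεt
    s := s
    σ := Φ.dom.indicator (s ∘ Φ.toFun)
    contDiff_σ := hσ
    tsupport_σ := hσs
    σ_eq := fun z hz => indicator_of_mem hz _
    s_eq_zero := ?_
    bounded := ?_
    proper := ?_
    tail := ?_ }, fun q => rfl, fun γ u => ?_⟩
  · intro q hq hq'
    by_contra h
    have h1 := subset_tsupport _ (left_ne_zero_of_mul h)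
    have h2 := subset_tsupport _ (right_ne_zero_of_mul h)
    obtain ⟨z, hz0, hzt, hzq⟩ := M.exists_logCoord hq (D.tsupport_cutoff h1) (D.φ_subordinate j h2)
    refine hq' ⟨z, ⟨haω _ (κ.symm (MellinData.tail z)) hz0 ?_, ?_⟩, hzq⟩
    · exact hzq.symm ▸ h1
    · rw [hzt]; exact ⟨_, h2, rfl⟩
  · refine exists_bound_of_invariant zero_le_one hσ (T := T) ?_ ?_
    · exact (isCompact_slab a (T + 1) hK₀c).of_isClosed_subset ((isClosed_tsupport _).inter
        (isClosed_le continuous_apply_zero continuous_const)) fun z hz =>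
          ⟨(hσs hz.1).1, hz.2, (hσs hz.1).2⟩
    · intro z hz t ht
      have e0 : (z + t • EuclideanSpace.single (0 : Fin (n + 1)) (1 : ℝ)) 0 = z 0 + t := by simp
      have e1 : MellinData.tail (z + t • EuclideanSpace.single (0 : Fin (n + 1)) (1 : ℝ)) =
          MellinData.tail z := by
        rw [← tailCLM_apply, map_add, map_smul, tailCLM_apply, tailCLM_apply, tail_single_zero,
          smul_zero, add_zero]
      have key : ∀ w : Rd (n + 1), T ≤ w 0 → Φ.dom.indicator (s ∘ Φ.toFun) w =
          κ.target.indicator (fun η => D.φ j (κ.symm η)) (MellinData.tail w) := by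
        intro w hw
        by_cases hwt : MellinData.tail w ∈ κ.target
        · have hwd : w ∈ Φ.dom := ⟨hT0.trans_le hw, hwt⟩
          rw [indicator_of_mem hwt, indicator_of_mem hwd, Function.comp_apply, hsΦ w hwd]
          refine (congrArg (· * D.φ j (κ.symm (MellinData.tail w))) (hT (w 0) hw _)).trans (one_mul _)
        · rw [indicator_of_notMem hwt, indicator_of_notMem fun h => hwt h.2]
      rw [key z hz, key _ (by rw [e0]; linarith), e1]
  · intro K hKi hK
    have hKc : Kᶜ ∈ 𝓝ˢ ((𝓡∂ (n + 1)).boundary B) := by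
      refine hK.isClosed.isOpen_compl.mem_nhdsSet.2 ?_
      rw [← ModelWithCorners.compl_interior]
      exact compl_subset_compl.2 hKi
    obtain ⟨x₀, hx₀, h⟩ := M.exists_collar_mem hKc
    refine (isCompact_slab a (-Real.log x₀) hK₀c).of_isClosed_subset
      (hΦc.preimage_isClosed_of_isClosed hS₀c hK.isClosed) fun z hz => ⟨hz.1.1, ?_, hz.1.2⟩
    by_contra hlt
    push Not at hlt
    refine h (Real.exp (-z 0)) ⟨(Real.exp_pos _).le, ?_⟩ (κ.symm (MellinData.tail z)) hz.2
    rw [← Real.exp_log hx₀.1]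
    exact Real.exp_le_exp.2 (by linarith)
  -- The points of `S₀` with `t ≤ R₀` form a compact slab, hence are bounded in norm.
  · intro R₀
    obtain ⟨R, hR⟩ := (isCompact_slab a R₀ hK₀c).isBounded.exists_norm_le
    refine ⟨R + 1, fun z hz hzR => ?_⟩
    by_contra hlt
    push Not at hlt
    rw [one_mul] at hlt
    linarith [hR z ⟨hz.1, hlt.le, hz.2⟩]
  · funext z
    simp only [Piece.localize, Piece.lift, Piece.mult, MellinData.collarPiece]
    by_cases hz : z ∈ Φ.dom
    · have hz' : 0 < z 0 ∧ MellinData.tail z ∈ (D.κ j).target := hz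
      rw [indicator_of_mem hz, if_pos hz', Function.comp_apply, hsΦ z hz, conicWeight]
      have : -(1 * ((n + 1 : ℝ) / 2 - γ) * z 0) = (γ - (n + 1) / 2) * z 0 := by ring
      rw [this, ← mul_assoc]
      rfl
    · have hz' : ¬(0 < z 0 ∧ MellinData.tail z ∈ (D.κ j).target) := hz
      rw [indicator_of_notMem hz, if_neg hz', mul_zero, zero_smul]

end CollarPiece

/-! ### Functions that are constant near the boundary -/

theorem lintegral_Ici_inv_sq {c : ℝ} (hc : 0 < c) :
    ∫⁻ t in Ici c, ENNReal.ofReal ((t ^ 2)⁻¹) = ENNReal.ofReal c⁻¹ := by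
  have h1 : IntegrableOn (fun t : ℝ => t ^ (-2 : ℝ)) (Ioi c) :=
    integrableOn_Ioi_rpow_of_lt (by norm_num) hc
  have h2 := integral_Ioi_rpow_of_lt (a := -2) (by norm_num) hc
  have h3 : ∀ t ∈ Ioi c, t ^ (-2 : ℝ) = (t ^ 2)⁻¹ := fun t ht => by
    rw [Real.rpow_neg (hc.trans ht).le]; norm_cast
  rw [setLIntegral_congr Ioi_ae_eq_Ici.symm,
    ← setLIntegral_congr_fun measurableSet_Ioi fun t ht => congrArg ENNReal.ofReal (h3 t ht),
    ← ofReal_integral_eq_lintegral_ofReal h1, h2]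
  · congr 1
    rw [show (-2 : ℝ) + 1 = -1 by norm_num, Real.rpow_neg_one]
    ring
  · filter_upwards [ae_restrict_mem measurableSet_Ioi] with t ht
    exact Real.rpow_nonneg (hc.trans ht).le _

theorem exists_lintegral_slab_le {n : ℕ} {K : Set (Rd n)} (hK : IsCompact K) (a : ℝ) :
    ∃ C : ℝ≥0, ∀ g : ℝ → ℝ≥0∞, Measurable g →
      ∫⁻ z in {z : Rd (n + 1) | a ≤ z 0 ∧ MellinData.tail z ∈ K}, g (z 0) ≤
        C * ∫⁻ t in Ici a, g t := by
  set K' : Set (Fin n → ℝ) := WithLp.ofLp '' K with hK'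
  have hK'c : IsCompact K' := hK.image (PiLp.continuous_ofLp 2 _)
  refine ⟨(volume K').toNNReal, fun g hg => ?_⟩
  rw [ENNReal.coe_toNNReal hK'c.measure_lt_top.ne]
  have hm : MeasurableSet {z : Rd (n + 1) | a ≤ z 0 ∧ MellinData.tail z ∈ K} :=
    ((isClosed_le continuous_const continuous_apply_zero).inter
      (hK.isClosed.preimage continuous_tail)).measurableSet
  have hmp := (volume_preserving_piFinSuccAbove (fun _ : Fin (n + 1) => ℝ) 0).comp
    (PiLp.volume_preserving_ofLp (Fin (n + 1)))
  have h1 : ∀ z : Rd (n + 1), {z : Rd (n + 1) | a ≤ z 0 ∧ MellinData.tail z ∈ K}.indicator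
      (fun z => g (z 0)) z ≤ (fun p : ℝ × (Fin n → ℝ) => (Ici a).indicator g p.1 * K'.indicator 1 p.2)
        ((MeasurableEquiv.piFinSuccAbove (fun _ => ℝ) 0 ∘ WithLp.ofLp) z) := by
    intro z
    by_cases hz : z ∈ {z : Rd (n + 1) | a ≤ z 0 ∧ MellinData.tail z ∈ K}
    · have h2 : z 0 ∈ Ici a := hz.1
      have h3 : (fun i : Fin n => z i.succ) ∈ K' := ⟨_, hz.2, rfl⟩
      rw [indicator_of_mem hz]
      refine le_of_eq ?_
      change g (z 0) = (Ici a).indicator g (z 0) * K'.indicator 1 (fun i : Fin n => z i.succ)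
      rw [indicator_of_mem h2, indicator_of_mem h3, Pi.one_apply, mul_one]
    · rw [indicator_of_notMem hz]; exact zero_le
  have hmeas : Measurable (fun p : ℝ × (Fin n → ℝ) => (Ici a).indicator g p.1 * K'.indicator (1 : (Fin n → ℝ) → ℝ≥0∞) p.2) :=
    ((hg.indicator measurableSet_Ici).comp measurable_fst).mul
      ((measurable_one.indicator hK'c.measurableSet).comp measurable_snd)
  rw [← lintegral_indicator hm]
  refine (lintegral_mono h1).trans (le_of_eq ?_)
  rw [hmp.lintegral_comp hmeas]
  refine (lintegral_prod_mul (hg.indicator measurableSet_Ici).aemeasurable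
    (measurable_one.indicator hK'c.measurableSet).aemeasurable).trans ?_
  rw [lintegral_indicator measurableSet_Ici, lintegral_indicator_one hK'c.measurableSet, mul_comm]

section CutoffConst
set_option linter.unusedSectionVars false
variable {n : ℕ} {B N : Type*}
    [TopologicalSpace B] [ChartedSpace (EuclideanHalfSpace (n + 1)) B]
    [IsManifold (𝓡∂ (n + 1)) ∞ B] [CompactSpace B] [T2Space B] [MeasurableSpace B] [BorelSpace B]
    [TopologicalSpace N] [ChartedSpace (EuclideanSpace ℝ (Fin n)) N]
    [IsManifold (𝓡 n) ∞ N] [CompactSpace N] [T2Space N] {M : ConicManifold n B N}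

/-- Only the `t`-derivative survives. The weights are replaced by cruder ones that serve all `n ≥ 1`
at once: `e^{-(n-1)t} ≤ 1` and `e^{-(n+1)t} ≤ e^{-2t} ≤ t^{-2}`. -/
theorem modelEnergy_mul_locallyConstant_le (hn : 1 ≤ n) {f : Rd (n + 1) → ℂ} {z : Rd (n + 1)} {b : ℝ → ℝ}
    {c : ℂ} (hz : 0 < z 0) (hf : f =ᶠ[𝓝 z] fun w => (b (w 0) : ℂ) * c)
    (hb : DifferentiableAt ℝ b (z 0)) :
    modelEnergy 1 f z ≤ ‖c‖ₑ ^ 2 *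
      ENNReal.ofReal (b (z 0) ^ 2 * ((z 0) ^ 2)⁻¹ + deriv b (z 0) ^ 2) := by
  have h0 : HasFDerivAt (fun w : Rd (n + 1) => w 0)
      (EuclideanSpace.proj (0 : Fin (n + 1)) : Rd (n + 1) →L[ℝ] ℝ) z :=
    (EuclideanSpace.proj (0 : Fin (n + 1)) : Rd (n + 1) →L[ℝ] ℝ).hasFDerivAt
  have h1 : HasFDerivAt (fun w : Rd (n + 1) => b (w 0))
      (deriv b (z 0) • (EuclideanSpace.proj (0 : Fin (n + 1)) : Rd (n + 1) →L[ℝ] ℝ)) z :=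
    hb.hasDerivAt.comp_hasFDerivAt z h0
  have h2 := (Complex.ofRealCLM.hasFDerivAt.comp z h1).mul_const c
  have hd : ∀ i, partialDeriv i f z =
      c * ((deriv b (z 0) * (EuclideanSpace.single i (1 : ℝ) : Rd (n + 1)) 0 : ℝ) : ℂ) := by
    intro i
    rw [partialDeriv, hf.fderiv_eq]
    have h3 : fderiv ℝ (fun w : Rd (n + 1) => (b (w 0) : ℂ) * c) z = _ := h2.fderiv
    rw [h3]
    rfl
  have hsum : ∑ i, ‖partialDeriv i f z‖ ^ 2 = ‖c‖ ^ 2 * deriv b (z 0) ^ 2 := by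
    rw [Finset.sum_eq_single (0 : Fin (n + 1))]
    · rw [hd]; simp [mul_pow]
    · intro i _ hi
      rw [hd]; simp [hi.symm]
    · simp
  have hfz : f z = (b (z 0) : ℂ) * c := hf.self_of_nhds
  rw [modelEnergy_eq, hsum, hfz, enorm_sq_eq_ofReal, ← ENNReal.ofReal_mul (sq_nonneg _)]
  refine ENNReal.ofReal_le_ofReal ?_
  have hn' : (1 : ℝ) ≤ n := by exact_mod_cast hn
  have hz' : 0 ≤ 1 * z 0 := by linarith
  have w1 : conicWeight 1 (n + 1) z ≤ ((z 0) ^ 2)⁻¹ := by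
    refine (conicWeight_anti hz' (show (2 : ℝ) ≤ n + 1 by linarith)).trans ?_
    rw [conicWeight, Real.exp_neg]
    refine inv_anti₀ (by positivity) ?_
    have h4 := Real.add_one_le_exp (z 0)
    calc (z 0) ^ 2 ≤ (Real.exp (z 0)) ^ 2 := by gcongr; linarith
      _ = Real.exp (1 * 2 * z 0) := by rw [← Real.exp_nat_mul]; congr 1; push_cast; ring
  have w2 : conicWeight 1 (n - 1) z ≤ 1 := by
    refine (conicWeight_anti hz' (show (0 : ℝ) ≤ n - 1 by linarith)).trans ?_
    simp [conicWeight]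
  have e1 : ‖(b (z 0) : ℂ) * c‖ ^ 2 = ‖c‖ ^ 2 * b (z 0) ^ 2 := by
    rw [norm_mul, mul_pow, Complex.norm_real, Real.norm_eq_abs, sq_abs, mul_comm]
  rw [e1, mul_add]
  have i1 := mul_le_mul_of_nonneg_right w1 (mul_nonneg (sq_nonneg ‖c‖) (sq_nonneg (b (z 0))))
  have i2 := mul_le_mul_of_nonneg_right w2 (mul_nonneg (sq_nonneg ‖c‖) (sq_nonneg (deriv b (z 0))))
  linarith

/-- This reduces the norm of a function `b(t) c(y)` to an integral in one variable; `N` contributes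
only the finite volumes of the chart images. -/
theorem MellinData.exists_enorm_sq_le_of_collar (hn : 1 ≤ n) (D : MellinData M) : ∃ a : ℝ, 0 < a ∧ ∃ C : ℝ≥0,
    ∀ (c : LocallyConstant N ℂ) (v : M.TestFun) (b : ℝ → ℝ) (g : ℝ → ℝ≥0∞), Measurable g →
      (tsupport v.1 ⊆ tsupport D.cutoff) →
      (∀ t, 0 < t → ∀ y, v.1 (M.collar (Real.exp (-t), y)) = (b t : ℂ) * c y) →
      (∀ t, a ≤ t → DifferentiableAt ℝ b t) →
      (∀ t, a ≤ t → ENNReal.ofReal (b t ^ 2 * (t ^ 2)⁻¹ + deriv b t ^ 2) ≤ g t) →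
      ‖v‖ₑ ^ 2 ≤ C * ‖(c : C(N, ℂ))‖ₑ ^ 2 * ∫⁻ t in Ici a, g t := by
  obtain ⟨a, ha, haω⟩ := D.exists_le_of_mem_tsupport_cutoff
  set K : Fin D.J → Set (Rd n) := fun j => D.κ j '' tsupport (D.φ j)
  set S : Fin D.J → Set (Rd (n + 1)) := fun j => {z | a ≤ z 0 ∧ MellinData.tail z ∈ K j} with hS
  set Φ : Fin D.J → InteriorParam n B := fun j => collarParam M (D.κ_mem j) with hΦ
  have hSm : ∀ j, MeasurableSet (S j) := fun j =>
    ((isClosed_le continuous_const continuous_apply_zero).inter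
      ((D.isCompact_image_tsupport j).isClosed.preimage continuous_tail)).measurableSet
  have hSd : ∀ j, S j ⊆ (Φ j).dom := fun j z hz => ⟨ha.trans_le hz.1, D.image_tsupport_subset j hz.2⟩
  choose C₁ hC₁ using fun j => InteriorParam.exists_modelEnergy_bounds
    (tameOn_collarParam M (D.κ_mem j) ha (D.isCompact_image_tsupport j) (D.image_tsupport_subset j)) (hSd j)
  choose C₂ hC₂ using fun j => exists_lintegral_slab_le (D.isCompact_image_tsupport j) a
  refine ⟨a, ha, ∑ j, C₁ j * C₂ j, fun c v b g hg hv hvb hb hbg => ?_⟩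
  have hcover : ∀ q, M.eDensity v.1 q ≤ (⋃ j, (Φ j).toFun '' S j).indicator (M.eDensity v.1) q := by
    intro q
    by_cases hq : q ∈ tsupport v.1
    · rw [indicator_of_mem]
      have hq1 := D.tsupport_cutoff (hv hq)
      obtain ⟨j, hj⟩ : ∃ j, D.φ j (M.collar.symm q).2 ≠ 0 := by
        by_contra! h
        have h1 := D.φ.sum_eq_one (mem_univ (M.collar.symm q).2)
        rw [finsum_eq_zero_of_forall_eq_zero h] at h1
        exact zero_ne_one h1
      have hj' := subset_tsupport _ hj
      obtain ⟨z, hz0, hzt, hzq⟩ := M.exists_logCoord (v.2.2.2 hq) hq1 (D.φ_subordinate j hj')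
      refine mem_iUnion.2 ⟨j, z, ⟨haω _ ((D.κ j).symm (MellinData.tail z)) hz0 ?_, ?_⟩, hzq⟩
      · exact hzq.symm ▸ hv hq
      · rw [hzt]; exact ⟨_, hj', rfl⟩
    · rw [M.eDensity_of_notMem_tsupport hq]; exact zero_le
  have hpiece : ∀ j, ∫⁻ q in (Φ j).toFun '' S j, M.eDensity v.1 q ∂M.vol ≤
      (C₁ j * C₂ j : ℝ≥0) * ‖(c : C(N, ℂ))‖ₑ ^ 2 * ∫⁻ t in Ici a, g t := by
    intro j
    have h1 := (hC₁ j v.1 v.2 (S j) subset_rfl (hSm j)).1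
    have h2 : ∫⁻ z in S j, modelEnergy 1 (v.1 ∘ (Φ j).toFun) z ≤
        ∫⁻ z in S j, ‖(c : C(N, ℂ))‖ₑ ^ 2 * g (z 0) := by
      refine setLIntegral_mono_ae' (hSm j) (.of_forall fun z hz => ?_)
      have hzd := hSd j hz
      have hcs : ContinuousAt (fun w : Rd (n + 1) => (D.κ j).symm (MellinData.tail w)) z :=
        ((D.κ j).continuousAt_symm hzd.2).comp continuous_tail.continuousAt
      -- Since `c` is locally constant, near each point the function depends on `t` alone.
      have hev : v.1 ∘ (Φ j).toFun =ᶠ[𝓝 z] fun w =>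
          (b (w 0) : ℂ) * c ((D.κ j).symm (MellinData.tail z)) := by
        filter_upwards [(Φ j).isOpen_dom.mem_nhds hzd,
          hcs.eventually (c.isLocallyConstant.eventually_eq _)] with w hw hwc
        exact (hvb _ hw.1 _).trans (congrArg (fun x => (b (w 0) : ℂ) * x) hwc)
      refine (modelEnergy_mul_locallyConstant_le hn hzd.1 hev (hb _ hz.1)).trans ?_
      refine mul_le_mul' ?_ (hbg _ hz.1)
      gcongr
      rw [enorm_le_iff_norm_le]
      exact (c : C(N, ℂ)).norm_coe_le_norm _
    have hgm : Measurable fun z : Rd (n + 1) => g (z 0) := hg.comp continuous_apply_zero.measurable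
    have h3 := h2.trans_eq (lintegral_const_mul _ hgm)
    calc _ ≤ _ := h1
      _ ≤ C₁ j * (‖(c : C(N, ℂ))‖ₑ ^ 2 * (C₂ j * ∫⁻ t in Ici a, g t)) := by
        gcongr
        exact h3.trans (by gcongr; exact hC₂ j g hg)
      _ = _ := by push_cast; ring
  calc ‖v‖ₑ ^ 2 = ∫⁻ q, M.eDensity v.1 q ∂M.vol := M.enorm_sq_eq_lintegral v
    _ ≤ ∫⁻ q, (⋃ j, (Φ j).toFun '' S j).indicator (M.eDensity v.1) q ∂M.vol := lintegral_mono hcover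
    _ ≤ ∫⁻ q in ⋃ j, (Φ j).toFun '' S j, M.eDensity v.1 q ∂M.vol := lintegral_indicator_le _ _
    _ ≤ ∑' j, ∫⁻ q in (Φ j).toFun '' S j, M.eDensity v.1 q ∂M.vol := lintegral_iUnion_le _ _
    _ = ∑ j, ∫⁻ q in (Φ j).toFun '' S j, M.eDensity v.1 q ∂M.vol := tsum_fintype _
    _ ≤ ∑ j, (C₁ j * C₂ j : ℝ≥0) * ‖(c : C(N, ℂ))‖ₑ ^ 2 * ∫⁻ t in Ici a, g t :=
      Finset.sum_le_sum fun j _ => hpiece j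
    _ = _ := by rw [← Finset.sum_mul, ← Finset.sum_mul]; push_cast; rfl

end CutoffConst

/-- The quantity `s θ'(s)` is invariant under scaling, so its bound controls `t` times the
derivative of `θ(t/k)` uniformly in `k`. -/
theorem exists_smooth_step : ∃ (θ : ℝ → ℝ) (K : ℝ), ContDiff ℝ ∞ θ ∧ (∀ s, s ≤ 1 → θ s = 1) ∧
    (∀ s, 2 ≤ s → θ s = 0) ∧ ∀ s, |θ s| ≤ K ∧ |s * deriv θ s| ≤ K := by
  set θ : ℝ → ℝ := fun s => Real.smoothTransition (2 - s) with hθ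
  have hc : ContDiff ℝ ∞ θ := Real.smoothTransition.contDiff.comp (contDiff_const.sub contDiff_id)
  have h1 : ∀ s, s ≤ 1 → θ s = 1 := fun s hs => Real.smoothTransition.one_of_one_le (by linarith)
  have h2 : ∀ s, 2 ≤ s → θ s = 0 := fun s hs => Real.smoothTransition.zero_of_nonpos (by linarith)
  have hd : Continuous fun s => s * deriv θ s := continuous_id.mul (hc.continuous_deriv (by simp))
  obtain ⟨K, hK⟩ := (isCompact_Icc (a := (1 : ℝ)) (b := 2)).exists_bound_of_continuousOn hd.continuousOn
  refine ⟨θ, max 1 K, hc, h1, h2, fun s => ⟨?_, ?_⟩⟩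
  · rw [abs_of_nonneg (Real.smoothTransition.nonneg _)]
    exact (Real.smoothTransition.le_one _).trans (le_max_left _ _)
  · by_cases hs : s ∈ Icc (1 : ℝ) 2
    · exact (hK s hs).trans (le_max_right _ _)
    · have h3 : deriv θ s = 0 := by
        rcases lt_or_ge s 1 with h | h
        · have h4 : θ =ᶠ[𝓝 s] fun _ => 1 := by
            filter_upwards [gt_mem_nhds h] with r hr using h1 r hr.le
          rw [h4.deriv_eq, deriv_const]
        · have h5 : 2 < s := lt_of_not_ge fun h' => hs ⟨h, h'⟩
          have h4 : θ =ᶠ[𝓝 s] fun _ => 0 := by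
            filter_upwards [lt_mem_nhds h5] with r hr using h2 r hr.le
          rw [h4.deriv_eq, deriv_const]
      rw [h3, mul_zero, abs_zero]
      positivity

theorem sq_mul_inv_add_sq_le {t x y K : ℝ} (ht : 0 < t) (hx : |x| ≤ K) (hy : t * |y| ≤ K) :
    x ^ 2 * (t ^ 2)⁻¹ + y ^ 2 ≤ 2 * K ^ 2 * (t ^ 2)⁻¹ := by
  have h1 : x ^ 2 ≤ K ^ 2 := sq_le_sq' (neg_le_of_abs_le hx) (le_of_abs_le hx)
  have h2 : t ^ 2 * y ^ 2 ≤ K ^ 2 := by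
    rw [← sq_abs y, ← mul_pow]
    exact pow_le_pow_left₀ (by positivity) hy 2
  have h3 : y ^ 2 = t ^ 2 * y ^ 2 * (t ^ 2)⁻¹ := by field_simp
  rw [h3, ← add_mul]
  gcongr
  linarith

section CutoffConst
set_option linter.unusedSectionVars false
variable {n : ℕ} {B N : Type*}
    [TopologicalSpace B] [ChartedSpace (EuclideanHalfSpace (n + 1)) B]
    [IsManifold (𝓡∂ (n + 1)) ∞ B] [CompactSpace B] [T2Space B] [MeasurableSpace B] [BorelSpace B]
    [TopologicalSpace N] [ChartedSpace (EuclideanSpace ℝ (Fin n)) N]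
    [IsManifold (𝓡 n) ∞ N] [CompactSpace N] [T2Space N] {M : ConicManifold n B N}

/-- The cut-off function as a function of `t = -log x`. -/
theorem MellinData.exists_cutoff_profile (D : MellinData M) {a : ℝ} (ha : 0 < a) : ∃ (w : ℝ → ℝ) (K : ℝ),
    (∀ t, 0 < t → ∀ y, D.cutoff (M.collar (Real.exp (-t), y)) = w t) ∧
      ∀ t, a ≤ t → DifferentiableAt ℝ w t ∧ |w t| ≤ K ∧ |t * deriv w t| ≤ K := by
  rcases isEmpty_or_nonempty N with hN | ⟨⟨y₀⟩⟩
  · exact ⟨fun _ => 1, 1, fun _ _ y => (hN.false y).elim, fun t _ => by simp⟩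
  set w : ℝ → ℝ := fun t => D.cutoff (M.collar (Real.exp (-t), y₀)) with hw
  obtain ⟨T, hT0, hT⟩ := D.exists_cutoff_eq_one
  have hmem : ∀ t : ℝ, 0 < t → Real.exp (-t) ∈ Ico (0 : ℝ) 1 := fun t ht =>
    ⟨(Real.exp_pos _).le, (exp_neg_mem_Ioo ht).2⟩
  have hs : ContDiffOn ℝ ∞ w (Ioi 0) := by
    have h1 : ContMDiff 𝓘(ℝ, ℝ) (𝓘(ℝ, ℝ).prod (𝓡 n)) ∞ fun t : ℝ => (Real.exp (-t), y₀) :=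
      (contDiff_neg.exp).contMDiff.prodMk contMDiff_const
    exact (D.contMDiff_cutoff.comp_contMDiffOn (M.contMDiffOn_collar.comp h1.contMDiffOn
      fun t ht => ⟨hmem t ht, mem_univ _⟩)).contDiffOn
  have hsub : Icc a (T + 1) ⊆ Ioi 0 := fun t ht => ha.trans_le ht.1
  obtain ⟨K₁, hK₁⟩ := (isCompact_Icc (a := a) (b := T + 1)).exists_bound_of_continuousOn
    (hs.continuousOn.mono hsub)
  obtain ⟨K₂, hK₂⟩ := (isCompact_Icc (a := a) (b := T + 1)).exists_bound_of_continuousOn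
    (continuousOn_id.mul ((hs.continuousOn_deriv_of_isOpen isOpen_Ioi (by simp)).mono hsub))
  refine ⟨w, max 1 (max K₁ K₂), fun t ht y => D.cutoff_collar _ (hmem t ht) _ _, fun t ht => ⟨?_, ?_, ?_⟩⟩
  · exact (hs.contDiffAt (Ioi_mem_nhds (ha.trans_le ht))).differentiableAt (by simp)
  · rcases le_or_gt t (T + 1) with h | h
    · exact (hK₁ t ⟨ht, h⟩).trans ((le_max_left _ _).trans (le_max_right _ _))
    · have : w t = 1 := hT t (by linarith) _
      rw [this, abs_one]
      exact le_max_left _ _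
  · rcases le_or_gt t (T + 1) with h | h
    · exact (hK₂ t ⟨ht, h⟩).trans ((le_max_right _ _).trans (le_max_right _ _))
    · have h4 : w =ᶠ[𝓝 t] fun _ => 1 := by
        filter_upwards [lt_mem_nhds h] with r hr using hT r (by linarith) _
      rw [h4.deriv_eq, deriv_const, mul_zero, abs_zero]
      exact zero_le_one.trans (le_max_left _ _)

/-- The factor `G` vanishes for small `x` and so keeps the support away from the boundary; the other
factors are smooth near the support of `ω`. -/
theorem MellinData.mul_cutoffConst_mem_testSubmodule (D : MellinData M) (c : LocallyConstant N ℂ)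
    {G : ℝ → ℝ} (hG : ContDiff ℝ ∞ G) {δ : ℝ} (hδ : 0 < δ) (h0 : ∀ x, x ≤ δ → G x = 0) :
    (fun q => (G (M.collar.symm q).1 : ℂ) * D.cutoffConst c q) ∈ ConicManifold.testSubmodule n B := by
  refine ⟨fun q => ?_, HasCompactSupport.of_compactSpace _, fun q hq => ?_⟩
  · by_cases hq : q ∈ tsupport D.cutoff
    · have h1 := (M.contMDiffOn_collar_symm _ (D.tsupport_cutoff hq)).contMDiffAt
        (M.isOpen_target.mem_nhds (D.tsupport_cutoff hq))
      have h2 : ContMDiffAt (𝓡∂ (n + 1)) 𝓘(ℝ, ℂ) ∞ (fun q => (G (M.collar.symm q).1 : ℂ)) q :=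
        ContMDiffAt.comp (f := fun q => (M.collar.symm q).1) _
          (Complex.ofRealCLM.contDiff.comp hG).contMDiff.contMDiffAt h1.fst
      have h3 : ContMDiffAt (𝓡∂ (n + 1)) 𝓘(ℝ, ℂ) ∞ (fun q => (D.cutoff q : ℂ)) q :=
        Complex.ofRealCLM.contDiff.contMDiff.contMDiffAt.comp _ (D.contMDiff_cutoff q)
      have h4 : ContMDiffAt (𝓡 n) 𝓘(ℝ, ℂ) ∞ c (M.collar.symm q).2 :=
        contMDiffAt_const.congr_of_eventuallyEq (c.isLocallyConstant.eventually_eq _)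
      have h5 : ContMDiffAt (𝓡∂ (n + 1)) 𝓘(ℝ, ℂ) ∞ (fun q => c (M.collar.symm q).2) q :=
        ContMDiffAt.comp (f := fun q => (M.collar.symm q).2) _ h4 h1.snd
      have hmul : ∀ {f g : B → ℂ}, ContMDiffAt (𝓡∂ (n + 1)) 𝓘(ℝ, ℂ) ∞ f q →
          ContMDiffAt (𝓡∂ (n + 1)) 𝓘(ℝ, ℂ) ∞ g q →
          ContMDiffAt (𝓡∂ (n + 1)) 𝓘(ℝ, ℂ) ∞ (fun q => f q * g q) q := fun hf hg =>
        (contDiff_mul (𝕜 := ℝ) (𝔸 := ℂ)).contMDiff.contMDiffAt.comp q (hf.prodMk_space hg)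
      exact hmul h2 (hmul h3 h5)
    · refine contMDiffAt_const (c := (0 : ℂ)) |>.congr_of_eventuallyEq ?_
      filter_upwards [notMem_tsupport_iff_eventuallyEq.1 hq] with r hr
      have hr' : D.cutoff r = 0 := hr
      simp [cutoffConst, hr']
  · by_contra hi
    have hb : q ∈ (𝓡∂ (n + 1)).boundary B := by rwa [← ModelWithCorners.compl_interior]
    rw [← M.collar_boundary] at hb
    obtain ⟨⟨x, y⟩, ⟨hx, -⟩, hxy⟩ := hb
    have hx0 : x = 0 := hx
    subst hx0
    have hs : ((0 : ℝ), y) ∈ M.collar.source := by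
      rw [M.collar_source]; exact ⟨⟨le_rfl, one_pos⟩, mem_univ _⟩
    have ht : q ∈ M.collar.target := hxy ▸ M.collar.map_source hs
    have h1 : ContinuousAt (fun q => (M.collar.symm q).1) q :=
      continuous_fst.continuousAt.comp
        (M.contMDiffOn_collar_symm.continuousOn.continuousAt (M.isOpen_target.mem_nhds ht))
    have h2 : (M.collar.symm q).1 < δ := by
      rw [← hxy, M.collar.left_inv hs]; exact hδ
    refine absurd hq (notMem_tsupport_iff_eventuallyEq.2 ?_)
    filter_upwards [h1.eventually (gt_mem_nhds h2)] with r hr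
    simp [h0 _ (le_of_lt hr)]

/-- A smooth function of `-log x` that vanishes for large `-log x` is already zero for small
positive `x`, so its extension by zero to `x ≤ 0` is smooth. -/
theorem contDiff_comp_neg_log {θ : ℝ → ℝ} (hθ : ContDiff ℝ ∞ θ) (h2 : ∀ s, 2 ≤ s → θ s = 0) {m : ℝ}
    (hm : 0 < m) : ContDiff ℝ ∞ (fun x => if x ≤ 0 then 0 else θ (-Real.log x / m)) ∧
      ∀ x, x ≤ Real.exp (-(2 * m)) → (if x ≤ 0 then 0 else θ (-Real.log x / m)) = 0 := by
  have h0 : ∀ x, x ≤ Real.exp (-(2 * m)) → (if x ≤ 0 then 0 else θ (-Real.log x / m)) = 0 := by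
    intro x hx
    split_ifs with h
    · rfl
    · push Not at h
      refine h2 _ ?_
      rw [le_div_iff₀ hm]
      have := Real.log_le_log h hx
      rw [Real.log_exp] at this
      linarith
  refine ⟨contDiff_iff_contDiffAt.2 fun x => ?_, h0⟩
  rcases lt_or_ge x (Real.exp (-(2 * m))) with hx | hx
  · refine contDiffAt_const (c := (0 : ℝ)) |>.congr_of_eventuallyEq ?_
    filter_upwards [gt_mem_nhds hx] with r hr using h0 r hr.le
  · have hx0 : 0 < x := (Real.exp_pos _).trans_le hx
    have h3 : ContDiffAt ℝ ∞ (fun x => θ (-Real.log x / m)) x :=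
      hθ.contDiffAt.comp x (((Real.contDiffAt_log.2 hx0.ne').neg).div_const m)
    refine h3.congr_of_eventuallyEq ?_
    filter_upwards [lt_mem_nhds hx0] with r hr
    rw [if_neg (not_le.2 hr)]

/-- Truncate by `θ(t/(k+1))` with `t = -log x`. The truncated profiles and `t` times their
derivatives are bounded uniformly, so the energy is dominated by `∫ t^{-2} dt`, and the difference
of two truncations sees only large `t`. The logarithmic scale is what makes this work for `n = 1`,
where the gradient has no decaying weight. -/
theorem MellinData.exists_toL2_eq_cutoffConst (hn : 1 ≤ n) (D : MellinData M) : ∃ C : ℝ≥0,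
    ∀ c : LocallyConstant N ℂ, ∃ U : M.H1, M.toL2 U =ᵐ[M.vol] D.cutoffConst c ∧
      ‖U‖ₑ ≤ C * ‖(c : C(N, ℂ))‖ₑ := by
  obtain ⟨a, ha, C, hC⟩ := D.exists_enorm_sq_le_of_collar hn
  obtain ⟨w, K₁, hwv, hw⟩ := D.exists_cutoff_profile ha
  obtain ⟨θ, K₂, hθ, hθ1, hθ2, hθK⟩ := exists_smooth_step
  have hm : ∀ k : ℕ, (0 : ℝ) < k + 1 := fun k => by positivity
  set b : ℕ → ℝ → ℝ := fun k t => θ (t / (k + 1)) * w t with hb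
  -- The product rule gives two terms, each at most `K₂ * K₁`.
  set K := K₂ * K₁ + K₂ * K₁ with hK
  have hK₂ : 0 ≤ K₂ := (abs_nonneg _).trans (hθK 0).1
  have hK₁ : 0 ≤ K₁ := (abs_nonneg _).trans (hw a le_rfl).2.1
  have hbd : ∀ k t, a ≤ t → DifferentiableAt ℝ (b k) t ∧ |b k t| ≤ K ∧ t * |deriv (b k) t| ≤ K := by
    intro k t ht
    obtain ⟨w1, w2, w3⟩ := hw t ht
    obtain ⟨q1, q2⟩ := hθK (t / (k + 1))
    have h1 : HasDerivAt (fun t : ℝ => θ (t / (k + 1))) (deriv θ (t / (k + 1)) * (1 / (k + 1))) t :=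
      ((hθ.differentiable (by simp)).differentiableAt.hasDerivAt).comp t
        ((hasDerivAt_id t).div_const _)
    have h2 := h1.mul w1.hasDerivAt
    refine ⟨h2.differentiableAt, ?_, ?_⟩
    · rw [hb, abs_mul]
      have := mul_le_mul q1 w2 (abs_nonneg _) hK₂
      have h3 := mul_nonneg hK₂ hK₁
      linarith
    · have h3 : deriv (b k) t = _ := h2.deriv
      have h4 : t * |deriv (b k) t| = |t * deriv (b k) t| := by
        rw [abs_mul, abs_of_pos (ha.trans_le ht)]
      rw [h4, h3, show t * (deriv θ (t / (k + 1)) * (1 / (k + 1)) * w t + θ (t / (k + 1)) * deriv w t) =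
        (t / (k + 1) * deriv θ (t / (k + 1))) * w t + θ (t / (k + 1)) * (t * deriv w t) by ring]
      refine (abs_add_le _ _).trans ?_
      rw [abs_mul, abs_mul (θ _)]
      exact add_le_add (mul_le_mul q2 w2 (abs_nonneg _) hK₂) (mul_le_mul q1 w3 (abs_nonneg _) hK₂)
  set A : ℝ≥0 := C * (2 * K ^ 2).toNNReal * (a⁻¹).toNNReal with hA
  refine ⟨NNReal.sqrt A, fun c => ?_⟩
  have hG := fun k : ℕ => contDiff_comp_neg_log hθ hθ2 (hm k)
  set v : ℕ → M.TestFun := fun k =>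
    ⟨_, D.mul_cutoffConst_mem_testSubmodule c (hG k).1 (Real.exp_pos _) (hG k).2⟩ with hv
  have hsupp : ∀ q, q ∉ tsupport D.cutoff → ∀ k, (v k).1 q = 0 := fun q hq k => by
    have h1 : D.cutoff q = 0 := image_eq_zero_of_notMem_tsupport hq
    have h2 : D.cutoffConst c q = 0 := by simp [cutoffConst, h1]
    exact (congrArg (fun x => _ * x) h2).trans (mul_zero _)
  have hval : ∀ k t, 0 < t → ∀ y, (v k).1 (M.collar (Real.exp (-t), y)) = (b k t : ℂ) * c y := by
    intro k t ht y
    have h1 : M.collar.symm (M.collar (Real.exp (-t), y)) = (Real.exp (-t), y) :=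
      M.collar.left_inv (by rw [M.collar_source]
                            exact ⟨⟨(Real.exp_pos _).le, (exp_neg_mem_Ioo ht).2⟩, mem_univ _⟩)
    change (((if (M.collar.symm (M.collar (Real.exp (-t), y))).1 ≤ 0 then 0 else
      θ (-Real.log (M.collar.symm (M.collar (Real.exp (-t), y))).1 / (k + 1)) : ℝ)) : ℂ) *
        ((D.cutoff (M.collar (Real.exp (-t), y)) : ℂ) *
          c (M.collar.symm (M.collar (Real.exp (-t), y))).2) = _
    rw [h1, hwv t ht, if_neg (not_le.2 (Real.exp_pos _)), Real.log_exp, neg_neg, hb]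
    push_cast
    ring
  have hmg : ∀ r : ℝ, Measurable fun t : ℝ => ENNReal.ofReal (r * (t ^ 2)⁻¹) := fun r =>
    ((measurable_id.pow_const 2).inv.const_mul r).ennreal_ofReal
  have hint : ∀ r s : ℝ, 0 ≤ r → 0 < s → ∫⁻ t in Ici s, ENNReal.ofReal (r * (t ^ 2)⁻¹) =
      ENNReal.ofReal r * ENNReal.ofReal s⁻¹ := fun r s hr hs => by
    rw [← lintegral_Ici_inv_sq hs, ← lintegral_const_mul' _ _ ENNReal.ofReal_ne_top]
    exact lintegral_congr fun t => ENNReal.ofReal_mul hr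
  have hnorm : ∀ k, ‖v k‖ₑ ^ 2 ≤ A * ‖(c : C(N, ℂ))‖ₑ ^ 2 := by
    intro k
    refine (hC c (v k) (b k) _ (hmg (2 * K ^ 2)) ?_ (hval k) (fun t ht => (hbd k t ht).1)
      fun t ht => ENNReal.ofReal_le_ofReal
        (sq_mul_inv_add_sq_le (ha.trans_le ht) (hbd k t ht).2.1 (hbd k t ht).2.2)).trans (le_of_eq ?_)
    · refine closure_minimal (fun q hq => ?_) (isClosed_tsupport _)
      by_contra h
      exact hq (hsupp q h k)
    · rw [hint _ _ (by positivity) ha, hA]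
      push_cast
      change _ = (C : ℝ≥0∞) * ENNReal.ofReal (2 * K ^ 2) * ENNReal.ofReal a⁻¹ * _
      ring
  set β : ℕ → ℝ≥0∞ := fun k => C * ‖(c : C(N, ℂ))‖ₑ ^ 2 * ENNReal.ofReal (2 * (2 * K) ^ 2) *
    ENNReal.ofReal ((k : ℝ) + 1)⁻¹ with hβ
  have hβ0 : Filter.Tendsto β Filter.atTop (𝓝 0) := by
    have h1 : Filter.Tendsto (fun k : ℕ => ENNReal.ofReal ((k : ℝ) + 1)⁻¹) Filter.atTop (𝓝 0) := by
      have h2 : Filter.Tendsto (fun k : ℕ => ((k : ℝ) + 1)⁻¹) Filter.atTop (𝓝 0) := by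
        simpa [one_div] using tendsto_one_div_add_atTop_nhds_zero_nat (𝕜 := ℝ)
      simpa using ENNReal.tendsto_ofReal h2
    have h3 := ENNReal.Tendsto.const_mul (a := C * ‖(c : C(N, ℂ))‖ₑ ^ 2 *
      ENNReal.ofReal (2 * (2 * K) ^ 2)) h1 (.inr (by finiteness))
    rw [mul_zero] at h3
    exact h3
  have hdiff : ∀ k l : ℕ, ‖v k - v l‖ₑ ^ 2 ≤ β k + β l := by
    intro k l
    -- For `t < m` both truncations leave `w` unchanged, so only `t ≥ m` contributes; there `t^{-2}`
    -- has the integral `1 / m`, at most the sum of the two reciprocals.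
    set m : ℝ := min ((k : ℝ) + 1) (l + 1) with hmdef
    have hm0 : 0 < m := lt_min (hm k) (hm l)
    have h0 : ∀ t, t < m → b k t - b l t = 0 := fun t ht => by
      have e1 : θ (t / (k + 1)) = 1 :=
        hθ1 _ ((div_le_one (hm k)).2 (ht.le.trans (min_le_left _ _)))
      have e2 : θ (t / (l + 1)) = 1 :=
        hθ1 _ ((div_le_one (hm l)).2 (ht.le.trans (min_le_right _ _)))
      simp only [hb, e1, e2, sub_self]
    have h1 := hC c (v k - v l) (fun t => b k t - b l t)
      ((Ici m).indicator fun t => ENNReal.ofReal (2 * (2 * K) ^ 2 * (t ^ 2)⁻¹))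
      ((hmg _).indicator measurableSet_Ici) ?_ (fun t ht y => ?_)
      (fun t ht => (hbd k t ht).1.sub (hbd l t ht).1) (fun t ht => ?_)
    · have h2 : ∫⁻ t in Ici a, (Ici m).indicator
          (fun t => ENNReal.ofReal (2 * (2 * K) ^ 2 * (t ^ 2)⁻¹)) t ≤
          ENNReal.ofReal (2 * (2 * K) ^ 2) * ENNReal.ofReal m⁻¹ := by
        rw [← hint _ _ (by positivity) hm0, ← lintegral_indicator (measurableSet_Ici (a := m))]
        exact setLIntegral_le_lintegral _ _
      have h3 : ENNReal.ofReal m⁻¹ ≤ ENNReal.ofReal ((k : ℝ) + 1)⁻¹ + ENNReal.ofReal ((l : ℝ) + 1)⁻¹ := by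
        rcases min_choice ((k : ℝ) + 1) (l + 1) with h | h
        · rw [hmdef, h]; exact le_self_add
        · rw [hmdef, h]; exact le_add_self
      calc _ ≤ _ := h1
        _ ≤ C * ‖(c : C(N, ℂ))‖ₑ ^ 2 * (ENNReal.ofReal (2 * (2 * K) ^ 2) *
            (ENNReal.ofReal ((k : ℝ) + 1)⁻¹ + ENNReal.ofReal ((l : ℝ) + 1)⁻¹)) := by
          gcongr
          exact h2.trans (by gcongr)
        _ = β k + β l := by rw [hβ]; ring
    · refine closure_minimal (fun q hq => ?_) (isClosed_tsupport _)
      by_contra h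
      refine hq ?_
      change (v k).1 q - (v l).1 q = 0
      exact (congrArg₂ (· - ·) (hsupp q h k) (hsupp q h l)).trans (sub_zero _)
    · refine (congrArg₂ (· - ·) (hval k t ht y) (hval l t ht y)).trans ?_
      push_cast
      ring
    · rcases lt_or_ge t m with htm | htm
      · have e1 : (fun t => b k t - b l t) =ᶠ[𝓝 t] fun _ => 0 := by
          filter_upwards [gt_mem_nhds htm] with r hr using h0 r hr
        rw [e1.deriv_eq, deriv_const, h0 t htm]
        simp
      · rw [indicator_of_mem (show t ∈ Ici m from htm)]
        obtain ⟨d1, d2, d3⟩ := hbd k t ht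
        obtain ⟨f1, f2, f3⟩ := hbd l t ht
        have ht0 := ha.trans_le ht
        refine ENNReal.ofReal_le_ofReal (sq_mul_inv_add_sq_le ht0 ?_ ?_)
        · exact (abs_sub _ _).trans (by linarith)
        · rw [deriv_fun_sub d1 f1]
          have := mul_le_mul_of_nonneg_left (abs_sub (deriv (b k) t) (deriv (b l) t)) ht0.le
          linarith
  obtain ⟨U, hU⟩ := ConicManifold.exists_tendsto_of_cauchy hβ0 hdiff
  refine ⟨U, ConicManifold.toL2_ae_eq_of_tendsto hU fun ns hns => ⟨id, strictMono_id, ?_⟩, ?_⟩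
  · have hint : ∀ᵐ q ∂M.vol, q ∈ (𝓡∂ (n + 1)).interior B := by
      rw [ae_iff]
      refine measure_mono_null (fun q hq => ?_) M.vol_boundary
      rw [← ModelWithCorners.compl_interior]
      exact hq
    filter_upwards [hint] with q hq
    by_cases hqs : q ∈ tsupport D.cutoff
    · have hqt := D.tsupport_cutoff hqs
      have h1 := M.collar.map_target hqt
      rw [M.collar_source] at h1
      have hx : 0 < (M.collar.symm q).1 := by
        refine h1.1.1.lt_of_ne fun h0 => ?_
        have h2 : q ∈ (𝓡∂ (n + 1)).boundary B := by
          rw [← M.collar_boundary]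
          exact ⟨M.collar.symm q, ⟨h0.symm, mem_univ _⟩, M.collar.right_inv hqt⟩
        rw [← ModelWithCorners.compl_interior] at h2
        exact h2 hq
      -- At a fixed interior point the truncation factor is `1` from some index on.
      obtain ⟨k₀, hk₀⟩ := exists_nat_ge (-Real.log (M.collar.symm q).1)
      refine tendsto_const_nhds.congr' ?_
      filter_upwards [Filter.eventually_ge_atTop k₀] with k hk
      have hk' : k₀ ≤ ns k := hk.trans (hns.id_le k)
      have h3 : θ (-Real.log (M.collar.symm q).1 / ((ns k : ℕ) + 1)) = 1 := by
        refine hθ1 _ ((div_le_one (hm _)).2 ?_)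
        have : (k₀ : ℝ) ≤ ns k := by exact_mod_cast hk'
        linarith
      have h4 : (if (M.collar.symm q).1 ≤ 0 then 0 else
          θ (-Real.log (M.collar.symm q).1 / ((ns k : ℕ) + 1))) = 1 := by
        rw [if_neg (not_le.2 hx), h3]
      exact ((congrArg (fun x : ℝ => (x : ℂ) * D.cutoffConst c q) h4).trans
        (by rw [Complex.ofReal_one, one_mul])).symm
    · have h1 : D.cutoff q = 0 := image_eq_zero_of_notMem_tsupport hqs
      have h2 : D.cutoffConst c q = 0 := by simp [cutoffConst, h1]
      rw [h2]
      exact tendsto_const_nhds.congr fun k => (hsupp q hqs _).symm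
  · refine le_of_tendsto (continuous_enorm.continuousAt.tendsto.comp hU) (.of_forall fun k => ?_)
    rw [Function.comp_apply, UniformSpace.Completion.enorm_coe,
      ← ENNReal.pow_le_pow_left_iff two_ne_zero, mul_pow, ← ENNReal.coe_pow, NNReal.sq_sqrt]
    exact hnorm k

end CutoffConst

/-- The translate of the set by one unit in `t` is contained in it and has the same volume. Were
that finite, the difference would be a null set, yet it contains a nonempty open slab. -/
theorem volume_halfCylinder_eq_top {n : ℕ} (T : ℝ) {U : Set (Rd n)} (hU : IsOpen U) (hne : U.Nonempty) :
    volume {z : Rd (n + 1) | T < z 0 ∧ MellinData.tail z ∈ U} = ⊤ := by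
  by_contra hfin
  set S := {z : Rd (n + 1) | T < z 0 ∧ MellinData.tail z ∈ U} with hS
  set e : Rd (n + 1) := EuclideanSpace.single 0 1 with he
  have hSo : IsOpen S := (isOpen_lt continuous_const continuous_apply_zero).inter
    (hU.preimage continuous_tail)
  have he0 : ∀ z : Rd (n + 1), (z + -e) 0 = z 0 - 1 := fun z => by simp [he, sub_eq_add_neg]
  have het : ∀ z : Rd (n + 1), MellinData.tail (z + -e) = MellinData.tail z := fun z => by
    rw [← tailCLM_apply, map_add, map_neg, tailCLM_apply, tailCLM_apply, tail_single_zero, neg_zero,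
      add_zero]
  set S' := (fun z : Rd (n + 1) => z + -e) ⁻¹' S with hS'
  have hsub : S' ⊆ S := fun z hz => by
    have h1 : T < (z + -e) 0 := hz.1
    have h2 : MellinData.tail (z + -e) ∈ U := hz.2
    rw [he0] at h1
    rw [het] at h2
    exact ⟨by linarith, h2⟩
  have hvol : volume S' = volume S := measure_preimage_add_right volume (-e) S
  have hdiff : volume (S \ S') = 0 := by
    rw [measure_sdiff hsub (hSo.preimage (continuous_id.add continuous_const)).measurableSet.nullMeasurableSet
      (hvol ▸ hfin), hvol, tsub_self]
  obtain ⟨η, hη⟩ := hne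
  have hO : IsOpen {z : Rd (n + 1) | T < z 0 ∧ z 0 < T + 1 ∧ MellinData.tail z ∈ U} :=
    (isOpen_lt continuous_const continuous_apply_zero).inter
      ((isOpen_lt continuous_apply_zero continuous_const).inter (hU.preimage continuous_tail))
  refine (hO.measure_pos volume ⟨consCLM n (T + 1 / 2, η), ?_⟩).ne' (measure_mono_null (fun z hz => ?_) hdiff)
  · refine ⟨by simp, ?_, hη⟩
    simp only [consCLM_zero]
    linarith
  · refine ⟨⟨hz.1, hz.2.2⟩, fun h => ?_⟩
    have h1 : T < (z + -e) 0 := h.1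
    rw [he0] at h1
    linarith [hz.2.1]

theorem lintegral_enorm_sq_lt_top_of_sobolevNorm {d : ℕ} {f : Rd d → ℂ} (h : sobolevNorm f < ⊤) :
    ∫⁻ z, ‖f z‖ₑ ^ 2 < ⊤ := by
  rw [← eLpNorm_two_sq]
  refine lt_of_le_of_lt le_self_add ((ENNReal.rpow_lt_top_iff_of_pos (by norm_num)).1 h)

/-! ### Assembly of the theorem -/

section Main
set_option linter.unusedSectionVars false
variable {n : ℕ} {B N : Type*}
    [TopologicalSpace B] [ChartedSpace (EuclideanHalfSpace (n + 1)) B]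
    [IsManifold (𝓡∂ (n + 1)) ∞ B] [CompactSpace B] [T2Space B] [MeasurableSpace B] [BorelSpace B]
    [TopologicalSpace N] [ChartedSpace (EuclideanSpace ℝ (Fin n)) N]
    [IsManifold (𝓡 n) ∞ N] [CompactSpace N] [T2Space N] {M : ConicManifold n B N}

/-- For `n = 1` and `γ = 1` the exponent `γ - (n + 1) / 2` is zero, so where `ω = 1` the collar
piece is `φⱼ c`, independent of `t`. If `c` does not vanish somewhere, its modulus is bounded below
on a half-cylinder of infinite volume, and the piece is not square integrable. -/
theorem MellinData.eq_zero_of_memMellin_cutoffConst (hn : n = 1) (D : MellinData M) {c : LocallyConstant N ℂ}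
    (hc : D.MemMellin 1 (D.cutoffConst c)) : c = 0 := by
  ext y
  rw [LocallyConstant.coe_zero, Pi.zero_apply]
  by_contra hy
  obtain ⟨j, hj⟩ : ∃ j, D.φ j y ≠ 0 := by
    by_contra! h
    have h1 := D.φ.sum_eq_one (mem_univ y)
    rw [finsum_eq_zero_of_forall_eq_zero h] at h1
    exact zero_ne_one h1
  have hys : y ∈ (D.κ j).source := D.φ_subordinate j (subset_tsupport _ hj)
  obtain ⟨T, hT0, hT⟩ := D.exists_cutoff_eq_one
  have hfin : ∫⁻ z, ‖D.collarPiece 1 (D.cutoffConst c) j z‖ₑ ^ 2 < ⊤ := by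
    refine lintegral_enorm_sq_lt_top_of_sobolevNorm (lt_of_le_of_lt ?_ hc)
    exact (Finset.single_le_sum (f := fun j => sobolevNorm (D.collarPiece 1 (D.cutoffConst c) j))
      (fun _ _ => zero_le) (Finset.mem_univ j)).trans le_self_add
  set r : Rd n → ℝ := fun η => ‖D.φ j ((D.κ j).symm η) • c ((D.κ j).symm η)‖ with hr
  have hrc : ContinuousOn r (D.κ j).target :=
    (((D.φ j).contMDiff.continuous.comp_continuousOn (D.κ j).symm.continuousOn).smul
      (c.continuous.comp_continuousOn (D.κ j).symm.continuousOn)).norm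
  set δ := r (D.κ j y) with hδ
  have hδ0 : 0 < δ := by
    rw [hδ, hr]
    simp only [(D.κ j).left_inv hys]
    exact norm_pos_iff.2 (smul_ne_zero hj hy)
  set U : Set (Rd n) := (D.κ j).target ∩ r ⁻¹' Ioi (δ / 2) with hU
  have hUo : IsOpen U := hrc.isOpen_inter_preimage (D.κ j).open_target isOpen_Ioi
  have hUne : U.Nonempty := ⟨D.κ j y, (D.κ j).map_source hys, half_lt_self hδ0⟩
  have hS : MeasurableSet {z : Rd (n + 1) | T < z 0 ∧ MellinData.tail z ∈ U} :=
    ((isOpen_lt continuous_const continuous_apply_zero).inter (hUo.preimage continuous_tail)).measurableSet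
  have hle : ∀ z ∈ {z : Rd (n + 1) | T < z 0 ∧ MellinData.tail z ∈ U},
      ENNReal.ofReal ((δ / 2) ^ 2) ≤ ‖D.collarPiece 1 (D.cutoffConst c) j z‖ₑ ^ 2 := by
    intro z hz
    have hz0 : 0 < z 0 := hT0.trans hz.1
    have h1 : M.collar.symm (M.collar (Real.exp (-z 0), (D.κ j).symm (MellinData.tail z))) =
        (Real.exp (-z 0), (D.κ j).symm (MellinData.tail z)) :=
      M.collar.left_inv (by rw [M.collar_source]; exact logCoord_mem_source (D.κ j) hz0)
    have h2 : D.collarPiece 1 (D.cutoffConst c) j z =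
        D.φ j ((D.κ j).symm (MellinData.tail z)) • c ((D.κ j).symm (MellinData.tail z)) := by
      rw [collarPiece, if_pos ⟨hz0, hz.2.1⟩, cutoffConst, hT _ hz.1.le, h1]
      have h3 : ((1 : ℝ) - ((n : ℝ) + 1) / 2) * z 0 = 0 := by
        have hn1 : (n : ℝ) = 1 := by rw [hn]; norm_num
        rw [hn1]; ring
      rw [h3]
      simp
    rw [enorm_sq_eq_ofReal, h2]
    refine ENNReal.ofReal_le_ofReal ?_
    have h3 : δ / 2 < r (MellinData.tail z) := hz.2.2
    gcongr
  have htop : ∫⁻ z, ‖D.collarPiece 1 (D.cutoffConst c) j z‖ₑ ^ 2 = ⊤ := by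
    refine top_le_iff.1 ?_
    calc (⊤ : ℝ≥0∞) = ENNReal.ofReal ((δ / 2) ^ 2) *
          volume {z : Rd (n + 1) | T < z 0 ∧ MellinData.tail z ∈ U} := by
          rw [volume_halfCylinder_eq_top T hUo hUne, ENNReal.mul_top]
          simpa using hδ0.ne'
      _ = ∫⁻ _ in {z : Rd (n + 1) | T < z 0 ∧ MellinData.tail z ∈ U}, ENNReal.ofReal ((δ / 2) ^ 2) :=
        (setLIntegral_const _ _).symm
      _ ≤ ∫⁻ z in {z : Rd (n + 1) | T < z 0 ∧ MellinData.tail z ∈ U},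
          ‖D.collarPiece 1 (D.cutoffConst c) j z‖ₑ ^ 2 := setLIntegral_mono' hS hle
      _ ≤ _ := setLIntegral_le_lintegral _ _
  exact hfin.ne htop

/-- The localizations that belong to the choices in the norm of the Mellin-Sobolev spaces. -/
theorem MellinData.exists_pieces (D : MellinData M) : ∃ P : Fin D.J ⊕ Fin D.L → Piece M,
    (∀ q ∈ (𝓡∂ (n + 1)).interior B, ∑ a, (P a).s q = 1) ∧
      ∀ γ u, D.mellinNorm γ u = ∑ a, sobolevNorm ((P a).localize γ u) := by
  choose P hPs hP using D.exists_collarPiece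
  choose Q hQs hQ using D.exists_chartPiece
  refine ⟨Sum.elim P Q, fun q hq => ?_, fun γ u => ?_⟩
  · rw [Fintype.sum_sum_type]
    simp only [Sum.elim_inl, Sum.elim_inr, hPs, hQs]
    -- The sum is `ω ∑ φⱼ + (∑ ψₗ)(1 - ω)`. Off the collar the point of `N` at which the `φⱼ` are
    -- evaluated is arbitrary, which is harmless as they sum to `1` everywhere.
    rw [← Finset.mul_sum, ← Finset.sum_mul]
    have h1 := D.φ.sum_eq_one (mem_univ (M.collar.symm q).2)
    have h2 := D.ψ.sum_eq_one (mem_univ q)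
    rw [finsum_eq_sum_of_fintype] at h1 h2
    rw [h1, h2]
    ring
  · rw [Fintype.sum_sum_type]
    simp only [Sum.elim_inl, Sum.elim_inr, hP, hQ]
    rfl

end Main

theorem mainTheorem6 {n : ℕ} (hn : 1 ≤ n) {B N : Type*}
    [TopologicalSpace B] [ChartedSpace (EuclideanHalfSpace (n + 1)) B]
    [IsManifold (𝓡∂ (n + 1)) ∞ B] [CompactSpace B] [T2Space B]
    [MeasurableSpace B] [BorelSpace B]
    [TopologicalSpace N] [ChartedSpace (EuclideanSpace ℝ (Fin n)) N]
    [IsManifold (𝓡 n) ∞ N] [CompactSpace N] [T2Space N]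
    (M : ConicManifold n B N) (D : MellinData M) :
    (∃ C : ℝ≥0, ∀ (u : B → ℂ) (c : LocallyConstant N ℂ), D.MemMellin 1 u →
      ∃ U : M.H1, M.toL2 U =ᵐ[M.vol] u + D.cutoffConst c ∧
        ‖U‖ₑ ≤ C * (D.mellinNorm 1 u + ‖(c : C(N, ℂ))‖ₑ)) ∧
    (n = 1 → ∀ c : LocallyConstant N ℂ, D.MemMellin 1 (D.cutoffConst c) → c = 0) ∧
    Function.Injective M.toL2 ∧
    (∀ β : ℝ, β < 1 → ∃ C : ℝ≥0, ∀ U : M.H1,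
      D.MemMellin β (M.toL2 U) ∧ D.mellinNorm β (M.toL2 U) ≤ C * ‖U‖ₑ) ∧
    IsCompactOperator M.toL2 := by
  obtain ⟨P, hPs, hP⟩ := D.exists_pieces
  refine ⟨?_, fun h1 c hc => D.eq_zero_of_memMellin_cutoffConst h1 hc, Piece.injective_toL2 hn hPs,
    fun β hβ => ?_, Piece.isCompactOperator_toL2 hn hPs⟩
  · choose C₁ hC₁ using fun a => (P a).exists_toL2_eq_smul
    obtain ⟨C₂, hC₂⟩ := D.exists_toL2_eq_cutoffConst hn
    refine ⟨∑ a, C₁ a + C₂, fun u c hu => ?_⟩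
    have hle : ∀ a, sobolevNorm ((P a).localize 1 u) ≤ D.mellinNorm 1 u := fun a => by
      rw [hP]
      exact Finset.single_le_sum (f := fun a => sobolevNorm ((P a).localize 1 u))
        (fun _ _ => zero_le) (Finset.mem_univ a)
    choose V hV hVn using fun a => hC₁ a u ((hle a).trans_lt hu)
    obtain ⟨W, hW, hWn⟩ := hC₂ c
    -- `V a` represents the cut-off `(P a).s` times `u`; these cut-offs add up to `1` on the
    -- interior, and the boundary is a null set.
    refine ⟨∑ a, V a + W, ?_, ?_⟩
    · have hint : ∀ᵐ q ∂M.vol, q ∈ (𝓡∂ (n + 1)).interior B := by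
        rw [ae_iff]
        refine measure_mono_null (fun q hq => ?_) M.vol_boundary
        rw [← ModelWithCorners.compl_interior]
        exact hq
      rw [map_add, map_sum]
      filter_upwards [Lp.coeFn_add (∑ a, M.toL2 (V a)) (M.toL2 W),
        Lp.coeFn_fun_finsetSum Finset.univ fun a => M.toL2 (V a), ae_all_iff.2 hV, hW, hint]
        with q h1 h2 h3 h4 h5
      rw [h1, Pi.add_apply, Pi.add_apply, h2, h4]
      simp only [h3]
      rw [← Finset.sum_smul, hPs q h5, one_smul]
    · calc ‖∑ a, V a + W‖ₑ ≤ ∑ a, ‖V a‖ₑ + ‖W‖ₑ :=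
          (enorm_add_le _ _).trans (by gcongr; exact enorm_sum_le _ _)
        _ ≤ ∑ a, (C₁ a : ℝ≥0∞) * D.mellinNorm 1 u + C₂ * ‖(c : C(N, ℂ))‖ₑ := by
          gcongr with a
          exact (hVn a).trans (by gcongr; exact hle a)
        _ ≤ (∑ a, (C₁ a : ℝ≥0∞) + C₂) * D.mellinNorm 1 u +
            (∑ a, (C₁ a : ℝ≥0∞) + C₂) * ‖(c : C(N, ℂ))‖ₑ := by
          rw [← Finset.sum_mul]
          gcongr
          · exact le_self_add
          · exact le_add_self
        _ = _ := by rw [← mul_add]; push_cast; rfl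
  · choose C hC using fun a => (P a).exists_sobolevNorm_localize_le hn hβ
    have h : ∀ U : M.H1, D.mellinNorm β (M.toL2 U) ≤ (∑ a, C a : ℝ≥0) * ‖U‖ₑ := fun U => by
      rw [hP, ENNReal.ofNNReal_finsetSum, Finset.sum_mul]
      exact Finset.sum_le_sum fun a _ => hC a U
    exact ⟨∑ a, C a, fun U => ⟨(h U).trans_lt (by finiteness), h U⟩⟩
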